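/- Throughout, $\Delta=\partial_x^2+\partial_y^2$, $\partial/\partial z=\frac12(\partial_x-i\partial_y)$, $D$ is the open unit disc, $J\subset\mathbb R$ is an interval with more than one point, $U\subset\mathbb C$ is open, and $\phi:U\to\mathbb R$ is smooth with $\Delta\phi>0$. Put $\kappa'=1/\Delta\phi$ and $\Lambda=\{(z,\frac{\partial\phi}{\partial z}(z)):z\in U\}\subset\mathbb C\times\mathbb P^1$. A family $(\Omega_t)_{t\in J}$ of smooth Jordan domains is increasing if $\Omega_t\subsetneq\Omega_{t'}$ for $t<t'$, and smooth if $\partial\Omega_t$ has a regular Jordan parametrization $\Gamma(t,\cdot)$ that is jointly smooth in $t$ and the curve parameter. A smooth increasing family of smooth Jordan domains containing $0$ solves the Hele-Shaw flow with permeability $\kappa$ if for every $t$ there is a function $p_t$ with $\Delta p_t=-\delta_0$ in $\Omega_t$, continuous on $\overline{\Omega_t}\setminus\{0\}$ and zero on $\partial\Omega_t$, whose gradient exists at the boundary and satisfies $V_t=-\kappa\nabla p_t$ on $\partial\Omega_t$, where $V_t$ is the normal outward velocity of $\partial\Omega_t$. Consider families $\Sigma_t=f_t(D)$, $t\in J$,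 where each $f_t:\overline D\to\mathbb C\times\mathbb P^1$ is an embedding that is holomorphic on $D$, $f_t(\zeta)$ is jointly smooth in $(t,\zeta)\in J\times\overline D$, and for every $t$: (1) the first projection $\pi_1:\Sigma_t\to\pi_1(\Sigma_t)$ is an isomorphism; (2) $f_t(\partial D)\subset\Lambda$; (3) the closure $\overline{\Sigma_t}$ meets $\{0\}\times\mathbb P^1$ precisely in $(0,\infty)$, and it meets $\mathbb C\times\{\infty\}$ precisely in $(0,\infty)$, transversally (so $\Sigma_t$ is the graph over $\pi_1(\Sigma_t)$ of a function that is holomorphic except for a simple pole at $0$). **Theorem.** (a) Let $(\Sigma_t)_{t\in J}$ be such a family and suppose that the $\Omega_t:=\pi_1(\Sigma_t)$ form an increasing family of smooth Jordan domains. Then, after a reparametrization of time, $\Omega_t$ solves the Hele-Shaw flow with permeability $\kappa'$: there are a smooth strictly increasing $s:J\to\mathbb R$ and a solution $(\Omega'_\sigma)_{\sigma\in s(J)}$ of the Hele-Shaw flow with permeability $\kappa'$ such that $\Omega'_{s(t)}=\Omega_t$ for all $t\in J$. (b) Conversely, let $(\Omega_t)_{t\in J}$ be a smooth increasing family of smooth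 Jordan domains that solves the Hele-Shaw flow with permeability $\kappa'$ and has $\partial\Omega_t\subset U$ for all $t\in J$. Let $t_0\in J$ be such that $(\Omega_{t_0},\phi)$ has a Schwarz function with a simple pole at $0$, i.e. a function $S$, holomorphic on $\Omega_{t_0}$ except for a simple pole at $0$, that extends continuously to $\partial\Omega_{t_0}$ with $S=\partial\phi/\partial z$ there. Let $r$ be its residue at $0$ and assume that $r+\frac{t-t_0}{4\pi}\neq0$ for all $t\in J$ (which is automatic if $r>0$ and $t_0=\min J$). Then there is a family $(\Sigma_t)_{t\in J}$ as above with $\pi_1(\Sigma_t)=\Omega_t$ for all $t\in J$. -/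

import Mathlib

open Set Filter Topology Complex
open scoped ContDiff InnerProductSpace

noncomputable section

/-! ### The Riemann sphere `OnePoint ℂ` and its two standard charts -/

/-- The chart `w` of the Riemann sphere, meaningful away from `∞`. -/
def sphereChartZero (w : OnePoint ℂ) : ℂ := w.elim 0 (fun z => z)

/-- The chart `1 / w` of the Riemann sphere, meaningful away from `0`; it sends `∞` to `0`. -/
def sphereChartInfty (w : OnePoint ℂ) : ℂ := w.elim 0 (fun z => z⁻¹)

/-- A sphere-valued map is `C^∞` (in the real sense) on `s` : it is continuous, and its expression
in each of the two charts is smooth at every point that is mapped into the domain of the chart. -/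
def SphereSmoothOn {E : Type*} [NormedAddCommGroup E] [NormedSpace ℝ E]
    (g : E → OnePoint ℂ) (s : Set E) : Prop :=
  ContinuousOn g s ∧ ∀ x ∈ s,
    (g x ≠ OnePoint.infty → ContDiffWithinAt ℝ ∞ (fun y => sphereChartZero (g y)) s x) ∧
    (g x ≠ ((0 : ℂ) : OnePoint ℂ) →
      ContDiffWithinAt ℝ ∞ (fun y => sphereChartInfty (g y)) s x)

/-- A sphere-valued map is holomorphic on the open set `s`. -/
def SphereHolomorphicOn (g : ℂ → OnePoint ℂ) (s : Set ℂ) : Prop :=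
  ContinuousOn g s ∧ ∀ ζ ∈ s,
    (g ζ ≠ OnePoint.infty → DifferentiableAt ℂ (fun y => sphereChartZero (g y)) ζ) ∧
    (g ζ ≠ ((0 : ℂ) : OnePoint ℂ) → DifferentiableAt ℂ (fun y => sphereChartInfty (g y)) ζ)

/-! ### Planar domains and families of planar domains -/

/-- `γ` is a smooth (`2π`-periodic, regular, non-self-intersecting) parametrization of the boundary
of the bounded domain `Ω`, that is, `Ω` is the interior of the smooth Jordan curve `γ`. -/
structure IsJordanParam (Ω : Set ℂ) (γ : ℝ → ℂ) : Prop where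
  smooth : ContDiff ℝ ∞ γ
  periodic : Function.Periodic γ (2 * Real.pi)
  injective : InjOn γ (Ico 0 (2 * Real.pi))
  regular : ∀ θ, deriv γ θ ≠ 0
  isOpen : IsOpen Ω
  isConnected : IsConnected Ω
  bounded : Bornology.IsBounded Ω
  frontier_eq : frontier Ω = range γ

/-- `Ω` is a smooth Jordan domain. -/
def IsSmoothJordanDomain (Ω : Set ℂ) : Prop := ∃ γ, IsJordanParam Ω γ

/-- The family `Ω t`, `t ∈ I`, is (strictly) increasing. -/
def IsIncreasingFamily (I : Set ℝ) (Ω : ℝ → Set ℂ) : Prop :=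
  ∀ t ∈ I, ∀ t' ∈ I, t < t' → Ω t ⊂ Ω t'

/-- The boundaries of `Ω t`, `t ∈ I`, are parametrized by the smooth Jordan curves `Γ t`, which
depend smoothly on `t`. -/
structure IsSmoothJordanFamily (I : Set ℝ) (Ω : ℝ → Set ℂ) (Γ : ℝ → ℝ → ℂ) : Prop where
  smooth : ContDiffOn ℝ ∞ (fun q : ℝ × ℝ => Γ q.1 q.2) (I ×ˢ univ)
  jordan : ∀ t ∈ I, IsJordanParam (Ω t) (Γ t)

/-! ### The Hele-Shaw flow -/

/-- `p` is the pressure of `Ω`: it vanishes on the boundary and `Δ p = - δ₀` in `Ω`.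
Since `-(1 / 2π) log |z|` is a fundamental solution of `-Δ`, the latter says that `p` differs from
it by a harmonic function on `Ω`. -/
structure IsPressure (Ω : Set ℂ) (p : ℂ → ℝ) : Prop where
  continuousOn : ContinuousOn p (closure Ω \ {0})
  boundary : ∀ z ∈ frontier Ω, p z = 0
  singular : ∃ h : ℂ → ℝ, InnerProductSpace.HarmonicOnNhd h Ω ∧
    ∀ z ∈ Ω \ {0}, p z = h z - (1 / (2 * Real.pi)) * Real.log ‖z‖

/-- `n` is the outward unit normal of `Ω` at the boundary point `γ θ`. -/
structure IsOutwardNormal (Ω : Set ℂ) (γ : ℝ → ℂ) (θ : ℝ) (n : ℂ) : Prop where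
  unit : ‖n‖ = 1
  normal : inner ℝ n (deriv γ θ) = 0
  outward : ∀ᶠ s : ℝ in 𝓝[>] 0, γ θ - s * n ∈ Ω ∧ γ θ + s * n ∉ closure Ω

/-- The smooth increasing family `Ω t`, `t ∈ I`, of smooth Jordan domains containing the origin
solves the Hele-Shaw flow with permeability `κ`: at every boundary point
`V = - κ ∇p`, where `V = ⟨∂Γ/∂t, n⟩ n` is the normal outward velocity of the boundary and `∇p` is
the (one-sided) gradient of the pressure. -/
def IsHeleShawFlow (κ : ℂ → ℝ) (I : Set ℝ) (Ω : ℝ → Set ℂ) : Prop :=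
  IsIncreasingFamily I Ω ∧ (∀ t ∈ I, (0 : ℂ) ∈ Ω t) ∧
  ∃ Γ : ℝ → ℝ → ℂ, IsSmoothJordanFamily I Ω Γ ∧
    ∀ t ∈ I, ∃ p : ℂ → ℝ, IsPressure (Ω t) p ∧
      ∀ θ : ℝ, ∃ n g : ℂ, IsOutwardNormal (Ω t) (Γ t) θ n ∧
        HasGradientWithinAt p g (closure (Ω t)) (Γ t θ) ∧
        (inner ℝ (derivWithin (fun τ => Γ τ θ) I t) n : ℝ) • n = -(κ (Γ t θ) • g)

/-! ### Schwarz functions and holomorphic discs -/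

/-- The Wirtinger derivative `∂φ/∂z = (∂φ/∂x - i ∂φ/∂y) / 2`. -/
def wirtinger (φ : ℂ → ℝ) (z : ℂ) : ℂ :=
  ((fderiv ℝ φ z 1 : ℝ) - I * (fderiv ℝ φ z I : ℝ)) / 2

/-- `S` is a Schwarz function of `(Ω, φ)` that is holomorphic on `Ω` except for a simple pole at
`0`, with residue `r`. (The value `S 0` is irrelevant.) -/
structure IsSchwarzFunction (Ω : Set ℂ) (φ : ℂ → ℝ) (S : ℂ → ℂ) (r : ℂ) : Prop where
  holomorphic : DifferentiableOn ℂ S (Ω \ {0})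
  residue_ne_zero : r ≠ 0
  residue : Tendsto (fun z => z * S z) (𝓝[≠] 0) (𝓝 r)
  continuousOn : ContinuousOn S (closure Ω \ {0})
  boundary : ∀ z ∈ frontier Ω, S z = wirtinger φ z

/-- The graph `Λ` of `∂φ/∂z` over `U`, inside `ℂ × ℙ¹`. -/
def graphLambda (U : Set ℂ) (φ : ℂ → ℝ) : Set (ℂ × OnePoint ℂ) :=
  {q | ∃ z ∈ U, q = (z, (wirtinger φ z : OnePoint ℂ))}

/-- The (open) disc `Σ` parametrized by `f`. -/
def discImage (f : ℂ → ℂ × OnePoint ℂ) : Set (ℂ × OnePoint ℂ) := f '' Metric.ball 0 1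

/-- The projection `π₁(Σ)` of the disc to the first factor. -/
def discShadow (f : ℂ → ℂ × OnePoint ℂ) : Set ℂ := Prod.fst '' discImage f

/-- `f` is an embedding of the closed unit disc into `ℂ × ℙ¹`, holomorphic in the interior
and smooth up to the boundary. -/
structure IsEmbeddedDisc (f : ℂ → ℂ × OnePoint ℂ) : Prop where
  smooth_fst : ContDiffOn ℝ ∞ (fun ζ => (f ζ).1) (Metric.closedBall 0 1)
  smooth_snd : SphereSmoothOn (fun ζ => (f ζ).2) (Metric.closedBall 0 1)
  holomorphic_fst : DifferentiableOn ℂ (fun ζ => (f ζ).1) (Metric.ball 0 1)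
  holomorphic_snd : SphereHolomorphicOn (fun ζ => (f ζ).2) (Metric.ball 0 1)
  injective : InjOn f (Metric.closedBall 0 1)
  immersion : ∀ ζ ∈ Metric.closedBall (0 : ℂ) 1,
    fderivWithin ℝ (fun y => (f y).1) (Metric.closedBall 0 1) ζ ≠ 0 ∨
    ((f ζ).2 ≠ OnePoint.infty ∧
      fderivWithin ℝ (fun y => sphereChartZero (f y).2) (Metric.closedBall 0 1) ζ ≠ 0) ∨
    ((f ζ).2 ≠ ((0 : ℂ) : OnePoint ℂ) ∧
      fderivWithin ℝ (fun y => sphereChartInfty (f y).2) (Metric.closedBall 0 1) ζ ≠ 0)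

/-- The conditions on a disc `Σ` relative to `Λ` and `(0, ∞)`:
* `isom`: `π₁ : Σ → π₁(Σ)` is an isomorphism;
* `boundary`: the boundary of `Σ` lies in `Λ`;
* `meets_fibre`: the closure of `Σ` meets `{0} × ℙ¹` precisely in `(0, ∞)`;
* `meets_infty`, `transversal`: the closure of `Σ` meets `ℂ × {∞}` precisely in `(0, ∞)`, and it
does so transversally; that is, `Σ` is the graph of a function whose only pole is a simple one
at `0`. -/
structure IsAdmissibleDisc (U : Set ℂ) (φ : ℂ → ℝ) (f : ℂ → ℂ × OnePoint ℂ) : Prop where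
  disc : IsEmbeddedDisc f
  isom : ∃ g : ℂ → ℂ, DifferentiableOn ℂ g (discShadow f) ∧
    ∀ ζ ∈ Metric.ball (0 : ℂ) 1, g (f ζ).1 = ζ
  boundary : f '' Metric.sphere 0 1 ⊆ graphLambda U φ
  meets_fibre : closure (discImage f) ∩ {q | q.1 = 0} = {((0 : ℂ), OnePoint.infty)}
  meets_infty : closure (discImage f) ∩ {q | q.2 = OnePoint.infty} = {((0 : ℂ), OnePoint.infty)}
  transversal : ∀ ζ ∈ Metric.ball (0 : ℂ) 1, (f ζ).2 = OnePoint.infty →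
    deriv (fun y => sphereChartInfty (f y).2) ζ ≠ 0

/-- A family `F t`, `t ∈ I`, of parametrized admissible discs that is smooth in `t` and in the
point of the closed disc jointly. -/
structure IsSmoothDiscFamily (U : Set ℂ) (φ : ℂ → ℝ) (I : Set ℝ)
    (F : ℝ → ℂ → ℂ × OnePoint ℂ) : Prop where
  smooth_fst : ContDiffOn ℝ ∞ (fun q : ℝ × ℂ => (F q.1 q.2).1) (I ×ˢ Metric.closedBall 0 1)
  smooth_snd : SphereSmoothOn (fun q : ℝ × ℂ => (F q.1 q.2).2) (I ×ˢ Metric.closedBall 0 1)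
  admissible : ∀ t ∈ I, IsAdmissibleDisc U φ (F t)

end

/-!
The two directions are tied together by the conformal map `a` of the disc onto a domain `Ω` with
`a 0 = 0` and `a' 0 > 0`. A disc over `Ω` is the graph of a Schwarz function `S`, and it is
described by `a` and by `ζ ↦ ζ S (a ζ)`, which is holomorphic with the boundary values `ζ ∂φ/∂z`;
its value at `0` is the residue divided by `a' 0`.

From discs to the flow. Automorphisms of the disc, found from contour integrals, put the family in
this form, `A t` and `B t` (`IsSmoothDiscFamily.exists_isNormalizedFamily`). Since `d(∂φ/∂z) ∧ dz`
is a multiple of `Δφ dx ∧ dy`, a combination of `A`, `B` and their derivatives that is holomorphic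
on the disc is real on the circle, so that it is a constant, proportional to the derivative `ρ` of
`4π` times the residue (`IsNormalizedFamily.newRate_eq`). Hence the boundary values `u` of `A`
satisfy `∂u/∂t = -i ρ K ∂u/∂θ`, where `Re K = 1 / (2π Δφ |∂u/∂θ|²)` (`timeDeriv_eq`,
`speedKernel_re`). This is the Hele-Shaw flow with the pressure `-(1 / 2π) log |a⁻¹|` at the rate
`ρ`. By the Schwarz lemma `ρ ≥ 0`, and `ρ` vanishes on no interval because the domains increase
strictly; so `4π` times the residue is a strictly increasing new time. It need not have a smooth
inverse, but the equation of motion has coefficients depending on `u` alone, so that `u` can be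
differentiated in the new time as often as desired (`TimeClass`, `IsTimeChange.contDiffOn`).

From the flow to discs. The pressure is the logarithmic potential of its own flux
(`HasPressureFlux.exists_potential`), and `z` divided by the exponential of a complex version of
this potential is the inverse of `a`; so the flux is the angular density of the boundary values of
`a` (`HasPressureFlux.exists_riemannMap`). By Darcy's law, the moment function
`∫ (∂φ/∂z) dz / (z - w)` changes at `w` outside `Ω` at the rate `-i / (2w)` (`IsOrientedFlow.momentFun_eq`). The
Schwarz function at time `t₀` thus makes it a multiple of `1 / w` at all times, and the
Sokhotski–Plemelj jump formula turns this into a Schwarz function with residue `r + (t - t₀) / 4π`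
(`IsOrientedFlow.isSchwarzFunction`). The conformal maps are power series whose coefficients are
Fourier coefficients in the angular variable given by the flux; they decrease rapidly with all
their time derivatives, whence joint smoothness up to the boundary (`AngleChange`, `RapidFamily`).
-/

noncomputable section

open Metric intervalIntegral Function Laplacian InnerProductSpace
open scoped Real

/-! ### Differentiability in a time interval and a space variable -/

section Partials

variable {𝕂 F : Type*} [RCLike 𝕂] [NormedAddCommGroup F] [NormedSpace ℝ F] [NormedSpace 𝕂 F]
  [IsScalarTower ℝ 𝕂 F]

/-- The real linear map `(τ, h) ↦ τ • a + h • b` on `ℝ × 𝕂`, as a continuous linear function of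
the pair `(a, b)` of partial derivatives. -/
def partialsCLM (𝕂 F : Type*) [RCLike 𝕂] [NormedAddCommGroup F] [NormedSpace ℝ F]
    [NormedSpace 𝕂 F] [IsScalarTower ℝ 𝕂 F] : F × F →L[ℝ] (ℝ × 𝕂 →L[ℝ] F) :=
  LinearMap.mkContinuous
    { toFun := fun p => (ContinuousLinearMap.fst ℝ ℝ 𝕂).smulRight p.1 +
        ((ContinuousLinearMap.toSpanSingleton 𝕂 p.2).restrictScalars ℝ).comp
          (ContinuousLinearMap.snd ℝ ℝ 𝕂)
      map_add' := fun p q => by ext <;> simp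
      map_smul' := fun c p => by
        ext x
        · simp
        · simpa using smul_algebra_smul_comm c x p.2 }
    2 (fun p => by
      refine ContinuousLinearMap.opNorm_le_bound _ (by positivity) (fun x => ?_)
      simp only [LinearMap.coe_mk, AddHom.coe_mk, add_apply,
        ContinuousLinearMap.smulRight_apply, ContinuousLinearMap.coe_fst',
        ContinuousLinearMap.comp_apply, ContinuousLinearMap.coe_snd',
        ContinuousLinearMap.coe_restrictScalars', ContinuousLinearMap.toSpanSingleton_apply]
      refine (norm_add_le _ _).trans ?_
      rw [norm_smul, norm_smul]
      have h1 := norm_fst_le x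
      have h2 := norm_snd_le x
      have h3 := norm_fst_le p
      have h4 := norm_snd_le p
      nlinarith [mul_le_mul h1 h3 (norm_nonneg _) (norm_nonneg _),
        mul_le_mul h2 h4 (norm_nonneg _) (norm_nonneg _)])

@[simp] theorem partialsCLM_apply (p : F × F) (x : ℝ × 𝕂) :
    partialsCLM 𝕂 F p x = x.1 • p.1 + x.2 • p.2 := rfl

/-- Only one of the two partial derivatives has to be continuous. -/
theorem hasFDerivWithinAt_of_partials {J : Set ℝ} {A : Set 𝕂} (hA : Convex ℝ A)
    {v vx : ℝ × 𝕂 → F} {vt : F} {q : ℝ × 𝕂} (hq : q ∈ J ×ˢ A)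
    (ht : HasDerivWithinAt (fun τ => v (τ, q.2)) vt J q.1)
    (hx : ∀ p ∈ J ×ˢ A, HasDerivWithinAt (fun x => v (p.1, x)) (vx p) A p.2)
    (hc : ContinuousWithinAt vx (J ×ˢ A) q) :
    HasFDerivWithinAt v (partialsCLM 𝕂 F (vt, vx q)) (J ×ˢ A) q := by
  rw [hasFDerivWithinAt_iff_isLittleO, Asymptotics.isLittleO_iff]
  intro c hc0
  rw [hasDerivWithinAt_iff_isLittleO, Asymptotics.isLittleO_iff] at ht
  have h1 := ht (half_pos hc0)
  have h2 := Metric.continuousWithinAt_iff.1 hc (c / 2) (half_pos hc0)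
  obtain ⟨δ, hδ, hδ'⟩ := h2
  obtain ⟨ε, hε, hε'⟩ := Metric.mem_nhdsWithin_iff.1 h1
  have h3 : ball q (min δ ε) ∩ J ×ˢ A ∈ 𝓝[J ×ˢ A] q :=
    inter_mem (mem_nhdsWithin_of_mem_nhds (ball_mem_nhds _ (lt_min hδ hε)))
      self_mem_nhdsWithin
  filter_upwards [h3] with p hp
  obtain ⟨hp1, hpJ, hpA⟩ := hp
  rw [mem_ball, Prod.dist_eq, max_lt_iff] at hp1
  have e1 : ‖v (p.1, q.2) - v (q.1, q.2) - (p.1 - q.1) • vt‖ ≤ c / 2 * ‖p.1 - q.1‖ :=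
    hε' ⟨(hp1.1).trans_le (min_le_right _ _), hpJ⟩
  have e2 : ‖(v (p.1, p.2) - p.2 • vx q) - (v (p.1, q.2) - q.2 • vx q)‖
      ≤ c / 2 * ‖p.2 - q.2‖ := by
    have hconv : Convex ℝ (A ∩ ball q.2 δ) := hA.inter (convex_ball _ _)
    refine Convex.norm_image_sub_le_of_norm_hasDerivWithin_le (𝕜 := 𝕂)
      (f := fun x => v (p.1, x) - x • vx q) (f' := fun x => vx (p.1, x) - vx q)
      (s := A ∩ ball q.2 δ) ?_ ?_ hconv ?_ ?_
    · intro x hx'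
      refine ((hx (p.1, x) ⟨hpJ, hx'.1⟩).mono inter_subset_left).sub ?_
      simpa using (hasDerivWithinAt_id x _).smul_const (vx q)
    · intro x hx'
      have := hδ' (x := (p.1, x)) ⟨hpJ, hx'.1⟩ (by
        rw [Prod.dist_eq, max_lt_iff]
        exact ⟨(hp1.1).trans_le (min_le_left _ _), hx'.2⟩)
      rw [dist_eq_norm] at this
      exact this.le
    · exact ⟨hq.2, mem_ball_self hδ⟩
    · exact ⟨hpA, (hp1.2).trans_le (min_le_left _ _)⟩
  have e3 : v p - v q - (partialsCLM 𝕂 F (vt, vx q)) (p - q) =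
      (v (p.1, q.2) - v (q.1, q.2) - (p.1 - q.1) • vt) +
      ((v (p.1, p.2) - p.2 • vx q) - (v (p.1, q.2) - q.2 • vx q)) := by
    simp only [partialsCLM_apply, Prod.fst_sub, Prod.snd_sub, sub_smul]
    abel
  rw [e3]
  refine (norm_add_le _ _).trans ?_
  have h4 := norm_fst_le (p - q)
  have h5 := norm_snd_le (p - q)
  rw [Prod.fst_sub] at h4
  rw [Prod.snd_sub] at h5
  nlinarith

/-- A graded family of functions on `J × A` that is stable under partial derivatives, up to a
decrease of the grading, consists of functions that are as smooth as the grading says. -/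
theorem contDiffOn_of_graded_family {J : Set ℝ} {A : Set 𝕂} (P : ℕ → (ℝ × 𝕂 → F) → Prop)
    (h0 : ∀ v, P 0 v → ContinuousOn v (J ×ˢ A))
    (hs : ∀ k v, P (k + 1) v → ∃ vt vx : ℝ × 𝕂 → F, P k vt ∧ P k vx ∧
      ∀ q ∈ J ×ˢ A, HasFDerivWithinAt v (partialsCLM 𝕂 F (vt q, vx q)) (J ×ˢ A) q)
    (k : ℕ) : ∀ v, P k v → ContDiffOn ℝ k v (J ×ˢ A) := by
  induction k with
  | zero => intro v hv; exact_mod_cast contDiffOn_zero.2 (h0 v hv)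
  | succ k ih =>
    intro v hv
    obtain ⟨vt, vx, h1, h2, h3⟩ := hs k v hv
    push_cast
    rw [contDiffOn_succ_iff_hasFDerivWithinAt (by simp)]
    intro q hq
    refine ⟨J ×ˢ A, ?_, by simp, fun q => partialsCLM 𝕂 F (vt q, vx q), h3, ?_⟩
    · rw [insert_eq_of_mem hq]; exact self_mem_nhdsWithin
    · exact (ContinuousLinearMap.contDiff (𝕜 := ℝ) (E := F × F) (F := ℝ × 𝕂 →L[ℝ] F)
        (partialsCLM 𝕂 F)).comp_contDiffOn ((ih vt h1).prodMk (ih vx h2))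

/-- A family of functions on `J × A` that is stable under partial derivatives consists of smooth
functions. -/
theorem contDiffOn_infty_of_family {J : Set ℝ} {A : Set 𝕂} (P : (ℝ × 𝕂 → F) → Prop)
    (hs : ∀ v, P v → ∃ vt vx : ℝ × 𝕂 → F, P vt ∧ P vx ∧
      ∀ q ∈ J ×ˢ A, HasFDerivWithinAt v (partialsCLM 𝕂 F (vt q, vx q)) (J ×ˢ A) q)
    {v : ℝ × 𝕂 → F} (hv : P v) : ContDiffOn ℝ ∞ v (J ×ˢ A) :=
  contDiffOn_infty.2 fun k => contDiffOn_of_graded_family (fun _ => P)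
    (fun v hv q hq => by
      obtain ⟨vt, vx, -, -, h⟩ := hs v hv
      exact (h q hq).continuousWithinAt) (fun _ => hs) k v hv

end Partials

section Intervals

/-- A nondegenerate interval has unique derivatives. -/
theorem uniqueDiffOn_of_ordConnected {J : Set ℝ} (hJ : J.OrdConnected) (hJ' : J.Nontrivial) :
    UniqueDiffOn ℝ J := by
  obtain ⟨a, ha, b, hb, hab⟩ := hJ'.exists_lt
  refine uniqueDiffOn_convex (hJ.convex (𝕜 := ℝ)) ⟨(a + b) / 2, ?_⟩
  have : Ioo a b ⊆ interior J := by
    rw [← interior_Icc]; exact interior_mono (hJ.out ha hb)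
  exact this ⟨by linarith, by linarith⟩

theorem subset_closure_interior_of_ordConnected {J : Set ℝ} (hJ : J.OrdConnected)
    (hJ' : J.Nontrivial) : J ⊆ closure (interior J) := by
  obtain ⟨a, ha, b, hb, hab⟩ := hJ'.exists_lt
  have : (interior J).Nonempty := ⟨(a + b) / 2, (by
    rw [← interior_Icc]; exact interior_mono (hJ.out ha hb) : Ioo a b ⊆ interior J)
      ⟨by linarith, by linarith⟩⟩
  rw [(hJ.convex (𝕜 := ℝ)).closure_interior_eq_closure_of_nonempty_interior this]
  exact subset_closure

variable {E : Type*} [NormedAddCommGroup E] [NormedSpace ℝ E]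

/-- Differentiation under the integral sign, with respect to a parameter in an interval that
need not be open. -/
theorem hasDerivWithinAt_intervalIntegral {J : Set ℝ} (hJ : J.OrdConnected)
    {u ut : ℝ → ℝ → E} {a b : ℝ}
    (hc : ∀ t ∈ J, ContinuousOn (u t) (uIcc a b))
    (hd : ∀ t ∈ J, ∀ x ∈ uIcc a b, HasDerivWithinAt (fun τ => u τ x) (ut t x) J t)
    (hut : ContinuousOn (fun q : ℝ × ℝ => ut q.1 q.2) (J ×ˢ uIcc a b)) {t : ℝ} (ht : t ∈ J) :
    HasDerivWithinAt (fun τ => ∫ x in a..b, u τ x) (∫ x in a..b, ut t x) J t := by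
  rw [hasDerivWithinAt_iff_isLittleO, Asymptotics.isLittleO_iff]
  intro c hc0
  set c' : ℝ := c / (|b - a| + 1) with hc'
  have hpos : 0 < |b - a| + 1 := by positivity
  have hc'0 : 0 < c' := div_pos hc0 hpos
  have huni : ∀ᶠ τ in 𝓝[J] t, ∀ x ∈ uIcc a b, ‖ut τ x - ut t x‖ ≤ c' := by
    have hK : IsCompact (uIcc a b) := isCompact_uIcc
    have : ∀ᶠ τ in 𝓝 t, ∀ x ∈ uIcc a b, τ ∈ J → ‖ut τ x - ut t x‖ ≤ c' := by
      have h := hK.eventually_forall_of_forall_eventually (x₀ := t)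
        (P := fun τ x => τ ∈ J → x ∈ uIcc a b → ‖ut τ x - ut t x‖ ≤ c') ?_
      · filter_upwards [h] with τ h x hx hτ using h x hx hτ hx
      · intro x hx
        have h1 := Metric.continuousWithinAt_iff.1 (hut (t, x) ⟨ht, hx⟩) (c' / 2) (half_pos hc'0)
        obtain ⟨δ, hδ, h2⟩ := h1
        filter_upwards [ball_mem_nhds (t, x) hδ] with p hp hpJ hpx
        have h3 := h2 (x := p) ⟨hpJ, hpx⟩ hp
        rw [mem_ball, Prod.dist_eq, max_lt_iff] at hp
        have h4 := h2 (x := (t, p.2)) ⟨ht, hpx⟩ (by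
          rw [Prod.dist_eq, max_lt_iff]; exact ⟨by simpa using hδ, hp.2⟩)
        rw [dist_eq_norm] at h3 h4
        calc ‖ut p.1 p.2 - ut t p.2‖ = ‖(ut p.1 p.2 - ut t x) - (ut t p.2 - ut t x)‖ := by
              congr 1; abel
          _ ≤ _ := (norm_sub_le _ _).trans (by linarith)
    filter_upwards [mem_nhdsWithin_of_mem_nhds this, self_mem_nhdsWithin] with τ h1 h2 x hx
      using h1 x hx h2
  obtain ⟨ε, hε, hε'⟩ := Metric.mem_nhdsWithin_iff.1 huni
  have h3 : ball t ε ∩ J ∈ 𝓝[J] t :=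
    inter_mem (mem_nhdsWithin_of_mem_nhds (ball_mem_nhds _ hε)) self_mem_nhdsWithin
  have hut' : ContinuousOn (ut t) (uIcc a b) :=
    hut.comp (f := fun x => (t, x)) (by fun_prop) (fun x hx => ⟨ht, hx⟩)
  filter_upwards [h3] with τ hτ
  have key : ∀ x ∈ uIcc a b, ‖u τ x - u t x - (τ - t) • ut t x‖ ≤ c' * ‖τ - t‖ := by
    intro x hx
    have hconv : Convex ℝ (ball t ε ∩ J) := (convex_ball _ _).inter hJ.convex
    have := Convex.norm_image_sub_le_of_norm_hasDerivWithin_le (𝕜 := ℝ)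
      (f := fun r => u r x - r • ut t x) (f' := fun r => ut r x - ut t x)
      (s := ball t ε ∩ J) (x := t) (y := τ) (C := c') (fun r hr => by
        refine ((hd r hr.2 x hx).mono inter_subset_right).sub ?_
        simpa using (hasDerivWithinAt_id r _).smul_const (ut t x))
      (fun r hr => hε' hr x hx) hconv ⟨mem_ball_self hε, ht⟩ hτ
    convert this using 2
    rw [sub_smul]; abel
  have hi1 : IntervalIntegrable (u τ) MeasureTheory.volume a b := (hc τ hτ.2).intervalIntegrable
  have hi2 : IntervalIntegrable (u t) MeasureTheory.volume a b := (hc t ht).intervalIntegrable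
  have hi3 : IntervalIntegrable (ut t) MeasureTheory.volume a b := hut'.intervalIntegrable
  rw [← integral_sub hi1 hi2, ← integral_smul,
    ← integral_sub (hi1.sub hi2) (g := fun x => (τ - t) • ut t x) (hi3.smul _)]
  refine (norm_integral_le_of_norm_le_const
    (fun x hx => key x (uIoc_subset_uIcc hx))).trans ?_
  have : c' * |b - a| ≤ c := by
    rw [hc', div_mul_eq_mul_div, div_le_iff₀ hpos]; nlinarith [abs_nonneg (b - a)]
  nlinarith [norm_nonneg (τ - t), mul_le_mul_of_nonneg_right this (norm_nonneg (τ - t))]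

end Intervals

/-! ### Smooth functions on a strip `J × ℝ` -/

section Strip

variable {E : Type*} [NormedAddCommGroup E] [NormedSpace ℝ E]

/-- `u t θ` is jointly smooth in `t ∈ J` and `θ ∈ ℝ`, up to the end points of `J`. -/
def SmoothOnStrip (J : Set ℝ) (u : ℝ → ℝ → E) : Prop :=
  ContDiffOn ℝ ∞ (fun q : ℝ × ℝ => u q.1 q.2) (J ×ˢ univ)

/-- The derivative `∂u/∂t`, one-sided at the end points of `J`. -/
def timeDeriv (J : Set ℝ) (u : ℝ → ℝ → E) : ℝ → ℝ → E :=
  fun t θ => derivWithin (fun τ => u τ θ) J t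

/-- The derivative `∂u/∂θ`. -/
def angleDeriv (u : ℝ → ℝ → E) : ℝ → ℝ → E := fun t θ => deriv (u t) θ

variable {J : Set ℝ} {u : ℝ → ℝ → E}

theorem uniqueDiffOn_strip (hJ : J.OrdConnected) (hJ' : J.Nontrivial) :
    UniqueDiffOn ℝ (J ×ˢ (univ : Set ℝ)) :=
  (uniqueDiffOn_of_ordConnected hJ hJ').prod uniqueDiffOn_univ

theorem SmoothOnStrip.hasFDerivWithinAt (hu : SmoothOnStrip J u) {t θ : ℝ} (ht : t ∈ J) :
    HasFDerivWithinAt (fun q : ℝ × ℝ => u q.1 q.2)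
      (fderivWithin ℝ (fun q : ℝ × ℝ => u q.1 q.2) (J ×ˢ univ) (t, θ)) (J ×ˢ univ) (t, θ) :=
  (hu.differentiableOn (by simp) (t, θ) ⟨ht, mem_univ _⟩).hasFDerivWithinAt

theorem SmoothOnStrip.hasDerivWithinAt_time' (hu : SmoothOnStrip J u) {t : ℝ} (ht : t ∈ J)
    (θ : ℝ) : HasDerivWithinAt (fun τ => u τ θ)
      (fderivWithin ℝ (fun q : ℝ × ℝ => u q.1 q.2) (J ×ˢ univ) (t, θ) (1, 0)) J t := by
  have h1 : HasDerivWithinAt (fun τ : ℝ => (τ, θ)) ((1 : ℝ), (0 : ℝ)) J t :=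
    (hasDerivWithinAt_id t J).prodMk (hasDerivWithinAt_const t J θ)
  exact HasFDerivWithinAt.comp_hasDerivWithinAt (f := fun τ : ℝ => (τ, θ)) t
    (hu.hasFDerivWithinAt ht) h1 (fun τ hτ => ⟨hτ, mem_univ _⟩)

theorem SmoothOnStrip.hasDerivAt_angle' (hu : SmoothOnStrip J u) {t : ℝ} (ht : t ∈ J)
    (θ : ℝ) : HasDerivAt (u t)
      (fderivWithin ℝ (fun q : ℝ × ℝ => u q.1 q.2) (J ×ˢ univ) (t, θ) (0, 1)) θ := by
  have h1 : HasDerivWithinAt (fun x : ℝ => (t, x)) ((0 : ℝ), (1 : ℝ)) univ θ :=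
    (hasDerivWithinAt_const θ univ t).prodMk (hasDerivWithinAt_id θ univ)
  exact (HasFDerivWithinAt.comp_hasDerivWithinAt (f := fun x : ℝ => (t, x)) θ
    (hu.hasFDerivWithinAt ht) h1 (fun τ _ => ⟨ht, mem_univ _⟩)).hasDerivAt (by simp)

theorem SmoothOnStrip.timeDeriv_eq (hu : SmoothOnStrip J u) (hJ : J.OrdConnected)
    (hJ' : J.Nontrivial) {t : ℝ} (ht : t ∈ J) (θ : ℝ) : timeDeriv J u t θ =
      fderivWithin ℝ (fun q : ℝ × ℝ => u q.1 q.2) (J ×ˢ univ) (t, θ) (1, 0) :=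
  (hu.hasDerivWithinAt_time' ht θ).derivWithin (uniqueDiffOn_of_ordConnected hJ hJ' t ht)

theorem SmoothOnStrip.angleDeriv_eq (hu : SmoothOnStrip J u) {t : ℝ} (ht : t ∈ J) (θ : ℝ) :
    angleDeriv u t θ =
      fderivWithin ℝ (fun q : ℝ × ℝ => u q.1 q.2) (J ×ˢ univ) (t, θ) (0, 1) :=
  (hu.hasDerivAt_angle' ht θ).deriv

theorem SmoothOnStrip.hasDerivWithinAt_time (hu : SmoothOnStrip J u) {t : ℝ} (ht : t ∈ J)
    (θ : ℝ) : HasDerivWithinAt (fun τ => u τ θ) (timeDeriv J u t θ) J t :=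
  (hu.hasDerivWithinAt_time' ht θ).differentiableWithinAt.hasDerivWithinAt

theorem SmoothOnStrip.hasDerivAt_angle (hu : SmoothOnStrip J u) {t : ℝ} (ht : t ∈ J)
    (θ : ℝ) : HasDerivAt (u t) (angleDeriv u t θ) θ :=
  (hu.hasDerivAt_angle' ht θ).differentiableAt.hasDerivAt

theorem SmoothOnStrip.congr {v : ℝ → ℝ → E} (hu : SmoothOnStrip J u)
    (h : ∀ t ∈ J, ∀ θ, v t θ = u t θ) : SmoothOnStrip J v :=
  ContDiffOn.congr hu (fun q hq => h q.1 hq.1 q.2)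

theorem SmoothOnStrip.timeDeriv (hu : SmoothOnStrip J u) (hJ : J.OrdConnected)
    (hJ' : J.Nontrivial) : SmoothOnStrip J (timeDeriv J u) := by
  have h := ContDiffOn.fderivWithin hu (uniqueDiffOn_strip hJ hJ') (m := ∞) (by simp)
  exact (h.clm_apply contDiffOn_const).congr fun q hq => hu.timeDeriv_eq hJ hJ' hq.1 q.2

theorem SmoothOnStrip.angleDeriv (hu : SmoothOnStrip J u) (hJ : J.OrdConnected)
    (hJ' : J.Nontrivial) : SmoothOnStrip J (angleDeriv u) := by
  have h := ContDiffOn.fderivWithin hu (uniqueDiffOn_strip hJ hJ') (m := ∞) (by simp)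
  exact (h.clm_apply contDiffOn_const).congr fun q hq => hu.angleDeriv_eq hq.1 q.2

theorem SmoothOnStrip.timeDeriv_angleDeriv (hu : SmoothOnStrip J u) (hJ : J.OrdConnected)
    (hJ' : J.Nontrivial) {t : ℝ} (ht : t ∈ J) (θ : ℝ) :
    _root_.timeDeriv J (_root_.angleDeriv u) t θ =
      _root_.angleDeriv (_root_.timeDeriv J u) t θ := by
  have hU := uniqueDiffOn_strip hJ hJ'
  set U : ℝ × ℝ → E := fun q => u q.1 q.2
  set S : Set (ℝ × ℝ) := J ×ˢ univ
  have hS : (t, θ) ∈ S := ⟨ht, mem_univ _⟩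
  have h := ContDiffOn.fderivWithin hu hU (m := ∞) (by simp)
  have hd : HasFDerivWithinAt (fderivWithin ℝ U S)
      (fderivWithin ℝ (fderivWithin ℝ U S) S (t, θ)) S (t, θ) :=
    (h.differentiableOn (by simp) _ hS).hasFDerivWithinAt
  have hsymm : IsSymmSndFDerivWithinAt ℝ U S (t, θ) := by
    refine (hu (t, θ) hS).isSymmSndFDerivWithinAt (by simpa using WithTop.coe_le_coe.2 (le_top : (2 : ℕ∞) ≤ ⊤)) hU ?_ hS
    rw [interior_prod_eq, closure_prod_eq]
    exact ⟨subset_closure_interior_of_ordConnected hJ hJ' ht, by simp⟩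
  have h1 : HasDerivWithinAt (fun τ : ℝ => (τ, θ)) ((1 : ℝ), (0 : ℝ)) J t :=
    (hasDerivWithinAt_id t J).prodMk (hasDerivWithinAt_const t J θ)
  have h2 : HasDerivWithinAt (fun x : ℝ => (t, x)) ((0 : ℝ), (1 : ℝ)) univ θ :=
    (hasDerivWithinAt_const θ univ t).prodMk (hasDerivWithinAt_id θ univ)
  have e1 : HasDerivWithinAt (fun τ => _root_.angleDeriv u τ θ)
      (fderivWithin ℝ (fderivWithin ℝ U S) S (t, θ) (1, 0) (0, 1)) J t := by
    have := (HasFDerivWithinAt.comp_hasDerivWithinAt (f := fun τ : ℝ => (τ, θ)) (s := J)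
      (t := S) t hd h1 (fun τ hτ => ⟨hτ, mem_univ _⟩)).clm_apply (hasDerivWithinAt_const t J ((0 : ℝ), (1 : ℝ)))
    simp only [comp_apply, map_zero, add_zero] at this
    exact this.congr (fun τ hτ => hu.angleDeriv_eq hτ θ) (hu.angleDeriv_eq ht θ)
  have e2 : HasDerivWithinAt (fun x => _root_.timeDeriv J u t x)
      (fderivWithin ℝ (fderivWithin ℝ U S) S (t, θ) (0, 1) (1, 0)) univ θ := by
    have := (HasFDerivWithinAt.comp_hasDerivWithinAt (f := fun x : ℝ => (t, x)) (s := univ)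
      (t := S) θ hd h2 (fun τ _ => ⟨ht, mem_univ _⟩)).clm_apply (hasDerivWithinAt_const θ univ ((1 : ℝ), (0 : ℝ)))
    simp only [comp_apply, map_zero, add_zero] at this
    exact this.congr (fun τ _ => hu.timeDeriv_eq hJ hJ' ht τ) (hu.timeDeriv_eq hJ hJ' ht θ)
  have e3 := e1.derivWithin (uniqueDiffOn_of_ordConnected hJ hJ' t ht)
  have e4 := (e2.hasDerivAt (by simp)).deriv
  exact e3.trans ((hsymm (1, 0) (0, 1)).trans e4.symm)

theorem SmoothOnStrip.contDiff (hu : SmoothOnStrip J u) {t : ℝ} (ht : t ∈ J) :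
    ContDiff ℝ ∞ (u t) := by
  rw [← contDiffOn_univ]
  exact ContDiffOn.comp (g := fun q : ℝ × ℝ => u q.1 q.2) (f := fun x : ℝ => (t, x)) hu
    (by fun_prop) (fun x _ => ⟨ht, mem_univ _⟩)

theorem SmoothOnStrip.continuousOn (hu : SmoothOnStrip J u) :
    ContinuousOn (fun q : ℝ × ℝ => u q.1 q.2) (J ×ˢ univ) := ContDiffOn.continuousOn hu

theorem SmoothOnStrip.hasFDerivWithinAt_partials (hu : SmoothOnStrip J u) (hJ : J.OrdConnected)
    (hJ' : J.Nontrivial) {q : ℝ × ℝ} (hq : q ∈ J ×ˢ (univ : Set ℝ)) :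
    HasFDerivWithinAt (fun q : ℝ × ℝ => u q.1 q.2)
      (partialsCLM ℝ E (_root_.timeDeriv J u q.1 q.2, _root_.angleDeriv u q.1 q.2))
      (J ×ˢ univ) q := by
  convert hu.hasFDerivWithinAt (t := q.1) (θ := q.2) hq.1 using 1
  rw [hu.timeDeriv_eq hJ hJ' hq.1, hu.angleDeriv_eq hq.1]
  ext <;> simp

theorem SmoothOnStrip.comp {F : Type*} [NormedAddCommGroup F] [NormedSpace ℝ F] {O : Set E}
    {g : E → F} (hg : ContDiffOn ℝ ∞ g O) (hu : SmoothOnStrip J u)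
    (hm : ∀ t ∈ J, ∀ θ, u t θ ∈ O) : SmoothOnStrip J (fun t θ => g (u t θ)) :=
  ContDiffOn.comp (g := g) hg hu (fun q hq => hm q.1 hq.1 q.2)

theorem SmoothOnStrip.prodMk {F : Type*} [NormedAddCommGroup F] [NormedSpace ℝ F]
    {v : ℝ → ℝ → F} (hu : SmoothOnStrip J u) (hv : SmoothOnStrip J v) :
    SmoothOnStrip J (fun t θ => (u t θ, v t θ)) := ContDiffOn.prodMk hu hv

theorem SmoothOnStrip.angle_integral [CompleteSpace E] (hu : SmoothOnStrip J u)
    (hJ : J.OrdConnected) (hJ' : J.Nontrivial) :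
    SmoothOnStrip J (fun t θ => ∫ x in (0 : ℝ)..θ, u t x) := by
  let P : (ℝ × ℝ → E) → Prop := fun V => ∃ v : ℝ → ℝ → E, SmoothOnStrip J v ∧
    (V = (fun q => v q.1 q.2) ∨ V = fun q => ∫ x in (0 : ℝ)..q.2, v q.1 x)
  refine contDiffOn_infty_of_family P ?_ ⟨u, hu, Or.inr rfl⟩
  rintro V ⟨v, hv, rfl | rfl⟩
  · exact ⟨_, _, ⟨_, hv.timeDeriv hJ hJ', Or.inl rfl⟩, ⟨_, hv.angleDeriv hJ hJ', Or.inl rfl⟩,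
      fun q hq => hv.hasFDerivWithinAt_partials hJ hJ' hq⟩
  · refine ⟨_, _, ⟨_, hv.timeDeriv hJ hJ', Or.inr rfl⟩, ⟨_, hv, Or.inl rfl⟩, fun q hq => ?_⟩
    refine hasFDerivWithinAt_of_partials (𝕂 := ℝ) convex_univ hq
      (v := fun q : ℝ × ℝ => ∫ x in (0 : ℝ)..q.2, v q.1 x) (vx := fun q => v q.1 q.2)
      ?_ ?_ (hv.continuousOn q hq)
    · refine hasDerivWithinAt_intervalIntegral hJ (fun t ht => ?_)
        (fun t ht x _ => hv.hasDerivWithinAt_time ht x) ?_ hq.1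
      · exact (hv.contDiff ht).continuous.continuousOn
      · exact (hv.timeDeriv hJ hJ').continuousOn.mono (prod_mono subset_rfl (subset_univ _))
    · intro p hp
      exact (integral_hasDerivAt_right
        ((hv.contDiff hp.1).continuous.intervalIntegrable _ _)
        (hv.contDiff hp.1).continuous.stronglyMeasurable.stronglyMeasurableAtFilter
        (hv.contDiff hp.1).continuous.continuousAt).hasDerivWithinAt

theorem SmoothOnStrip.hasDerivWithinAt_integral (hu : SmoothOnStrip J u) (hJ : J.OrdConnected)
    (hJ' : J.Nontrivial) (a b : ℝ) {t : ℝ} (ht : t ∈ J) :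
    HasDerivWithinAt (fun t => ∫ x in a..b, u t x)
      (∫ x in a..b, _root_.timeDeriv J u t x) J t :=
  hasDerivWithinAt_intervalIntegral hJ (fun _ ht => (hu.contDiff ht).continuous.continuousOn)
    (fun _ ht x _ => hu.hasDerivWithinAt_time ht x)
    ((hu.timeDeriv hJ hJ').continuousOn.mono (prod_mono subset_rfl (subset_univ _))) ht

theorem SmoothOnStrip.contDiffOn_integral [CompleteSpace E] (hu : SmoothOnStrip J u)
    (hJ : J.OrdConnected) (hJ' : J.Nontrivial) (b : ℝ) :
    ContDiffOn ℝ ∞ (fun t => ∫ x in (0 : ℝ)..b, u t x) J :=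
  ContDiffOn.comp (g := fun q : ℝ × ℝ => ∫ x in (0 : ℝ)..q.2, u q.1 x)
    (f := fun t : ℝ => (t, b)) (hu.angle_integral hJ hJ') (by fun_prop)
    (fun x hx => ⟨hx, mem_univ _⟩)

/-- Local boundedness in `t`, uniformly over a period. -/
theorem SmoothOnStrip.exists_bound (hu : SmoothOnStrip J u) {t : ℝ} (ht : t ∈ J) (a b : ℝ) :
    ∃ B, ∀ᶠ τ in 𝓝[J] t, ∀ θ ∈ Icc a b, ‖u τ θ‖ ≤ B := by
  obtain ⟨B, hB⟩ := (isCompact_Icc (a := a) (b := b)).exists_bound_of_continuousOn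
    (hu.contDiff ht).continuous.continuousOn
  refine ⟨B + 1, ?_⟩
  have h := (isCompact_Icc (a := a) (b := b)).eventually_forall_of_forall_eventually (x₀ := t)
    (P := fun τ x => τ ∈ J → ‖u τ x‖ ≤ B + 1) ?_
  · filter_upwards [mem_nhdsWithin_of_mem_nhds h, self_mem_nhdsWithin] with τ h h' x hx
      using h x hx h'
  · intro x hx
    have h1 := (hu.continuousOn (t, x) ⟨ht, mem_univ _⟩).norm.eventually
      (eventually_lt_nhds (lt_of_le_of_lt (hB x hx) (lt_add_one B)))
    rw [eventually_nhdsWithin_iff] at h1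
    filter_upwards [h1] with p hp hpJ using (hp ⟨hpJ, mem_univ _⟩).le

end Strip

/-! ### Power series with rapidly decreasing coefficients -/

/-- Term by term differentiation within a set, when the terms are locally Lipschitz with summable
constants. -/
theorem hasDerivWithinAt_tsum {𝕂 F : Type*} [NontriviallyNormedField 𝕂] [NormedAddCommGroup F]
    [CompleteSpace F] [NormedSpace 𝕂 F] {f : ℕ → 𝕂 → F} {g : ℕ → F} {s : Set 𝕂} {x : 𝕂} {b : ℕ → ℝ}
    (hb : Summable b) (hd : ∀ n, HasDerivWithinAt (f n) (g n) s x)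
    (hx : Summable fun n => f n x)
    (hl : ∀ᶠ y in 𝓝[s] x, ∀ n, ‖f n y - f n x‖ ≤ b n * ‖y - x‖) :
    HasDerivWithinAt (fun y => ∑' n, f n y) (∑' n, g n) s x := by
  rw [hasDerivWithinAt_iff_tendsto_slope]
  have hl' : ∀ᶠ y in 𝓝[s \ {x}] x, ∀ n, ‖slope (f n) x y‖ ≤ b n := by
    filter_upwards [hl.filter_mono (nhdsWithin_mono _ sdiff_subset), self_mem_nhdsWithin]
      with y hy hy' n
    have h0 : 0 < ‖y - x‖ := norm_pos_iff.2 (sub_ne_zero.2 hy'.2)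
    rw [slope_def_module, norm_smul, norm_inv, inv_mul_le_iff₀ h0, mul_comm]
    exact hy n
  have h1 : Tendsto (fun y => ∑' n, slope (f n) x y) (𝓝[s \ {x}] x) (𝓝 (∑' n, g n)) :=
    tendsto_tsum_of_dominated_convergence hb
      (fun n => hasDerivWithinAt_iff_tendsto_slope.1 (hd n)) hl'
  refine h1.congr' ?_
  filter_upwards [hl', self_mem_nhdsWithin] with y hy hy'
  have h0 : y - x ≠ 0 := sub_ne_zero.2 hy'.2
  have hs : Summable fun n => slope (f n) x y := Summable.of_norm_bounded hb hy
  have hy2 : Summable fun n => f n y := by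
    have := (hs.const_smul (y - x)).add hx
    refine this.congr fun n => ?_
    simp [slope_def_module, smul_smul, mul_inv_cancel₀ h0]
  simp only [slope_def_module]
  rw [(hy2.tsum_sub hx).symm]
  exact (hy2.sub hx).tsum_const_smul _

/-- `C j n t` is the `j`-th derivative of the coefficient `C 0 n t`, and all the derivatives
decrease rapidly in `n`, locally uniformly in `t ∈ J`. -/
structure RapidFamily (J : Set ℝ) (C : ℕ → ℕ → ℝ → ℂ) : Prop where
  deriv : ∀ j n, ∀ t ∈ J, HasDerivWithinAt (C j n) (C (j + 1) n t) J t
  bound : ∀ j m, ∀ t ∈ J, ∃ B, ∀ᶠ τ in 𝓝[J] t, ∀ n : ℕ, (n : ℝ) ^ m * ‖C j n τ‖ ≤ B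

/-- The sum of a power series. -/
def powerSum (c : ℕ → ℂ) (ζ : ℂ) : ℂ := ∑' n, c n * ζ ^ n

/-- The coefficients of the derivative of a power series. -/
def derivCoeff (c : ℕ → ℂ) : ℕ → ℂ := fun n => (n + 1) * c (n + 1)

theorem summable_inv_succ_sq (B : ℝ) : Summable fun n : ℕ => B / ((n : ℝ) + 1) ^ 2 := by
  have := (summable_nat_add_iff 1).2 (Real.summable_one_div_nat_pow.2 (one_lt_two))
  refine (this.mul_left B).congr fun n => ?_
  push_cast
  ring

namespace RapidFamily

variable {J : Set ℝ} {C : ℕ → ℕ → ℝ → ℂ}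

theorem time (h : RapidFamily J C) : RapidFamily J (fun j => C (j + 1)) :=
  ⟨fun j n => h.deriv (j + 1) n, fun j => h.bound (j + 1)⟩

theorem exists_bound (h : RapidFamily J C) (j m : ℕ) {t : ℝ} (ht : t ∈ J) :
    ∃ B, ∀ᶠ τ in 𝓝[J] t, ∀ n : ℕ, ((n : ℝ) + 1) ^ m * ‖C j n τ‖ ≤ B := by
  obtain ⟨B₁, h1⟩ := h.bound j 0 t ht
  obtain ⟨B₂, h2⟩ := h.bound j m t ht
  refine ⟨2 ^ m * (B₁ + B₂), ?_⟩
  filter_upwards [h1, h2] with τ h1 h2 n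
  have h1 := h1 n
  have h2 := h2 n
  have hn : ((n : ℝ) + 1) ^ m ≤ 2 ^ m * (1 + (n : ℝ) ^ m) := by
    rcases Nat.eq_zero_or_pos n with rfl | hn
    · have : (1 : ℝ) ≤ 2 ^ m := one_le_pow₀ one_le_two
      have h0 : (0 : ℝ) ≤ (0 : ℝ) ^ m := by positivity
      simp only [Nat.cast_zero, zero_add, one_pow]
      nlinarith
    · have : (1 : ℝ) ≤ n := by exact_mod_cast hn
      calc ((n : ℝ) + 1) ^ m ≤ (2 * n) ^ m := by gcongr; linarith
        _ = 2 ^ m * (n : ℝ) ^ m := by rw [mul_pow]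
        _ ≤ _ := by gcongr; linarith
  calc _ ≤ 2 ^ m * (1 + (n : ℝ) ^ m) * ‖C j n τ‖ := by gcongr
    _ = 2 ^ m * ((n : ℝ) ^ 0 * ‖C j n τ‖ + (n : ℝ) ^ m * ‖C j n τ‖) := by ring
    _ ≤ _ := by gcongr

theorem space (h : RapidFamily J C) :
    RapidFamily J (fun j n t => derivCoeff (fun n => C j n t) n) := by
  refine ⟨fun j n t ht => (h.deriv j (n + 1) t ht).const_mul _, fun j m t ht => ?_⟩
  obtain ⟨B, hB⟩ := h.exists_bound j (m + 1) ht
  refine ⟨B, ?_⟩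
  filter_upwards [hB] with τ hB n
  have h1 := hB (n + 1)
  refine le_trans ?_ h1
  have e : ‖((n : ℂ) + 1)‖ = (n : ℝ) + 1 := by
    rw [show ((n : ℂ) + 1) = ((n + 1 : ℕ) : ℂ) by push_cast; ring, norm_natCast]
    push_cast; ring
  rw [derivCoeff, norm_mul, e, ← mul_assoc]
  gcongr
  rw [pow_succ]
  push_cast
  gcongr <;> linarith

theorem summable_bound (h : RapidFamily J C) (j m : ℕ) {t : ℝ} (ht : t ∈ J) :
    ∃ b : ℕ → ℝ, Summable b ∧ ∀ᶠ τ in 𝓝[J] t, ∀ n : ℕ, (n : ℝ) ^ m * ‖C j n τ‖ ≤ b n := by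
  obtain ⟨B, hB⟩ := h.exists_bound j (m + 2) ht
  refine ⟨_, summable_inv_succ_sq B, ?_⟩
  filter_upwards [hB] with τ hB n
  have h1 := hB n
  rw [le_div_iff₀ (by positivity)]
  refine le_trans ?_ h1
  rw [pow_add]
  have : (n : ℝ) ^ m ≤ ((n : ℝ) + 1) ^ m := by gcongr; linarith
  have h3 := norm_nonneg (C j n τ)
  have h4 : (0 : ℝ) ≤ ((n : ℝ) + 1) ^ 2 := by positivity
  nlinarith [mul_le_mul_of_nonneg_right this (mul_nonneg h3 h4)]

theorem norm_term_le {c ζ : ℂ} {n : ℕ} (hζ : ζ ∈ closedBall (0 : ℂ) 1) :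
    ‖c * ζ ^ n‖ ≤ ‖c‖ := by
  rw [mem_closedBall_zero_iff] at hζ
  rw [norm_mul, norm_pow]
  exact mul_le_of_le_one_right (norm_nonneg _) (pow_le_one₀ (norm_nonneg _) hζ)

theorem summable (h : RapidFamily J C) (j : ℕ) {t : ℝ} (ht : t ∈ J) {ζ : ℂ}
    (hζ : ζ ∈ closedBall (0 : ℂ) 1) : Summable fun n => C j n t * ζ ^ n := by
  obtain ⟨b, hb, hb'⟩ := h.summable_bound j 0 ht
  have := (mem_of_mem_nhdsWithin ht hb' :)
  refine Summable.of_norm_bounded hb fun n => (norm_term_le hζ).trans ?_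
  simpa using this n

theorem hasDerivWithinAt_time (h : RapidFamily J C) (hJ : J.OrdConnected) (j : ℕ) {t : ℝ}
    (ht : t ∈ J) {ζ : ℂ} (hζ : ζ ∈ closedBall (0 : ℂ) 1) :
    HasDerivWithinAt (fun τ => powerSum (fun n => C j n τ) ζ)
      (powerSum (fun n => C (j + 1) n t) ζ) J t := by
  obtain ⟨b, hb, hb'⟩ := h.summable_bound (j + 1) 0 ht
  refine hasDerivWithinAt_tsum hb (fun n => (h.deriv j n t ht).mul_const _) (h.summable j ht hζ) ?_
  obtain ⟨ε, hε, hε'⟩ := Metric.mem_nhdsWithin_iff.1 hb'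
  have h3 : ball t ε ∩ J ∈ 𝓝[J] t :=
    inter_mem (mem_nhdsWithin_of_mem_nhds (ball_mem_nhds _ hε)) self_mem_nhdsWithin
  filter_upwards [h3] with τ hτ n
  rw [← sub_mul]
  refine (norm_term_le hζ).trans ?_
  refine Convex.norm_image_sub_le_of_norm_hasDerivWithin_le (𝕜 := ℝ) (f := C j n)
    (f' := C (j + 1) n) (s := ball t ε ∩ J)
    (fun r hr => (h.deriv j n r hr.2).mono inter_subset_right) (fun r hr => ?_)
    ((convex_ball _ _).inter hJ.convex) ⟨mem_ball_self hε, ht⟩ hτ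
  simpa using hε' hr n

theorem hasDerivWithinAt_space (h : RapidFamily J C) (j : ℕ) {t : ℝ}
    (ht : t ∈ J) {ζ : ℂ} (hζ : ζ ∈ closedBall (0 : ℂ) 1) :
    HasDerivWithinAt (powerSum (fun n => C j n t))
      (powerSum (derivCoeff fun n => C j n t) ζ) (closedBall 0 1) ζ := by
  obtain ⟨b, hb, hb'⟩ := h.summable_bound j 1 ht
  have hb'' : ∀ n : ℕ, (n : ℝ) ^ 1 * ‖C j n t‖ ≤ b n := mem_of_mem_nhdsWithin ht hb'
  have h1 : HasDerivWithinAt (powerSum (fun n => C j n t))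
      (∑' n : ℕ, C j n t * (n * ζ ^ (n - 1))) (closedBall 0 1) ζ := by
    refine hasDerivWithinAt_tsum hb
      (fun n => ((hasDerivAt_pow n ζ).hasDerivWithinAt).const_mul _) (h.summable j ht hζ) ?_
    filter_upwards [self_mem_nhdsWithin] with ξ hξ n
    rw [← mul_sub, norm_mul]
    have h2 : ‖ξ ^ n - ζ ^ n‖ ≤ n * ‖ξ - ζ‖ := by
      refine Convex.norm_image_sub_le_of_norm_hasDerivWithin_le (𝕜 := ℂ) (f := fun x => x ^ n)
        (f' := fun x => n * x ^ (n - 1)) (s := closedBall (0 : ℂ) 1)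
        (fun x _ => (hasDerivAt_pow n x).hasDerivWithinAt) (fun x hx => norm_term_le hx |>.trans ?_)
        (convex_closedBall _ _) hζ hξ
      simp
    calc ‖C j n t‖ * ‖ξ ^ n - ζ ^ n‖ ≤ ‖C j n t‖ * (n * ‖ξ - ζ‖) := by gcongr
      _ = ((n : ℝ) ^ 1 * ‖C j n t‖) * ‖ξ - ζ‖ := by ring
      _ ≤ _ := by gcongr; exact hb'' n
  have h3 : (∑' n : ℕ, C j n t * (n * ζ ^ (n - 1))) = powerSum (derivCoeff fun n => C j n t) ζ := by
    have hs : Summable fun n : ℕ => C j n t * (n * ζ ^ (n - 1)) := by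
      refine Summable.of_norm_bounded hb fun n => ?_
      rw [show C j n t * (n * ζ ^ (n - 1)) = (n * C j n t) * ζ ^ (n - 1) by ring]
      refine (norm_term_le hζ).trans (le_trans (le_of_eq ?_) (hb'' n))
      rw [norm_mul, norm_natCast, pow_one]
    rw [hs.tsum_eq_zero_add]
    simp only [Nat.cast_zero, zero_mul, mul_zero, zero_add, powerSum, derivCoeff]
    refine tsum_congr fun n => ?_
    push_cast
    ring
  rwa [h3] at h1

theorem continuousOn (h : RapidFamily J C) (j : ℕ) :
    ContinuousOn (fun q : ℝ × ℂ => powerSum (fun n => C j n q.1) q.2)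
      (J ×ˢ closedBall 0 1) := by
  rintro ⟨t, ζ⟩ ⟨ht, hζ⟩
  obtain ⟨b, hb, hb'⟩ := h.summable_bound j 0 ht
  refine tendsto_tsum_of_dominated_convergence hb (fun n => ?_) ?_
  · have h1 : ContinuousWithinAt (fun q : ℝ × ℂ => C j n q.1) (J ×ˢ closedBall 0 1) (t, ζ) :=
      (h.deriv j n t ht).continuousWithinAt.comp (f := fun q : ℝ × ℂ => q.1)
        continuous_fst.continuousWithinAt (fun q hq => hq.1)
    exact h1.mul (continuous_snd.pow n).continuousWithinAt
  · have h1 : Tendsto (fun q : ℝ × ℂ => q.1) (𝓝[J ×ˢ closedBall 0 1] (t, ζ)) (𝓝[J] t) :=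
      (continuous_fst.continuousWithinAt (x := (t, ζ))).tendsto_nhdsWithin (fun q hq => hq.1)
    filter_upwards [h1.eventually hb', self_mem_nhdsWithin] with q hq hq' n
    exact (norm_term_le hq'.2).trans (by simpa using hq n)

theorem contDiffOn (h : RapidFamily J C) (hJ : J.OrdConnected) :
    ContDiffOn ℝ ∞ (fun q : ℝ × ℂ => powerSum (fun n => C 0 n q.1) q.2)
      (J ×ˢ closedBall 0 1) := by
  let P : (ℝ × ℂ → ℂ) → Prop := fun V => ∃ C : ℕ → ℕ → ℝ → ℂ, RapidFamily J C ∧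
    V = fun q => powerSum (fun n => C 0 n q.1) q.2
  refine contDiffOn_infty_of_family P ?_ ⟨C, h, rfl⟩
  rintro V ⟨C, h, rfl⟩
  refine ⟨_, _, ⟨_, h.time, rfl⟩, ⟨_, h.space, rfl⟩, fun q hq => ?_⟩
  exact hasFDerivWithinAt_of_partials (𝕂 := ℂ) (convex_closedBall _ _) hq
    (v := fun q : ℝ × ℂ => powerSum (fun n => C 0 n q.1) q.2)
    (vx := fun q : ℝ × ℂ => powerSum (derivCoeff fun n => C 0 n q.1) q.2)
    (h.hasDerivWithinAt_time hJ 0 hq.1 hq.2)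
    (fun p hp => h.hasDerivWithinAt_space 0 hp.1 hp.2) (h.space.continuousOn 0 q hq)

end RapidFamily

/-! ### Fourier coefficients with respect to a moving angular variable -/

/-- `u t θ` is jointly smooth in `t ∈ J` and `θ`, and `2π`-periodic in `θ`. -/
structure SmoothPeriodic {E : Type*} [NormedAddCommGroup E] [NormedSpace ℝ E] (J : Set ℝ)
    (u : ℝ → ℝ → E) : Prop where
  smooth : SmoothOnStrip J u
  periodic : ∀ t ∈ J, Periodic (u t) (2 * π)

/-- The function `α t` is a change of the angular variable on the circle `ℝ / 2πℤ`, with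
derivative `β t`, depending smoothly on `t`. -/
structure AngleChange (J : Set ℝ) (α β : ℝ → ℝ → ℝ) : Prop where
  smooth : SmoothOnStrip J α
  deriv : ∀ t ∈ J, ∀ θ, HasDerivAt (α t) (β t θ) θ
  pos : ∀ t ∈ J, ∀ θ, 0 < β t θ
  add_period : ∀ t ∈ J, ∀ θ, α t (θ + 2 * π) = α t θ + 2 * π

/-- The Fourier coefficients of `v t`, as a function of the angular variable `α t` with
`dα = β dθ`. -/
def modeCoeff (α β : ℝ → ℝ → ℝ) (v : ℝ → ℝ → ℂ) (n : ℕ) (t : ℝ) : ℂ :=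
  (1 / (2 * π)) * ∫ θ in (0 : ℝ)..(2 * π),
    v t θ * cexp (-(n * α t θ) * I) * β t θ

section

variable {J : Set ℝ}

theorem timeDeriv_eq_of_hasDerivWithinAt {E : Type*} [NormedAddCommGroup E] [NormedSpace ℝ E]
    {u : ℝ → ℝ → E} (hJ : J.OrdConnected) (hJ' : J.Nontrivial) {t θ : ℝ} (ht : t ∈ J) {d : E}
    (h : HasDerivWithinAt (fun τ => u τ θ) d J t) : timeDeriv J u t θ = d :=
  h.derivWithin (uniqueDiffOn_of_ordConnected hJ hJ' t ht)

namespace SmoothPeriodic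

variable {E F : Type*} [NormedAddCommGroup E] [NormedSpace ℝ E] [NormedAddCommGroup F]
  [NormedSpace ℝ F]

theorem timeDeriv {u : ℝ → ℝ → E} (hu : SmoothPeriodic J u) (hJ : J.OrdConnected)
    (hJ' : J.Nontrivial) : SmoothPeriodic J (timeDeriv J u) := by
  refine ⟨hu.smooth.timeDeriv hJ hJ', fun t ht θ => ?_⟩
  refine timeDeriv_eq_of_hasDerivWithinAt hJ hJ' ht ?_
  exact (hu.smooth.hasDerivWithinAt_time ht θ).congr (fun τ hτ => hu.periodic τ hτ θ)
    (hu.periodic t ht θ)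

theorem angleDeriv {u : ℝ → ℝ → E} (hu : SmoothPeriodic J u) (hJ : J.OrdConnected)
    (hJ' : J.Nontrivial) : SmoothPeriodic J (angleDeriv u) := by
  refine ⟨hu.smooth.angleDeriv hJ hJ', fun t ht θ => ?_⟩
  have h1 : HasDerivAt (u t) (_root_.angleDeriv u t (θ + 2 * π)) θ := by
    have := (hu.smooth.hasDerivAt_angle ht (θ + 2 * π)).comp_add_const θ (2 * π)
    have e : (fun x => u t (x + 2 * π)) = u t := funext (hu.periodic t ht)
    rwa [e] at this
  exact h1.deriv.symm

theorem at_two_pi {u : ℝ → ℝ → E} (hu : SmoothPeriodic J u) {t : ℝ} (ht : t ∈ J) :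
    u t (2 * π) = u t 0 := by
  simpa using hu.periodic t ht 0

theorem comp {u : ℝ → ℝ → E} (hu : SmoothPeriodic J u) {O : Set E} {g : E → F}
    (hg : ContDiffOn ℝ ∞ g O) (hm : ∀ t ∈ J, ∀ θ, u t θ ∈ O) :
    SmoothPeriodic J (fun t θ => g (u t θ)) :=
  ⟨hu.smooth.comp hg hm, fun t ht θ => by simp only [hu.periodic t ht θ]⟩

theorem prodMk {u : ℝ → ℝ → E} {v : ℝ → ℝ → F} (hu : SmoothPeriodic J u)
    (hv : SmoothPeriodic J v) : SmoothPeriodic J (fun t θ => (u t θ, v t θ)) :=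
  ⟨hu.smooth.prodMk hv.smooth,
    fun t ht θ => by simp only [hu.periodic t ht θ, hv.periodic t ht θ]⟩

theorem mul {u v : ℝ → ℝ → ℂ} (hu : SmoothPeriodic J u) (hv : SmoothPeriodic J v) :
    SmoothPeriodic J (fun t θ => u t θ * v t θ) :=
  ⟨ContDiffOn.mul hu.smooth hv.smooth,
    fun t ht θ => by simp only [hu.periodic t ht θ, hv.periodic t ht θ]⟩

theorem sub {u v : ℝ → ℝ → ℂ} (hu : SmoothPeriodic J u) (hv : SmoothPeriodic J v) :
    SmoothPeriodic J (fun t θ => u t θ - v t θ) :=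
  ⟨ContDiffOn.sub hu.smooth hv.smooth,
    fun t ht θ => by simp only [hu.periodic t ht θ, hv.periodic t ht θ]⟩

theorem const_mul {u : ℝ → ℝ → ℂ} (hu : SmoothPeriodic J u) (a : ℂ) :
    SmoothPeriodic J (fun t θ => a * u t θ) :=
  ⟨ContDiffOn.mul contDiffOn_const hu.smooth,
    fun t ht θ => by simp only [hu.periodic t ht θ]⟩

theorem ofReal {u : ℝ → ℝ → ℝ} (hu : SmoothPeriodic J u) :
    SmoothPeriodic J (fun t θ => (u t θ : ℂ)) :=
  hu.comp (g := fun x : ℝ => (x : ℂ)) (O := univ) ofRealCLM.contDiff.contDiffOn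
    (fun _ _ _ => mem_univ _)

end SmoothPeriodic

namespace AngleChange

variable {α β : ℝ → ℝ → ℝ} {v : ℝ → ℝ → ℂ}

theorem smoothPeriodic (h : AngleChange J α β) (hJ : J.OrdConnected) (hJ' : J.Nontrivial) :
    SmoothPeriodic J β := by
  refine ⟨(h.smooth.angleDeriv hJ hJ').congr fun t ht θ => (h.deriv t ht θ).deriv.symm,
    fun t ht θ => ?_⟩
  have h1 := (h.deriv t ht (θ + 2 * π)).comp_add_const θ (2 * π)
  have e : (fun x => α t (x + 2 * π)) = fun x => α t x + 2 * π :=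
    funext (h.add_period t ht)
  rw [e] at h1
  exact h1.unique ((h.deriv t ht θ).add_const _)

theorem smoothPeriodic_timeDeriv (h : AngleChange J α β) (hJ : J.OrdConnected)
    (hJ' : J.Nontrivial) : SmoothPeriodic J (timeDeriv J α) := by
  refine ⟨h.smooth.timeDeriv hJ hJ', fun t ht θ => ?_⟩
  refine timeDeriv_eq_of_hasDerivWithinAt hJ hJ' ht ?_
  exact ((h.smooth.hasDerivWithinAt_time ht θ).add_const (2 * π)).congr
    (fun τ hτ => h.add_period τ hτ θ) (h.add_period t ht θ)

theorem hasDerivAt_timeDeriv (h : AngleChange J α β) (hJ : J.OrdConnected) (hJ' : J.Nontrivial)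
    {t : ℝ} (ht : t ∈ J) (θ : ℝ) : HasDerivAt (timeDeriv J α t) (timeDeriv J β t θ) θ := by
  have h1 := (h.smooth.timeDeriv hJ hJ').hasDerivAt_angle ht θ
  rw [← h.smooth.timeDeriv_angleDeriv hJ hJ' ht θ] at h1
  refine h1.congr_deriv (Eq.symm (timeDeriv_eq_of_hasDerivWithinAt (u := β) hJ hJ' ht ?_))
  exact ((h.smooth.angleDeriv hJ hJ').hasDerivWithinAt_time ht θ).congr
    (fun τ hτ => (h.deriv τ hτ θ).deriv.symm) (h.deriv t ht θ).deriv.symm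

theorem smoothPeriodic_exp (h : AngleChange J α β) (n : ℕ) :
    SmoothPeriodic J (fun t θ => cexp (-(n * α t θ) * I)) := by
  constructor
  · exact h.smooth.comp (g := fun x : ℝ => cexp (-(n * x) * I)) (O := univ)
      (((contDiff_const.mul ofRealCLM.contDiff).neg.mul contDiff_const).cexp).contDiffOn
      (fun _ _ _ => mem_univ _)
  · intro t ht θ
    simp only [h.add_period t ht θ]
    rw [exp_eq_exp_iff_exists_int]
    refine ⟨-n, ?_⟩
    push_cast
    ring

/-- The derivative with respect to the angular variable `α`. -/
def angleOp (β : ℝ → ℝ → ℝ) (v : ℝ → ℝ → ℂ) : ℝ → ℝ → ℂ :=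
  fun t θ => -I * (angleDeriv v t θ * ((β t θ)⁻¹ : ℝ))

/-- The derivative with respect to time, with `α` kept fixed. -/
def timeOp (J : Set ℝ) (α β : ℝ → ℝ → ℝ) (v : ℝ → ℝ → ℂ) : ℝ → ℝ → ℂ :=
  fun t θ => timeDeriv J v t θ - (timeDeriv J α t θ : ℝ) * (angleDeriv v t θ * ((β t θ)⁻¹ : ℝ))

theorem smoothPeriodic_inv (h : AngleChange J α β) (hJ : J.OrdConnected) (hJ' : J.Nontrivial) :
    SmoothPeriodic J (fun t θ => (((β t θ)⁻¹ : ℝ) : ℂ)) :=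
  ((h.smoothPeriodic hJ hJ').comp (g := fun x : ℝ => x⁻¹) (O := {0}ᶜ)
    (contDiffOn_inv ℝ) (fun t ht θ => (h.pos t ht θ).ne')).ofReal

theorem smoothPeriodic_angleOp (h : AngleChange J α β) (hJ : J.OrdConnected) (hJ' : J.Nontrivial)
    (hv : SmoothPeriodic J v) : SmoothPeriodic J (angleOp β v) :=
  ((hv.angleDeriv hJ hJ').mul (h.smoothPeriodic_inv hJ hJ')).const_mul _

theorem smoothPeriodic_timeOp (h : AngleChange J α β) (hJ : J.OrdConnected) (hJ' : J.Nontrivial)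
    (hv : SmoothPeriodic J v) : SmoothPeriodic J (timeOp J α β v) :=
  (hv.timeDeriv hJ hJ').sub ((h.smoothPeriodic_timeDeriv hJ hJ').ofReal.mul
    ((hv.angleDeriv hJ hJ').mul (h.smoothPeriodic_inv hJ hJ')))

theorem hasDerivAt_exp (h : AngleChange J α β) (n : ℕ) {t : ℝ} (ht : t ∈ J) (θ : ℝ) :
    HasDerivAt (fun x => cexp (-(n * α t x) * I))
      (cexp (-(n * α t θ) * I) * (-(n * β t θ) * I)) θ :=
  (((h.deriv t ht θ).ofReal_comp.const_mul (n : ℂ)).neg.mul_const I).cexp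

theorem hasDerivWithinAt_exp (h : AngleChange J α β) (n : ℕ) {t : ℝ} (ht : t ∈ J) (θ : ℝ) :
    HasDerivWithinAt (fun τ => cexp (-(n * α τ θ) * I))
      (cexp (-(n * α t θ) * I) * (-(n * (timeDeriv J α t θ : ℝ)) * I)) J t := by
  have h1 : HasDerivWithinAt (fun τ => (α τ θ : ℂ)) ((timeDeriv J α t θ : ℝ) : ℂ) J t :=
    ofRealCLM.hasFDerivAt.comp_hasDerivWithinAt t (h.smooth.hasDerivWithinAt_time ht θ)
  exact ((h1.const_mul (n : ℂ)).neg.mul_const I).cexp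

theorem mul_modeCoeff (h : AngleChange J α β) (hJ : J.OrdConnected) (hJ' : J.Nontrivial)
    (hv : SmoothPeriodic J v) (n : ℕ) {t : ℝ} (ht : t ∈ J) :
    n * modeCoeff α β v n t = modeCoeff α β (angleOp β v) n t := by
  have hp : SmoothPeriodic J (fun t θ => v t θ * cexp (-(n * α t θ) * I)) :=
    hv.mul (h.smoothPeriodic_exp n)
  have hc1 : Continuous fun θ => v t θ * cexp (-(n * α t θ) * I) * β t θ :=
    ((hp.mul (h.smoothPeriodic hJ hJ').ofReal).smooth.contDiff ht).continuous
  have hc2 : Continuous fun θ => angleOp β v t θ * cexp (-(n * α t θ) * I) * β t θ :=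
    ((((h.smoothPeriodic_angleOp hJ hJ' hv).mul (h.smoothPeriodic_exp n)).mul
      (h.smoothPeriodic hJ hJ').ofReal).smooth.contDiff ht).continuous
  have h1 : ∫ θ in (0 : ℝ)..(2 * π), (I * (angleOp β v t θ * cexp (-(n * α t θ) * I) * β t θ)
      - I * (n * (v t θ * cexp (-(n * α t θ) * I) * β t θ))) = 0 := by
    rw [integral_eq_sub_of_hasDerivAt
      (f := fun θ => v t θ * cexp (-(n * α t θ) * I))]
    · exact sub_eq_zero.2 (hp.at_two_pi ht)
    · intro θ _
      refine ((hv.smooth.hasDerivAt_angle ht θ).mul (h.hasDerivAt_exp n ht θ)).congr_deriv ?_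
      have hb : (β t θ : ℂ) ≠ 0 := by exact_mod_cast (h.pos t ht θ).ne'
      simp only [angleOp]
      push_cast
      field_simp
      linear_combination (_root_.angleDeriv v t θ) * I_sq
    · exact ((hc2.const_mul _).sub ((hc1.const_mul _).const_mul _)).intervalIntegrable _ _
  rw [integral_sub ((hc2.const_mul _).intervalIntegrable _ _)
    (((hc1.const_mul _).const_mul _).intervalIntegrable _ _),
    integral_const_mul, integral_const_mul,
    integral_const_mul, ← mul_sub] at h1
  have h2 := (mul_eq_zero.1 h1).resolve_left I_ne_zero
  simp only [modeCoeff]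
  linear_combination (-(1 / (2 * π) : ℂ)) * h2

theorem hasDerivWithinAt_modeCoeff (h : AngleChange J α β) (hJ : J.OrdConnected)
    (hJ' : J.Nontrivial) (hv : SmoothPeriodic J v) (n : ℕ) {t : ℝ} (ht : t ∈ J) :
    HasDerivWithinAt (modeCoeff α β v n) (modeCoeff α β (timeOp J α β v) n t) J t := by
  have hβ := (h.smoothPeriodic hJ hJ').ofReal
  have hαt := (h.smoothPeriodic_timeDeriv hJ hJ').ofReal
  have hp : SmoothPeriodic J (fun t θ => v t θ * cexp (-(n * α t θ) * I) * β t θ) :=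
    (hv.mul (h.smoothPeriodic_exp n)).mul hβ
  refine ((hp.smooth.hasDerivWithinAt_integral hJ hJ' 0 (2 * π) ht).const_mul
    (1 / (2 * π) : ℂ)).congr_deriv ?_
  rw [modeCoeff]
  congr 1
  have hq : SmoothPeriodic J (fun t θ => (timeDeriv J α t θ : ℝ) * (v t θ * cexp (-(n * α t θ) * I))) :=
    hαt.mul (hv.mul (h.smoothPeriodic_exp n))
  have hc1 : Continuous fun θ => timeOp J α β v t θ * cexp (-(n * α t θ) * I) * β t θ :=
    ((((h.smoothPeriodic_timeOp hJ hJ' hv).mul (h.smoothPeriodic_exp n)).mul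
      hβ).smooth.contDiff ht).continuous
  have hc2 := ((hp.timeDeriv hJ hJ').smooth.contDiff ht).continuous
  rw [← sub_eq_zero, ← integral_sub
    (hc2.intervalIntegrable _ _) (hc1.intervalIntegrable _ _),
    integral_eq_sub_of_hasDerivAt
      (f := fun θ => (timeDeriv J α t θ : ℝ) * (v t θ * cexp (-(n * α t θ) * I)))]
  · exact sub_eq_zero.2 (hq.at_two_pi ht)
  · intro θ _
    have e1 : HasDerivWithinAt (fun τ => (β τ θ : ℂ)) ((timeDeriv J β t θ : ℝ) : ℂ) J t :=
      ofRealCLM.hasFDerivAt.comp_hasDerivWithinAt t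
        ((h.smoothPeriodic hJ hJ').smooth.hasDerivWithinAt_time ht θ)
    have e2 := timeDeriv_eq_of_hasDerivWithinAt hJ hJ' ht
      (u := fun t θ => v t θ * cexp (-(n * α t θ) * I) * β t θ)
      (((hv.smooth.hasDerivWithinAt_time ht θ).mul (h.hasDerivWithinAt_exp n ht θ)).mul e1)
    have e3 := (h.hasDerivAt_timeDeriv hJ hJ' ht θ).ofReal_comp.mul
      ((hv.smooth.hasDerivAt_angle ht θ).mul (h.hasDerivAt_exp n ht θ))
    refine e3.congr_deriv ?_
    rw [e2]
    simp only [timeOp, Pi.mul_apply]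
    have hb : (β t θ : ℂ) ≠ 0 := by exact_mod_cast (h.pos t ht θ).ne'
    push_cast
    field_simp
    ring
  · exact (hc2.sub hc1).intervalIntegrable _ _

theorem norm_modeCoeff_le (h : AngleChange J α β) {t : ℝ} (ht : t ∈ J) {B : ℝ}
    (hB : ∀ θ ∈ Icc 0 (2 * π), ‖v t θ‖ ≤ B) (n : ℕ) : ‖modeCoeff α β v n t‖ ≤ B := by
  have hπ := Real.pi_pos
  have hβc : Continuous (β t) := by
    have : β t = _root_.deriv (α t) := funext fun θ => (h.deriv t ht θ).deriv.symm
    rw [this]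
    exact (h.smooth.contDiff ht).continuous_deriv (by simp)
  have h1 : ∫ θ in (0 : ℝ)..(2 * π), β t θ = 2 * π := by
    rw [integral_eq_sub_of_hasDerivAt (fun θ _ => h.deriv t ht θ)
      (hβc.intervalIntegrable _ _)]
    have := h.add_period t ht 0
    rw [zero_add] at this
    linarith
  have h2 : ‖∫ θ in (0 : ℝ)..(2 * π), v t θ * cexp (-(n * α t θ) * I) * β t θ‖
      ≤ ∫ θ in (0 : ℝ)..(2 * π), B * β t θ := by
    refine norm_integral_le_of_norm_le (by positivity)
      (Eventually.of_forall fun θ hθ => ?_) ((hβc.const_mul _).intervalIntegrable _ _)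
    have e : ‖cexp (-(n * α t θ) * I)‖ = 1 := by
      rw [show (-(n * α t θ) * I : ℂ) = ((-(n * α t θ) : ℝ) : ℂ) * I by push_cast; ring]
      exact norm_exp_ofReal_mul_I _
    rw [norm_mul, norm_mul, e, mul_one, norm_real, Real.norm_of_nonneg (h.pos t ht θ).le]
    exact mul_le_mul_of_nonneg_right (hB θ (Ioc_subset_Icc_self hθ)) (h.pos t ht θ).le
  rw [integral_const_mul, h1] at h2
  rw [modeCoeff, norm_mul]
  have e : ‖(1 / (2 * π) : ℂ)‖ = 1 / (2 * π) := by
    rw [show (1 / (2 * π) : ℂ) = ((1 / (2 * π) : ℝ) : ℂ) by push_cast; ring,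
      norm_real, Real.norm_of_nonneg (by positivity)]
  rw [e, one_div, inv_mul_le_iff₀ (by positivity)]
  linarith

theorem rapidFamily (h : AngleChange J α β) (hJ : J.OrdConnected) (hJ' : J.Nontrivial)
    (hv : SmoothPeriodic J v) :
    RapidFamily J (fun j n t => modeCoeff α β ((timeOp J α β)^[j] v) n t) := by
  have hs : ∀ j, SmoothPeriodic J ((timeOp J α β)^[j] v) := by
    intro j
    induction j with
    | zero => exact hv
    | succ j ih =>
      rw [Function.iterate_succ_apply']
      exact h.smoothPeriodic_timeOp hJ hJ' ih
  have hm : ∀ m : ℕ, ∀ u, SmoothPeriodic J u → SmoothPeriodic J ((angleOp β)^[m] u) ∧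
      ∀ n : ℕ, ∀ t ∈ J, (n : ℂ) ^ m * modeCoeff α β u n t =
        modeCoeff α β ((angleOp β)^[m] u) n t := by
    intro m
    induction m with
    | zero => intro u hu; exact ⟨hu, fun n t _ => by simp⟩
    | succ m ih =>
      intro u hu
      obtain ⟨h1, h2⟩ := ih _ (h.smoothPeriodic_angleOp hJ hJ' hu)
      refine ⟨h1, fun n t ht => ?_⟩
      rw [Function.iterate_succ_apply, ← h2 n t ht, ← h.mul_modeCoeff hJ hJ' hu n ht]
      ring
  refine ⟨fun j n t ht => ?_, fun j m t ht => ?_⟩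
  · simp only [Function.iterate_succ_apply']
    exact h.hasDerivWithinAt_modeCoeff hJ hJ' (hs j) n ht
  · obtain ⟨h1, h2⟩ := hm m _ (hs j)
    obtain ⟨B, hB⟩ := h1.smooth.exists_bound ht 0 (2 * π)
    refine ⟨B, ?_⟩
    filter_upwards [hB, self_mem_nhdsWithin] with τ hτ hτJ n
    have := h.norm_modeCoeff_le hτJ hτ n
    rw [← h2 n τ hτJ, norm_mul, norm_pow, norm_natCast] at this
    exact this

/-- The power series attached to the Fourier coefficients of a function that extends
holomorphically to the disc is this extension. -/
theorem powerSum_modeCoeff (h : AngleChange J α β) (hJ : J.OrdConnected) (hJ' : J.Nontrivial)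
    (hv : SmoothPeriodic J v) {t : ℝ} (ht : t ∈ J) {f : ℂ → ℂ}
    (hf : DiffContOnCl ℂ f (ball 0 1)) (hfv : ∀ θ, f (cexp (α t θ * I)) = v t θ)
    {ζ : ℂ} (hζ : ζ ∈ closedBall (0 : ℂ) 1) :
    powerSum (fun n => modeCoeff α β v n t) ζ = f ζ := by
  have hcoef : ∀ n : ℕ, ∀ w : ℂ, cauchyPowerSeries f 0 1 n (fun _ => w) =
      modeCoeff α β v n t * w ^ n := by
    intro n w
    have hper : Periodic (fun φ : ℝ => f (cexp (φ * I)) * cexp (-(n * φ) * I))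
        (2 * π) := by
      intro φ
      have e1 : cexp (((φ + 2 * π : ℝ) : ℂ) * I) = cexp (φ * I) := by
        rw [exp_eq_exp_iff_exists_int]; exact ⟨1, by push_cast; ring⟩
      have e2 : cexp (-(n * ((φ + 2 * π : ℝ) : ℂ)) * I) = cexp (-(n * φ) * I) := by
        rw [exp_eq_exp_iff_exists_int]; exact ⟨-n, by push_cast; ring⟩
      simp only [e1, e2]
    have hcont : Continuous fun φ : ℝ => f (cexp (φ * I)) * cexp (-(n * φ) * I) := by
      refine Continuous.mul ?_ (by fun_prop)
      have h1 : ContinuousOn f (closedBall 0 1) := by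
        have := hf.continuousOn
        rwa [closure_ball _ one_ne_zero] at this
      exact h1.comp_continuous (by fun_prop) (fun φ => by
        rw [mem_closedBall_zero_iff, norm_exp_ofReal_mul_I])
    have hβc : Continuous (β t) := ((h.smoothPeriodic hJ hJ').smooth.contDiff ht).continuous
    have h1 : ∫ θ in (0 : ℝ)..(2 * π), v t θ * cexp (-(n * α t θ) * I) * β t θ =
        ∫ φ in (0 : ℝ)..(2 * π), f (cexp (φ * I)) * cexp (-(n * φ) * I) := by
      have := integral_deriv_smul_comp (a := 0) (b := 2 * π)
        (fun θ _ => h.deriv t ht θ) hβc.continuousOn hcont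
      have e := h.add_period t ht 0
      rw [zero_add] at e
      rw [e, hper.intervalIntegral_add_eq (α t 0) 0, zero_add] at this
      rw [← this]
      refine integral_congr fun θ _ => ?_
      simp only [comp_apply, hfv, real_smul]
      ring
    rw [cauchyPowerSeries_apply, circleIntegral, modeCoeff, h1]
    simp only [deriv_circleMap, circleMap, zero_add, ofReal_one, one_mul, sub_zero, smul_eq_mul]
    rw [← integral_const_mul, ← integral_const_mul,
      ← integral_mul_const]
    refine integral_congr fun φ _ => ?_
    have e3 : cexp (-(n * φ) * I) = (cexp (φ * I))⁻¹ ^ n := by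
      rw [← Complex.exp_neg, ← exp_nat_mul]; congr 1; ring
    have e4 := exp_ne_zero (φ * I)
    simp only [e3, div_eq_mul_inv, mul_pow]
    have hπ : (π : ℂ) ≠ 0 := by exact_mod_cast Real.pi_ne_zero
    field_simp
  have hR : RapidFamily J _ := h.rapidFamily hJ hJ' hv
  have hcl : closure (ball (0 : ℂ) 1) = closedBall 0 1 :=
    closure_ball _ one_ne_zero
  have hball : EqOn (powerSum (fun n => modeCoeff α β v n t)) f (ball 0 1) := by
    intro w hw
    have hfp := DiffContOnCl.hasFPowerSeriesOnBall (R := 1) (c := 0) (f := f)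
      (by simpa using hf) one_pos
    have h2 := hfp.hasSum (y := w) (by
      simpa [← ofReal_norm, ENNReal.ofReal_lt_one] using hw)
    simp only [NNReal.coe_one, hcoef, zero_add] at h2
    exact h2.tsum_eq
  have hc1 : ContinuousOn (powerSum (fun n => modeCoeff α β v n t)) (closure (ball 0 1)) := by
    rw [hcl]
    intro w hw
    exact (hR.hasDerivWithinAt_space 0 ht hw).continuousWithinAt
  exact hball.of_subset_closure hc1 hf.continuousOn subset_closure subset_rfl (by rwa [hcl])

end AngleChange

end

/-! ### Geometry of smooth Jordan curves -/

/-- A smooth regular simple closed curve, with its `2π`-periodic parametrization. -/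
structure IsSimpleClosedCurve (γ : ℝ → ℂ) : Prop where
  smooth : ContDiff ℝ ∞ γ
  periodic : Periodic γ (2 * π)
  injective : InjOn γ (Ico 0 (2 * π))
  regular : ∀ θ, deriv γ θ ≠ 0

theorem IsJordanParam.isSimpleClosedCurve {Ω : Set ℂ} {γ : ℝ → ℂ} (h : IsJordanParam Ω γ) :
    IsSimpleClosedCurve γ := ⟨h.smooth, h.periodic, h.injective, h.regular⟩

/-- The unit normal on the right of the curve, which is the outward normal of the interior domain
of a positively oriented Jordan curve. -/
def rightNormal (γ : ℝ → ℂ) (θ : ℝ) : ℂ := -I * (deriv γ θ / ‖deriv γ θ‖)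

/-- Reduction of an angle modulo `2π`, centred at a given angle. -/
theorem exists_angle_near (θ φ : ℝ) :
    ∃ x : ℝ, |x| ≤ π ∧ ∃ k : ℤ, φ = θ + x + k * (2 * π) := by
  have hπ : 0 < 2 * π := by positivity
  refine ⟨toIcoMod hπ (-π) (φ - θ), ?_, toIcoDiv hπ (-π) (φ - θ), ?_⟩
  · have := toIcoMod_mem_Ico hπ (-π) (φ - θ)
    rw [abs_le]
    exact ⟨this.1, by linarith [this.2]⟩
  · have := toIcoMod_add_toIcoDiv_zsmul hπ (-π) (φ - θ)
    rw [zsmul_eq_mul] at this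
    linarith

theorem eq_of_eq_add_int_mul {a b : ℝ} (ha : a ∈ Ico 0 (2 * π)) (hb : b ∈ Ico 0 (2 * π)) {k : ℤ}
    (h : a = b + k * (2 * π)) : a = b := by
  have hπ := Real.two_pi_pos
  have h1 : (k : ℝ) * (2 * π) < 1 * (2 * π) := by linarith [ha.2, hb.1]
  have h2 : (-1 : ℝ) * (2 * π) < k * (2 * π) := by linarith [ha.1, hb.2]
  have h3 : k < 1 := by exact_mod_cast lt_of_mul_lt_mul_right h1 hπ.le
  have h4 : -1 < k := by exact_mod_cast lt_of_mul_lt_mul_right h2 hπ.le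
  rw [h, show k = 0 by omega, Int.cast_zero, zero_mul, add_zero]

namespace IsSimpleClosedCurve

variable {γ : ℝ → ℂ}

theorem hasDerivAt (h : IsSimpleClosedCurve γ) (θ : ℝ) : HasDerivAt γ (deriv γ θ) θ :=
  (h.smooth.differentiable (by simp) θ).hasDerivAt

theorem contDiff_deriv (h : IsSimpleClosedCurve γ) : ContDiff ℝ ∞ (deriv γ) :=
  h.smooth.deriv'

theorem continuous (h : IsSimpleClosedCurve γ) : Continuous γ := h.smooth.continuous

theorem continuous_deriv (h : IsSimpleClosedCurve γ) : Continuous (deriv γ) :=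
  h.contDiff_deriv.continuous

theorem deriv_periodic (h : IsSimpleClosedCurve γ) :
    Periodic (deriv γ) (2 * π) := by
  intro θ
  have := (h.hasDerivAt (θ + 2 * π)).comp_add_const θ (2 * π)
  have e : (fun x => γ (x + 2 * π)) = γ := funext h.periodic
  rw [e] at this
  exact this.unique (h.hasDerivAt θ)

theorem eq_iff (h : IsSimpleClosedCurve γ) {a b : ℝ} (hab : γ a = γ b) :
    ∃ k : ℤ, a = b + k * (2 * π) := by
  have hπ : 0 < 2 * π := by positivity
  have e : ∀ a, γ (toIcoMod hπ 0 a) = γ a := fun a => by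
    rw [toIcoMod]; exact h.periodic.sub_zsmul_eq _
  have hm : ∀ a, toIcoMod hπ 0 a ∈ Ico 0 (2 * π) := fun a => by
    simpa using toIcoMod_mem_Ico hπ 0 a
  have h1 := h.injective (hm a) (hm b) (by rw [e, e, hab])
  refine ⟨toIcoDiv hπ 0 a - toIcoDiv hπ 0 b, ?_⟩
  have ha := toIcoMod_add_toIcoDiv_zsmul hπ 0 a
  have hb := toIcoMod_add_toIcoDiv_zsmul hπ 0 b
  rw [zsmul_eq_mul] at ha hb
  push_cast
  linarith

theorem apply_add_int (h : IsSimpleClosedCurve γ) (θ : ℝ) (k : ℤ) :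
    γ (θ + k * (2 * π)) = γ θ := by
  have := h.periodic.int_mul k θ
  exact this

/-- The chord-arc inequality. -/
theorem chord_arc (h : IsSimpleClosedCurve γ) :
    ∃ c > 0, ∀ θ x : ℝ, |x| ≤ π → c * |x| ≤ ‖γ (θ + x) - γ θ‖ := by
  have hπ := Real.pi_pos
  set q : ℝ × ℝ → ℂ := fun p => ∫ s in (0 : ℝ)..1, deriv γ (p.1 + s * p.2) with hq
  have hqc : Continuous q := by
    refine continuous_parametric_intervalIntegral_of_continuous' ?_ 0 1
    exact h.continuous_deriv.comp (by fun_prop)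
  have hqe : ∀ θ x : ℝ, γ (θ + x) - γ θ = x * q (θ, x) := by
    intro θ x
    have h1 : ∀ s ∈ uIcc (0 : ℝ) 1, HasDerivAt (fun s => γ (θ + s * x))
        ((x : ℂ) * deriv γ (θ + s * x)) s := by
      intro s _
      have h2 : HasDerivAt (fun s : ℝ => θ + s * x) x s := by
        simpa using ((hasDerivAt_id s).mul_const x).const_add θ
      simpa [Function.comp_def] using (h.hasDerivAt (θ + s * x)).scomp s h2
    have h3 := integral_eq_sub_of_hasDerivAt h1
      (((continuous_const.mul (h.continuous_deriv.comp
        (by fun_prop : Continuous fun s : ℝ => θ + s * x)))).intervalIntegrable _ _)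
    rw [integral_const_mul] at h3
    simpa using h3.symm
  have hq0 : ∀ θ x : ℝ, |x| ≤ π → q (θ, x) ≠ 0 := by
    intro θ x hx h0
    rcases eq_or_ne x 0 with rfl | hx0
    · simp only [hq, mul_zero, add_zero, integral_const, sub_zero, one_smul] at h0
      exact h.regular θ h0
    · have h1 := hqe θ x
      rw [h0, mul_zero, sub_eq_zero] at h1
      obtain ⟨k, hk⟩ := h.eq_iff h1
      have hk' : x = k * (2 * π) := by linarith
      have hk0 : k ≠ 0 := by rintro rfl; simp at hk'; exact hx0 hk'
      have : (1 : ℝ) ≤ |(k : ℝ)| := by exact_mod_cast Int.one_le_abs hk0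
      rw [hk', abs_mul, abs_of_pos (by positivity : 0 < 2 * π)] at hx
      nlinarith
  obtain ⟨p, hp, hmin⟩ := (isCompact_Icc.prod isCompact_Icc).exists_isMinOn
    (s := Icc (0 : ℝ) (2 * π) ×ˢ Icc (-π) π)
    ⟨(0, 0), ⟨by positivity, by positivity⟩, by simp [hπ.le], by simp [hπ.le]⟩
    hqc.norm.continuousOn
  refine ⟨‖q p‖, norm_pos_iff.2 (hq0 p.1 p.2 (abs_le.2 hp.2)), fun θ x hx => ?_⟩
  obtain ⟨θ', hθ', k, hk⟩ : ∃ θ' ∈ Icc (0 : ℝ) (2 * π), ∃ k : ℤ,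
      θ = θ' + k * (2 * π) := by
    have hπ2 : 0 < 2 * π := by positivity
    refine ⟨toIcoMod hπ2 0 θ, ?_, toIcoDiv hπ2 0 θ, ?_⟩
    · have := toIcoMod_mem_Ico hπ2 0 θ
      simp only [zero_add] at this
      exact Ico_subset_Icc_self this
    · have := toIcoMod_add_toIcoDiv_zsmul hπ2 0 θ
      rw [zsmul_eq_mul] at this
      exact this.symm
  have e1 : γ (θ + x) = γ (θ' + x) := by
    rw [hk, add_right_comm]; exact h.apply_add_int _ k
  have e2 : γ θ = γ θ' := by rw [hk]; exact h.apply_add_int _ k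
  rw [e1, e2, hqe, norm_mul, norm_real, Real.norm_eq_abs, mul_comm]
  gcongr
  exact hmin (show (θ', x) ∈ _ from ⟨hθ', abs_le.1 hx⟩)

theorem exists_taylor_bound (h : IsSimpleClosedCurve γ) :
    ∃ C > 0, ∀ θ x : ℝ, ‖γ (θ + x) - γ θ - x * deriv γ θ‖ ≤ C * x ^ 2 := by
  have hπ := Real.pi_pos
  have hd : ∀ θ, HasDerivAt (deriv γ) (deriv (deriv γ) θ) θ := fun θ =>
    (h.contDiff_deriv.differentiable (by simp) θ).hasDerivAt
  have hper : Periodic (deriv (deriv γ)) (2 * π) := by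
    intro θ
    have := (hd (θ + 2 * π)).comp_add_const θ (2 * π)
    have e : (fun x => deriv γ (x + 2 * π)) = deriv γ := funext h.deriv_periodic
    rw [e] at this
    exact this.unique (hd θ)
  have hc : Continuous (deriv (deriv γ)) := h.contDiff_deriv.continuous_deriv (by simp)
  obtain ⟨C, hC⟩ := (isCompact_Icc (a := 0) (b := 2 * π)).exists_bound_of_continuousOn
    hc.continuousOn
  have hC' : ∀ θ, ‖deriv (deriv γ) θ‖ ≤ C := by
    intro θ
    obtain ⟨y, hy, hy'⟩ := hper.exists_mem_Ico₀ (by positivity) θ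
    rw [hy']
    exact hC y (Ico_subset_Icc_self hy)
  have hC0 : 0 ≤ C := (norm_nonneg _).trans (hC' 0)
  refine ⟨C + 1, by positivity, fun θ x => ?_⟩
  have h1 : ∀ y, ‖deriv γ y - deriv γ θ‖ ≤ C * ‖y - θ‖ := fun y =>
    Convex.norm_image_sub_le_of_norm_hasDerivWithin_le (𝕜 := ℝ)
      (fun z _ => (hd z).hasDerivWithinAt) (fun z _ => hC' z) convex_univ (mem_univ θ) (mem_univ y)
  have h2 := Convex.norm_image_sub_le_of_norm_hasDerivWithin_le (𝕜 := ℝ)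
    (f := fun y => γ y - y * deriv γ θ) (f' := fun y => deriv γ y - deriv γ θ)
    (s := uIcc θ (θ + x)) (C := C * |x|) (x := θ) (y := θ + x)
    (fun z _ => ((h.hasDerivAt z).sub (by
      simpa using (hasDerivAt_id z).ofReal_comp.mul_const (deriv γ θ))).hasDerivWithinAt)
    (fun z hz => (h1 z).trans (by
      gcongr
      have := abs_sub_left_of_mem_uIcc hz
      simpa using this)) (convex_uIcc _ _) left_mem_uIcc right_mem_uIcc
  have e : (fun y : ℝ => γ y - y * deriv γ θ) (θ + x) - (fun y : ℝ => γ y - y * deriv γ θ) θ =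
      γ (θ + x) - γ θ - x * deriv γ θ := by
    push_cast; ring
  rw [e] at h2
  refine h2.trans ?_
  rw [add_sub_cancel_left, Real.norm_eq_abs, mul_assoc, abs_mul_abs_self, ← sq]
  nlinarith [sq_nonneg x]

theorem norm_rightNormal (h : IsSimpleClosedCurve γ) (θ : ℝ) : ‖rightNormal γ θ‖ = 1 := by
  have := norm_ne_zero_iff.2 (h.regular θ)
  rw [rightNormal, norm_mul, norm_div, norm_neg, norm_I, norm_real, norm_norm,
    div_self this, one_mul]

theorem continuous_rightNormal (h : IsSimpleClosedCurve γ) : Continuous (rightNormal γ) :=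
  continuous_const.mul (h.continuous_deriv.div (continuous_ofReal.comp h.continuous_deriv.norm)
    (fun θ => by simpa using h.regular θ))

theorem inner_rightNormal_deriv (θ : ℝ) : inner ℝ (rightNormal γ θ) (deriv γ θ) = 0 := by
  rw [Complex.inner, rightNormal]
  simp only [map_mul, map_neg, conj_I, map_div₀, conj_ofReal, neg_neg]
  rw [show deriv γ θ * (I * ((starRingEnd ℂ) (deriv γ θ) / ‖deriv γ θ‖)) =
    I * (((starRingEnd ℂ) (deriv γ θ) * deriv γ θ) / ‖deriv γ θ‖) by ring,
    ← normSq_eq_conj_mul_self]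
  rw [← Complex.ofReal_div, re_mul_ofReal]
  simp

theorem exists_inner_bound (h : IsSimpleClosedCurve γ) :
    ∃ C > 0, ∀ θ φ : ℝ, |inner ℝ (rightNormal γ θ) (γ φ - γ θ)| ≤ C * ‖γ φ - γ θ‖ ^ 2 := by
  obtain ⟨c, hc, hc'⟩ := h.chord_arc
  obtain ⟨C, hC, hC'⟩ := h.exists_taylor_bound
  refine ⟨C / c ^ 2, by positivity, fun θ φ => ?_⟩
  obtain ⟨x, hx, k, hk⟩ := exists_angle_near θ φ
  have e : γ φ = γ (θ + x) := by rw [hk]; exact h.apply_add_int _ k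
  rw [e]
  have h1 : inner ℝ (rightNormal γ θ) (γ (θ + x) - γ θ) =
      inner ℝ (rightNormal γ θ) (γ (θ + x) - γ θ - x * deriv γ θ) := by
    rw [inner_sub_right _ (γ (θ + x) - γ θ), ← real_smul, real_inner_smul_right,
      inner_rightNormal_deriv, mul_zero, sub_zero]
  rw [h1]
  have h2 := abs_real_inner_le_norm (rightNormal γ θ) (γ (θ + x) - γ θ - x * deriv γ θ)
  rw [h.norm_rightNormal, one_mul] at h2
  refine h2.trans ((hC' θ x).trans ?_)
  have h3 : (c * |x|) ^ 2 ≤ ‖γ (θ + x) - γ θ‖ ^ 2 := by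
    have := hc' θ x hx
    gcongr
  rw [mul_pow, sq_abs] at h3
  rw [div_mul_eq_mul_div, le_div_iff₀ (by positivity)]
  nlinarith

/-- Uniform interior and exterior balls: the distance from the point at height `s` on a normal to
the points of the curve. -/
theorem exists_normal_bound (h : IsSimpleClosedCurve γ) :
    ∃ δ > 0, ∀ θ φ s : ℝ, |s| ≤ δ →
      s ^ 2 + ‖γ φ - γ θ‖ ^ 2 / 2 ≤ ‖γ φ - γ θ - s * rightNormal γ θ‖ ^ 2 := by
  obtain ⟨C, hC, hC'⟩ := h.exists_inner_bound
  refine ⟨1 / (4 * C), by positivity, fun θ φ s hs => ?_⟩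
  have h1 := hC' θ φ
  have e : ‖γ φ - γ θ - s * rightNormal γ θ‖ ^ 2 =
      ‖γ φ - γ θ‖ ^ 2 - 2 * (s * inner ℝ (rightNormal γ θ) (γ φ - γ θ)) + s ^ 2 := by
    rw [@norm_sub_sq_real, ← real_smul, real_inner_smul_right, real_inner_comm, norm_smul,
      h.norm_rightNormal, mul_one, Real.norm_eq_abs, sq_abs]
  rw [e]
  have h2 : s * inner ℝ (rightNormal γ θ) (γ φ - γ θ) ≤ ‖γ φ - γ θ‖ ^ 2 / 4 := by
    refine (le_abs_self _).trans ?_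
    rw [abs_mul]
    calc _ ≤ 1 / (4 * C) * (C * ‖γ φ - γ θ‖ ^ 2) := by gcongr
      _ = _ := by field_simp
  linarith

theorem normal_notMem_range {δ : ℝ} (hδ : ∀ θ φ s : ℝ, |s| ≤ δ →
      s ^ 2 + ‖γ φ - γ θ‖ ^ 2 / 2 ≤ ‖γ φ - γ θ - s * rightNormal γ θ‖ ^ 2)
    {θ s : ℝ} (hs : |s| ≤ δ) (hs0 : s ≠ 0) : γ θ + s * rightNormal γ θ ∉ range γ := by
  rintro ⟨φ, hφ⟩
  have h1 := hδ θ φ s hs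
  rw [hφ, add_sub_cancel_left, sub_self, norm_zero, zero_pow two_ne_zero] at h1
  have : 0 < s ^ 2 := by positivity
  have := sq_nonneg ‖(s : ℂ) * rightNormal γ θ‖
  linarith

theorem isCompact_range (h : IsSimpleClosedCurve γ) : IsCompact (range γ) := by
  have : range γ = γ '' Icc 0 (2 * π) := by
    refine Subset.antisymm ?_ (image_subset_range _ _)
    rintro _ ⟨θ, rfl⟩
    obtain ⟨y, hy, hy'⟩ := h.periodic.exists_mem_Ico₀ (by positivity) θ
    exact ⟨y, Ico_subset_Icc_self hy, hy'.symm⟩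
  rw [this]
  exact isCompact_Icc.image h.continuous

/-- A point is on the normal through the point of the curve nearest to it. -/
theorem exists_nearest (h : IsSimpleClosedCurve γ) (z : ℂ) :
    ∃ θ s : ℝ, z = γ θ + s * rightNormal γ θ ∧ ∀ φ, |s| ≤ ‖z - γ φ‖ := by
  obtain ⟨_, ⟨θ, rfl⟩, hmin⟩ := h.isCompact_range.exists_isMinOn (range_nonempty γ)
    (f := fun w => ‖z - w‖) (by fun_prop)
  have hmin' : ∀ φ, ‖z - γ θ‖ ≤ ‖z - γ φ‖ := fun φ => hmin (mem_range_self φ)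
  have h1 : IsLocalMin (fun φ => ‖z - γ φ‖ ^ 2) θ :=
    Eventually.of_forall fun φ => pow_le_pow_left₀ (norm_nonneg _) (hmin' φ) 2
  have h2 : HasDerivAt (fun φ => ‖z - γ φ‖ ^ 2) (2 * inner ℝ (z - γ θ) (-deriv γ θ)) θ := by
    have := (((h.hasDerivAt θ).const_sub z)).norm_sq
    exact this
  have h3 := h1.hasDerivAt_eq_zero h2
  have h4 : inner ℝ (deriv γ θ) (z - γ θ) = 0 := by
    rw [inner_neg_right, real_inner_comm] at h3; linarith
  have hd := h.regular θ
  have hd' : (‖deriv γ θ‖ : ℂ) ≠ 0 := by simpa using hd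
  set s : ℝ := ((z - γ θ) * (starRingEnd ℂ) (deriv γ θ)).im * (-1) / ‖deriv γ θ‖ with hs
  have e : z = γ θ + s * rightNormal γ θ := by
    rw [Complex.inner] at h4
    set a := (z - γ θ) * (starRingEnd ℂ) (deriv γ θ) with ha
    have ha' : a = (a.im : ℂ) * I := by
      apply Complex.ext <;> simp [h4]
    have h5 : deriv γ θ * a = (‖deriv γ θ‖ : ℂ) ^ 2 * (z - γ θ) := by
      rw [ha, mul_left_comm, mul_conj, normSq_eq_norm_sq]; push_cast; ring
    rw [ha'] at h5
    rw [hs, rightNormal]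
    push_cast
    field_simp
    linear_combination -h5
  refine ⟨θ, s, e, fun φ => ?_⟩
  have h6 : ‖z - γ θ‖ = |s| := by
    rw [e, add_sub_cancel_left, norm_mul, h.norm_rightNormal, mul_one, norm_real,
      Real.norm_eq_abs]
  rw [← h6]
  exact hmin' φ

/-- The points at nonzero height at most `δ` on the normals are connected on each side. -/
theorem isPreconnected_collar (h : IsSimpleClosedCurve γ) (ε δ : ℝ) :
    IsPreconnected ((fun p : ℝ × ℝ => γ p.1 + ((ε * p.2 : ℝ) : ℂ) * rightNormal γ p.1) ''
      (univ ×ˢ Ioc 0 δ)) :=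
  (isPreconnected_univ.prod isPreconnected_Ioc).image _
    ((h.continuous.comp continuous_fst).add (Continuous.mul (by fun_prop)
      (h.continuous_rightNormal.comp continuous_fst))).continuousOn

end IsSimpleClosedCurve

/-- The interior domain `Ω` lies to the left of the curve, with normals of length `δ`. -/
structure IsLeftCollar (Ω : Set ℂ) (γ : ℝ → ℂ) (δ : ℝ) : Prop where
  pos : 0 < δ
  normal_bound : ∀ θ φ s : ℝ, |s| ≤ δ →
    s ^ 2 + ‖γ φ - γ θ‖ ^ 2 / 2 ≤ ‖γ φ - γ θ - s * rightNormal γ θ‖ ^ 2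
  inside : ∀ θ, ∀ s ∈ Ioc 0 δ, γ θ - s * rightNormal γ θ ∈ Ω
  outside : ∀ θ, ∀ s ∈ Ioc 0 δ, γ θ + s * rightNormal γ θ ∉ closure Ω

namespace IsJordanParam

variable {Ω : Set ℂ} {γ : ℝ → ℂ}

theorem closure_eq (h : IsJordanParam Ω γ) : closure Ω = Ω ∪ range γ := by
  rw [closure_eq_self_union_frontier, h.frontier_eq]

theorem disjoint_range (h : IsJordanParam Ω γ) : Disjoint Ω (range γ) := by
  rw [← h.frontier_eq, h.isOpen.frontier_eq]
  exact disjoint_sdiff_right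

theorem mem_closure (h : IsJordanParam Ω γ) (θ : ℝ) : γ θ ∈ closure Ω := by
  rw [h.closure_eq]; exact Or.inr (mem_range_self θ)

theorem notMem (h : IsJordanParam Ω γ) (θ : ℝ) : γ θ ∉ Ω := fun h' =>
  disjoint_left.1 h.disjoint_range h' (mem_range_self θ)

theorem subset_or (h : IsJordanParam Ω γ) {s : Set ℂ} (hs : IsPreconnected s)
    (hd : Disjoint s (range γ)) : s ⊆ Ω ∨ s ⊆ (closure Ω)ᶜ := by
  refine hs.subset_or_subset h.isOpen isClosed_closure.isOpen_compl ?_ ?_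
  · exact disjoint_compl_right.mono_left subset_closure
  · intro z hz
    by_cases h' : z ∈ closure Ω
    · rw [h.closure_eq] at h'
      exact Or.inl (h'.resolve_right (disjoint_left.1 hd hz))
    · exact Or.inr h'

theorem isCompact_closure (h : IsJordanParam Ω γ) : IsCompact (closure Ω) :=
  h.bounded.isCompact_closure

/-- Each side of the curve is entirely inside or entirely outside. -/
theorem collar_subset_or (h : IsJordanParam Ω γ) {δ : ℝ}
    (hδ : ∀ θ φ s : ℝ, |s| ≤ δ →
      s ^ 2 + ‖γ φ - γ θ‖ ^ 2 / 2 ≤ ‖γ φ - γ θ - s * rightNormal γ θ‖ ^ 2)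
    {ε : ℝ} (hε : |ε| = 1) :
    (∀ θ, ∀ s ∈ Ioc 0 δ, γ θ + ((ε * s : ℝ) : ℂ) * rightNormal γ θ ∈ Ω) ∨
    (∀ θ, ∀ s ∈ Ioc 0 δ, γ θ + ((ε * s : ℝ) : ℂ) * rightNormal γ θ ∉ closure Ω) := by
  have h0 := h.isSimpleClosedCurve
  have := h.subset_or (h0.isPreconnected_collar ε δ) (by
    rw [disjoint_left]
    rintro _ ⟨⟨θ, s⟩, ⟨-, hs⟩, rfl⟩
    refine IsSimpleClosedCurve.normal_notMem_range hδ ?_ ?_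
    · rw [abs_mul, hε, one_mul, abs_of_pos hs.1]; exact hs.2
    · have : ε ≠ 0 := by rintro rfl; simp at hε
      exact mul_ne_zero this hs.1.ne')
  refine this.imp (fun H θ s hs => ?_) (fun H θ s hs => ?_)
  · exact H ⟨(θ, s), ⟨mem_univ _, hs⟩, rfl⟩
  · exact H ⟨(θ, s), ⟨mem_univ _, hs⟩, rfl⟩

/-- It suffices to know the side of the interior domain on one normal, arbitrarily close to the
curve. -/
theorem exists_isLeftCollar (h : IsJordanParam Ω γ) {θ : ℝ}
    (hθ : ∃ᶠ s : ℝ in 𝓝[>] 0, γ θ - s * rightNormal γ θ ∈ Ω)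
    (hθ' : ∃ᶠ s : ℝ in 𝓝[>] 0, γ θ + s * rightNormal γ θ ∉ closure Ω) :
    ∃ δ, IsLeftCollar Ω γ δ := by
  obtain ⟨δ, hδ, hδ'⟩ := h.isSimpleClosedCurve.exists_normal_bound
  have hev : ∀ᶠ s : ℝ in 𝓝[>] 0, s ∈ Ioc 0 δ := Ioc_mem_nhdsGT hδ
  refine ⟨δ, hδ, hδ', ?_, ?_⟩
  · rcases h.collar_subset_or hδ' (ε := -1) (by simp) with H | H
    · intro φ s hs
      simpa [sub_eq_add_neg] using H φ s hs
    · obtain ⟨s, hs1, hs2⟩ := (hθ.and_eventually hev).exists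
      exact absurd (subset_closure hs1) (by simpa [sub_eq_add_neg] using H θ s hs2)
  · rcases h.collar_subset_or hδ' (ε := 1) (by simp) with H | H
    · obtain ⟨s, hs1, hs2⟩ := (hθ'.and_eventually hev).exists
      exact absurd (subset_closure (H θ s hs2)) (by simpa using hs1)
    · intro φ s hs
      simpa using H φ s hs

end IsJordanParam

namespace IsLeftCollar

variable {Ω : Set ℂ} {γ : ℝ → ℂ} {δ : ℝ}

/-- A point off the curve lies on a normal segment that does not meet the curve, and its side
tells whether it is inside or outside. -/
theorem exists_normal (hc : IsLeftCollar Ω γ δ) (h : IsJordanParam Ω γ) {z : ℂ}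
    (hz : z ∉ range γ) : ∃ θ s : ℝ, 0 < s ∧ (∀ φ, s ≤ ‖z - γ φ‖) ∧
      ((z ∈ Ω ∧ z = γ θ - s * rightNormal γ θ) ∨
        (z ∉ closure Ω ∧ z = γ θ + s * rightNormal γ θ)) := by
  have h0 := h.isSimpleClosedCurve
  obtain ⟨θ, s, hs, hmin⟩ := h0.exists_nearest z
  have hs0 : s ≠ 0 := by
    rintro rfl
    exact hz ⟨θ, by simpa using hs.symm⟩
  -- the open segment from the nearest point to `z` avoids the curve
  have hseg : ∀ ε : ℝ, |ε| = 1 → s = ε * |s| → ∀ x ∈ Ioc (0 : ℝ) |s|,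
      γ θ + ((ε * x : ℝ) : ℂ) * rightNormal γ θ ∉ range γ := by
    rintro ε hε hsε x hx ⟨φ, hφ⟩
    have h1 := hmin φ
    rw [hφ, hs] at h1
    have e : γ θ + s * rightNormal γ θ - (γ θ + ((ε * x : ℝ) : ℂ) * rightNormal γ θ) =
        ((ε * (|s| - x) : ℝ) : ℂ) * rightNormal γ θ := by
      nth_rewrite 1 [hsε]; push_cast; ring
    rw [e, norm_mul, h0.norm_rightNormal, mul_one, norm_real, Real.norm_eq_abs, abs_mul,
      hε, one_mul, abs_of_nonneg (sub_nonneg.2 hx.2)] at h1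
    linarith [hx.1]
  have hside : ∀ ε : ℝ, |ε| = 1 → s = ε * |s| →
      (fun x : ℝ => γ θ + ((ε * x : ℝ) : ℂ) * rightNormal γ θ) '' Ioc 0 |s| ⊆ Ω ∨
      (fun x : ℝ => γ θ + ((ε * x : ℝ) : ℂ) * rightNormal γ θ) '' Ioc 0 |s| ⊆ (closure Ω)ᶜ := by
    intro ε hε hsε
    refine h.subset_or (isPreconnected_Ioc.image _ (by fun_prop)) ?_
    rw [disjoint_left]
    rintro _ ⟨x, hx, rfl⟩
    exact hseg ε hε hsε x hx
  have hs1 : 0 < |s| := abs_pos.2 hs0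
  have hm : min |s| δ ∈ Ioc 0 |s| := ⟨lt_min hs1 hc.pos, min_le_left _ _⟩
  have hm' : min |s| δ ∈ Ioc 0 δ := ⟨lt_min hs1 hc.pos, min_le_right _ _⟩
  refine ⟨θ, |s|, hs1, hmin, ?_⟩
  rcases lt_or_gt_of_ne hs0 with hneg | hpos
  · left
    have hsε : s = -1 * |s| := by rw [abs_of_neg hneg]; ring
    have hzeq : z = γ θ - |s| * rightNormal γ θ := by
      rw [hs]; nth_rewrite 1 [hsε]; push_cast; ring
    refine ⟨?_, hzeq⟩
    rcases hside (-1) (by simp) hsε with H | H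
    · have := H ⟨|s|, ⟨hs1, le_rfl⟩, rfl⟩
      rw [hzeq]; simpa [sub_eq_add_neg] using this
    · exact absurd (subset_closure (hc.inside θ _ hm')) (by
        simpa [sub_eq_add_neg] using H ⟨_, hm, rfl⟩)
  · right
    have hsε : s = 1 * |s| := by rw [abs_of_pos hpos]; ring
    have hzeq : z = γ θ + |s| * rightNormal γ θ := by
      rw [hs]; nth_rewrite 1 [hsε]; push_cast; ring
    refine ⟨?_, hzeq⟩
    rcases hside 1 (by simp) hsε with H | H
    · exact absurd (subset_closure (H ⟨_, hm, rfl⟩)) (by simpa using hc.outside θ _ hm')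
    · have := H ⟨|s|, ⟨hs1, le_rfl⟩, rfl⟩
      rw [hzeq]; simpa using this

/-- The exterior of a smooth Jordan domain is connected: the normal segments connect every point
to the collar. -/
theorem isPreconnected_compl_closure (hc : IsLeftCollar Ω γ δ) (h : IsJordanParam Ω γ) :
    IsPreconnected (closure Ω)ᶜ := by
  have h0 := h.isSimpleClosedCurve
  set Y := (fun p : ℝ × ℝ => γ p.1 + ((1 * p.2 : ℝ) : ℂ) * rightNormal γ p.1) ''
      (univ ×ˢ Ioc 0 δ) with hY
  have hYc : IsPreconnected Y := h0.isPreconnected_collar 1 δ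
  have hYo : Y ⊆ (closure Ω)ᶜ := by
    rintro _ ⟨⟨θ, s⟩, ⟨-, hs⟩, rfl⟩
    simpa using hc.outside θ s hs
  have hmem : γ 0 + δ * rightNormal γ 0 ∈ Y := ⟨(0, δ), ⟨mem_univ _, hc.pos, le_rfl⟩, by simp⟩
  refine isPreconnected_of_forall (γ 0 + δ * rightNormal γ 0) fun z hz => ?_
  have hzr : z ∉ range γ := fun h' => hz (by rw [h.closure_eq]; exact Or.inr h')
  obtain ⟨θ, s, hs, hmin, ⟨hzΩ, -⟩ | ⟨-, hzs⟩⟩ := hc.exists_normal h hzr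
  · exact absurd (subset_closure hzΩ) hz
  set T := (fun x : ℝ => γ θ + (x : ℂ) * rightNormal γ θ) '' Ioc 0 s with hT
  have hTc : IsPreconnected T := isPreconnected_Ioc.image _ (by fun_prop)
  have hzT : z ∈ T := ⟨s, ⟨hs, le_rfl⟩, hzs.symm⟩
  have hTo : T ⊆ (closure Ω)ᶜ := by
    refine (h.subset_or hTc ?_).resolve_left fun H => hz (subset_closure (H hzT))
    rw [disjoint_left]
    rintro _ ⟨x, hx, rfl⟩ ⟨φ, hφ⟩
    have h1 := hmin φ
    rw [hφ, hzs, show γ θ + s * rightNormal γ θ - (γ θ + (x : ℂ) * rightNormal γ θ) =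
      ((s - x : ℝ) : ℂ) * rightNormal γ θ by push_cast; ring, norm_mul, h0.norm_rightNormal,
      mul_one, norm_real, Real.norm_eq_abs, abs_of_nonneg (sub_nonneg.2 hx.2)] at h1
    linarith [hx.1]
  refine ⟨Y ∪ T, union_subset hYo hTo, Or.inl hmem, Or.inr hzT, ?_⟩
  have hm : min s δ ∈ Ioc 0 s := ⟨lt_min hs hc.pos, min_le_left _ _⟩
  have hm' : min s δ ∈ Ioc 0 δ := ⟨lt_min hs hc.pos, min_le_right _ _⟩
  exact IsPreconnected.union (γ θ + (min s δ : ℝ) * rightNormal γ θ)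
    ⟨(θ, min s δ), ⟨mem_univ _, hm'⟩, by simp⟩ ⟨min s δ, hm, rfl⟩ hYc hTc

end IsLeftCollar

/-! ### Integrals of Cauchy type -/

/-- The Cauchy type integral `∫ χ(θ) / (γ(θ) - z) dθ`. -/
def cauchyInt (γ : ℝ → ℂ) (χ : ℝ → ℂ) (z : ℂ) : ℂ :=
  ∫ θ in (0 : ℝ)..(2 * π), χ θ / (γ θ - z)

namespace IsSimpleClosedCurve

variable {γ : ℝ → ℂ} {χ : ℝ → ℂ}

theorem sub_ne_zero_of_notMem {z : ℂ} (hz : z ∉ range γ) (θ : ℝ) : γ θ - z ≠ 0 :=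
  sub_ne_zero.2 fun h => hz ⟨θ, h⟩

theorem isOpen_compl_range (h : IsSimpleClosedCurve γ) : IsOpen (range γ)ᶜ :=
  h.isCompact_range.isClosed.isOpen_compl

theorem intervalIntegrable_cauchy (h : IsSimpleClosedCurve γ) (hχ : Continuous χ) {z : ℂ}
    (hz : z ∉ range γ) (a b : ℝ) :
    IntervalIntegrable (fun θ => χ θ / (γ θ - z)) MeasureTheory.volume a b :=
  (hχ.div (h.continuous.sub continuous_const) (sub_ne_zero_of_notMem hz)).intervalIntegrable _ _

theorem hasDerivAt_cauchyInt (h : IsSimpleClosedCurve γ) (hχ : Continuous χ) {z : ℂ}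
    (hz : z ∉ range γ) :
    HasDerivAt (cauchyInt γ χ) (∫ θ in (0 : ℝ)..(2 * π), χ θ / (γ θ - z) ^ 2) z := by
  obtain ⟨ε, hε, hball⟩ := Metric.isOpen_iff.1 h.isOpen_compl_range z hz
  obtain ⟨M, hM⟩ := (isCompact_uIcc (a := 0) (b := 2 * π)).exists_bound_of_continuousOn
    hχ.continuousOn
  have hfar : ∀ w ∈ ball z (ε / 2), ∀ θ, ε / 2 ≤ ‖γ θ - w‖ := by
    intro w hw θ
    by_contra! hlt
    refine hball (a := γ θ) ?_ (mem_range_self θ)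
    rw [mem_ball] at hw ⊢
    calc dist (γ θ) z ≤ dist (γ θ) w + dist w z := dist_triangle _ _ _
      _ < ε := by rw [dist_eq_norm (γ θ)]; linarith
  have hsub : ∀ w ∈ ball z (ε / 2), w ∉ range γ := fun w hw =>
    hball (ball_subset_ball (by linarith) hw)
  refine (intervalIntegral.hasDerivAt_integral_of_dominated_loc_of_deriv_le
    (F := fun w θ => χ θ / (γ θ - w)) (F' := fun w θ => χ θ / (γ θ - w) ^ 2)
    (bound := fun _ => M / (ε / 2) ^ 2) (ball_mem_nhds z (half_pos hε)) ?_ ?_ ?_ ?_ ?_ ?_).2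
  · filter_upwards [ball_mem_nhds z (half_pos hε)] with w hw
    exact (h.intervalIntegrable_cauchy hχ (hsub w hw) _ _).aestronglyMeasurable_restrict_uIoc
  · exact h.intervalIntegrable_cauchy hχ hz _ _
  · refine (Continuous.intervalIntegrable ?_ 0 (2 * π)).aestronglyMeasurable_restrict_uIoc
    exact hχ.div ((h.continuous.sub continuous_const).pow 2)
      (fun θ => pow_ne_zero 2 (sub_ne_zero_of_notMem hz θ))
  · refine Eventually.of_forall fun θ hθ w hw => ?_
    rw [norm_div, norm_pow]
    have h1 := hfar w hw θ
    have h2 := hM θ (uIoc_subset_uIcc hθ)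
    have h3 : 0 ≤ M := (norm_nonneg _).trans h2
    gcongr
  · exact intervalIntegrable_const
  · refine Eventually.of_forall fun θ _ w hw => ?_
    have h1 := sub_ne_zero_of_notMem (hsub w hw) θ
    have := ((hasDerivAt_const w (χ θ)).div ((hasDerivAt_id w).const_sub (γ θ)) h1)
    refine this.congr_deriv ?_
    simp

theorem differentiableOn_cauchyInt (h : IsSimpleClosedCurve γ) (hχ : Continuous χ) :
    DifferentiableOn ℂ (cauchyInt γ χ) (range γ)ᶜ := fun _ hz =>
  (h.hasDerivAt_cauchyInt hχ hz).differentiableAt.differentiableWithinAt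

/-- The integral over a period, centred at the angle `θ`. -/
theorem cauchyInt_eq (h : IsSimpleClosedCurve γ)
    (hχp : Periodic χ (2 * π)) (z : ℂ) (θ : ℝ) :
    cauchyInt γ χ z = ∫ x in (-π)..π, χ (θ + x) / (γ (θ + x) - z) := by
  have hper : Periodic (fun θ => χ θ / (γ θ - z)) (2 * π) := fun θ => by
    simp only [hχp θ, h.periodic θ]
  have h1 := hper.intervalIntegral_add_eq 0 (θ - π)
  rw [zero_add] at h1
  rw [cauchyInt, h1, integral_comp_add_left (fun θ => χ θ / (γ θ - z))]
  congr 1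
  all_goals ring

/-- The **Sokhotski–Plemelj jump formula** for the boundary values on the two sides of the curve,
with a merely continuous density. The density need not be periodic: the integral is over the
period centred at the angle in question. -/
theorem tendsto_window_jump (h : IsSimpleClosedCurve γ) (hχ : Continuous χ) (θ₀ : ℝ) :
    Tendsto (fun p : ℝ × ℝ =>
      (∫ x in (-π)..π,
        χ (p.2 + x) / (γ (p.2 + x) - (γ p.2 - p.1 * rightNormal γ p.2))) -
      ∫ x in (-π)..π,
        χ (p.2 + x) / (γ (p.2 + x) - (γ p.2 + p.1 * rightNormal γ p.2))) (𝓝[>] 0 ×ˢ 𝓝 θ₀)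
      (𝓝 (2 * π * I * χ θ₀ / deriv γ θ₀)) := by
  have hπ := Real.pi_pos
  obtain ⟨δ, hδ, hδ'⟩ := h.exists_normal_bound
  obtain ⟨c, hc, hc'⟩ := h.chord_arc
  obtain ⟨C, hC, hC'⟩ := h.exists_taylor_bound
  obtain ⟨M, hM⟩ := (isCompact_Icc (a := θ₀ - 1 - π)
    (b := θ₀ + 1 + π)).exists_bound_of_continuousOn hχ.continuousOn
  have hM0 : 0 ≤ M := (norm_nonneg _).trans (hM θ₀ ⟨by linarith, by linarith⟩)
  -- the kernel after the substitution `x = s y`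
  set D : ℝ × ℝ → ℝ → ℂ := fun p y =>
    ((γ (p.2 + p.1 * y) - γ p.2) / p.1) ^ 2 - rightNormal γ p.2 ^ 2 with hD
  set Φ : ℝ × ℝ → ℝ → ℂ := fun p y =>
    χ (p.2 + p.1 * y) * (-2 * rightNormal γ p.2) / D p y with hΦ
  have hDbound : ∀ s ∈ Ioc 0 δ, ∀ θ y : ℝ, |s * y| ≤ π →
      1 + c ^ 2 / 2 * y ^ 2 ≤ ‖D (s, θ) y‖ := by
    intro s hs θ y hy
    have hs0 : (s : ℂ) ≠ 0 := by exact_mod_cast hs.1.ne'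
    have e : D (s, θ) y = ((γ (θ + s * y) - γ θ - s * rightNormal γ θ) *
        (γ (θ + s * y) - γ θ - (-s : ℝ) * rightNormal γ θ)) / s ^ 2 := by
      simp only [hD]; push_cast; field_simp; ring
    have h1 := hδ' θ (θ + s * y) s (by rw [abs_of_pos hs.1]; exact hs.2)
    have h2 := hδ' θ (θ + s * y) (-s) (by rw [abs_neg, abs_of_pos hs.1]; exact hs.2)
    have h3 := hc' θ (s * y) hy
    rw [abs_mul, abs_of_pos hs.1] at h3
    have h4 : (c * (s * |y|)) ^ 2 ≤ ‖γ (θ + s * y) - γ θ‖ ^ 2 :=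
      pow_le_pow_left₀ (by have := hs.1; positivity) h3 2
    rw [mul_pow, mul_pow, sq_abs] at h4
    rw [neg_sq] at h2
    set A := ‖γ (θ + s * y) - γ θ - s * rightNormal γ θ‖
    set B := ‖γ (θ + s * y) - γ θ - (-s : ℝ) * rightNormal γ θ‖
    have h5 : s ^ 2 * (1 + c ^ 2 / 2 * y ^ 2) ≤ A ^ 2 := by nlinarith
    have h6 : s ^ 2 * (1 + c ^ 2 / 2 * y ^ 2) ≤ B ^ 2 := by nlinarith
    have h7 : s ^ 2 * (1 + c ^ 2 / 2 * y ^ 2) ≤ A * B := by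
      have hA : 0 ≤ A := norm_nonneg _
      have hB : 0 ≤ B := norm_nonneg _
      have h0 : 0 ≤ s ^ 2 * (1 + c ^ 2 / 2 * y ^ 2) := by positivity
      refine le_of_sq_le_sq ?_ (by positivity)
      calc _ = (s ^ 2 * (1 + c ^ 2 / 2 * y ^ 2)) * (s ^ 2 * (1 + c ^ 2 / 2 * y ^ 2)) := sq _
        _ ≤ A ^ 2 * B ^ 2 := by gcongr
        _ = _ := by ring
    rw [e, norm_div, norm_mul, norm_pow, norm_real, Real.norm_of_nonneg hs.1.le,
      le_div_iff₀ (by have := hs.1; positivity), mul_comm]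
    exact h7
  have hint : ∀ s ∈ Ioc 0 δ, ∀ θ : ℝ, (∫ x in (-π)..π,
        χ (θ + x) / (γ (θ + x) - (γ θ - s * rightNormal γ θ))) -
      (∫ x in (-π)..π,
        χ (θ + x) / (γ (θ + x) - (γ θ + s * rightNormal γ θ))) =
      ∫ y, (Icc (-(π / s)) (π / s)).indicator (Φ (s, θ)) y := by
    intro s hs θ
    have hs0 : (s : ℂ) ≠ 0 := by exact_mod_cast hs.1.ne'
    have hn1 : γ θ - s * rightNormal γ θ ∉ range γ := by
      have := normal_notMem_range hδ' (θ := θ) (s := -s) (by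
        rw [abs_neg, abs_of_pos hs.1]; exact hs.2) (neg_ne_zero.2 hs.1.ne')
      simpa [sub_eq_add_neg] using this
    have hn2 : γ θ + s * rightNormal γ θ ∉ range γ :=
      normal_notMem_range hδ' (by rw [abs_of_pos hs.1]; exact hs.2) hs.1.ne'
    have hI : ∀ z, z ∉ range γ → IntervalIntegrable (fun x => χ (θ + x) / (γ (θ + x) - z))
        MeasureTheory.volume (-π) π := fun z hz =>
      Continuous.intervalIntegrable ((hχ.comp (continuous_const_add θ)).div
        ((h.continuous.comp (continuous_const_add θ)).sub continuous_const)
        (fun x => sub_ne_zero_of_notMem hz _)) _ _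
    rw [← integral_sub
      (hI _ hn1) (hI _ hn2)]
    have hsub := intervalIntegral.smul_integral_comp_mul_left (a := -(π / s))
      (b := π / s) (fun x => χ (θ + x) / (γ (θ + x) - (γ θ - s * rightNormal γ θ)) -
        χ (θ + x) / (γ (θ + x) - (γ θ + s * rightNormal γ θ))) s
    rw [show s * -(π / s) = -π by field_simp [hs.1.ne'],
      show s * (π / s) = π by field_simp [hs.1.ne']] at hsub
    rw [← hsub, MeasureTheory.integral_indicator measurableSet_Icc,
      MeasureTheory.integral_Icc_eq_integral_Ioc, ← intervalIntegral.integral_of_le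
        (by have := div_pos hπ hs.1; linarith), ← integral_smul]
    refine integral_congr fun y _ => ?_
    have h1 := sub_ne_zero_of_notMem hn1 (θ + s * y)
    have h2 := sub_ne_zero_of_notMem hn2 (θ + s * y)
    have e : D (s, θ) y = ((γ (θ + s * y) - (γ θ - s * rightNormal γ θ)) *
        (γ (θ + s * y) - (γ θ + s * rightNormal γ θ))) / s ^ 2 := by
      simp only [hD]; field_simp; ring
    simp only [hΦ, e, real_smul]
    rw [div_sub_div _ _ h1 h2, div_div_eq_mul_div, mul_div_assoc']
    congr 1
    ring
  have hlim : Tendsto (fun p : ℝ × ℝ =>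
      ∫ y, (Icc (-(π / p.1)) (π / p.1)).indicator (Φ p) y) (𝓝[>] 0 ×ˢ 𝓝 θ₀)
      (𝓝 (∫ y : ℝ, χ θ₀ * (-2 * rightNormal γ θ₀) /
        ((deriv γ θ₀ * y) ^ 2 - rightNormal γ θ₀ ^ 2))) := by
    have hs1 : Tendsto (fun p : ℝ × ℝ => p.1) (𝓝[>] 0 ×ˢ 𝓝 θ₀) (𝓝[>] 0) := tendsto_fst
    have hs2 : Tendsto (fun p : ℝ × ℝ => p.2) (𝓝[>] 0 ×ˢ 𝓝 θ₀) (𝓝 θ₀) := tendsto_snd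
    have hev : ∀ᶠ p : ℝ × ℝ in 𝓝[>] 0 ×ˢ 𝓝 θ₀, p.1 ∈ Ioc 0 δ :=
      hs1.eventually (Ioc_mem_nhdsGT hδ)
    have hs10 : Tendsto (fun p : ℝ × ℝ => p.1) (𝓝[>] 0 ×ˢ 𝓝 θ₀) (𝓝 0) :=
      hs1.mono_right nhdsWithin_le_nhds
    refine MeasureTheory.tendsto_integral_filter_of_dominated_convergence
      (fun y => 2 * M * (1 + (c ^ 2 / 2) * y ^ 2)⁻¹) ?_ ?_ ?_ ?_
    · refine Eventually.of_forall fun p => ?_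
      refine (Measurable.indicator ?_ measurableSet_Icc).aestronglyMeasurable
      have h1 : Measurable fun y : ℝ => χ (p.2 + p.1 * y) :=
        (hχ.comp (by fun_prop : Continuous fun y : ℝ => p.2 + p.1 * y)).measurable
      have h2 : Measurable fun y : ℝ => γ (p.2 + p.1 * y) :=
        (h.continuous.comp (by fun_prop : Continuous fun y : ℝ => p.2 + p.1 * y)).measurable
      exact (h1.mul_const _).div ((((h2.sub_const _).div_const _).pow_const 2).sub_const _)
    · filter_upwards [hev, hs2.eventually (Icc_mem_nhds (sub_one_lt θ₀) (lt_add_one θ₀))]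
        with p hp hp2
      refine Eventually.of_forall fun y => ?_
      by_cases hy : y ∈ Icc (-(π / p.1)) (π / p.1)
      · rw [indicator_of_mem hy]
        have hy' : |p.1 * y| ≤ π := by
          have := abs_le.2 hy
          rw [abs_mul, abs_of_pos hp.1]
          rwa [le_div_iff₀ hp.1, mul_comm] at this
        have h1 := hDbound p.1 hp p.2 y hy'
        have h2 : 0 < 1 + c ^ 2 / 2 * y ^ 2 := by positivity
        simp only [hΦ]
        rw [norm_div, norm_mul, norm_mul, h.norm_rightNormal, norm_neg, Complex.norm_ofNat,
          mul_one, ← div_eq_mul_inv, mul_comm (2 : ℝ) M]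
        gcongr
        have := abs_le.1 hy'
        exact hM _ ⟨by linarith [hp2.1], by linarith [hp2.2]⟩
      · rw [indicator_of_notMem hy, norm_zero]
        positivity
    · have h1 : MeasureTheory.Integrable fun y : ℝ => (1 + (c / √2 * y) ^ 2)⁻¹ :=
        integrable_inv_one_add_sq.comp_mul_left' (by positivity)
      refine (h1.const_mul (2 * M)).congr (Eventually.of_forall fun y => ?_)
      simp only [mul_pow, div_pow, Real.sq_sqrt (zero_le_two)]
    · refine Eventually.of_forall fun y => ?_
      have hev2 : ∀ᶠ p : ℝ × ℝ in 𝓝[>] 0 ×ˢ 𝓝 θ₀, y ∈ Icc (-(π / p.1)) (π / p.1) := by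
        have : ∀ᶠ s : ℝ in 𝓝[>] 0, s ∈ Ioo 0 (π / (|y| + 1)) :=
          Ioo_mem_nhdsGT (by positivity)
        filter_upwards [hs1.eventually this] with p hp
        refine abs_le.1 ?_
        rw [le_div_iff₀ hp.1]
        have := hp.2
        rw [lt_div_iff₀ (by positivity)] at this
        nlinarith [hp.1, abs_nonneg y]
      have hl : Tendsto (fun p : ℝ × ℝ => Φ p y) (𝓝[>] 0 ×ˢ 𝓝 θ₀)
          (𝓝 (χ θ₀ * (-2 * rightNormal γ θ₀) /
            ((deriv γ θ₀ * y) ^ 2 - rightNormal γ θ₀ ^ 2))) := by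
        have hν : Tendsto (fun p : ℝ × ℝ => rightNormal γ p.2) (𝓝[>] 0 ×ˢ 𝓝 θ₀)
            (𝓝 (rightNormal γ θ₀)) := (h.continuous_rightNormal.tendsto θ₀).comp hs2
        have hχ' : Tendsto (fun p : ℝ × ℝ => χ (p.2 + p.1 * y)) (𝓝[>] 0 ×ˢ 𝓝 θ₀) (𝓝 (χ θ₀)) := by
          refine (hχ.tendsto θ₀).comp ?_
          simpa using hs2.add (hs10.mul_const y)
        have hq : Tendsto (fun p : ℝ × ℝ => (γ (p.2 + p.1 * y) - γ p.2) / p.1) (𝓝[>] 0 ×ˢ 𝓝 θ₀)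
            (𝓝 (deriv γ θ₀ * y)) := by
          have h1 : Tendsto (fun p : ℝ × ℝ => deriv γ p.2 * y) (𝓝[>] 0 ×ˢ 𝓝 θ₀)
            (𝓝 (deriv γ θ₀ * y)) := ((h.continuous_deriv.tendsto θ₀).comp hs2).mul_const _
          have h2 : Tendsto (fun p : ℝ × ℝ => (γ (p.2 + p.1 * y) - γ p.2) / p.1 -
              deriv γ p.2 * y) (𝓝[>] 0 ×ˢ 𝓝 θ₀) (𝓝 0) := by
            rw [tendsto_zero_iff_norm_tendsto_zero]
            have h3 : Tendsto (fun p : ℝ × ℝ => C * (p.1 * y ^ 2)) (𝓝[>] 0 ×ˢ 𝓝 θ₀) (𝓝 0) := by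
              simpa using (hs10.mul_const (y ^ 2)).const_mul C
            refine tendsto_of_tendsto_of_tendsto_of_le_of_le' tendsto_const_nhds h3
              (Eventually.of_forall fun _ => norm_nonneg _) ?_
            filter_upwards [hev] with p hp
            have hp0 : (p.1 : ℂ) ≠ 0 := by exact_mod_cast hp.1.ne'
            have h4 := hC' p.2 (p.1 * y)
            have e : (γ (p.2 + p.1 * y) - γ p.2) / p.1 - deriv γ p.2 * y =
                (γ (p.2 + p.1 * y) - γ p.2 - ((p.1 * y : ℝ) : ℂ) * deriv γ p.2) / p.1 := by
              push_cast; field_simp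
            rw [e, norm_div, norm_real, Real.norm_of_nonneg hp.1.le, div_le_iff₀ hp.1]
            refine h4.trans (le_of_eq ?_)
            ring
          simpa using h2.add h1
        have hne : (deriv γ θ₀ * y) ^ 2 - rightNormal γ θ₀ ^ 2 ≠ 0 := by
          have hm : (‖deriv γ θ₀‖ : ℂ) ≠ 0 := by simpa using h.regular θ₀
          have e : (deriv γ θ₀ * y) ^ 2 - rightNormal γ θ₀ ^ 2 =
              (deriv γ θ₀) ^ 2 * ((y ^ 2 + (‖deriv γ θ₀‖ ^ 2)⁻¹ : ℝ) : ℂ) := by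
            rw [rightNormal]; push_cast; field_simp
            linear_combination (-(deriv γ θ₀) ^ 2) * I_sq
          rw [e]
          refine mul_ne_zero (pow_ne_zero 2 (h.regular θ₀)) ?_
          have : 0 < y ^ 2 + (‖deriv γ θ₀‖ ^ 2)⁻¹ := by
            have := norm_pos_iff.2 (h.regular θ₀)
            positivity
          exact_mod_cast this.ne'
        exact (hχ'.mul (hν.const_mul (-2))).div ((hq.pow 2).sub (hν.pow 2)) hne
      refine hl.congr' ?_
      filter_upwards [hev2] with p hp
      rw [indicator_of_mem hp]
  -- the limit is an arctangent integral
  have hval : (∫ y : ℝ, χ θ₀ * (-2 * rightNormal γ θ₀) /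
        ((deriv γ θ₀ * y) ^ 2 - rightNormal γ θ₀ ^ 2)) =
      2 * π * I * χ θ₀ / deriv γ θ₀ := by
    set m : ℝ := ‖deriv γ θ₀‖ with hm
    have hm0 : 0 < m := norm_pos_iff.2 (h.regular θ₀)
    have hmC : (m : ℂ) ≠ 0 := by exact_mod_cast hm0.ne'
    have hd := h.regular θ₀
    have e : ∀ y : ℝ, χ θ₀ * (-2 * rightNormal γ θ₀) /
        ((deriv γ θ₀ * y) ^ 2 - rightNormal γ θ₀ ^ 2) =
        (2 * I * m * χ θ₀ / deriv γ θ₀) * (((1 + (m * y) ^ 2)⁻¹ : ℝ) : ℂ) := by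
      intro y
      have h1 : (1 + ((m : ℂ) * y) ^ 2) ≠ 0 := by
        have : 0 < 1 + (m * y) ^ 2 := by positivity
        exact_mod_cast this.ne'
      have h2 : (deriv γ θ₀ * y) ^ 2 - rightNormal γ θ₀ ^ 2 =
          deriv γ θ₀ ^ 2 * (1 + ((m : ℂ) * y) ^ 2) / m ^ 2 := by
        rw [rightNormal, ← hm]; field_simp; linear_combination (-1 : ℂ) * I_sq
      rw [h2, rightNormal, ← hm]
      push_cast
      field_simp
    simp_rw [e]
    rw [MeasureTheory.integral_const_mul, integral_complex_ofReal,
      MeasureTheory.Measure.integral_comp_mul_left (fun y : ℝ => (1 + y ^ 2)⁻¹) m,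
      integral_univ_inv_one_add_sq, abs_of_pos (inv_pos.2 hm0)]
    simp only [smul_eq_mul]
    push_cast
    field_simp
  rw [← hval]
  refine hlim.congr' ?_
  filter_upwards [tendsto_fst.eventually (Ioc_mem_nhdsGT hδ)] with p hp
  rw [hint p.1 hp p.2]

theorem tendsto_cauchyInt_jump (h : IsSimpleClosedCurve γ) (hχ : Continuous χ)
    (hχp : Periodic χ (2 * π)) (θ₀ : ℝ) :
    Tendsto (fun p : ℝ × ℝ => cauchyInt γ χ (γ p.2 - p.1 * rightNormal γ p.2) -
      cauchyInt γ χ (γ p.2 + p.1 * rightNormal γ p.2)) (𝓝[>] 0 ×ˢ 𝓝 θ₀)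
      (𝓝 (2 * π * I * χ θ₀ / deriv γ θ₀)) := by
  refine (h.tendsto_window_jump hχ θ₀).congr fun p => ?_
  rw [h.cauchyInt_eq hχp _ p.2, h.cauchyInt_eq hχp _ p.2]

end IsSimpleClosedCurve

/-! ### A maximum principle -/

/-- A harmonic function is constant near a local maximum. -/
theorem eventually_eq_of_isLocalMax_of_harmonicAt {v : ℂ → ℝ} {z : ℂ}
    (hv : HarmonicAt v z) (hz : IsLocalMax v z) : ∀ᶠ w in 𝓝 z, v w = v z := by
  obtain ⟨R, hR, hball⟩ := Metric.eventually_nhds_iff_ball.1 hv.eventually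
  obtain ⟨f, hf, hfv⟩ :=
    InnerProductSpace.HarmonicOnNhd.exists_analyticOnNhd_ball_re_eq (f := v) (z := z) (R := R) hball
  have hmem := ball_mem_nhds z hR
  have hnorm : ∀ w ∈ ball z R, ‖cexp (f w)‖ = Real.exp (v w) := fun w hw => by
    rw [Complex.norm_exp]; exact congrArg _ (hfv hw)
  have h1 : ∀ᶠ w in 𝓝 z, ‖cexp (f w)‖ = ‖cexp (f z)‖ := by
    refine Complex.norm_eventually_eq_of_isLocalMax (f := fun w => cexp (f w)) ?_ ?_
    · filter_upwards [hmem] with w hw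
      exact (hf w hw).differentiableAt.cexp
    · filter_upwards [hmem, hz] with w hw hw'
      simp only [comp_apply]
      rw [hnorm w hw, hnorm z (mem_ball_self hR)]
      exact Real.exp_le_exp.2 hw'
  filter_upwards [h1, hmem] with w hw hw'
  rw [hnorm w hw', hnorm z (mem_ball_self hR)] at hw
  exact Real.exp_injective hw

/-- A form of the maximum principle that allows for points that are not local maxima for other
reasons than harmonicity. -/
theorem exists_le_of_harmonicAt_or_not_isLocalMax {v : ℂ → ℝ} {K B : Set ℂ} (hK : IsCompact K)
    (hv : ContinuousOn v K)
    (h : ∀ z ∈ K, z ∉ B → K ∈ 𝓝 z ∧ (HarmonicAt v z ∨ ¬ IsLocalMax v z))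
    {z : ℂ} (hz : z ∈ K) : ∃ b ∈ K ∩ B, v z ≤ v b := by
  obtain ⟨x, hx, hmax⟩ := hK.exists_isMaxOn ⟨z, hz⟩ hv
  -- among the maxima, the rightmost one cannot have a neighbourhood consisting of maxima
  have hS : IsCompact (K ∩ {w | v w = v x}) :=
    hK.of_isClosed_subset (hv.preimage_isClosed_of_isClosed hK.isClosed isClosed_singleton)
      inter_subset_left
  obtain ⟨y, ⟨hyK, hy⟩, hright⟩ := hS.exists_isMaxOn ⟨x, hx, rfl⟩ (f := fun w => w.re)
    continuous_re.continuousOn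
  simp only [mem_ofPred_eq] at hy
  refine ⟨y, ⟨hyK, ?_⟩, by rw [hy]; exact hmax hz⟩
  by_contra hyB
  obtain ⟨hnhds, hh⟩ := h y hyK hyB
  have hloc : IsLocalMax v y := by
    filter_upwards [hnhds] with w hw
    rw [hy]; exact hmax hw
  have h1 := eventually_eq_of_isLocalMax_of_harmonicAt
    (hh.resolve_right (not_not.2 hloc)) hloc
  have h2 : Tendsto (fun s : ℝ => y + s) (𝓝[>] 0) (𝓝 y) := by
    have : Continuous fun s : ℝ => y + s := by fun_prop
    simpa using (this.tendsto 0).mono_left nhdsWithin_le_nhds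
  obtain ⟨s, ⟨hs1, hs2⟩, hs3⟩ :=
    ((h2.eventually (h1.and hnhds)).and self_mem_nhdsWithin).exists
  have := hright (show y + s ∈ K ∩ {w | v w = v x} from ⟨hs2, by simp [hs1, hy]⟩)
  simp at this
  exact absurd hs3 (not_lt.2 this)

/-! ### Logarithmic potentials of smooth curves -/

theorem HasDerivAt.log_norm {f : ℝ → ℂ} {f' : ℂ} {s : ℝ} (hf : HasDerivAt f f' s)
    (h0 : f s ≠ 0) : HasDerivAt (fun x => Real.log ‖f x‖) (f' / f s).re s := by
  have hn : ‖f s‖ ≠ 0 := norm_ne_zero_iff.2 h0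
  have h1 := (hf.norm_sq.log (pow_ne_zero 2 hn)).const_mul (1 / 2)
  have e : (fun x => Real.log ‖f x‖) = fun x => 1 / 2 * Real.log (‖f x‖ ^ 2) := by
    funext x; rw [Real.log_pow]; push_cast; ring
  rw [e]
  refine h1.congr_deriv ?_
  rw [Complex.inner, Complex.div_re, ← normSq_eq_norm_sq]
  have : normSq (f s) ≠ 0 := by simpa using h0
  simp only [mul_re, conj_re, conj_im]
  field_simp
  ring

/-- The logarithmic potential `∫ ρ(θ) log |γ(θ) - z| dθ`. -/
def logPot (γ : ℝ → ℂ) (ρ : ℝ → ℝ) (z : ℂ) : ℝ :=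
  ∫ θ in (0 : ℝ)..(2 * π), ρ θ * Real.log ‖γ θ - z‖

namespace IsSimpleClosedCurve

variable {γ : ℝ → ℂ} {ρ : ℝ → ℝ}

theorem primitive_continuous (hρ : Continuous ρ) :
    Continuous fun θ => ∫ x in (0 : ℝ)..θ, ρ x :=
  continuous_primitive (fun _ _ => hρ.intervalIntegrable _ _) 0

theorem primitive_hasDerivAt (hρ : Continuous ρ) (θ : ℝ) :
    HasDerivAt (fun θ => ∫ x in (0 : ℝ)..θ, ρ x) (ρ θ) θ :=
  integral_hasDerivAt_right (hρ.intervalIntegrable _ _)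
    (hρ.stronglyMeasurableAtFilter _ _) hρ.continuousAt

/-- Off the curve, integration by parts turns a logarithmic potential into the real part of a
Cauchy type integral. -/
theorem logPot_eq (h : IsSimpleClosedCurve γ) (hρ : Continuous ρ) {z : ℂ} (hz : z ∉ range γ) :
    logPot γ ρ z = (∫ x in (0 : ℝ)..(2 * π), ρ x) * Real.log ‖γ 0 - z‖ -
      (cauchyInt γ (fun θ => ((∫ x in (0 : ℝ)..θ, ρ x : ℝ) : ℂ) * deriv γ θ) z).re := by
  have hne := sub_ne_zero_of_notMem hz
  have hA := primitive_continuous hρ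
  have hd : ∀ θ ∈ uIcc 0 (2 * π), HasDerivAt (fun θ => Real.log ‖γ θ - z‖)
      (deriv γ θ / (γ θ - z)).re θ := fun θ _ => ((h.hasDerivAt θ).sub_const z).log_norm (hne θ)
  have hcont : Continuous fun θ => deriv γ θ / (γ θ - z) :=
    h.continuous_deriv.div (h.continuous.sub continuous_const) hne
  have h1 := integral_mul_deriv_eq_deriv_mul
    (fun θ _ => primitive_hasDerivAt hρ θ) hd (hρ.intervalIntegrable _ _)
    ((continuous_re.comp hcont).intervalIntegrable _ _)
  have h2 : γ (2 * π) = γ 0 := by simpa using h.periodic 0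
  rw [h2, integral_same, zero_mul, sub_zero] at h1
  have h3 : (cauchyInt γ (fun θ => ((∫ x in (0 : ℝ)..θ, ρ x : ℝ) : ℂ) * deriv γ θ) z).re =
      ∫ θ in (0 : ℝ)..(2 * π), (∫ x in (0 : ℝ)..θ, ρ x) * (deriv γ θ / (γ θ - z)).re := by
    rw [cauchyInt]
    refine Eq.trans (reCLM.intervalIntegral_comp_comm ?_).symm ?_
    · exact h.intervalIntegrable_cauchy
        ((continuous_ofReal.comp hA).mul h.continuous_deriv) hz _ _
    · refine integral_congr fun θ _ => ?_
      simp only [reCLM_apply]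
      rw [mul_div_assoc, re_ofReal_mul]
  rw [h3, logPot]
  linarith

/-- Integration by parts in the derivative of a Cauchy type integral. -/
theorem hasDerivAt_cauchyInt_primitive (h : IsSimpleClosedCurve γ) (hρ : Continuous ρ) {z : ℂ}
    (hz : z ∉ range γ) :
    HasDerivAt (cauchyInt γ (fun θ => ((∫ x in (0 : ℝ)..θ, ρ x : ℝ) : ℂ) * deriv γ θ))
      (cauchyInt γ (fun θ => (ρ θ : ℂ)) z -
        (∫ x in (0 : ℝ)..(2 * π), ρ x : ℝ) / (γ 0 - z)) z := by
  have hne := sub_ne_zero_of_notMem hz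
  have hA := continuous_ofReal.comp (primitive_continuous hρ)
  refine (h.hasDerivAt_cauchyInt (hA.mul h.continuous_deriv) hz).congr_deriv ?_
  have hd : ∀ θ ∈ uIcc 0 (2 * π), HasDerivAt (fun θ => (γ θ - z)⁻¹)
      (-deriv γ θ / (γ θ - z) ^ 2) θ := fun θ _ =>
    ((h.hasDerivAt θ).sub_const z).fun_inv (hne θ)
  have hcont : Continuous fun θ => -deriv γ θ / (γ θ - z) ^ 2 :=
    h.continuous_deriv.neg.div ((h.continuous.sub continuous_const).pow 2)
      (fun θ => pow_ne_zero 2 (hne θ))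
  have h1 := integral_mul_deriv_eq_deriv_mul
    (fun θ _ => (primitive_hasDerivAt hρ θ).ofReal_comp) hd
    ((continuous_ofReal.comp hρ).intervalIntegrable _ _) (hcont.intervalIntegrable _ _)
  have h2 : γ (2 * π) = γ 0 := by simpa using h.periodic 0
  rw [h2, integral_same, ofReal_zero, zero_mul, sub_zero] at h1
  have e1 : (∫ θ in (0 : ℝ)..(2 * π), ((∫ x in (0 : ℝ)..θ, ρ x : ℝ) : ℂ) * deriv γ θ /
      (γ θ - z) ^ 2) = -∫ θ in (0 : ℝ)..(2 * π), ((∫ x in (0 : ℝ)..θ, ρ x : ℝ) : ℂ) *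
      (-deriv γ θ / (γ θ - z) ^ 2) := by
    rw [← integral_neg]
    refine integral_congr fun θ _ => ?_
    ring
  refine e1.trans ?_
  rw [h1, cauchyInt]
  simp only [div_eq_mul_inv]
  ring

theorem harmonicAt_logPot (h : IsSimpleClosedCurve γ) (hρ : Continuous ρ) {z : ℂ}
    (hz : z ∉ range γ) : HarmonicAt (logPot γ ρ) z := by
  have hO : (range γ)ᶜ ∈ 𝓝 z := h.isOpen_compl_range.mem_nhds hz
  have hχ : Continuous fun θ => ((∫ x in (0 : ℝ)..θ, ρ x : ℝ) : ℂ) * deriv γ θ :=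
    (continuous_ofReal.comp (primitive_continuous hρ)).mul h.continuous_deriv
  have h1 := ((h.differentiableOn_cauchyInt hχ).analyticAt hO).harmonicAt_re
  have h2 : HarmonicAt (fun z => Real.log ‖γ 0 - z‖) z :=
    AnalyticAt.harmonicAt_log_norm (f := fun z => γ 0 - z) (by fun_prop)
      (sub_ne_zero_of_notMem hz 0)
  have h3 := (h2.const_smul (c := ∫ x in (0 : ℝ)..(2 * π), ρ x)).sub h1
  refine (harmonicAt_congr_nhds ?_).2 h3
  filter_upwards [hO] with w hw
  simpa using h.logPot_eq hρ hw

/-- The derivative of a logarithmic potential along a path off the curve. -/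
theorem hasDerivAt_logPot_comp (h : IsSimpleClosedCurve γ) (hρ : Continuous ρ) {c : ℝ → ℂ}
    {c' : ℂ} {s : ℝ} (hc : HasDerivAt c c' s) (hz : c s ∉ range γ) :
    HasDerivAt (fun x => logPot γ ρ (c x))
      (-(cauchyInt γ (fun θ => (ρ θ : ℂ)) (c s) * c').re) s := by
  have h1 := ((hc.const_sub (γ 0)).log_norm (sub_ne_zero_of_notMem hz 0)).const_mul
    (∫ x in (0 : ℝ)..(2 * π), ρ x)
  have h2 := (h.hasDerivAt_cauchyInt_primitive hρ hz).comp s hc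
  have h3 := reCLM.hasFDerivAt.comp_hasDerivAt s h2
  have h4 := h1.sub h3
  have hO : (range γ)ᶜ ∈ 𝓝 (c s) := h.isOpen_compl_range.mem_nhds hz
  refine (h4.congr_of_eventuallyEq ?_).congr_deriv ?_
  · filter_upwards [hc.continuousAt hO] with x hx
    simpa using h.logPot_eq hρ hx
  · simp only [reCLM_apply]
    rw [← re_ofReal_mul, ← Complex.sub_re, ← Complex.neg_re]
    congr 1
    have := sub_ne_zero_of_notMem hz 0
    field_simp
    ring

end IsSimpleClosedCurve

namespace IsSimpleClosedCurve

variable {γ : ℝ → ℂ} {ρ : ℝ → ℝ}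

/-- The regularized logarithm `log (r² + ε²) / 2` approximates `log r` with an integrable error. -/
theorem abs_log_sqrt_sub_log_le {r ε : ℝ} (hr : 0 < r) (hε : 0 < ε) :
    |Real.log (r ^ 2 + ε ^ 2) / 2 - Real.log r| ≤ 2 * √ε * r ^ (-(1 / 2) : ℝ) := by
  have h1 : Real.log (r ^ 2 + ε ^ 2) / 2 - Real.log r = Real.log (1 + (ε / r) ^ 2) / 2 := by
    have : r ^ 2 + ε ^ 2 = r ^ 2 * (1 + (ε / r) ^ 2) := by field_simp
    rw [this, Real.log_mul (by positivity) (by positivity), Real.log_pow]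
    push_cast; ring
  have h2 : 0 ≤ Real.log (1 + (ε / r) ^ 2) := Real.log_nonneg (by
    have := sq_nonneg (ε / r); linarith)
  rw [h1, abs_of_nonneg (by positivity)]
  -- `log (1 + x²) ≤ 2 log (1 + x) ≤ 4 √x`, for `x = ε / r`
  set x := ε / r with hx
  have hx0 : 0 < x := by positivity
  have h3 : Real.log (1 + x ^ 2) ≤ 2 * Real.log (1 + x) := by
    have : 2 * Real.log (1 + x) = Real.log ((1 + x) ^ 2) := by rw [Real.log_pow]; push_cast; ring
    rw [this]
    exact Real.log_le_log (by positivity) (by nlinarith)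
  have h4 : Real.log (1 + x) ≤ 2 * √x := by
    have h5 : 1 + x ≤ (1 + √x) ^ 2 := by nlinarith [Real.sq_sqrt hx0.le, Real.sqrt_nonneg x]
    have h6 := Real.log_le_log (by positivity) h5
    rw [Real.log_pow] at h6
    have h7 := Real.log_le_sub_one_of_pos (show 0 < 1 + √x by positivity)
    push_cast at h6
    linarith
  have h5 : √x = √ε * r ^ (-(1 / 2) : ℝ) := by
    rw [hx, Real.sqrt_div hε.le, Real.rpow_neg hr.le, ← Real.sqrt_eq_rpow, div_eq_mul_inv]
  nlinarith

theorem exists_lower_bound_window (h : IsSimpleClosedCurve γ) :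
    ∃ c > 0, ∀ z : ℂ, ∃ θ : ℝ, ∀ x : ℝ, |x| ≤ π → c * |x| ≤ ‖γ (θ + x) - z‖ := by
  obtain ⟨c, hc, hc'⟩ := h.chord_arc
  refine ⟨c / 2, by positivity, fun z => ?_⟩
  obtain ⟨θ, s, hs, hmin⟩ := h.exists_nearest z
  refine ⟨θ, fun x hx => ?_⟩
  have h1 := hc' θ x hx
  have h2 : ‖z - γ θ‖ = |s| := by
    rw [hs, add_sub_cancel_left, norm_mul, h.norm_rightNormal, mul_one, norm_real,
      Real.norm_eq_abs]
  have h3 := hmin (θ + x)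
  rw [norm_sub_rev] at h3
  have h4 : ‖γ (θ + x) - γ θ‖ ≤ ‖γ (θ + x) - z‖ + ‖z - γ θ‖ := norm_sub_le_norm_sub_add_norm_sub _ _ _
  linarith

theorem window_integral_eq {f : ℝ → ℝ} (hf : Periodic f (2 * π)) (θ : ℝ) :
    ∫ x in (0 : ℝ)..(2 * π), f x = ∫ x in (-π)..π, f (θ + x) := by
  have h1 := hf.intervalIntegral_add_eq 0 (θ - π)
  rw [zero_add] at h1
  rw [h1, integral_comp_add_left]
  congr 1
  all_goals ring

/-- Logarithmic potentials are continuous on the whole plane. -/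
theorem continuous_logPot (h : IsSimpleClosedCurve γ) (hρ : Continuous ρ)
    (hρp : Periodic ρ (2 * π)) : Continuous (logPot γ ρ) := by
  have hπ := Real.pi_pos
  obtain ⟨c, hc, hc'⟩ := h.exists_lower_bound_window
  obtain ⟨M, hM⟩ := (isCompact_Icc (a := 0) (b := 2 * π)).exists_bound_of_continuousOn
    hρ.continuousOn
  have hM' : ∀ θ, |ρ θ| ≤ M := by
    intro θ
    obtain ⟨y, hy, hy'⟩ := hρp.exists_mem_Ico₀ (by positivity) θ
    rw [hy']; exact hM y (Ico_subset_Icc_self hy)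
  have hM0 : 0 ≤ M := (abs_nonneg _).trans (hM' 0)
  have hint : IntervalIntegrable (fun x : ℝ => |x| ^ (-(1 / 2) : ℝ)) MeasureTheory.volume
      (-π) π := by
    have h1 := intervalIntegral.intervalIntegrable_rpow' (a := 0) (b := π)
      (show (-1 : ℝ) < -(1 / 2) by norm_num)
    have h2 : IntervalIntegrable (fun x : ℝ => |x| ^ (-(1 / 2) : ℝ)) MeasureTheory.volume 0
        π := h1.congr (fun x hx => by
      rw [uIoc_of_le hπ.le] at hx
      rw [abs_of_pos hx.1])
    have h3 := h2.comp_sub_left 0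
    simp only [zero_sub, abs_neg, neg_zero] at h3
    exact h3.symm.trans h2
  set L := ∫ x in (-π)..π, |x| ^ (-(1 / 2) : ℝ) with hL
  -- the regularized potentials converge uniformly
  set W : ℝ → ℂ → ℝ := fun ε z =>
    ∫ θ in (0 : ℝ)..(2 * π), ρ θ * (Real.log (‖γ θ - z‖ ^ 2 + ε ^ 2) / 2) with hW
  have hWc : ∀ ε, 0 < ε → Continuous (W ε) := by
    intro ε hε
    refine continuous_parametric_intervalIntegral_of_continuous' ?_ 0 _
    refine (hρ.comp continuous_snd).mul (Continuous.div_const (Continuous.log ?_ ?_) _)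
    · exact (((h.continuous.comp continuous_snd).sub continuous_fst).norm.pow 2).add
        continuous_const
    · intro p; positivity
  have hdiff : ∀ ε, 0 < ε → ∀ z, |logPot γ ρ z - W ε z| ≤
      M * (2 * √ε * (c ^ (-(1 / 2) : ℝ))) * L := by
    intro ε hε z
    obtain ⟨θ, hθ⟩ := hc' z
    set F : ℝ → ℝ := fun φ => ρ φ * (Real.log (‖γ φ - z‖ ^ 2 + ε ^ 2) / 2) with hF
    set G : ℝ → ℝ := fun φ => ρ φ * (Real.log (‖γ φ - z‖ ^ 2 + ε ^ 2) / 2 -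
      Real.log ‖γ φ - z‖) with hG
    have hFc : Continuous F := by
      refine hρ.mul (Continuous.div_const (Continuous.log ?_ ?_) _)
      · exact ((h.continuous.sub continuous_const).norm.pow 2).add continuous_const
      · intro p; positivity
    have hGm : Measurable G := by
      refine hρ.measurable.mul (Measurable.sub ?_ ?_)
      · exact (((h.continuous.sub continuous_const).norm.pow 2).add
          continuous_const).measurable.log.div_const _
      · exact (h.continuous.sub continuous_const).norm.measurable.log
    have hbound : ∀ x : ℝ, x ≠ 0 → |x| ≤ π →
        ‖G (θ + x)‖ ≤ M * (2 * √ε * (c ^ (-(1 / 2) : ℝ))) * |x| ^ (-(1 / 2) : ℝ) := by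
      intro x hx hx'
      have h1 := hθ x hx'
      have h2 : 0 < c * |x| := by positivity
      rw [hG, Real.norm_eq_abs, abs_mul, mul_assoc M]
      refine mul_le_mul (hM' _) ?_ (abs_nonneg _) hM0
      refine (abs_log_sqrt_sub_log_le (h2.trans_le h1) hε).trans ?_
      rw [mul_assoc _ (c ^ _), ← Real.mul_rpow hc.le (abs_nonneg x)]
      refine mul_le_mul_of_nonneg_left ?_ (by positivity)
      exact Real.rpow_le_rpow_of_nonpos h2 h1 (by norm_num)
    have hae : ∀ᵐ x : ℝ, x ∈ Ioc (-π) π →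
        ‖G (θ + x)‖ ≤ M * (2 * √ε * (c ^ (-(1 / 2) : ℝ))) * |x| ^ (-(1 / 2) : ℝ) := by
      have : ∀ᵐ x : ℝ, x ≠ 0 := by
        rw [MeasureTheory.ae_iff]; simp
      filter_upwards [this] with x hx hx'
      exact hbound x hx (abs_le.2 ⟨hx'.1.le, hx'.2⟩)
    have hper : Periodic G (2 * π) := fun φ => by
      simp only [hG, hρp φ, h.periodic φ]
    have hGi : IntervalIntegrable (fun x => G (θ + x)) MeasureTheory.volume
        (-π) π := by
      refine IntervalIntegrable.mono_fun' (hint.const_mul (M * (2 * √ε * (c ^ (-(1 / 2) : ℝ)))))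
        (hGm.comp (measurable_const_add θ)).aestronglyMeasurable ?_
      rw [uIoc_of_le (by linarith)]
      exact (MeasureTheory.ae_restrict_iff' measurableSet_Ioc).2 hae
    have hGi' : IntervalIntegrable G MeasureTheory.volume 0 (2 * π) := by
      have h1 := hGi.comp_sub_right θ
      simp only [add_sub_cancel] at h1
      exact hper.intervalIntegrable (by positivity) (t := -π + θ)
        (by convert h1 using 1; ring) _ _
    have e : logPot γ ρ z = W ε z - ∫ φ in (0 : ℝ)..(2 * π), G φ := by
      rw [hW, logPot, ← integral_sub (hFc.intervalIntegrable _ _) hGi']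
      refine integral_congr fun φ _ => ?_
      simp only [hF, hG]
      ring
    rw [e, sub_sub_cancel_left, abs_neg, window_integral_eq hper θ, hL,
      ← integral_const_mul, ← Real.norm_eq_abs]
    exact norm_integral_le_of_norm_le (by linarith) hae (hint.const_mul _)
  have hlim : TendstoUniformly W (logPot γ ρ) (𝓝[>] 0) := by
    rw [Metric.tendstoUniformly_iff]
    intro η hη
    have h1 : Tendsto (fun ε : ℝ => M * (2 * √ε * (c ^ (-(1 / 2) : ℝ))) * L) (𝓝[>] 0) (𝓝 0) := by
      have : Continuous fun ε : ℝ => M * (2 * √ε * (c ^ (-(1 / 2) : ℝ))) * L := by fun_prop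
      simpa using (this.tendsto 0).mono_left nhdsWithin_le_nhds
    filter_upwards [h1.eventually (gt_mem_nhds hη), self_mem_nhdsWithin] with ε h2 h3 z
    rw [Real.dist_eq]
    exact (hdiff ε h3 z).trans_lt h2
  refine hlim.continuous (Eventually.frequently ?_)
  filter_upwards [self_mem_nhdsWithin] with ε hε
  exact hWc ε hε

/-- The normal derivatives of a logarithmic potential have opposite contributions on the two
sides of the curve, which add up to a corner. -/
theorem tendsto_logPot_kink (h : IsSimpleClosedCurve γ) (hρ : Continuous ρ)
    (hρp : Periodic ρ (2 * π)) (θ : ℝ) :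
    Tendsto (fun s : ℝ => (logPot γ ρ (γ θ + s * rightNormal γ θ) +
      logPot γ ρ (γ θ - s * rightNormal γ θ) - 2 * logPot γ ρ (γ θ)) / s) (𝓝[>] 0)
      (𝓝 (2 * π * ρ θ / ‖deriv γ θ‖)) := by
  obtain ⟨δ, hδ, hδ'⟩ := h.exists_normal_bound
  set ν := rightNormal γ θ with hν
  set K := cauchyInt γ (fun θ => (ρ θ : ℂ)) with hK
  set f : ℝ → ℝ := fun s => logPot γ ρ (γ θ + s * ν) + logPot γ ρ (γ θ - s * ν) with hf
  have hd : ∀ s ∈ Ioo 0 δ, HasDerivAt f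
      ((K (γ θ - s * ν) - K (γ θ + s * ν)) * ν).re s := by
    intro s hs
    have hn1 : γ θ - s * ν ∉ range γ := by
      have := normal_notMem_range hδ' (θ := θ) (s := -s) (by
        rw [abs_neg, abs_of_pos hs.1]; exact hs.2.le) (neg_ne_zero.2 hs.1.ne')
      simpa [sub_eq_add_neg] using this
    have hn2 : γ θ + s * ν ∉ range γ :=
      normal_notMem_range hδ' (by rw [abs_of_pos hs.1]; exact hs.2.le) hs.1.ne'
    have hc : HasDerivAt (fun s : ℝ => (s : ℂ) * ν) ν s := by
      simpa using (ofRealCLM.hasDerivAt (x := s)).mul_const ν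
    have h1 := h.hasDerivAt_logPot_comp hρ (hc.const_add (γ θ)) hn2
    have h2 := h.hasDerivAt_logPot_comp hρ (hc.const_sub (γ θ)) hn1
    refine (h1.add h2).congr_deriv ?_
    rw [sub_mul, Complex.sub_re, mul_neg, Complex.neg_re]
    ring
  have hcont : Continuous f := by
    have := h.continuous_logPot hρ hρp
    exact (this.comp (by fun_prop)).add (this.comp (by fun_prop))
  have hlim : Tendsto (fun s : ℝ => ((K (γ θ - s * ν) - K (γ θ + s * ν)) * ν).re) (𝓝[>] 0)
      (𝓝 (2 * π * ρ θ / ‖deriv γ θ‖)) := by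
    have h1 := (h.tendsto_cauchyInt_jump (χ := fun θ => (ρ θ : ℂ))
      (continuous_ofReal.comp hρ) (fun x => by simp [hρp x]) θ).comp
      (tendsto_id.prodMk (tendsto_const_nhds (x := θ) (f := 𝓝[>] (0 : ℝ))))
    have h2 := (continuous_re.tendsto _).comp (h1.mul_const ν)
    have e : (2 * π * I * (ρ θ : ℂ) / deriv γ θ * ν) =
        ((2 * π * ρ θ / ‖deriv γ θ‖ : ℝ) : ℂ) := by
      have := h.regular θ
      rw [hν, rightNormal]
      push_cast
      field_simp
      linear_combination (-((ρ θ : ℂ) / ‖deriv γ θ‖)) * I_sq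
    rw [e, ofReal_re] at h2
    exact h2
  have h1 : HasDerivWithinAt f (2 * π * ρ θ / ‖deriv γ θ‖) (Ici 0) 0 := by
    refine hasDerivWithinAt_Ici_of_tendsto_deriv (s := Ioo 0 δ)
      (fun s hs => (hd s hs).differentiableAt.differentiableWithinAt) hcont.continuousWithinAt
      (Ioo_mem_nhdsGT hδ) (hlim.congr' ?_)
    filter_upwards [Ioo_mem_nhdsGT hδ] with s hs
    exact (hd s hs).deriv.symm
  have h2 := (hasDerivWithinAt_iff_tendsto_slope' self_notMem_Ioi).1
    (h1.mono Ioi_subset_Ici_self)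
  refine h2.congr fun s => ?_
  simp [hf, slope_def_field]
  ring

/-- A logarithmic potential at infinity. -/
theorem tendsto_logPot_sub_log (h : IsSimpleClosedCurve γ) (hρ : Continuous ρ) :
    Tendsto (fun z => logPot γ ρ z - (∫ x in (0 : ℝ)..(2 * π), ρ x) * Real.log ‖z‖)
      (Bornology.cobounded ℂ) (𝓝 0) := by
  have hπ := Real.pi_pos
  obtain ⟨R, hR0, hR⟩ := h.isCompact_range.isBounded.exists_pos_norm_le
  have hlog : ∀ z : ℂ, 2 * R ≤ ‖z‖ → ∀ θ, |Real.log ‖γ θ - z‖ - Real.log ‖z‖| ≤ 2 * R / ‖z‖ := by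
    intro z hz θ
    have hz0 : 0 < ‖z‖ := by linarith
    have h1 : ‖γ θ‖ ≤ R := hR _ (mem_range_self θ)
    have h2 : ‖z‖ - R ≤ ‖γ θ - z‖ := by
      have := norm_sub_norm_le z (γ θ)
      rw [norm_sub_rev] at this; linarith
    have h3 : ‖γ θ - z‖ ≤ ‖z‖ + R := (norm_sub_le _ _).trans (by linarith)
    have h4 : 0 < ‖γ θ - z‖ := by linarith
    rw [abs_le]
    constructor
    · have := Real.log_le_sub_one_of_pos (div_pos hz0 h4)
      rw [Real.log_div hz0.ne' h4.ne'] at this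
      have h5 : ‖z‖ / ‖γ θ - z‖ - 1 ≤ 2 * R / ‖z‖ := by
        rw [sub_le_iff_le_add, div_le_iff₀ h4]
        have : (2 * R / ‖z‖ + 1) * (‖z‖ - R) ≤ (2 * R / ‖z‖ + 1) * ‖γ θ - z‖ := by gcongr
        refine le_trans ?_ this
        have e : (2 * R / ‖z‖ + 1) * (‖z‖ - R) = ‖z‖ + R * (1 - 2 * R / ‖z‖) := by
          field_simp; ring
        rw [e]
        have : 2 * R / ‖z‖ ≤ 1 := by rw [div_le_one hz0]; exact hz
        nlinarith
      linarith
    · have := Real.log_le_sub_one_of_pos (div_pos h4 hz0)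
      rw [Real.log_div h4.ne' hz0.ne'] at this
      have h5 : ‖γ θ - z‖ / ‖z‖ - 1 ≤ 2 * R / ‖z‖ := by
        rw [sub_le_iff_le_add, div_le_iff₀ hz0]
        have e : (2 * R / ‖z‖ + 1) * ‖z‖ = 2 * R + ‖z‖ := by field_simp
        rw [e]; linarith
      linarith
  obtain ⟨M, hM⟩ := (isCompact_Icc (a := 0) (b := 2 * π)).exists_bound_of_continuousOn
    hρ.continuousOn
  have hM0 : 0 ≤ M := (norm_nonneg _).trans (hM 0 ⟨le_rfl, by linarith⟩)
  have hT : Tendsto (fun z : ℂ => M * (2 * R / ‖z‖) * |2 * π - 0|) (Bornology.cobounded ℂ)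
      (𝓝 0) := by
    have := (tendsto_norm_cobounded_atTop (E := ℂ)).const_div_atTop (2 * R)
    simpa using (this.const_mul M).mul_const |2 * π - 0|
  refine squeeze_zero_norm' ?_ hT
  filter_upwards [(tendsto_norm_cobounded_atTop (E := ℂ)).eventually_ge_atTop (2 * R)] with z hz
  have hzr : z ∉ range γ := fun hz' => by have := hR z hz'; linarith
  have hc1 : Continuous fun θ => ρ θ * Real.log ‖γ θ - z‖ :=
    hρ.mul ((h.continuous.sub continuous_const).norm.log
      (fun θ => norm_ne_zero_iff.2 (sub_ne_zero_of_notMem hzr θ)))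
  have hc2 : Continuous fun θ => ρ θ * Real.log ‖z‖ := hρ.mul continuous_const
  rw [logPot, ← integral_mul_const, ← integral_sub
    (hc1.intervalIntegrable _ _) (hc2.intervalIntegrable _ _)]
  refine norm_integral_le_of_norm_le_const fun θ hθ => ?_
  rw [uIoc_of_le (by positivity)] at hθ
  rw [← mul_sub, norm_mul]
  exact mul_le_mul (hM θ ⟨hθ.1.le, hθ.2⟩) (hlog z hz θ) (norm_nonneg _) hM0

end IsSimpleClosedCurve

/-! ### The pressure as a logarithmic potential -/

/-- The points of a smooth Jordan domain near a boundary point lie on short normals to the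
boundary near that point. -/
theorem IsLeftCollar.nhdsWithin_le_map {Ω : Set ℂ} {γ : ℝ → ℂ} {δ : ℝ} (hc : IsLeftCollar Ω γ δ)
    (h : IsJordanParam Ω γ) (θ₀ : ℝ) :
    𝓝[Ω] (γ θ₀) ≤ map (fun p : ℝ × ℝ => γ p.2 - p.1 * rightNormal γ p.2) (𝓝[>] 0 ×ˢ 𝓝 θ₀) := by
  have h0 := h.isSimpleClosedCurve
  obtain ⟨c, hc0, hc'⟩ := h0.chord_arc
  intro S hS
  rw [Filter.mem_map, Filter.mem_prod_iff] at hS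
  obtain ⟨A, hA, B, hB, hAB⟩ := hS
  obtain ⟨ε, hε, hεA⟩ := mem_nhdsGT_iff_exists_Ioo_subset.1 hA
  obtain ⟨η, hη, hηB⟩ := Metric.mem_nhds_iff.1 hB
  simp only [mem_Ioi] at hε
  rw [mem_nhdsWithin]
  refine ⟨ball (γ θ₀) (min ε (c * η / 2)), isOpen_ball,
    mem_ball_self (by positivity), ?_⟩
  rintro z ⟨hz, hzΩ⟩
  rw [mem_ball, dist_eq_norm, lt_min_iff] at hz
  have hzr : z ∉ range γ := fun hz' => disjoint_left.1 h.disjoint_range hzΩ hz'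
  obtain ⟨θ, s, hs, hmin, ⟨-, hzs⟩ | ⟨hz', -⟩⟩ := hc.exists_normal h hzr
  swap
  · exact absurd (subset_closure hzΩ) hz'
  obtain ⟨x, hx, k, hk⟩ := exists_angle_near θ₀ θ
  have hper : γ θ = γ (θ₀ + x) := by rw [hk]; exact h0.apply_add_int _ k
  have hν : rightNormal γ θ = rightNormal γ (θ₀ + x) := by
    have : deriv γ θ = deriv γ (θ₀ + x) := by
      rw [hk]; exact h0.deriv_periodic.int_mul k _
    rw [rightNormal, rightNormal, this]
  have h1 : ‖γ (θ₀ + x) - γ θ₀‖ ≤ 2 * ‖z - γ θ₀‖ := by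
    have h2 : ‖z - γ (θ₀ + x)‖ = s := by
      rw [hzs, hper, hν, sub_sub_cancel_left, norm_neg, norm_mul, h0.norm_rightNormal, mul_one,
        norm_real, Real.norm_of_nonneg hs.le]
    have h3 := hmin θ₀
    have h4 := norm_sub_le_norm_sub_add_norm_sub (γ (θ₀ + x)) z (γ θ₀)
    rw [norm_sub_rev (γ (θ₀ + x)) z] at h4
    linarith
  have hx' : |x| < η := by
    have := hc' θ₀ x hx
    have h5 : c * |x| < c * η := by linarith [hz.2]
    exact lt_of_mul_lt_mul_left h5 hc0.le
  have := hAB (mk_mem_prod (hεA ⟨hs, (hmin θ₀).trans_lt hz.1⟩)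
    (hηB (show θ₀ + x ∈ ball θ₀ η by simpa [Real.dist_eq] using hx')))
  simpa [← hper, ← hν, ← hzs] using this

/-- The pressure `p` of the smooth Jordan domain `Ω`, whose boundary is positively parametrized
by `γ`, has the inward normal derivative `ρ` at the boundary. -/
structure HasPressureFlux (Ω : Set ℂ) (γ : ℝ → ℂ) (δ : ℝ) (p : ℂ → ℝ) (ρ : ℝ → ℝ) : Prop where
  jordan : IsJordanParam Ω γ
  collar : IsLeftCollar Ω γ δ
  zero_mem : (0 : ℂ) ∈ Ω
  pressure : IsPressure Ω p
  continuous : Continuous ρ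
  periodic : Periodic ρ (2 * π)
  flux : ∀ θ, Tendsto (fun s : ℝ => p (γ θ - s * rightNormal γ θ) / s) (𝓝[>] 0) (𝓝 (ρ θ))

namespace HasPressureFlux

variable {Ω : Set ℂ} {γ : ℝ → ℂ} {δ : ℝ} {p : ℂ → ℝ} {ρ : ℝ → ℝ}

/-- The density of the flux with respect to the angular parameter. -/
def density (γ : ℝ → ℂ) (ρ : ℝ → ℝ) (θ : ℝ) : ℝ := ρ θ * ‖deriv γ θ‖

theorem curve (hP : HasPressureFlux Ω γ δ p ρ) : IsSimpleClosedCurve γ :=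
  hP.jordan.isSimpleClosedCurve

theorem continuous_density (hP : HasPressureFlux Ω γ δ p ρ) : Continuous (density γ ρ) :=
  hP.continuous.mul hP.curve.continuous_deriv.norm

theorem periodic_density (hP : HasPressureFlux Ω γ δ p ρ) :
    Periodic (density γ ρ) (2 * π) := fun θ => by
  rw [density, density, hP.periodic θ, hP.curve.deriv_periodic θ]

theorem ne_zero (hP : HasPressureFlux Ω γ δ p ρ) (θ : ℝ) : γ θ ≠ 0 := fun h =>
  hP.jordan.notMem θ (h ▸ hP.zero_mem)

open Classical in
/-- The pressure, extended by zero to the exterior, without its singularity at the origin and with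
the opposite singularity at infinity instead. -/
theorem exists_extension (hP : HasPressureFlux Ω γ δ p ρ) :
    ∃ P : ℂ → ℝ, Continuous P ∧ (∀ z ∉ range γ, HarmonicAt P z) ∧
      (∀ z ∈ closure Ω \ {0}, P z = p z + 1 / (2 * π) * Real.log ‖z‖) ∧
      (∀ z ∉ Ω, P z = 1 / (2 * π) * Real.log ‖z‖) := by
  obtain ⟨h, hh, hph⟩ := hP.pressure.singular
  have hfr : ∀ z ∈ closure Ω, z ∉ Ω → p z = 0 := fun z hz hz' =>
    hP.pressure.boundary z ⟨hz, by rwa [hP.jordan.isOpen.interior_eq]⟩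
  set L : ℂ → ℝ := fun z => 1 / (2 * π) * Real.log ‖z‖ with hL
  set P : ℂ → ℝ := fun z => if z ∈ Ω then h z else L z with hPdef
  have hin : ∀ z ∈ closure Ω \ {0}, P z = p z + L z := by
    rintro z ⟨hz, hz0⟩
    by_cases hzΩ : z ∈ Ω
    · simp only [hPdef, hzΩ, if_true, hph z ⟨hzΩ, hz0⟩, hL]; ring
    · simp only [hPdef, hzΩ, if_false, hfr z hz hzΩ, zero_add]
  have hout : ∀ z ∉ Ω, P z = L z := fun z hz => by simp only [hPdef, hz, if_false]
  have hne : ∀ z ∉ Ω, z ≠ 0 := fun z hz h0 => hz (h0 ▸ hP.zero_mem)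
  have hLc : ∀ z : ℂ, z ≠ 0 → ContinuousAt L z := fun z hz =>
    continuousAt_const.mul (continuous_norm.continuousAt.log (norm_ne_zero_iff.2 hz))
  have hharm : ∀ z ∉ range γ, HarmonicAt P z := by
    intro z hz
    by_cases hzΩ : z ∈ Ω
    · refine (harmonicAt_congr_nhds ?_).2 (hh z hzΩ)
      filter_upwards [hP.jordan.isOpen.mem_nhds hzΩ] with w hw
      simp only [hPdef, hw, if_true]
    · have hzc : z ∉ closure Ω := by
        rw [hP.jordan.closure_eq]; exact fun h' => h'.elim hzΩ hz
      have h1 : HarmonicAt L z :=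
        (AnalyticAt.harmonicAt_log_norm analyticAt_id (hne z hzΩ)).const_smul
      refine (harmonicAt_congr_nhds ?_).2 h1
      filter_upwards [isClosed_closure.isOpen_compl.mem_nhds hzc] with w hw
      exact hout w fun h' => hw (subset_closure h')
  refine ⟨P, continuous_iff_continuousAt.2 fun z => ?_, hharm, hin, hout⟩
  by_cases hz : z ∈ range γ
  · obtain ⟨θ, rfl⟩ := hz
    have hz0 := hP.ne_zero θ
    have hzc := hP.jordan.mem_closure θ
    have h1 : ContinuousWithinAt P (closure Ω) (γ θ) := by
      have h2 : ContinuousWithinAt (fun z => p z + L z) (closure Ω \ {0}) (γ θ) :=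
        (hP.pressure.continuousOn _ ⟨hzc, hz0⟩).add (hLc _ hz0).continuousWithinAt
      have h3 := h2.congr hin (hin _ ⟨hzc, hz0⟩)
      refine h3.mono_of_mem_nhdsWithin ?_
      exact inter_mem self_mem_nhdsWithin
        (mem_nhdsWithin_of_mem_nhds (isOpen_compl_singleton.mem_nhds hz0))
    have h4 : ContinuousWithinAt P Ωᶜ (γ θ) :=
      (hLc _ hz0).continuousWithinAt.congr hout (hout _ (hP.jordan.notMem θ))
    have h5 := h1.union h4
    have : closure Ω ∪ Ωᶜ = univ := by
      rw [eq_univ_iff_forall]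
      intro w
      by_cases hw : w ∈ Ω
      · exact Or.inl (subset_closure hw)
      · exact Or.inr hw
    rwa [this, continuousWithinAt_univ] at h5
  · exact (hharm z hz).1.continuousAt

/-- The pressure is a logarithmic potential, with the flux as its density; the total flux is `1`. -/
theorem exists_potential (hP : HasPressureFlux Ω γ δ p ρ) :
    (∫ θ in (0 : ℝ)..(2 * π), density γ ρ θ) = 1 ∧
    (∀ z ∈ closure Ω \ {0},
      p z = (logPot γ (density γ ρ) z - Real.log ‖z‖) / (2 * π)) ∧
    (∀ z ∉ Ω, logPot γ (density γ ρ) z = Real.log ‖z‖) := by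
  have hπ := Real.pi_pos
  have h0 := hP.curve
  obtain ⟨P, hPc, hPh, hPin, hPout⟩ := hP.exists_extension
  set W := logPot γ (density γ ρ) with hW
  set W₁ := logPot γ (fun _ => (1 : ℝ)) with hW₁
  have hWc : Continuous W := h0.continuous_logPot hP.continuous_density hP.periodic_density
  have hW₁c : Continuous W₁ := h0.continuous_logPot continuous_const (fun _ => rfl)
  set m := ∫ θ in (0 : ℝ)..(2 * π), density γ ρ θ with hm
  set u : ℂ → ℝ := fun z => P z - W z / (2 * π) with hu
  have huc : Continuous u := hPc.sub (hWc.div_const _)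
  have huh : ∀ z ∉ range γ, HarmonicAt u z := fun z hz => by
    refine (hPh z hz).sub ?_
    have := (h0.harmonicAt_logPot hP.continuous_density hz).const_smul (c := (2 * π)⁻¹)
    refine (harmonicAt_congr_nhds (Eventually.of_forall fun w => ?_)).2 this
    simp [hW, div_eq_inv_mul]
  -- the corner of the potential along the curve compensates that of the pressure
  have hkink : ∀ θ, Tendsto (fun s : ℝ => (u (γ θ + s * rightNormal γ θ) +
      u (γ θ - s * rightNormal γ θ) - 2 * u (γ θ)) / s) (𝓝[>] 0) (𝓝 0) := by
    intro θ
    set ν := rightNormal γ θ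
    have h1 := h0.tendsto_logPot_kink hP.continuous_density hP.periodic_density θ
    have h2 : Tendsto (fun s : ℝ => (Real.log ‖γ θ + s * ν‖ + Real.log ‖γ θ - s * ν‖ -
        2 * Real.log ‖γ θ‖) / s) (𝓝[>] 0) (𝓝 0) := by
      have hcd : HasDerivAt (fun s : ℝ => (s : ℂ) * ν) ν 0 := by
        simpa using (ofRealCLM.hasDerivAt (x := 0)).mul_const ν
      have h3 := ((hcd.const_add (γ θ)).log_norm (by simpa using hP.ne_zero θ)).add
        ((hcd.const_sub (γ θ)).log_norm (by simpa using hP.ne_zero θ))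
      have h4 := (hasDerivWithinAt_iff_tendsto_slope' self_notMem_Ioi).1
        (h3.hasDerivWithinAt (s := Ioi 0))
      refine (h4.congr fun s => ?_).trans_eq ?_
      · simp [slope_def_field]; ring
      · simp [neg_div]
    have h3 := ((h2.const_mul (1 / (2 * π))).add (hP.flux θ)).sub
      (h1.div_const (2 * π))
    have e0 : 1 / (2 * π) * 0 + ρ θ -
        2 * π * density γ ρ θ / ‖deriv γ θ‖ / (2 * π) = 0 := by
      have : ‖deriv γ θ‖ ≠ 0 := norm_ne_zero_iff.2 (h0.regular θ)
      rw [density]; field_simp; ring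
    rw [e0] at h3
    have hnz : ∀ᶠ s : ℝ in 𝓝[>] 0, γ θ - s * ν ≠ 0 := by
      have : Continuous fun s : ℝ => γ θ - s * ν := by fun_prop
      exact ((this.tendsto 0).mono_left nhdsWithin_le_nhds).eventually_ne
        (by simpa using hP.ne_zero θ)
    refine h3.congr' ?_
    filter_upwards [Ioc_mem_nhdsGT hP.collar.pos, hnz] with s hs hs0
    have e1 := hPin _ ⟨subset_closure (hP.collar.inside θ s hs), hs0⟩
    have e2 := hPout _ fun h' => hP.collar.outside θ s hs (subset_closure h')
    have e3 := hPout _ (hP.jordan.notMem θ)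
    simp only [hu]
    rw [e1, e2, e3]
    have := hs.1.ne'
    field_simp
    ring
  -- a small multiple of the potential of a positive density rules out maxima on the curve
  have hnotmax : ∀ σ : ℝ, ∀ ε > 0, ∀ θ, ¬ IsLocalMax (fun z => σ * u z + ε * W₁ z) (γ θ) := by
    intro σ ε hε θ hmax
    set ν := rightNormal γ θ
    have h1 := (h0.tendsto_logPot_kink (ρ := fun _ => (1 : ℝ)) continuous_const
      (fun _ => rfl) θ).const_mul ε
    have h2 := ((hkink θ).const_mul σ).add h1
    have hpos : 0 < σ * 0 + ε * (2 * π * 1 / ‖deriv γ θ‖) := by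
      have := norm_pos_iff.2 (h0.regular θ)
      rw [mul_zero, zero_add]; positivity
    have hmap : ∀ τ : ℝ, Tendsto (fun s : ℝ => γ θ + ((τ * s : ℝ) : ℂ) * ν) (𝓝[>] 0)
        (𝓝 (γ θ)) := fun τ => by
      have : Continuous fun s : ℝ => γ θ + ((τ * s : ℝ) : ℂ) * ν := by fun_prop
      simpa using (this.tendsto 0).mono_left nhdsWithin_le_nhds
    obtain ⟨s, ⟨⟨hs1, hs2⟩, hs3⟩, hs4⟩ := ((((h2.eventually (lt_mem_nhds hpos)).and
      ((hmap 1).eventually hmax)).and ((hmap (-1)).eventually hmax)).and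
      self_mem_nhdsWithin).exists
    rw [one_mul] at hs2
    rw [neg_one_mul, ofReal_neg, neg_mul, ← sub_eq_add_neg] at hs3
    rw [← mul_div_assoc, ← mul_div_assoc, ← add_div, lt_div_iff₀ hs4, zero_mul] at hs1
    linarith
  -- the behaviour at infinity
  set c := (1 - m) / (2 * π) with hc
  have hinf : Tendsto (fun z => u z - c * Real.log ‖z‖) (Bornology.cobounded ℂ) (𝓝 0) := by
    have h1 := (h0.tendsto_logPot_sub_log hP.continuous_density).div_const (2 * π)
    have h2 := h1.neg
    rw [zero_div, neg_zero] at h2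
    refine h2.congr' ?_
    obtain ⟨R, hR⟩ := hP.jordan.bounded.subset_closedBall 0
    filter_upwards [(tendsto_norm_cobounded_atTop (E := ℂ)).eventually_gt_atTop R] with z hz
    have hzΩ : z ∉ Ω := fun h' => by
      have := hR h'
      rw [mem_closedBall_zero_iff] at this
      linarith
    simp only [hu, hc, hPout z hzΩ]
    field_simp
    ring
  have hkey : ∀ η > 0, ∀ᶠ R : ℝ in atTop, ∀ z, ‖z‖ ≤ R → |u z - c * Real.log R| ≤ η := by
    intro η hη
    have h1 := hinf.eventually (ball_mem_nhds (0 : ℝ) hη)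
    obtain ⟨R₀, -, hR₀⟩ := hasBasis_cobounded_norm.eventually_iff.1 h1
    filter_upwards [eventually_ge_atTop R₀] with R hR z hz
    have hK := isCompact_closedBall (0 : ℂ) R
    obtain ⟨C, hC⟩ := hK.exists_bound_of_continuousOn hW₁c.continuousOn
    have hone : ∀ σ : ℝ, |σ| = 1 → σ * (u z - c * Real.log R) ≤ η := by
      intro σ hσ
      refine le_of_forall_pos_le_add fun e he => ?_
      have hzK : z ∈ closedBall (0 : ℂ) R := mem_closedBall_zero_iff.2 hz
      have hC0 : 0 ≤ C := (norm_nonneg _).trans (hC z hzK)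
      have hε : 0 < e / (2 * C + 1) := by positivity
      obtain ⟨b, ⟨hbK, hbB⟩, hb⟩ := exists_le_of_harmonicAt_or_not_isLocalMax
        (v := fun z => σ * u z + e / (2 * C + 1) * W₁ z) (B := sphere 0 R) hK
        ((continuous_const.mul huc).add (continuous_const.mul hW₁c)).continuousOn
        (fun w hw hw' => by
          refine ⟨mem_of_superset (isOpen_ball.mem_nhds ?_) ball_subset_closedBall,
            ?_⟩
          · rw [mem_closedBall_zero_iff] at hw
            rw [mem_sphere_zero_iff_norm] at hw'
            exact mem_ball_zero_iff.2 (lt_of_le_of_ne hw hw')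
          · by_cases hwr : w ∈ range γ
            · obtain ⟨θ, rfl⟩ := hwr
              exact Or.inr (hnotmax σ _ hε θ)
            · refine Or.inl ((huh w hwr).const_smul.add (HarmonicAt.const_smul
                (h0.harmonicAt_logPot continuous_const hwr)))) hzK
      rw [mem_sphere_zero_iff_norm] at hbB
      have h2 := hR₀ (show R₀ ≤ ‖b‖ by rw [hbB]; exact hR)
      rw [Real.dist_eq, sub_zero, hbB] at h2
      have h3 : σ * (u b - c * Real.log R) ≤ η := by
        refine (le_abs_self _).trans ?_
        rw [abs_mul, hσ, one_mul]; exact h2.le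
      have h4 : W₁ b - W₁ z ≤ 2 * C := by
        have := (le_abs_self _).trans (hC b hbK)
        have := (neg_le_abs _).trans (hC z hzK)
        linarith
      have h5 : e / (2 * C + 1) * (W₁ b - W₁ z) ≤ e := by
        calc _ ≤ e / (2 * C + 1) * (2 * C + 1) := by gcongr; linarith
          _ = e := by field_simp
      linarith
    rw [abs_le]
    have h2 := hone 1 (by simp)
    have h3 := hone (-1) (by simp)
    constructor <;> linarith
  -- circles of radius `exp n`; the limit can exist only for `c = 0`
  have hlim : ∀ z, Tendsto (fun n : ℕ => c * n) atTop (𝓝 (u z)) := by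
    intro z
    rw [Metric.tendsto_nhds]
    intro η hη
    have h1 := (Real.tendsto_exp_atTop.comp tendsto_natCast_atTop_atTop).eventually
      ((hkey (η / 2) (by positivity)).and (eventually_ge_atTop ‖z‖))
    filter_upwards [h1] with n hn
    have := hn.1 z hn.2
    simp only [comp_apply, Real.log_exp] at this
    rw [Real.dist_eq, abs_sub_comm]
    linarith
  have hc0 : c = 0 := by
    have h1 := (hlim 0).comp (tendsto_add_atTop_nat 1)
    have h2 := h1.sub (hlim 0)
    rw [sub_self] at h2
    refine tendsto_nhds_unique (f := fun _ : ℕ => c) tendsto_const_nhds (h2.congr fun n => ?_)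
    simp; ring
  have hu0 : ∀ z, u z = 0 := fun z => by
    refine tendsto_nhds_unique (hlim z) ?_
    simp [hc0]
  refine ⟨?_, fun z hz => ?_, fun z hz => ?_⟩
  · rw [hc, div_eq_zero_iff] at hc0
    rcases hc0 with h | h
    · linarith
    · linarith
  · have h1 := hu0 z
    simp only [hu, hPin z hz] at h1
    field_simp at h1 ⊢
    linarith
  · have h1 := hu0 z
    simp only [hu, hPout z hz] at h1
    field_simp at h1
    linarith

end HasPressureFlux

/-! ### The conformal map onto the disc -/

namespace HasPressureFlux

variable {Ω : Set ℂ} {γ : ℝ → ℂ} {δ : ℝ} {p : ℂ → ℝ} {ρ : ℝ → ℝ}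

/-- The flux through the boundary arc from `γ 0` to `γ θ`, normalized to have total mass `2π`. -/
def fluxAngle (γ : ℝ → ℂ) (ρ : ℝ → ℝ) (θ : ℝ) : ℝ :=
  2 * π * ∫ x in (0 : ℝ)..θ, density γ ρ x

/-- A holomorphic function off the curve, whose absolute value is the exponential of the
logarithmic potential of the flux. -/
def denom (γ : ℝ → ℂ) (ρ : ℝ → ℝ) (z : ℂ) : ℂ :=
  (γ 0 - z) * cexp (-cauchyInt γ
    (fun θ => ((∫ x in (0 : ℝ)..θ, density γ ρ x : ℝ) : ℂ) * deriv γ θ) z)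

theorem denom_ne_zero {z : ℂ} (hz : z ∉ range γ) : denom γ ρ z ≠ 0 :=
  mul_ne_zero (IsSimpleClosedCurve.sub_ne_zero_of_notMem hz 0) (exp_ne_zero _)

theorem norm_denom (hP : HasPressureFlux Ω γ δ p ρ) {z : ℂ} (hz : z ∉ range γ) :
    ‖denom γ ρ z‖ = Real.exp (logPot γ (density γ ρ) z) := by
  have h1 := norm_pos_iff.2 (IsSimpleClosedCurve.sub_ne_zero_of_notMem hz 0)
  rw [hP.curve.logPot_eq hP.continuous_density hz, hP.exists_potential.1, one_mul, Real.exp_sub,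
    Real.exp_log h1, denom, norm_mul, norm_exp, neg_re, Real.exp_neg, div_eq_mul_inv]

theorem hasDerivAt_denom (hP : HasPressureFlux Ω γ δ p ρ) {z : ℂ} (hz : z ∉ range γ) :
    HasDerivAt (denom γ ρ)
      (-cauchyInt γ (fun θ => (density γ ρ θ : ℂ)) z * denom γ ρ z) z := by
  have h1 := hP.curve.hasDerivAt_cauchyInt_primitive hP.continuous_density hz
  have h2 := ((hasDerivAt_id z).const_sub (γ 0)).mul h1.neg.cexp
  refine h2.congr_deriv ?_
  have := IsSimpleClosedCurve.sub_ne_zero_of_notMem hz 0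
  rw [hP.exists_potential.1, denom]
  simp only [id, Pi.neg_apply, ofReal_one]
  field_simp
  ring

/-- The flux reproduces the Cauchy kernel at the origin for the exterior of the domain. -/
theorem cauchyInt_density (hP : HasPressureFlux Ω γ δ p ρ) {z : ℂ} (hz : z ∉ closure Ω) :
    cauchyInt γ (fun θ => (density γ ρ θ : ℂ)) z = -1 / z := by
  have hzr : z ∉ range γ := fun h' => hz (by rw [hP.jordan.closure_eq]; exact Or.inr h')
  have hz0 : z ≠ 0 := fun h' => hz (subset_closure (h' ▸ hP.zero_mem))
  have key : ∀ c : ℂ, ((cauchyInt γ (fun θ => (density γ ρ θ : ℂ)) z + 1 / z) * c).re = 0 := by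
    intro c
    have hcd : HasDerivAt (fun s : ℝ => z + (s : ℂ) * c) c 0 := by
      simpa using ((ofRealCLM.hasDerivAt (x := 0)).mul_const c).const_add z
    have h1 := hP.curve.hasDerivAt_logPot_comp hP.continuous_density hcd (by simpa using hzr)
    have h2 := hcd.log_norm (by simpa using hz0)
    have h3 := h1.congr_of_eventuallyEq (f₁ := fun s : ℝ => Real.log ‖z + (s : ℂ) * c‖) (by
      have : ∀ᶠ s : ℝ in 𝓝 0, z + (s : ℂ) * c ∈ (closure Ω)ᶜ :=
        hcd.continuousAt.eventually_mem (isClosed_closure.isOpen_compl.mem_nhds (by simpa using hz))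
      filter_upwards [this] with s hs
      exact (hP.exists_potential.2.2 _ fun h' => hs (subset_closure h')).symm)
    have h4 := h2.unique h3
    simp only [ofReal_zero, zero_mul, add_zero] at h4
    rw [add_mul, add_re, one_div, inv_mul_eq_div, h4]
    ring
  have h1 := key 1
  have h2 := key I
  rw [mul_one] at h1
  rw [mul_I_re] at h2
  have h3 : cauchyInt γ (fun θ => (density γ ρ θ : ℂ)) z + 1 / z = 0 :=
    Complex.ext h1 (neg_eq_zero.1 h2)
  rw [neg_div]
  exact eq_neg_of_add_eq_zero_left h3

theorem exists_denom_eq (hP : HasPressureFlux Ω γ δ p ρ) :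
    ∃ c : ℂ, ‖c‖ = 1 ∧ ∀ z ∉ closure Ω, denom γ ρ z = c * z := by
  have hr : ∀ z ∉ closure Ω, z ∉ range γ := fun z hz h' =>
    hz (by rw [hP.jordan.closure_eq]; exact Or.inr h')
  have h0 : ∀ z ∉ closure Ω, z ≠ 0 := fun z hz h' => hz (subset_closure (h' ▸ hP.zero_mem))
  have hd : ∀ z ∉ closure Ω, HasDerivAt (fun z => denom γ ρ z / z) 0 z := by
    intro z hz
    have hz0 := h0 z hz
    refine ((hP.hasDerivAt_denom (hr z hz)).div (hasDerivAt_id z) hz0).congr_deriv ?_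
    rw [hP.cauchyInt_density hz]
    simp only [id]
    field_simp
    ring
  obtain ⟨c, hc⟩ := isClosed_closure.isOpen_compl.exists_is_const_of_deriv_eq_zero
    (hP.collar.isPreconnected_compl_closure hP.jordan)
    (fun z hz => (hd z hz).differentiableAt.differentiableWithinAt)
    (fun z hz => (hd z hz).deriv)
  have hc' : ∀ z ∉ closure Ω, denom γ ρ z = c * z := fun z hz => by
    rw [← hc z hz, div_mul_cancel₀ _ (h0 z hz)]
  refine ⟨c, ?_, hc'⟩
  have hz := hP.collar.outside 0 δ ⟨hP.collar.pos, le_rfl⟩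
  have h1 := hP.norm_denom (hr _ hz)
  have h2 := norm_pos_iff.2 (h0 _ hz)
  rw [hc' _ hz, norm_mul, hP.exists_potential.2.2 _ fun h' => hz (subset_closure h'),
    Real.exp_log h2] at h1
  exact (mul_eq_right₀ h2.ne').1 h1

theorem primitive_add_period (hP : HasPressureFlux Ω γ δ p ρ) (θ : ℝ) :
    (∫ x in (0 : ℝ)..(θ + 2 * π), density γ ρ x) =
      (∫ x in (0 : ℝ)..θ, density γ ρ x) + 1 := by
  have hi : ∀ a b, IntervalIntegrable (density γ ρ) MeasureTheory.volume a b := fun a b =>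
    hP.continuous_density.intervalIntegrable a b
  rw [← integral_add_adjacent_intervals (hi 0 θ) (hi θ _),
    hP.periodic_density.intervalIntegral_add_eq θ 0, zero_add, hP.exists_potential.1]

/-- The base point of the curve in the definition of `denom` is immaterial. -/
theorem denom_eq_window (hP : HasPressureFlux Ω γ δ p ρ) {z : ℂ} (hz : z ∉ range γ) (θ : ℝ) :
    denom γ ρ z = (γ (θ - π) - z) * cexp (-∫ x in (-π)..π,
      ((∫ y in (0 : ℝ)..(θ + x), density γ ρ y : ℝ) : ℂ) * deriv γ (θ + x) /
        (γ (θ + x) - z)) := by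
  have hne := IsSimpleClosedCurve.sub_ne_zero_of_notMem hz
  set A : ℝ → ℂ := fun θ => ((∫ y in (0 : ℝ)..θ, density γ ρ y : ℝ) : ℂ) with hA
  have hAc : Continuous A :=
    continuous_ofReal.comp (IsSimpleClosedCurve.primitive_continuous hP.continuous_density)
  set f : ℝ → ℂ := fun θ => A θ * deriv γ θ / (γ θ - z) with hf
  have hfc : Continuous f := (hAc.mul hP.curve.continuous_deriv).div
    (hP.curve.continuous.sub continuous_const) hne
  have hprim : ∀ θ, HasDerivAt (fun θ => ∫ x in (0 : ℝ)..θ, f x) (f θ) θ := fun θ =>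
    integral_hasDerivAt_right (hfc.intervalIntegrable _ _)
      (hfc.stronglyMeasurableAtFilter _ _) hfc.continuousAt
  set Ψ : ℝ → ℂ := fun φ => (∫ x in (0 : ℝ)..(φ + 2 * π), f x) - ∫ x in (0 : ℝ)..φ, f x
    with hΨ
  have hΨd : ∀ φ, HasDerivAt Ψ (deriv γ φ / (γ φ - z)) φ := by
    intro φ
    refine (((hprim (φ + 2 * π)).comp_add_const φ (2 * π)).sub
      (hprim φ)).congr_deriv ?_
    simp only [hf, hA]
    rw [hP.primitive_add_period, hP.curve.deriv_periodic, hP.curve.periodic]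
    push_cast
    ring
  have hconst : ∀ φ, HasDerivAt (fun φ => (γ φ - z) * cexp (-Ψ φ)) 0 φ := by
    intro φ
    refine (((hP.curve.hasDerivAt φ).sub_const z).mul (hΨd φ).neg.cexp).congr_deriv ?_
    have := hne φ
    simp only [Pi.neg_apply]
    field_simp
    ring
  have h1 := is_const_of_deriv_eq_zero (fun φ => (hconst φ).differentiableAt)
    (fun φ => (hconst φ).deriv) 0 (θ - π)
  have hi : ∀ a b, IntervalIntegrable f MeasureTheory.volume a b := fun a b =>
    hfc.intervalIntegrable a b
  have h2 : Ψ 0 = ∫ x in (0 : ℝ)..(2 * π), f x := by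
    simp only [hΨ, zero_add, integral_same, sub_zero]
  have h3 : Ψ (θ - π) = ∫ x in (-π)..π, f (θ + x) := by
    simp only [hΨ]
    rw [integral_interval_sub_left (hi _ _) (hi _ _),
      integral_comp_add_left]
    congr 1
    all_goals ring
  rw [h2, h3] at h1
  exact h1

/-- The jump of the Cauchy type integral gives the boundary values of `denom` from inside. -/
theorem tendsto_denom (hP : HasPressureFlux Ω γ δ p ρ) {c : ℂ}
    (hc : ∀ z ∉ closure Ω, denom γ ρ z = c * z) (θ₀ : ℝ) :
    Tendsto (denom γ ρ) (𝓝[Ω] (γ θ₀)) (𝓝 (c * γ θ₀ * cexp (-(fluxAngle γ ρ θ₀ * I)))) := by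
  refine Tendsto.mono_left ?_ (hP.collar.nhdsWithin_le_map hP.jordan θ₀)
  rw [tendsto_map'_iff]
  have h0 := hP.curve
  set A : ℝ → ℂ := fun θ => ((∫ y in (0 : ℝ)..θ, density γ ρ y : ℝ) : ℂ) with hA
  have hAc : Continuous A :=
    continuous_ofReal.comp (IsSimpleClosedCurve.primitive_continuous hP.continuous_density)
  have hs1 : Tendsto (fun p : ℝ × ℝ => p.1) (𝓝[>] 0 ×ˢ 𝓝 θ₀) (𝓝[>] 0) := tendsto_fst
  have hs10 : Tendsto (fun p : ℝ × ℝ => (p.1 : ℂ)) (𝓝[>] 0 ×ˢ 𝓝 θ₀) (𝓝 0) :=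
    ((continuous_ofReal.tendsto 0).comp (hs1.mono_right nhdsWithin_le_nhds))
  have hs2 : Tendsto (fun p : ℝ × ℝ => p.2) (𝓝[>] 0 ×ˢ 𝓝 θ₀) (𝓝 θ₀) := tendsto_snd
  have hj := h0.tendsto_window_jump (hAc.mul h0.continuous_deriv) θ₀
  have hν : Tendsto (fun p : ℝ × ℝ => (p.1 : ℂ) * rightNormal γ p.2) (𝓝[>] 0 ×ˢ 𝓝 θ₀) (𝓝 0) := by
    simpa using hs10.mul ((h0.continuous_rightNormal.tendsto θ₀).comp hs2)
  have hγ := (h0.continuous.tendsto θ₀).comp hs2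
  have hγπ : Tendsto (fun p : ℝ × ℝ => γ (p.2 - π)) (𝓝[>] 0 ×ˢ 𝓝 θ₀)
      (𝓝 (γ (θ₀ - π))) :=
    ((h0.continuous.comp (continuous_sub_right π)).tendsto θ₀).comp hs2
  have hne : γ (θ₀ - π) - γ θ₀ ≠ 0 := by
    intro h'
    obtain ⟨k, hk⟩ := h0.eq_iff (sub_eq_zero.1 h')
    have hπ := Real.pi_pos
    have h1 : ((2 * k + 1 : ℤ) : ℝ) * π = 0 := by push_cast; linarith
    rcases mul_eq_zero.1 h1 with h2 | h2
    · have : 2 * k + 1 = 0 := by exact_mod_cast h2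
      omega
    · exact hπ.ne' h2
  have hin := hγ.sub hν
  have hout := hγ.add hν
  rw [sub_zero] at hin
  rw [add_zero] at hout
  have hlim := (((hγπ.sub hin).div (hγπ.sub hout) hne).mul hj.neg.cexp).mul (hout.const_mul c)
  have e0 : (γ (θ₀ - π) - γ θ₀) / (γ (θ₀ - π) - γ θ₀) *
      cexp (-(2 * π * I * (A θ₀ * deriv γ θ₀) / deriv γ θ₀)) * (c * γ θ₀) =
      c * γ θ₀ * cexp (-(fluxAngle γ ρ θ₀ * I)) := by
    have := h0.regular θ₀
    rw [div_self hne, one_mul, mul_comm]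
    congr 3
    simp only [hA, fluxAngle]
    push_cast
    field_simp
  simp only [Pi.mul_apply] at hlim
  rw [e0] at hlim
  refine hlim.congr' ?_
  filter_upwards [hs1.eventually (Ioc_mem_nhdsGT hP.collar.pos)] with q hq
  have h1 := hP.collar.inside q.2 q.1 hq
  have h2 := hP.collar.outside q.2 q.1 hq
  have hn1 : γ q.2 - q.1 * rightNormal γ q.2 ∉ range γ := fun h' =>
    disjoint_left.1 hP.jordan.disjoint_range h1 h'
  have hn2 : γ q.2 + q.1 * rightNormal γ q.2 ∉ range γ := fun h' =>
    h2 (by rw [hP.jordan.closure_eq]; exact Or.inr h')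
  simp only [comp_apply]
  rw [← hc _ h2, hP.denom_eq_window hn1 q.2, hP.denom_eq_window hn2 q.2]
  have h3 := IsSimpleClosedCurve.sub_ne_zero_of_notMem hn2 (q.2 - π)
  have key : ∀ a b X Y : ℂ, b ≠ 0 →
      a / b * cexp (-(X - Y)) * (b * cexp (-Y)) = a * cexp (-X) := by
    intro a b X Y hb
    have : cexp (-(X - Y)) * cexp (-Y) = cexp (-X) := by rw [← exp_add]; ring_nf
    rw [← this]
    field_simp
  exact key _ _ _ _ h3

/-- The holomorphic map `Ω → D` whose absolute value is `exp (-2πp)`, with its boundary values. -/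
theorem exists_discMap (hP : HasPressureFlux Ω γ δ p ρ) :
    ∃ G : ℂ → ℂ, DifferentiableOn ℂ G Ω ∧ ContinuousOn G (closure Ω) ∧
      (∀ θ, G (γ θ) = cexp (fluxAngle γ ρ θ * I)) ∧
      (∀ z ∈ Ω, G z = 0 ↔ z = 0) ∧ deriv G 0 ≠ 0 ∧
      ∀ z ∈ Ω \ {0}, ‖G z‖ = Real.exp (-(2 * π * p z)) := by
  obtain ⟨c, hc1, hc⟩ := hP.exists_denom_eq
  have hc0 : c ≠ 0 := norm_ne_zero_iff.1 (by rw [hc1]; exact one_ne_zero)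
  have hr : ∀ z ∈ Ω, z ∉ range γ := fun z hz h' => disjoint_left.1 hP.jordan.disjoint_range hz h'
  set G₀ : ℂ → ℂ := fun z => c * z / denom γ ρ z with hG₀
  have hd : ∀ z ∈ Ω, HasDerivAt G₀ ((c * denom γ ρ z - c * z *
      (-cauchyInt γ (fun θ => (density γ ρ θ : ℂ)) z * denom γ ρ z)) / denom γ ρ z ^ 2) z := by
    intro z hz
    have := ((hasDerivAt_id z).const_mul c).div (hP.hasDerivAt_denom (hr z hz))
      (denom_ne_zero (hr z hz))
    exact this.congr_deriv (by simp)
  have hin : ∀ z ∈ Ω, Tendsto G₀ (𝓝[Ω] z) (𝓝 (G₀ z)) := fun z hz =>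
    (hd z hz).continuousAt.continuousWithinAt
  have hbd : ∀ θ, Tendsto G₀ (𝓝[Ω] (γ θ)) (𝓝 (cexp (fluxAngle γ ρ θ * I))) := by
    intro θ
    have hγ0 := hP.ne_zero θ
    have h1 : Tendsto (fun z => c * z) (𝓝[Ω] (γ θ)) (𝓝 (c * γ θ)) :=
      ((continuous_const.mul continuous_id).tendsto (γ θ)).mono_left nhdsWithin_le_nhds
    have h2 := h1.div (hP.tendsto_denom hc θ)
      (mul_ne_zero (mul_ne_zero hc0 hγ0) (exp_ne_zero _))
    have e : c * γ θ / (c * γ θ * cexp (-(fluxAngle γ ρ θ * I))) =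
        cexp (fluxAngle γ ρ θ * I) := by
      rw [exp_neg]; field_simp
    rwa [e] at h2
  set G := extendFrom Ω G₀ with hG
  have hGin : ∀ z ∈ Ω, G z = G₀ z := fun z hz => extendFrom_eq (subset_closure hz) (hin z hz)
  have hGev : ∀ z ∈ Ω, G =ᶠ[𝓝 z] G₀ := fun z hz => by
    filter_upwards [hP.jordan.isOpen.mem_nhds hz] with w hw
    exact hGin w hw
  refine ⟨G, fun z hz => ((hd z hz).congr_of_eventuallyEq
    (hGev z hz)).differentiableAt.differentiableWithinAt, ?_, fun θ =>
      extendFrom_eq (hP.jordan.mem_closure θ) (hbd θ), fun z hz => ?_, ?_, fun z hz => ?_⟩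
  · refine continuousOn_extendFrom Subset.rfl fun z hz => ?_
    rw [hP.jordan.closure_eq] at hz
    rcases hz with hz | ⟨θ, rfl⟩
    · exact ⟨_, hin z hz⟩
    · exact ⟨_, hbd θ⟩
  · rw [hGin z hz]
    simp only [hG₀, div_eq_zero_iff, mul_eq_zero, hc0, false_or,
      denom_ne_zero (hr z hz), or_false]
  · have hz := hP.zero_mem
    have h3 := denom_ne_zero (ρ := ρ) (hr 0 hz)
    rw [(hGev 0 hz).deriv_eq, (hd 0 hz).deriv, mul_zero, zero_mul, sub_zero]
    positivity
  · have hp := hP.exists_potential.2.1 z ⟨subset_closure hz.1, hz.2⟩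
    have hz0 : 0 < ‖z‖ := norm_pos_iff.2 hz.2
    have hπ := Real.pi_pos
    rw [hGin z hz.1, hp]
    simp only [hG₀]
    rw [norm_div, norm_mul, hc1, one_mul, hP.norm_denom (hr z hz.1), mul_div_cancel₀ _
      (by positivity), neg_sub, Real.exp_sub, Real.exp_log hz0]

end HasPressureFlux

/-- Near a critical point, a nonconstant holomorphic function takes each value near the critical
value at least twice. -/
theorem exists_two_preimages_of_deriv_eq_zero {G : ℂ → ℂ} {z₀ : ℂ} (hG : AnalyticAt ℂ G z₀)
    (hconst : ¬ ∀ᶠ z in 𝓝 z₀, G z = G z₀) (hd : deriv G z₀ = 0) {A : Set ℂ} (hA : A ∈ 𝓝 z₀) :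
    ∀ᶠ ζ in 𝓝 (G z₀), ζ ≠ G z₀ → ∃ w₁ ∈ A, ∃ w₂ ∈ A, w₁ ≠ w₂ ∧ G w₁ = ζ ∧ G w₂ = ζ := by
  have hf : AnalyticAt ℂ (fun z => G z - G z₀) z₀ := hG.sub analyticAt_const
  obtain ⟨m, g, hg, hg0, hgG⟩ := hf.exists_eventuallyEq_pow_smul_nonzero_iff.2 (by
    intro h; exact hconst (h.mono fun z hz => sub_eq_zero.1 hz))
  have hm0 : m ≠ 0 := by
    rintro rfl
    have := hgG.self_of_nhds
    simp at this
    exact hg0 this.symm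
  have hm1 : m ≠ 1 := by
    rintro rfl
    have h1 : HasDerivAt (fun z => (z - z₀) ^ 1 • g z) (g z₀) z₀ := by
      have := ((hasDerivAt_id z₀).sub_const z₀).mul hg.differentiableAt.hasDerivAt
      simp only [id, sub_self, zero_mul, add_zero, one_mul] at this
      exact this.congr_of_eventuallyEq (Eventually.of_forall fun z => by simp)
    have h2 := (h1.congr_of_eventuallyEq hgG).add_const (G z₀)
    simp only [sub_add_cancel] at h2
    rw [h2.deriv] at hd
    exact hg0 hd
  -- an `m`-th root of `g`
  obtain ⟨μ, hμ⟩ := IsAlgClosed.exists_pow_nat_eq (g z₀) (Nat.pos_of_ne_zero hm0)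
  have hμ0 : μ ≠ 0 := by rintro rfl; rw [zero_pow hm0] at hμ; exact hg0 hμ.symm
  set k : ℂ → ℂ := fun z => μ * cexp (Complex.log (g z / g z₀) / m) with hk
  have hmC : (m : ℂ) ≠ 0 := by exact_mod_cast hm0
  have hka : AnalyticAt ℂ k z₀ := by
    have h1 : AnalyticAt ℂ (fun z => g z / g z₀) z₀ := hg.div analyticAt_const hg0
    have h2 : AnalyticAt ℂ (fun z => Complex.log (g z / g z₀)) z₀ :=
      h1.clog (by rw [div_self hg0]; exact one_mem_slitPlane)
    exact analyticAt_const.mul (h2.div analyticAt_const hmC).cexp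
  have hkm : ∀ᶠ z in 𝓝 z₀, k z ^ m = g z := by
    filter_upwards [hg.continuousAt.eventually_ne hg0] with z hz
    simp only [hk]
    rw [mul_pow, hμ, ← exp_nat_mul, mul_div_cancel₀ _ hmC, exp_log (div_ne_zero hz hg0),
      mul_div_cancel₀ _ hg0]
  set h : ℂ → ℂ := fun z => (z - z₀) * k z with hh
  have hha : AnalyticAt ℂ h z₀ := (analyticAt_id.sub analyticAt_const).mul hka
  have hk0 : k z₀ ≠ 0 := mul_ne_zero hμ0 (exp_ne_zero _)
  have hhd : deriv h z₀ = k z₀ := by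
    have := ((hasDerivAt_id z₀).sub_const z₀).mul hka.differentiableAt.hasDerivAt
    simp only [id, sub_self, zero_mul, add_zero, one_mul] at this
    exact this.deriv
  have hstrict := hha.hasStrictDerivAt
  rw [hhd] at hstrict
  set e := (hstrict.hasStrictFDerivAt_equiv hk0).toOpenPartialHomeomorph h with he
  have hee : ∀ z, e z = h z := fun z => rfl
  have hsrc : z₀ ∈ e.source := (hstrict.hasStrictFDerivAt_equiv hk0).mem_toOpenPartialHomeomorph_source
  have hh0 : h z₀ = 0 := by simp [hh]
  have htgt : (0 : ℂ) ∈ e.target := by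
    rw [← hh0, ← hee]; exact e.map_source hsrc
  have hsymm : e.symm 0 = z₀ := by rw [← hh0, ← hee]; exact e.left_inv hsrc
  have hcont : Tendsto e.symm (𝓝 0) (𝓝 z₀) := by
    have := e.symm.continuousAt (x := 0) htgt
    rwa [ContinuousAt, hsymm] at this
  have hgood : ∀ᶠ ξ in 𝓝 (0 : ℂ), ξ ∈ e.target ∧ e.symm ξ ∈ A ∧
      G (e.symm ξ) = G z₀ + ξ ^ m := by
    filter_upwards [e.open_target.mem_nhds htgt, hcont.eventually hA,
      hcont.eventually (hgG.and hkm)] with ξ h1 h2 h3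
    refine ⟨h1, h2, ?_⟩
    have h4 : h (e.symm ξ) = ξ := e.right_inv h1
    have h5 : ξ ^ m = (e.symm ξ - z₀) ^ m * g (e.symm ξ) := by
      rw [← h3.2, ← mul_pow]; exact congrArg (· ^ m) h4.symm
    have h6 := h3.1
    rw [smul_eq_mul] at h6
    rw [h5, ← h6]; ring
  obtain ⟨ε, hε, hball⟩ := Metric.mem_nhds_iff.1 hgood
  have hω := Complex.isPrimitiveRoot_exp m hm0
  set ω' := cexp (2 * π * I / m) with hω'
  have hω1 : ω' ≠ 1 := hω.ne_one (by omega)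
  have hωm : ω' ^ m = 1 := hω.pow_eq_one
  have hωn : ‖ω'‖ = 1 := hω.norm'_eq_one hm0
  filter_upwards [ball_mem_nhds (G z₀) (pow_pos hε m)] with ζ hζ hne
  obtain ⟨ξ, hξ⟩ := IsAlgClosed.exists_pow_nat_eq (ζ - G z₀) (Nat.pos_of_ne_zero hm0)
  have hξ0 : ξ ≠ 0 := by
    rintro rfl
    rw [zero_pow hm0] at hξ
    exact hne (sub_eq_zero.1 hξ.symm)
  have hξn : ‖ξ‖ < ε := by
    rw [mem_ball, dist_eq_norm, ← hξ, norm_pow] at hζ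
    exact lt_of_pow_lt_pow_left₀ m hε.le hζ
  obtain ⟨h1, h2, h3⟩ := hball (mem_ball_zero_iff.2 hξn)
  obtain ⟨h1', h2', h3'⟩ := hball (mem_ball_zero_iff.2
    (show ‖ω' * ξ‖ < ε by rw [norm_mul, hωn, one_mul]; exact hξn))
  refine ⟨_, h2, _, h2', fun heq => ?_, ?_, ?_⟩
  · have := e.symm.injOn h1 h1' heq
    have h5 : (ω' - 1) * ξ = 0 := by rw [sub_mul, ← this]; ring
    rcases mul_eq_zero.1 h5 with h6 | h6
    · exact hω1 (sub_eq_zero.1 h6)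
    · exact hξ0 h6
  · rw [h3, hξ]; ring
  · rw [h3', mul_pow, hωm, hξ]; ring

/-- A holomorphic map of a bounded domain to the disc that maps the boundary to the circle and
has one simple zero is bijective: the set of the values that are taken exactly once, and not at a
critical point, is open and closed. -/
theorem bijOn_ball_of_norm_frontier_eq_one {Ω : Set ℂ} {G : ℂ → ℂ} (hΩ : IsOpen Ω)
    (hΩc : IsPreconnected Ω) (hb : Bornology.IsBounded Ω) (hG : DifferentiableOn ℂ G Ω)
    (hGc : ContinuousOn G (closure Ω)) (hlt : ∀ z ∈ Ω, ‖G z‖ < 1)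
    (hfr : ∀ z ∈ frontier Ω, ‖G z‖ = 1) {z₁ : ℂ} (hz₁ : z₁ ∈ Ω)
    (h0 : ∀ z ∈ Ω, G z = 0 ↔ z = z₁) (hd : deriv G z₁ ≠ 0) :
    BijOn G Ω (ball 0 1) ∧ ∀ z ∈ Ω, deriv G z ≠ 0 := by
  have hcompact : IsCompact (closure Ω) := hb.isCompact_closure
  have han : ∀ z ∈ Ω, AnalyticAt ℂ G z := fun z hz => hG.analyticAt (hΩ.mem_nhds hz)
  have hin : ∀ z ∈ closure Ω, ‖G z‖ < 1 → z ∈ Ω := fun z hz hz' => by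
    by_contra hzΩ
    exact hz'.ne (hfr z ⟨hz, by rwa [hΩ.interior_eq]⟩)
  have hnc : ∀ z ∈ Ω, ¬ ∀ᶠ w in 𝓝 z, G w = G z := by
    intro z hz hev
    have h1 := (hG.analyticOnNhd hΩ).eqOn_of_preconnected_of_eventuallyEq
      (analyticOnNhd_const (v := G z)) hΩc hz hev
    refine hd ?_
    have : G =ᶠ[𝓝 z₁] fun _ => G z := by
      filter_upwards [hΩ.mem_nhds hz₁] with w hw
      exact h1 hw
    rw [this.deriv_eq, deriv_const]
  set E : Set ℂ := {ζ | ‖ζ‖ < 1 ∧ ∃ z ∈ Ω, G z = ζ ∧ deriv G z ≠ 0 ∧ ∀ w ∈ Ω, G w = ζ → w = z}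
    with hE
  have hEo : IsOpen E := by
    rw [isOpen_iff_mem_nhds]
    rintro ζ ⟨hζ, z, hz, hGz, hdz, huniq⟩
    have hs := (han z hz).hasStrictDerivAt
    set e := (hs.hasStrictFDerivAt_equiv hdz).toOpenPartialHomeomorph G with he
    have hee : ∀ z, e z = G z := fun z => rfl
    have hsrc : z ∈ e.source := (hs.hasStrictFDerivAt_equiv hdz).mem_toOpenPartialHomeomorph_source
    have hdc : ContinuousAt (deriv G) z := (han z hz).deriv.continuousAt
    obtain ⟨N, hNsub, hNo, hzN⟩ := _root_.mem_nhds_iff.1 (inter_mem (inter_mem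
      (e.open_source.mem_nhds hsrc) (hΩ.mem_nhds hz)) (hdc.eventually_ne hdz))
    have hC : IsCompact (closure Ω \ N) := hcompact.diff hNo
    have hGC : IsClosed (G '' (closure Ω \ N)) :=
      (hC.image_of_continuousOn (hGc.mono sdiff_subset)).isClosed
    have hζC : ζ ∉ G '' (closure Ω \ N) := by
      rintro ⟨w, ⟨hw, hwN⟩, hwζ⟩
      have := huniq w (hin w hw (by rw [hwζ]; exact hζ)) hwζ
      exact hwN (this ▸ hzN)
    have hNim : IsOpen (G '' N) :=
      e.isOpen_image_of_subset_source hNo (fun w hw => (hNsub hw).1.1)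
    have hball : IsOpen {ζ : ℂ | ‖ζ‖ < 1} := isOpen_lt continuous_norm continuous_const
    filter_upwards [hGC.isOpen_compl.mem_nhds hζC, hNim.mem_nhds ⟨z, hzN, hGz⟩,
      hball.mem_nhds hζ] with ξ h1 h2 h3
    obtain ⟨w, hwN, hw⟩ := h2
    refine ⟨h3, w, (hNsub hwN).1.2, hw, (hNsub hwN).2, fun v hv hvξ => ?_⟩
    have hvN : v ∈ N := by
      by_contra hvN
      exact h1 ⟨v, ⟨subset_closure hv, hvN⟩, hvξ⟩
    exact e.injOn (hNsub hvN).1.1 (hNsub hwN).1.1 (by rw [hee, hee, hvξ, hw])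
  have hsub : ball (0 : ℂ) 1 ⊆ E := by
    refine (convex_ball (0 : ℂ) 1).isPreconnected.subset_of_closure_inter_subset hEo ?_ ?_
    · exact ⟨0, by simp, by simp, z₁, hz₁, (h0 z₁ hz₁).2 rfl, hd, fun w hw => (h0 w hw).1⟩
    · rintro ζ ⟨hζ, hζ1⟩
      rw [mem_ball_zero_iff] at hζ1
      have hcl : closure E ⊆ G '' closure Ω := by
        refine closure_minimal ?_ (hcompact.image_of_continuousOn hGc).isClosed
        rintro ξ ⟨-, z, hz, hzξ, -⟩
        exact ⟨z, subset_closure hz, hzξ⟩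
      obtain ⟨z, hz, rfl⟩ := hcl hζ
      have hzΩ := hin z hz hζ1
      have hfreq : ∃ᶠ ξ in 𝓝 (G z), ξ ∈ E := mem_closure_iff_frequently.1 hζ
      by_cases hzE : G z ∈ E
      · exact hzE
      exfalso
      have hopen : ∀ w ∈ Ω, 𝓝 (G w) ≤ map G (𝓝 w) := fun w hw =>
        ((han w hw).eventually_constant_or_nhds_le_map_nhds).resolve_left (hnc w hw)
      have huniq : ∀ w ∈ Ω, G w = G z → w = z := by
        intro w hw hwz
        by_contra hne
        obtain ⟨A, B, hA, hB, hwA, hzB, hAB⟩ := t2_separation hne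
        have h1 : G '' (A ∩ Ω) ∈ 𝓝 (G z) := hwz ▸ hopen w hw
          (image_mem_map (inter_mem (hA.mem_nhds hwA) (hΩ.mem_nhds hw)))
        have h2 : G '' (B ∩ Ω) ∈ 𝓝 (G z) := hopen z hzΩ
          (image_mem_map (inter_mem (hB.mem_nhds hzB) (hΩ.mem_nhds hzΩ)))
        obtain ⟨ξ, ⟨-, v, -, -, -, hv⟩, ⟨a, ⟨haA, haΩ⟩, ha⟩, ⟨b, ⟨hbB, hbΩ⟩, hb⟩⟩ :=
          (hfreq.and_eventually (inter_mem h1 h2)).exists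
        have : a = b := (hv a haΩ ha).trans (hv b hbΩ hb).symm
        exact disjoint_left.1 hAB haA (this ▸ hbB)
      have hdz : deriv G z = 0 := by
        by_contra hdz
        exact hzE ⟨hζ1, z, hzΩ, rfl, hdz, huniq⟩
      have h2 := exists_two_preimages_of_deriv_eq_zero (han z hzΩ) (hnc z hzΩ) hdz
        (hΩ.mem_nhds hzΩ)
      obtain ⟨ξ, hξE, hξ⟩ := (hfreq.and_eventually h2).exists
      obtain ⟨w₁, hw₁, w₂, hw₂, hne, h3, h4⟩ := hξ (fun h => hzE (h ▸ hξE))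
      obtain ⟨-, v, -, -, -, hv⟩ := hξE
      exact hne ((hv w₁ hw₁ h3).trans (hv w₂ hw₂ h4).symm)
  refine ⟨⟨fun z hz => mem_ball_zero_iff.2 (hlt z hz), fun z hz w hw hzw => ?_, fun ζ hζ => ?_⟩,
    fun z hz => ?_⟩
  · obtain ⟨-, v, -, -, -, hv⟩ := hsub (mem_ball_zero_iff.2 (hlt z hz))
    exact (hv z hz rfl).trans (hv w hw hzw.symm).symm
  · obtain ⟨-, v, hv, hvζ, -⟩ := hsub hζ
    exact ⟨v, hv, hvζ⟩
  · obtain ⟨-, v, hv, hvζ, hdv, huniq⟩ := hsub (mem_ball_zero_iff.2 (hlt z hz))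
    rw [huniq z hz rfl]; exact hdv

namespace HasPressureFlux

variable {Ω : Set ℂ} {γ : ℝ → ℂ} {δ : ℝ} {p : ℂ → ℝ} {ρ : ℝ → ℝ}

theorem mem_frontier_iff (hP : HasPressureFlux Ω γ δ p ρ) {z : ℂ} :
    z ∈ frontier Ω ↔ ∃ θ, γ θ = z := by rw [hP.jordan.frontier_eq, mem_range]

theorem norm_lt_one (hP : HasPressureFlux Ω γ δ p ρ) {G : ℂ → ℂ} (hG : DifferentiableOn ℂ G Ω)
    (hGc : ContinuousOn G (closure Ω)) (hGb : ∀ θ, G (γ θ) = cexp (fluxAngle γ ρ θ * I))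
    (h0 : G 0 = 0) {z : ℂ} (hz : z ∈ Ω) : ‖G z‖ < 1 := by
  have hle : ∀ z ∈ Ω, ‖G z‖ ≤ 1 := fun z hz => by
    refine Complex.norm_le_of_forall_mem_frontier_norm_le hP.jordan.bounded ⟨hG, hGc⟩
      (fun w hw => ?_) (subset_closure hz)
    obtain ⟨θ, rfl⟩ := hP.mem_frontier_iff.1 hw
    rw [hGb, norm_exp_ofReal_mul_I]
  refine lt_of_le_of_ne (hle z hz) fun h1 => ?_
  have h2 := Complex.eqOn_of_isPreconnected_of_isMaxOn_norm hP.jordan.isConnected.isPreconnected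
    hP.jordan.isOpen hG hz (fun w hw => by simpa [h1] using hle w hw) hP.zero_mem
  rw [h0, Function.const_apply] at h2
  rw [← h2, norm_zero] at h1
  exact zero_ne_one h1

theorem pressure_pos (hP : HasPressureFlux Ω γ δ p ρ) {z : ℂ} (hz : z ∈ Ω \ {0}) : 0 < p z := by
  obtain ⟨G, hG, hGc, hGb, hG0, -, hGp⟩ := hP.exists_discMap
  have h1 := hP.norm_lt_one hG hGc hGb ((hG0 0 hP.zero_mem).2 rfl) hz.1
  rw [hGp z hz, Real.exp_lt_one_iff] at h1
  have := Real.pi_pos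
  by_contra! hneg
  nlinarith

theorem harmonicAt_pressure (hP : HasPressureFlux Ω γ δ p ρ) {z : ℂ} (hz : z ∈ Ω \ {0}) :
    HarmonicAt p z := by
  obtain ⟨h, hh, hph⟩ := hP.pressure.singular
  have h1 : HarmonicAt (fun z : ℂ => Real.log ‖z‖) z :=
    AnalyticAt.harmonicAt_log_norm analyticAt_id hz.2
  have h2 := (hh z hz.1).sub (h1.const_smul (c := 1 / (2 * π)))
  refine (harmonicAt_congr_nhds ?_).2 h2
  filter_upwards [(hP.jordan.isOpen.sdiff isClosed_singleton).mem_nhds hz] with w hw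
  simpa using hph w hw

/-- The **Hopf lemma** for the pressure. -/
theorem flux_pos (hP : HasPressureFlux Ω γ δ p ρ) (θ : ℝ) : 0 < ρ θ := by
  have h0 := hP.curve
  set ν := rightNormal γ θ with hν
  have hν1 : ‖ν‖ = 1 := h0.norm_rightNormal θ
  have hγ0 := norm_pos_iff.2 (hP.ne_zero θ)
  -- an interior ball that touches the boundary, away from the origin
  obtain ⟨r, hr, hrδ, hrγ⟩ : ∃ r > 0, r ≤ δ ∧ 2 * r < ‖γ θ‖ :=
    ⟨min δ (‖γ θ‖ / 4), lt_min hP.collar.pos (by positivity), min_le_left _ _, by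
      have := min_le_right δ (‖γ θ‖ / 4); linarith⟩
  set c := γ θ - r * ν with hc
  have hball : ball c r ⊆ Ω := by
    have h1 := hP.jordan.subset_or (convex_ball c r).isPreconnected (by
      rw [disjoint_left]
      rintro _ hz ⟨φ, rfl⟩
      have h2 := hP.collar.normal_bound θ φ (-r) (by rw [abs_neg, abs_of_pos hr]; exact hrδ)
      have h3 : γ φ - γ θ - ((-r : ℝ) : ℂ) * rightNormal γ θ = γ φ - c := by
        rw [hc, hν]; push_cast; ring
      rw [h3, neg_sq] at h2
      rw [mem_ball, dist_eq_norm] at hz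
      have := pow_lt_pow_left₀ hz (norm_nonneg _) two_ne_zero
      nlinarith [sq_nonneg ‖γ φ - γ θ‖])
    refine h1.resolve_right fun h2 => h2 (mem_ball_self hr) ?_
    exact subset_closure (hP.collar.inside θ r ⟨hr, hrδ⟩)
  have hne : ∀ z ∈ closedBall c r, z ≠ 0 := by
    rintro z hz rfl
    rw [mem_closedBall, dist_eq_norm, zero_sub, norm_neg] at hz
    have : ‖γ θ‖ ≤ ‖c‖ + ‖(r : ℂ) * ν‖ := by
      have := norm_add_le c (r * ν)
      rwa [hc, sub_add_cancel, ← hc] at this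
    rw [norm_mul, hν1, mul_one, norm_real, Real.norm_of_nonneg hr.le] at this
    linarith
  have hcl : closedBall c r ⊆ closure Ω := by
    rw [← closure_ball c hr.ne']; exact closure_mono hball
  have hpc : ContinuousOn p (closedBall c r) :=
    hP.pressure.continuousOn.mono fun z hz => ⟨hcl hz, hne z hz⟩
  have hp0 : ∀ z ∈ closedBall c r, 0 ≤ p z := by
    intro z hz
    by_cases hzΩ : z ∈ Ω
    · exact (hP.pressure_pos ⟨hzΩ, hne z hz⟩).le
    · exact (hP.pressure.boundary z ⟨hcl hz, by rwa [hP.jordan.isOpen.interior_eq]⟩).ge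
  obtain ⟨b, hb, hbmin⟩ := (isCompact_sphere c (r / 2)).exists_isMinOn
    (NormedSpace.sphere_nonempty.2 (by positivity)) (hpc.mono (fun z hz => by
      rw [mem_sphere] at hz
      rw [mem_closedBall, hz]; linarith))
  have hbm : b ∈ ball c r := by
    rw [mem_sphere] at hb
    rw [mem_ball, hb]; linarith
  have hm : 0 < p b := hP.pressure_pos ⟨hball hbm, hne b (ball_subset_closedBall hbm)⟩
  set k := p b / Real.log 2 with hk
  have hlog2 : 0 < Real.log 2 := Real.log_pos one_lt_two
  have hk0 : 0 < k := div_pos hm hlog2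
  -- the logarithmic barrier on the annulus
  have hbar : ∀ z, r / 2 ≤ ‖z - c‖ → ‖z - c‖ ≤ r → k * Real.log (r / ‖z - c‖) ≤ p z := by
    intro z hz1 hz2
    set K := closedBall c r \ ball c (r / 2) with hK
    have hKc : IsCompact K := (isCompact_closedBall c r).diff isOpen_ball
    have hKne : ∀ w ∈ K, w - c ≠ 0 := by
      rintro w ⟨-, hw⟩ h'
      rw [mem_ball, dist_eq_norm, h', norm_zero] at hw
      exact hw (by positivity)
    have hvc : ContinuousOn (fun z => k * Real.log (r / ‖z - c‖) - p z) K := by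
      refine ContinuousOn.sub (continuousOn_const.mul (ContinuousOn.log ?_ ?_))
        (hpc.mono sdiff_subset)
      · exact continuousOn_const.div (by fun_prop) fun w hw => norm_ne_zero_iff.2 (hKne w hw)
      · exact fun w hw => div_ne_zero hr.ne' (norm_ne_zero_iff.2 (hKne w hw))
    obtain ⟨w, ⟨hwK, hwB⟩, hw⟩ := exists_le_of_harmonicAt_or_not_isLocalMax
      (B := sphere c r ∪ sphere c (r / 2)) hKc hvc (z := z) (fun w hwK hwB => by
        have hwc := hKne w hwK
        rw [hK, Set.mem_sdiff, mem_closedBall, mem_ball, not_lt] at hwK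
        rw [mem_union, mem_sphere, mem_sphere, not_or] at hwB
        have h1 : dist w c < r := lt_of_le_of_ne hwK.1 hwB.1
        have h2 : r / 2 < dist w c := lt_of_le_of_ne hwK.2 (Ne.symm hwB.2)
        have hmem : ball c r ∩ (closedBall c (r / 2))ᶜ ∈ 𝓝 w :=
          (isOpen_ball.inter isClosed_closedBall.isOpen_compl).mem_nhds
            ⟨h1, by simpa using h2⟩
        refine ⟨mem_of_superset hmem fun x hx => ⟨ball_subset_closedBall hx.1, fun h' =>
          hx.2 (ball_subset_closedBall h')⟩, Or.inl ?_⟩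
        have h3 : HarmonicAt (fun z => Real.log ‖z - c‖) w :=
          AnalyticAt.harmonicAt_log_norm (f := fun z => z - c) (by fun_prop) hwc
        have h4 : HarmonicAt (fun _ : ℂ => k * Real.log r) w := by
          simp
        have h5 := (h4.sub (h3.const_smul (c := k))).sub (hP.harmonicAt_pressure
          ⟨hball h1, hne w (ball_subset_closedBall h1)⟩)
        refine (harmonicAt_congr_nhds ?_).2 h5
        filter_upwards [hmem] with x hx
        have hx0 : ‖x - c‖ ≠ 0 := fun h' => hx.2 (by
          rw [mem_closedBall, dist_eq_norm, h']; positivity)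
        simp only [Pi.sub_apply, Pi.smul_apply, smul_eq_mul]
        rw [Real.log_div hr.ne' hx0]
        ring) ⟨by rw [mem_closedBall, dist_eq_norm]; exact hz2, by
          rw [mem_ball, dist_eq_norm, not_lt]; exact hz1⟩
    have hle : k * Real.log (r / ‖w - c‖) - p w ≤ 0 := by
      rcases hwB with h1 | h1
      · rw [mem_sphere, dist_eq_norm] at h1
        rw [h1, div_self hr.ne', Real.log_one, mul_zero, zero_sub]
        have := hp0 w hwK.1
        linarith
      · have h2 := hbmin h1
        rw [mem_sphere, dist_eq_norm] at h1
        rw [h1, show r / (r / 2) = 2 by field_simp, hk, div_mul_cancel₀ _ hlog2.ne']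
        simp only [mem_ofPred_eq] at h2
        linarith
    linarith
  have hlow : k / r ≤ ρ θ := by
    refine ge_of_tendsto (hP.flux θ) ?_
    filter_upwards [Ioo_mem_nhdsGT (show 0 < r / 2 by positivity)] with s hs
    have hn : ‖γ θ - s * ν - c‖ = r - s := by
      have : γ θ - s * ν - c = ((r - s : ℝ) : ℂ) * ν := by rw [hc]; push_cast; ring
      rw [this, norm_mul, hν1, mul_one, norm_real, Real.norm_of_nonneg (by linarith [hs.2])]
    have h1 := hbar (γ θ - s * ν) (by rw [hn]; linarith [hs.2]) (by rw [hn]; linarith [hs.1])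
    rw [hn] at h1
    have hrs : 0 < r - s := by linarith [hs.2]
    have h2 : s / r ≤ Real.log (r / (r - s)) := by
      have := Real.log_le_sub_one_of_pos (div_pos hrs hr)
      rw [Real.log_div hrs.ne' hr.ne'] at this
      rw [Real.log_div hr.ne' hrs.ne']
      have e : (r - s) / r - 1 = -(s / r) := by field_simp; ring
      linarith
    rw [le_div_iff₀ hs.1]
    calc k / r * s = k * (s / r) := by ring
      _ ≤ k * Real.log (r / (r - s)) := by gcongr
      _ ≤ _ := h1
  exact (div_pos hk0 hr).trans_le hlow

theorem density_pos (hP : HasPressureFlux Ω γ δ p ρ) (θ : ℝ) : 0 < density γ ρ θ :=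
  mul_pos (hP.flux_pos θ) (norm_pos_iff.2 (hP.curve.regular θ))

theorem hasDerivAt_fluxAngle (hP : HasPressureFlux Ω γ δ p ρ) (θ : ℝ) :
    HasDerivAt (fluxAngle γ ρ) (2 * π * density γ ρ θ) θ :=
  (IsSimpleClosedCurve.primitive_hasDerivAt hP.continuous_density θ).const_mul _

theorem strictMono_fluxAngle (hP : HasPressureFlux Ω γ δ p ρ) : StrictMono (fluxAngle γ ρ) := by
  refine strictMono_of_deriv_pos fun θ => ?_
  rw [(hP.hasDerivAt_fluxAngle θ).deriv]
  have := hP.density_pos θ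
  positivity

theorem fluxAngle_add_period (hP : HasPressureFlux Ω γ δ p ρ) (θ : ℝ) :
    fluxAngle γ ρ (θ + 2 * π) = fluxAngle γ ρ θ + 2 * π := by
  rw [fluxAngle, fluxAngle, hP.primitive_add_period]; ring

/-- The Riemann map of the domain, and its boundary values: harmonic measure seen from the origin
is the flux of the pressure. -/
theorem exists_riemannMap (hP : HasPressureFlux Ω γ δ p ρ) :
    ∃ a G : ℂ → ℂ, DifferentiableOn ℂ a (ball 0 1) ∧
      ContinuousOn a (closedBall 0 1) ∧ DifferentiableOn ℂ G Ω ∧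
      (∀ θ, a (cexp (fluxAngle γ ρ θ * I)) = γ θ) ∧ a 0 = 0 ∧
      BijOn a (ball 0 1) Ω ∧ InjOn a (closedBall 0 1) ∧
      (∀ ζ ∈ ball (0 : ℂ) 1, G (a ζ) = ζ) ∧
      ∀ ζ ∈ ball (0 : ℂ) 1, deriv a ζ ≠ 0 := by
  have hπ := Real.pi_pos
  obtain ⟨G, hG, hGc, hGb, hG0, hGd, -⟩ := hP.exists_discMap
  have hlt : ∀ z ∈ Ω, ‖G z‖ < 1 := fun z hz =>
    hP.norm_lt_one hG hGc hGb ((hG0 0 hP.zero_mem).2 rfl) hz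
  have hfr1 : ∀ z ∈ frontier Ω, ‖G z‖ = 1 := fun z hz => by
    obtain ⟨θ, rfl⟩ := hP.mem_frontier_iff.1 hz
    rw [hGb, norm_exp_ofReal_mul_I]
  obtain ⟨hbij, hderiv⟩ := bijOn_ball_of_norm_frontier_eq_one hP.jordan.isOpen
    hP.jordan.isConnected.isPreconnected hP.jordan.bounded hG hGc hlt hfr1 hP.zero_mem hG0 hGd
  have hcl : ∀ z ∈ closure Ω, z ∈ Ω ∨ ∃ θ, γ θ = z := fun z hz => by
    rw [hP.jordan.closure_eq] at hz; exact hz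
  have hα := hP.strictMono_fluxAngle
  have hαc : Continuous (fluxAngle γ ρ) :=
    continuous_iff_continuousAt.2 fun θ => (hP.hasDerivAt_fluxAngle θ).continuousAt
  have hinj : InjOn G (closure Ω) := by
    intro z hz w hw hzw
    rcases hcl z hz with hz' | ⟨θ, rfl⟩ <;> rcases hcl w hw with hw' | ⟨φ, rfl⟩
    · exact hbij.injOn hz' hw' hzw
    · have := hlt z hz'
      rw [hzw, hGb, norm_exp_ofReal_mul_I] at this
      exact absurd this (lt_irrefl _)
    · have := hlt w hw'
      rw [← hzw, hGb, norm_exp_ofReal_mul_I] at this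
      exact absurd this (lt_irrefl _)
    · rw [hGb, hGb, exp_eq_exp_iff_exists_int] at hzw
      obtain ⟨n, hn⟩ := hzw
      have h1 : fluxAngle γ ρ θ = fluxAngle γ ρ φ + n * (2 * π) := by
        have h2 : (fluxAngle γ ρ θ : ℂ) * I =
            ((fluxAngle γ ρ φ + n * (2 * π) : ℝ) : ℂ) * I := by
          rw [hn]; push_cast; ring
        exact_mod_cast mul_right_cancel₀ I_ne_zero h2
      have h3 : ∀ θ, fluxAngle γ ρ θ - θ = fluxAngle γ ρ (θ + n * (2 * π)) -
          (θ + n * (2 * π)) := by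
        have hper : Periodic (fun θ => fluxAngle γ ρ θ - θ) (2 * π) := fun θ => by
          simp only [hP.fluxAngle_add_period θ]; ring
        exact fun θ => (hper.int_mul n θ).symm
      have h4 : fluxAngle γ ρ θ = fluxAngle γ ρ (φ + n * (2 * π)) := by
        have := h3 φ; linarith
      rw [hα.injective h4]
      exact hP.curve.apply_add_int φ n
  have himg : G '' closure Ω = closedBall 0 1 := by
    refine Subset.antisymm ?_ fun ζ hζ => ?_
    · rintro _ ⟨z, hz, rfl⟩
      rw [mem_closedBall_zero_iff]
      rcases hcl z hz with hz' | ⟨θ, rfl⟩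
      · exact (hlt z hz').le
      · rw [hGb, norm_exp_ofReal_mul_I]
    · rw [mem_closedBall_zero_iff] at hζ
      rcases hζ.lt_or_eq with h1 | h1
      · obtain ⟨z, hz, hzζ⟩ := hbij.surjOn (mem_ball_zero_iff.2 h1)
        exact ⟨z, subset_closure hz, hzζ⟩
      · -- the boundary values cover the circle
        have h2 : fluxAngle γ ρ 0 = 0 := by simp [fluxAngle]
        have hsurj : Function.Surjective (fluxAngle γ ρ) := by
          have hper : ∀ (n : ℤ), fluxAngle γ ρ (n * (2 * π)) = n * (2 * π) := by
            intro n
            have hper : Periodic (fun θ => fluxAngle γ ρ θ - θ) (2 * π) :=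
              fun θ => by simp only [hP.fluxAngle_add_period θ]; ring
            have h3 : fluxAngle γ ρ (0 + n * (2 * π)) - (0 + n * (2 * π)) =
              fluxAngle γ ρ 0 - 0 := hper.int_mul n 0
            rw [h2, zero_add] at h3
            linarith
          intro y
          obtain ⟨n, hn⟩ := exists_nat_ge (|y| / (2 * π))
          rw [div_le_iff₀ (by positivity)] at hn
          have h4 := abs_le.1 hn
          have h5 := hper n
          have h6 := hper (-n)
          push_cast at h5 h6
          have := intermediate_value_uIcc hαc.continuousOn (a := -(n : ℝ) * (2 * π))
            (b := n * (2 * π))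
          rw [h5, h6] at this
          obtain ⟨x, -, hx⟩ := this (mem_uIcc.2 (Or.inl ⟨by linarith [h4.1], h4.2⟩) :
            y ∈ uIcc (-(n : ℝ) * (2 * π)) (n * (2 * π)))
          exact ⟨x, hx⟩
        obtain ⟨θ, hθ⟩ := hsurj (arg ζ)
        refine ⟨γ θ, hP.jordan.mem_closure θ, ?_⟩
        have := norm_mul_exp_arg_mul_I ζ
        rw [h1, ofReal_one, one_mul] at this
        rw [hGb, hθ, this]
  set a := invFunOn G (closure Ω) with ha
  have hleft : ∀ z ∈ closure Ω, a (G z) = z := fun z hz => hinj.leftInvOn_invFunOn hz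
  have hright : ∀ ζ ∈ closedBall (0 : ℂ) 1, G (a ζ) = ζ := fun ζ hζ =>
    Function.invFunOn_eq (himg ▸ hζ : ζ ∈ G '' closure Ω)
  have hac : ContinuousOn a (closedBall 0 1) := by
    rw [continuousOn_iff_isClosed]
    intro C hC
    refine ⟨G '' (closure Ω ∩ C), ?_, ?_⟩
    · exact ((hP.jordan.isCompact_closure.inter_right hC).image_of_continuousOn
        (hGc.mono inter_subset_left)).isClosed
    · ext ζ
      constructor
      · rintro ⟨hζC, hζ⟩
        exact ⟨⟨a ζ, ⟨Function.invFunOn_mem (himg ▸ hζ : ζ ∈ G '' closure Ω), hζC⟩,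
          hright ζ hζ⟩, hζ⟩
      · rintro ⟨⟨z, ⟨hz, hzC⟩, rfl⟩, hζ⟩
        exact ⟨by rw [mem_preimage, hleft z hz]; exact hzC, hζ⟩
  have hain : ∀ ζ ∈ ball (0 : ℂ) 1, a ζ ∈ Ω := by
    intro ζ hζ
    obtain ⟨z, hz, rfl⟩ := hbij.surjOn hζ
    rw [hleft z (subset_closure hz)]; exact hz
  have had : ∀ ζ ∈ ball (0 : ℂ) 1, HasDerivAt a (deriv G (a ζ))⁻¹ ζ := by
    intro ζ hζ
    have hnh := isOpen_ball.mem_nhds hζ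
    refine HasDerivAt.of_local_left_inverse (f := G)
      (hac.continuousAt (mem_of_superset hnh ball_subset_closedBall))
      (hG.differentiableAt (hP.jordan.isOpen.mem_nhds (hain ζ hζ))).hasDerivAt
      (hderiv _ (hain ζ hζ)) ?_
    filter_upwards [hnh] with ξ hξ
    exact hright ξ (ball_subset_closedBall hξ)
  refine ⟨a, G, fun ζ hζ => (had ζ hζ).differentiableAt.differentiableWithinAt, hac, hG,
    fun θ => ?_, ?_, ⟨hain, ?_, ?_⟩, ?_, fun ζ hζ => hright ζ (ball_subset_closedBall hζ),
    fun ζ hζ => ?_⟩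
  · rw [← hGb, hleft _ (hP.jordan.mem_closure θ)]
  · rw [← (hG0 0 hP.zero_mem).2 rfl, hleft _ (subset_closure hP.zero_mem)]
    exact ((hG0 0 hP.zero_mem).2 rfl).symm
  · intro ζ hζ ξ hξ h
    rw [← hright ζ (ball_subset_closedBall hζ), h,
      hright ξ (ball_subset_closedBall hξ)]
  · intro z hz
    exact ⟨G z, hbij.mapsTo hz, hleft z (subset_closure hz)⟩
  · intro ζ hζ ξ hξ h
    rw [← hright ζ hζ, h, hright ξ hξ]
  · rw [(had ζ hζ).deriv]
    exact inv_ne_zero (hderiv _ (hain ζ hζ))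

end HasPressureFlux

/-! ### The Wirtinger derivative -/

section Wirtinger

variable {U : Set ℂ} {φ : ℂ → ℝ}

theorem contDiffOn_wirtinger (hU : IsOpen U) (hφ : ContDiffOn ℝ ∞ φ U) :
    ContDiffOn ℝ ∞ (wirtinger φ) U := by
  have h1 : ContDiffOn ℝ ∞ (fderiv ℝ φ) U := hφ.fderiv_of_isOpen hU (by simp)
  have h2 : ∀ c : ℂ, ContDiffOn ℝ ∞ (fun z => ((fderiv ℝ φ z c : ℝ) : ℂ)) U := fun c =>
    ofRealCLM.contDiff.comp_contDiffOn (h1.clm_apply contDiffOn_const)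
  exact ((h2 1).sub (contDiffOn_const.mul (h2 I))).div_const 2

theorem contDiffOn_laplacian (hU : IsOpen U) (hφ : ContDiffOn ℝ ∞ φ U) :
    ContDiffOn ℝ ∞ (laplacian φ) U := by
  have h1 : ContDiffOn ℝ ∞ (fderiv ℝ (fderiv ℝ φ)) U :=
    (hφ.fderiv_of_isOpen (m := ∞) hU (by simp)).fderiv_of_isOpen hU (by simp)
  rw [InnerProductSpace.laplacian_eq_iteratedFDeriv_complexPlane]
  simp only [iteratedFDeriv_two_apply]
  exact ((h1.clm_apply contDiffOn_const).clm_apply contDiffOn_const).add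
    ((h1.clm_apply contDiffOn_const).clm_apply contDiffOn_const)

/-- The exterior derivative of the form `(∂φ/∂z) dz`: since `∂²φ / ∂z∂z̄ = Δφ / 4`, it is
`(i / 2) Δφ dx ∧ dy`. -/
theorem fderiv_wirtinger_antisymm (hU : IsOpen U) (hφ : ContDiffOn ℝ ∞ φ U) {z : ℂ} (hz : z ∈ U)
    (u v : ℂ) : fderiv ℝ (wirtinger φ) z u * v - fderiv ℝ (wirtinger φ) z v * u =
      I / 2 * ((laplacian φ z * (starRingEnd ℂ u * v).im : ℝ) : ℂ) := by
  have h1 : ContDiffOn ℝ ∞ (fderiv ℝ φ) U := hφ.fderiv_of_isOpen hU (by simp)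
  have h2 : HasFDerivAt (fderiv ℝ φ) (fderiv ℝ (fderiv ℝ φ) z) z :=
    ((h1.differentiableOn (by simp)).differentiableAt (hU.mem_nhds hz)).hasFDerivAt
  set D := fderiv ℝ (fderiv ℝ φ) z with hD
  have h3 : ∀ c : ℂ, HasFDerivAt (fun w => ((fderiv ℝ φ w c : ℝ) : ℂ))
      (ofRealCLM.comp (D.flip c)) z := fun c => by
    have := h2.clm_apply (hasFDerivAt_const c z)
    refine ofRealCLM.hasFDerivAt.comp z (this.congr_fderiv ?_)
    ext w; simp
  have h4 : ∀ c : ℂ, fderiv ℝ (wirtinger φ) z c = ((D c 1 : ℝ) - I * (D c I : ℝ)) / 2 := by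
    intro c
    have h5 := ((h3 1).sub ((h3 I).const_mul I)).mul_const (2 : ℂ)⁻¹
    have h6 : HasFDerivAt (wirtinger φ) _ z := h5
    rw [h6.fderiv]
    simp [div_eq_inv_mul]
  have hsymm : D 1 I = D I 1 := by
    have h7 : IsSymmSndFDerivAt ℝ φ z :=
      (hφ.contDiffAt (hU.mem_nhds hz)).isSymmSndFDerivAt (by
        rw [minSmoothness_of_isRCLikeNormedField]; 
        exact WithTop.coe_le_coe.2 (le_top : (2 : ℕ∞) ≤ ⊤))
    exact h7 1 I
  have h8 : ∀ c d : ℂ, D c d = c.re * D 1 d + c.im * D I d := by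
    intro c d
    have : c = c.re • (1 : ℂ) + c.im • I := by
      apply Complex.ext <;> simp
    calc D c d = D (c.re • (1 : ℂ) + c.im • I) d := by rw [← this]
      _ = _ := by rw [map_add, map_smul, map_smul]; simp
  have hL : laplacian φ z = D 1 1 + D I I := by
    rw [InnerProductSpace.laplacian_eq_iteratedFDeriv_complexPlane]
    simp [iteratedFDeriv_two_apply, hD]
  rw [h4, h4, h8 u, h8 u, h8 v, h8 v, hL, hsymm]
  apply Complex.ext
  · simp
    ring
  · simp
    ring

end Wirtinger

/-! ### Quotients as maps to the Riemann sphere -/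

open Classical in
/-- The point `b / d` of the Riemann sphere, which is `∞` for `d = 0`. -/
def sphereQuot (b d : ℂ) : OnePoint ℂ := if d = 0 then OnePoint.infty else ((b / d : ℂ) : OnePoint ℂ)

theorem sphereQuot_zero (b : ℂ) : sphereQuot b 0 = OnePoint.infty := by simp [sphereQuot]

theorem sphereQuot_of_ne {b d : ℂ} (h : d ≠ 0) : sphereQuot b d = ((b / d : ℂ) : OnePoint ℂ) := by
  simp [sphereQuot, h]

theorem sphereQuot_eq_infty {b d : ℂ} : sphereQuot b d = OnePoint.infty ↔ d = 0 := by
  by_cases h : d = 0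
  · simp [sphereQuot, h]
  · simp [sphereQuot, h]

theorem sphereChartZero_coe (z : ℂ) : sphereChartZero (z : OnePoint ℂ) = z := rfl

theorem sphereChartInfty_coe (z : ℂ) : sphereChartInfty (z : OnePoint ℂ) = z⁻¹ := rfl

theorem sphereChartInfty_infty : sphereChartInfty OnePoint.infty = 0 := rfl

theorem sphereChartInfty_sphereQuot (b d : ℂ) : sphereChartInfty (sphereQuot b d) = d / b := by
  by_cases h : d = 0
  · rw [h, sphereQuot_zero, sphereChartInfty_infty, zero_div]
  · rw [sphereQuot_of_ne h, sphereChartInfty_coe, inv_div]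

theorem continuousWithinAt_sphereQuot {E : Type*} [TopologicalSpace E] {b d : E → ℂ} {s : Set E}
    {x : E} (hb : ContinuousWithinAt b s x) (hd : ContinuousWithinAt d s x)
    (h : b x ≠ 0 ∨ d x ≠ 0) : ContinuousWithinAt (fun y => sphereQuot (b y) (d y)) s x := by
  by_cases hdx : d x = 0
  · have hbx : b x ≠ 0 := h.resolve_right (not_not.2 hdx)
    rw [ContinuousWithinAt, hdx, sphereQuot_zero]
    -- away from the zeros of `d`, the quotient tends to infinity
    have h1 : Tendsto (fun y => b y / d y) (𝓝[s] x ⊓ 𝓟 {y | d y ≠ 0}) (Bornology.cobounded ℂ) := by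
      have h2 : Tendsto d (𝓝[s] x ⊓ 𝓟 {y | d y ≠ 0}) (𝓝[≠] 0) := by
        refine tendsto_nhdsWithin_iff.2 ⟨?_, ?_⟩
        · rw [← hdx]; exact hd.mono_left inf_le_left
        · exact eventually_inf_principal.2 (Eventually.of_forall fun y hy => hy)
      have h3 := tendsto_inv₀_nhdsNE_zero.comp h2
      rw [← tendsto_norm_atTop_iff_cobounded] at h3 ⊢
      have h4 := Tendsto.pos_mul_atTop (norm_pos_iff.2 hbx)
        ((hb.mono_left (inf_le_left (b := 𝓟 {y | d y ≠ 0}))).norm) h3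
      simpa [div_eq_mul_inv, Function.comp_def] using h4
    rw [Metric.cobounded_eq_cocompact, ← coclosedCompact_eq_cocompact] at h1
    have h5 := OnePoint.tendsto_coe_infty.comp h1
    intro V hV
    have h6 : ∀ᶠ y in 𝓝[s] x, d y ≠ 0 → ((b y / d y : ℂ) : OnePoint ℂ) ∈ V :=
      eventually_inf_principal.1 (h5.eventually hV)
    change ∀ᶠ y in 𝓝[s] x, sphereQuot (b y) (d y) ∈ V
    filter_upwards [h6] with y hy
    by_cases hdy : d y = 0
    · rw [hdy, sphereQuot_zero]; exact mem_of_mem_nhds hV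
    · rw [sphereQuot_of_ne hdy]; exact hy hdy
  · have h1 : ContinuousWithinAt (fun y => ((b y / d y : ℂ) : OnePoint ℂ)) s x :=
      OnePoint.continuous_coe.continuousAt.comp_continuousWithinAt (hb.div hd hdx)
    refine h1.congr_of_eventuallyEq ?_ (sphereQuot_of_ne hdx)
    filter_upwards [hd.eventually_ne hdx] with y hy
    exact sphereQuot_of_ne hy

theorem sphereSmoothOn_sphereQuot {E : Type*} [NormedAddCommGroup E] [NormedSpace ℝ E]
    {b d : E → ℂ} {s : Set E} (hb : ContDiffOn ℝ ∞ b s) (hd : ContDiffOn ℝ ∞ d s)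
    (h : ∀ x ∈ s, b x ≠ 0 ∨ d x ≠ 0) : SphereSmoothOn (fun y => sphereQuot (b y) (d y)) s := by
  refine ⟨fun x hx => continuousWithinAt_sphereQuot (hb.continuousOn x hx)
    (hd.continuousOn x hx) (h x hx), fun x hx => ⟨fun h1 => ?_, fun h1 => ?_⟩⟩
  · have hdx : d x ≠ 0 := fun h' => h1 (sphereQuot_eq_infty.2 h')
    refine ((hb x hx).mul ((hd x hx).inv hdx)).congr_of_eventuallyEq ?_ ?_
    · filter_upwards [(hd.continuousOn x hx).eventually_ne hdx] with y hy
      rw [sphereQuot_of_ne hy, sphereChartZero_coe, div_eq_mul_inv, Pi.inv_apply]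
    · simp only [sphereQuot_of_ne hdx, sphereChartZero_coe, div_eq_mul_inv, Pi.inv_apply]
  · have hbx : b x ≠ 0 := by
      intro hbx
      have hdx := (h x hx).resolve_left (not_not.2 hbx)
      exact h1 (show sphereQuot (b x) (d x) = _ by rw [hbx, sphereQuot_of_ne hdx, zero_div])
    simp only [sphereChartInfty_sphereQuot, div_eq_mul_inv]
    exact (hd x hx).mul ((hb x hx).inv hbx)

theorem sphereHolomorphicOn_sphereQuot {b d : ℂ → ℂ} {s : Set ℂ} (hs : IsOpen s)
    (hb : DifferentiableOn ℂ b s) (hd : DifferentiableOn ℂ d s)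
    (h : ∀ x ∈ s, b x ≠ 0 ∨ d x ≠ 0) : SphereHolomorphicOn (fun y => sphereQuot (b y) (d y)) s := by
  refine ⟨fun x hx => continuousWithinAt_sphereQuot (hb.continuousOn x hx)
    (hd.continuousOn x hx) (h x hx), fun x hx => ?_⟩
  have hbx' := hb.differentiableAt (hs.mem_nhds hx)
  have hdx' := hd.differentiableAt (hs.mem_nhds hx)
  refine ⟨fun h1 => ?_, fun h1 => ?_⟩
  · have hdx : d x ≠ 0 := fun h' => h1 (sphereQuot_eq_infty.2 h')
    refine (hbx'.div hdx' hdx).congr_of_eventuallyEq ?_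
    filter_upwards [hdx'.continuousAt.eventually_ne hdx] with y hy
    rw [sphereQuot_of_ne hy, sphereChartZero_coe, Pi.div_apply]
  · have hbx : b x ≠ 0 := by
      intro hbx
      have hdx := (h x hx).resolve_left (not_not.2 hbx)
      exact h1 (show sphereQuot (b x) (d x) = _ by rw [hbx, sphereQuot_of_ne hdx, zero_div])
    simp only [sphereChartInfty_sphereQuot]
    exact hdx'.div hbx' hbx

/-! ### A criterion for admissible discs -/

theorem closure_image_ball {X : Type*} [TopologicalSpace X] [T2Space X] {f : ℂ → X}
    (hf : ContinuousOn f (closedBall 0 1)) :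
    closure (f '' ball 0 1) = f '' closedBall 0 1 := by
  refine Subset.antisymm (closure_minimal (image_mono ball_subset_closedBall)
    ((isCompact_closedBall 0 1).image_of_continuousOn hf).isClosed) ?_
  rw [← closure_ball (0 : ℂ) one_ne_zero] at hf ⊢
  exact hf.image_closure

theorem uniqueDiffOn_closedBall : UniqueDiffOn ℝ (closedBall (0 : ℂ) 1) :=
  uniqueDiffOn_convex (convex_closedBall 0 1) (by rw [interior_closedBall _ one_ne_zero]; simp)

section Disc

variable {U : Set ℂ} {φ : ℂ → ℝ} {A B G : ℂ → ℂ}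

/-- The disc parametrized by `A` in the first factor and by `B ζ / ζ` in the second one. -/
def quotDisc (A B : ℂ → ℂ) (ζ : ℂ) : ℂ × OnePoint ℂ := (A ζ, sphereQuot (B ζ) ζ)

theorem discShadow_quotDisc (A B : ℂ → ℂ) :
    discShadow (quotDisc A B) = A '' ball 0 1 := by
  rw [discShadow, discImage, image_image]; rfl

theorem isAdmissibleDisc_quotDisc
    (hA : ContDiffOn ℝ ∞ A (closedBall 0 1)) (hB : ContDiffOn ℝ ∞ B (closedBall 0 1))
    (hAd : DifferentiableOn ℂ A (ball 0 1)) (hBd : DifferentiableOn ℂ B (ball 0 1))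
    (hinj : InjOn A (closedBall 0 1)) (hA0 : A 0 = 0) (hB0 : B 0 ≠ 0)
    (hreg : ∀ ζ ∈ closedBall (0 : ℂ) 1, ∃ d ≠ 0,
      HasDerivWithinAt A d (closedBall 0 1) ζ)
    (hbd : ∀ ζ ∈ sphere (0 : ℂ) 1, A ζ ∈ U ∧ B ζ / ζ = wirtinger φ (A ζ))
    (hG : DifferentiableOn ℂ G (A '' ball 0 1))
    (hGA : ∀ ζ ∈ ball (0 : ℂ) 1, G (A ζ) = ζ) :
    IsAdmissibleDisc U φ (quotDisc A B) := by
  have hne : ∀ ζ : ℂ, B ζ ≠ 0 ∨ ζ ≠ 0 := fun ζ => by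
    by_cases h : ζ = 0
    · exact Or.inl (h ▸ hB0)
    · exact Or.inr h
  have hsm : SphereSmoothOn (fun ζ => (quotDisc A B ζ).2) (closedBall 0 1) :=
    sphereSmoothOn_sphereQuot hB contDiffOn_id fun ζ _ => hne ζ
  have hcont : ContinuousOn (quotDisc A B) (closedBall 0 1) :=
    hA.continuousOn.prodMk hsm.1
  have hcl : closure (discImage (quotDisc A B)) = quotDisc A B '' closedBall 0 1 :=
    closure_image_ball hcont
  have h0 : quotDisc A B 0 = ((0 : ℂ), OnePoint.infty) := by
    rw [quotDisc, hA0, sphereQuot_zero]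
  have hmem0 : (0 : ℂ) ∈ closedBall (0 : ℂ) 1 := mem_closedBall_self zero_le_one
  refine
    { disc := ⟨hA, hsm, hAd, sphereHolomorphicOn_sphereQuot isOpen_ball hBd
        differentiableOn_id fun ζ _ => hne ζ, ?_, ?_⟩
      isom := ⟨G, by rwa [discShadow_quotDisc], hGA⟩
      boundary := ?_
      meets_fibre := ?_
      meets_infty := ?_
      transversal := ?_ }
  · intro ζ hζ ξ hξ h
    exact hinj hζ hξ (congrArg Prod.fst h)
  · intro ζ hζ
    obtain ⟨d, hd, hd'⟩ := hreg ζ hζ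
    refine Or.inl fun h => hd ?_
    have h1 := (hd'.hasFDerivWithinAt.restrictScalars ℝ).fderivWithin
      (uniqueDiffOn_closedBall ζ hζ)
    have h2 := congrArg (fun L : ℂ →L[ℝ] ℂ => L 1) (h1.symm.trans h)
    simpa using h2
  · rintro _ ⟨ζ, hζ, rfl⟩
    obtain ⟨h1, h2⟩ := hbd ζ hζ
    have hζ0 : ζ ≠ 0 := Metric.ne_of_mem_sphere hζ one_ne_zero
    exact ⟨A ζ, h1, by rw [quotDisc, sphereQuot_of_ne hζ0, h2]⟩
  · rw [hcl]
    refine Subset.antisymm ?_ ?_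
    · rintro _ ⟨⟨ζ, hζ, rfl⟩, h⟩
      have : ζ = 0 := hinj hζ hmem0 (by rw [hA0]; exact h)
      rw [this, h0]; rfl
    · rintro _ rfl
      exact ⟨⟨0, hmem0, h0⟩, rfl⟩
  · rw [hcl]
    refine Subset.antisymm ?_ ?_
    · rintro _ ⟨⟨ζ, hζ, rfl⟩, h⟩
      have : ζ = 0 := sphereQuot_eq_infty.1 h
      rw [this, h0]; rfl
    · rintro _ rfl
      exact ⟨⟨0, hmem0, h0⟩, rfl⟩
  · intro ζ hζ h
    have hζ0 : ζ = 0 := sphereQuot_eq_infty.1 h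
    subst hζ0
    simp only [quotDisc, sphereChartInfty_sphereQuot]
    have h1 := (hasDerivAt_id (0 : ℂ)).div
      (hBd.differentiableAt (isOpen_ball.mem_nhds hζ)).hasDerivAt hB0
    have h2 : HasDerivAt (fun y => y / B y) _ 0 := h1
    rw [h2.deriv]
    simp [hB0]

end Disc

/-! ### Hele-Shaw flows in terms of the flux of the pressure -/

section Orientation

variable {Ω : Set ℂ} {γ : ℝ → ℂ} {p : ℂ → ℝ} {vel : ℝ → ℂ} {κ : ℂ → ℝ}

/-- The boundary conditions of the Hele-Shaw flow at one time, for the velocity `vel`. -/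
def HasDarcyVelocity (κ : ℂ → ℝ) (Ω : Set ℂ) (γ : ℝ → ℂ) (p : ℂ → ℝ) (vel : ℝ → ℂ) : Prop :=
  ∀ θ : ℝ, ∃ n g : ℂ, IsOutwardNormal Ω γ θ n ∧ HasGradientWithinAt p g (closure Ω) (γ θ) ∧
    (inner ℝ (vel θ) n : ℝ) • n = -(κ (γ θ) • g)

theorem IsJordanParam.comp_neg (h : IsJordanParam Ω γ) : IsJordanParam Ω (fun θ => γ (-θ)) := by
  have h0 := h.isSimpleClosedCurve
  refine ⟨h.smooth.comp contDiff_neg, fun θ => ?_, fun θ hθ φ hφ he => ?_, fun θ => ?_,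
    h.isOpen, h.isConnected, h.bounded, ?_⟩
  · rw [neg_add, ← sub_eq_add_neg]; exact h.periodic.sub_eq _
  · obtain ⟨k, hk⟩ := h0.eq_iff he
    exact (eq_of_eq_add_int_mul hφ hθ (k := k) (by linarith)).symm
  · have := (h0.hasDerivAt (-θ)).scomp θ (hasDerivAt_neg θ)
    have h1 : HasDerivAt (fun θ => γ (-θ)) _ θ := this
    rw [h1.deriv]
    simpa using h.regular (-θ)
  · rw [h.frontier_eq]
    ext z
    constructor
    · rintro ⟨θ, rfl⟩; exact ⟨-θ, by simp⟩
    · rintro ⟨θ, rfl⟩; exact ⟨-θ, rfl⟩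

theorem IsSimpleClosedCurve.deriv_comp_neg (h : IsSimpleClosedCurve γ) (θ : ℝ) :
    deriv (fun θ => γ (-θ)) θ = -deriv γ (-θ) := by
  have h1 : HasDerivAt (fun θ => γ (-θ)) _ θ := (h.hasDerivAt (-θ)).scomp θ (hasDerivAt_neg θ)
  rw [h1.deriv]; simp

theorem IsSimpleClosedCurve.rightNormal_comp_neg (h : IsSimpleClosedCurve γ) (θ : ℝ) :
    rightNormal (fun θ => γ (-θ)) θ = -rightNormal γ (-θ) := by
  rw [rightNormal, rightNormal, h.deriv_comp_neg, norm_neg]; ring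

theorem IsOutwardNormal.eq_or_eq_neg (h0 : IsSimpleClosedCurve γ) {θ : ℝ} {n : ℂ}
    (hn : IsOutwardNormal Ω γ θ n) : n = rightNormal γ θ ∨ n = -rightNormal γ θ := by
  set d := deriv γ θ with hd
  have hd0 : (‖d‖ : ℂ) ≠ 0 := by simpa using h0.regular θ
  have h1 : (d * starRingEnd ℂ n).re = 0 := by rw [← Complex.inner]; exact hn.normal
  set y := (d * starRingEnd ℂ n).im with hy
  have h2 : d * starRingEnd ℂ n = y * I := by
    apply Complex.ext <;> simp [h1, hy]
  have h3 : starRingEnd ℂ n * n = 1 := by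
    rw [← normSq_eq_conj_mul_self, normSq_eq_norm_sq, hn.unit]; simp
  have h4 : d = y * I * n := by rw [← h2, mul_assoc, h3, mul_one]
  have h5 : |y| = ‖d‖ := by
    rw [h4, norm_mul, norm_mul, hn.unit, norm_I, norm_real, Real.norm_eq_abs]; ring
  have h6 : rightNormal γ θ = (y / ‖d‖ : ℂ) * n := by
    rw [rightNormal, ← hd]
    nth_rewrite 1 [h4]
    linear_combination (-(y / ‖d‖ : ℂ) * n) * I_sq
  rcases abs_eq (norm_nonneg d) |>.1 h5 with h7 | h7
  · left; rw [h6, h7, div_self hd0, one_mul]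
  · right; rw [h6, h7]; push_cast; rw [neg_div, div_self hd0]; ring

theorem HasGradientWithinAt.exists_hasFDerivWithinAt {s : Set ℂ} {z g : ℂ}
    (hg : HasGradientWithinAt p g s z) :
    ∃ L : ℂ →L[ℝ] ℝ, (∀ v, L v = inner ℝ g v) ∧ HasFDerivWithinAt p L s z :=
  ⟨_, fun _ => InnerProductSpace.toDual_apply_apply, hg.hasFDerivWithinAt⟩

theorem HasDerivWithinAt.tendsto_quotient {f : ℝ → ℝ} {l δ : ℝ} (hδ : 0 < δ)
    (h : HasDerivWithinAt f l (Icc 0 δ) 0) :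
    Tendsto (fun x : ℝ => (f x - f 0) / x) (𝓝[>] 0) (𝓝 l) := by
  have h1 : HasDerivWithinAt f l (Ioi 0) 0 :=
    h.mono_of_mem_nhdsWithin (mem_of_superset (Ioc_mem_nhdsGT hδ) Ioc_subset_Icc_self)
  have e : (fun x : ℝ => (f x - f 0) / x) = slope f 0 := by
    funext x
    rw [slope_def_field, sub_zero]
  rw [e]
  exact (hasDerivWithinAt_iff_tendsto_slope' self_notMem_Ioi).1 h1

theorem HasGradientWithinAt.tendsto_slope_of_segment {s : Set ℂ} {z g ν : ℂ} {δ : ℝ}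
    (hg : HasGradientWithinAt p g s z) (hδ : 0 < δ)
    (hs : ∀ x ∈ Icc 0 δ, z - ((x : ℝ) : ℂ) * ν ∈ s) :
    Tendsto (fun x : ℝ => (p (z - (x : ℂ) * ν) - p z) / x) (𝓝[>] 0) (𝓝 (-inner ℝ g ν)) := by
  obtain ⟨L, hL, h2⟩ := hg.exists_hasFDerivWithinAt
  have h1 : HasDerivAt (fun x : ℝ => z - (x : ℂ) * ν) (-ν) 0 :=
    (((ofRealCLM.hasDerivAt (x := 0)).mul_const ν).const_sub z).congr_deriv (by simp)
  have h0 : z - ((0 : ℝ) : ℂ) * ν = z := by simp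
  rw [← h0] at h2
  have h3 : HasDerivWithinAt (p ∘ fun x : ℝ => z - (x : ℂ) * ν) (L (-ν)) (Icc 0 δ) 0 :=
    HasFDerivWithinAt.comp_hasDerivWithinAt (f := fun x : ℝ => z - (x : ℂ) * ν) (0 : ℝ) h2
      h1.hasDerivWithinAt hs
  have h4 := h3.tendsto_quotient hδ
  rw [hL, inner_neg_right] at h4
  refine h4.congr fun x => ?_
  rw [comp_apply, comp_apply, h0]

theorem HasDarcyVelocity.hasPressureFlux (hv : HasDarcyVelocity κ Ω γ p vel)
    (h : IsJordanParam Ω γ) (hp : IsPressure Ω p) (h0 : (0 : ℂ) ∈ Ω) (hκ : ∀ θ, 0 < κ (γ θ))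
    {θ₀ : ℝ} (hor : IsOutwardNormal Ω γ θ₀ (rightNormal γ θ₀))
    (hc : Continuous fun θ => (κ (γ θ))⁻¹ * inner ℝ (vel θ) (rightNormal γ θ))
    (hper : Periodic (fun θ => (κ (γ θ))⁻¹ * inner ℝ (vel θ) (rightNormal γ θ))
      (2 * π)) :
    ∃ δ, HasPressureFlux Ω γ δ p fun θ => (κ (γ θ))⁻¹ * inner ℝ (vel θ) (rightNormal γ θ) := by
  have hs := h.isSimpleClosedCurve
  obtain ⟨δ, hδ⟩ := h.exists_isLeftCollar (hor.outward.mono fun _ hs => hs.1).frequently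
    (hor.outward.mono fun _ hs => hs.2).frequently
  refine ⟨δ, h, hδ, h0, hp, hc, hper, fun θ => ?_⟩
  obtain ⟨n, g, hn, hg, hV⟩ := hv θ
  set ν := rightNormal γ θ with hν
  have hnν : n = ν := by
    refine (hn.eq_or_eq_neg hs).resolve_right fun h' => ?_
    obtain ⟨s, hs1, hs2⟩ := (hn.outward.and (Ioc_mem_nhdsGT hδ.pos)).exists
    have h3 := hs1.1
    rw [h', mul_neg, sub_neg_eq_add] at h3
    exact hδ.outside θ s hs2 (subset_closure h3)
  rw [hnν] at hV
  have hk := hκ θ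
  have h1 : (κ (γ θ))⁻¹ * inner ℝ (vel θ) ν = -inner ℝ g ν := by
    have h2 := congrArg (fun x => inner ℝ x ν) hV
    simp only [inner_neg_left, real_inner_smul_left, real_inner_self_eq_norm_sq] at h2
    rw [hν, hs.norm_rightNormal, ← hν] at h2
    field_simp
    linarith
  rw [h1]
  have h5 : p (γ θ) = 0 := hp.boundary _ (by rw [h.frontier_eq]; exact mem_range_self θ)
  have h4 := hg.tendsto_slope_of_segment (ν := ν) hδ.pos (fun s hs => by
    rcases hs.1.eq_or_lt with h' | h'
    · rw [← h']; simpa using h.mem_closure θ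
    · exact subset_closure (hδ.inside θ s ⟨h', hs.2⟩))
  rw [h5] at h4
  simpa only [sub_zero] using h4

theorem HasDarcyVelocity.comp_neg (hv : HasDarcyVelocity κ Ω γ p vel)
    (hs : IsSimpleClosedCurve γ) :
    HasDarcyVelocity κ Ω (fun θ => γ (-θ)) p (fun θ => vel (-θ)) := by
  intro θ
  obtain ⟨n, g, hn, hg, hV⟩ := hv (-θ)
  exact ⟨n, g, ⟨hn.unit, by rw [hs.deriv_comp_neg, inner_neg_right, hn.normal, neg_zero],
    hn.outward⟩, hg, hV⟩

end Orientation

section Flow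

variable {J : Set ℝ} {Ω : ℝ → Set ℂ} {U : Set ℂ} {φ : ℂ → ℝ} {Γ : ℝ → ℝ → ℂ}

theorem IsSmoothJordanFamily.smoothPeriodic (h : IsSmoothJordanFamily J Ω Γ) :
    SmoothPeriodic J Γ := ⟨h.smooth, fun t ht => (h.jordan t ht).periodic⟩

theorem IsSmoothJordanFamily.comp_neg (h : IsSmoothJordanFamily J Ω Γ) :
    IsSmoothJordanFamily J Ω (fun t θ => Γ t (-θ)) := by
  refine ⟨?_, fun t ht => (h.jordan t ht).comp_neg⟩
  exact ContDiffOn.comp (g := fun q : ℝ × ℝ => Γ q.1 q.2) (f := fun q : ℝ × ℝ => (q.1, -q.2))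
    h.smooth (by fun_prop) (fun q hq => ⟨hq.1, mem_univ _⟩)

/-- The flux density that corresponds to the velocity of the boundary. -/
def flowFlux (J : Set ℝ) (φ : ℂ → ℝ) (Γ : ℝ → ℝ → ℂ) (t θ : ℝ) : ℝ :=
  laplacian φ (Γ t θ) * inner ℝ (timeDeriv J Γ t θ) (rightNormal (Γ t) θ)

theorem continuous_flowFlux (hU : IsOpen U) (hφ : ContDiffOn ℝ ∞ φ U) (hJ : J.OrdConnected)
    (hJ' : J.Nontrivial) (hΓ : IsSmoothJordanFamily J Ω Γ) (hΓU : ∀ t ∈ J, ∀ θ, Γ t θ ∈ U)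
    {t : ℝ} (ht : t ∈ J) : Continuous (flowFlux J φ Γ t) := by
  have h1 := (hΓ.smoothPeriodic.comp (contDiffOn_laplacian hU hφ) hΓU).smooth.contDiff ht
  have h2 := ((hΓ.smoothPeriodic.timeDeriv hJ hJ').smooth.contDiff ht).continuous
  exact h1.continuous.mul (h2.inner (hΓ.jordan t ht).isSimpleClosedCurve.continuous_rightNormal)

theorem periodic_flowFlux (hJ : J.OrdConnected) (hJ' : J.Nontrivial)
    (hΓ : IsSmoothJordanFamily J Ω Γ) {t : ℝ} (ht : t ∈ J) :
    Periodic (flowFlux J φ Γ t) (2 * π) := fun θ => by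
  have h1 := (hΓ.smoothPeriodic.timeDeriv hJ hJ').periodic t ht θ
  have h2 := (hΓ.jordan t ht).isSimpleClosedCurve
  rw [flowFlux, flowFlux, h1, h2.periodic θ, rightNormal, rightNormal, h2.deriv_periodic θ]

theorem continuousOn_inner_rightNormal (hJ : J.OrdConnected)
    (hJ' : J.Nontrivial) (hΓ : IsSmoothJordanFamily J Ω Γ) (θ : ℝ) :
    ContinuousOn (fun t => inner ℝ (timeDeriv J Γ t θ) (rightNormal (Γ t) θ)) J := by
  have hs := hΓ.smoothPeriodic.smooth
  have hm : ContinuousOn (fun t : ℝ => (t, θ)) J := by fun_prop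
  have h1 : ContinuousOn (fun t => timeDeriv J Γ t θ) J :=
    (hs.timeDeriv hJ hJ').continuousOn.comp hm (fun t ht => ⟨ht, mem_univ _⟩)
  have h2 : ContinuousOn (fun t => deriv (Γ t) θ) J :=
    (hs.angleDeriv hJ hJ').continuousOn.comp hm (fun t ht => ⟨ht, mem_univ _⟩)
  refine h1.inner (continuousOn_const.mul (h2.div
    (continuous_ofReal.comp_continuousOn h2.norm) fun t ht => ?_))
  simpa using (hΓ.jordan t ht).regular θ

/-- A Hele-Shaw flow has a positively oriented parametrization: the normal velocity has the sign
of the flux of the pressure, so the orientation cannot change with time. -/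
theorem IsHeleShawFlow.exists_positive_param (hU : IsOpen U) (hφ : ContDiffOn ℝ ∞ φ U)
    (hsub : ∀ z ∈ U, 0 < laplacian φ z) (hJ : J.OrdConnected) (hJ' : J.Nontrivial)
    (hflow : IsHeleShawFlow (fun z => 1 / laplacian φ z) J Ω)
    (hΩU : ∀ t ∈ J, frontier (Ω t) ⊆ U) :
    ∃ Γ : ℝ → ℝ → ℂ, IsSmoothJordanFamily J Ω Γ ∧
      ∀ t ∈ J, ∃ δ p, HasPressureFlux (Ω t) (Γ t) δ p (flowFlux J φ Γ t) := by
  obtain ⟨-, h0, Γ, hΓ, hdarcy⟩ := hflow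
  have hmem : ∀ Γ, IsSmoothJordanFamily J Ω Γ → ∀ t ∈ J, ∀ θ, Γ t θ ∈ U := fun Γ hΓ t ht θ =>
    hΩU t ht (by rw [(hΓ.jordan t ht).frontier_eq]; exact mem_range_self θ)
  set Γ' : ℝ → ℝ → ℂ := fun t θ => Γ t (-θ) with hΓ'
  have hΓ'f : IsSmoothJordanFamily J Ω Γ' := hΓ.comp_neg
  have hkey : ∀ Γ, IsSmoothJordanFamily J Ω Γ → ∀ t ∈ J, ∀ p, IsPressure (Ω t) p →
      HasDarcyVelocity (fun z => 1 / laplacian φ z) (Ω t) (Γ t) p (timeDeriv J Γ t) →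
      IsOutwardNormal (Ω t) (Γ t) 0 (rightNormal (Γ t) 0) →
      ∃ δ, HasPressureFlux (Ω t) (Γ t) δ p (flowFlux J φ Γ t) := by
    intro Γ hΓ t ht p hp hv hor
    have e : (fun θ => (1 / laplacian φ (Γ t θ))⁻¹ *
        inner ℝ (timeDeriv J Γ t θ) (rightNormal (Γ t) θ)) = flowFlux J φ Γ t := by
      funext θ; rw [flowFlux, one_div, inv_inv]
    have := hv.hasPressureFlux (hΓ.jordan t ht) hp (h0 t ht)
      (fun θ => one_div_pos.2 (hsub _ (hmem Γ hΓ t ht θ))) hor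
      (by rw [e]; exact continuous_flowFlux hU hφ hJ hJ' hΓ (hmem Γ hΓ) ht)
      (by rw [e]; exact periodic_flowFlux hJ hJ' hΓ ht)
    rwa [e] at this
  have hdich : ∀ t ∈ J, (∃ δ p, HasPressureFlux (Ω t) (Γ t) δ p (flowFlux J φ Γ t)) ∨
      (∃ δ p, HasPressureFlux (Ω t) (Γ' t) δ p (flowFlux J φ Γ' t)) := by
    intro t ht
    obtain ⟨p, hp, hv'⟩ := hdarcy t ht
    have hv : HasDarcyVelocity (fun z => 1 / laplacian φ z) (Ω t) (Γ t) p
      (timeDeriv J Γ t) := hv'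
    have hs := (hΓ.jordan t ht).isSimpleClosedCurve
    obtain ⟨n, g, hn, -, -⟩ := hv 0
    rcases hn.eq_or_eq_neg hs with h1 | h1
    · obtain ⟨δ, hδ⟩ := hkey Γ hΓ t ht p hp hv (h1 ▸ hn)
      exact Or.inl ⟨δ, p, hδ⟩
    · have h2 : rightNormal (Γ' t) 0 = n := by
        rw [hΓ', hs.rightNormal_comp_neg, neg_zero, h1]
      have hv'' : HasDarcyVelocity (fun z => 1 / laplacian φ z) (Ω t) (Γ' t) p
        (timeDeriv J Γ' t) := hv.comp_neg hs
      obtain ⟨δ, hδ⟩ := hkey Γ' hΓ'f t ht p hp hv'' (by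
        rw [h2]
        exact ⟨hn.unit, by rw [hΓ', hs.deriv_comp_neg, inner_neg_right, neg_zero, hn.normal,
          neg_zero], by simpa [hΓ'] using hn.outward⟩)
      exact Or.inr ⟨δ, p, hδ⟩
  -- the sign of the normal velocity at `θ = 0`
  set f : ℝ → ℝ := fun t => inner ℝ (timeDeriv J Γ t 0) (rightNormal (Γ t) 0) with hf
  have hfc : ContinuousOn f J := continuousOn_inner_rightNormal hJ hJ' hΓ 0
  have hpos : ∀ t ∈ J, (∃ δ p, HasPressureFlux (Ω t) (Γ t) δ p (flowFlux J φ Γ t)) → 0 < f t := by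
    rintro t ht ⟨δ, p, hP⟩
    exact pos_of_mul_pos_right (hP.flux_pos 0) (hsub _ (hmem Γ hΓ t ht 0)).le
  have hneg : ∀ t ∈ J, (∃ δ p, HasPressureFlux (Ω t) (Γ' t) δ p (flowFlux J φ Γ' t)) →
      f t < 0 := by
    rintro t ht ⟨δ, p, hP⟩
    have h1 := pos_of_mul_pos_right (hP.flux_pos 0) (hsub _ (hmem Γ' hΓ'f t ht 0)).le
    have h2 : timeDeriv J Γ' t 0 = timeDeriv J Γ t 0 := by
      simp only [timeDeriv, hΓ', neg_zero]
    rw [h2, hΓ', (hΓ.jordan t ht).isSimpleClosedCurve.rightNormal_comp_neg, neg_zero,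
      inner_neg_right] at h1
    simp only [hf]
    linarith
  by_cases hall : ∀ t ∈ J, ∃ δ p, HasPressureFlux (Ω t) (Γ t) δ p (flowFlux J φ Γ t)
  · exact ⟨Γ, hΓ, hall⟩
  · push Not at hall
    obtain ⟨t₁, ht₁, hno⟩ := hall
    have h1 : f t₁ < 0 := hneg t₁ ht₁ ((hdich t₁ ht₁).resolve_left (by
      rintro ⟨δ, p, hP⟩; exact hno δ p hP))
    refine ⟨Γ', hΓ'f, fun t ht => (hdich t ht).resolve_left fun h2 => ?_⟩
    have h3 := hpos t ht h2
    obtain ⟨τ, hτ, hτ0⟩ := hJ.isPreconnected.intermediate_value ht₁ ht hfc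
      (⟨h1.le, h3.le⟩ : (0 : ℝ) ∈ Icc (f t₁) (f t))
    rcases hdich τ hτ with h4 | h4
    · exact (hpos τ hτ h4).ne' hτ0
    · exact (hneg τ hτ h4).ne hτ0

end Flow

/-! ### Moments of a Hele-Shaw flow -/

section Wirtinger

variable {U : Set ℂ} {φ : ℂ → ℝ} {J : Set ℝ} {Γ : ℝ → ℝ → ℂ}

theorem SmoothOnStrip.wirtinger (hU : IsOpen U) (hφ : ContDiffOn ℝ ∞ φ U) (hΓ : SmoothOnStrip J Γ)
    (hm : ∀ t ∈ J, ∀ θ, Γ t θ ∈ U) : SmoothOnStrip J (fun t θ => wirtinger φ (Γ t θ)) :=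
  hΓ.comp (contDiffOn_wirtinger hU hφ) hm

theorem hasFDerivAt_wirtinger (hU : IsOpen U) (hφ : ContDiffOn ℝ ∞ φ U) {z : ℂ} (hz : z ∈ U) :
    HasFDerivAt (wirtinger φ) (fderiv ℝ (wirtinger φ) z) z :=
  (((contDiffOn_wirtinger hU hφ).contDiffAt (hU.mem_nhds hz)).differentiableAt (by simp)).hasFDerivAt

/-- The form `dw ∧ dz`, where `w = ∂φ/∂z`, is `Δφ` times the area form, up to a constant. -/
theorem SmoothOnStrip.wirtinger_antisymm (hU : IsOpen U) (hφ : ContDiffOn ℝ ∞ φ U)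
    (hJ : J.OrdConnected) (hJ' : J.Nontrivial) (hΓ : SmoothOnStrip J Γ)
    (hm : ∀ t ∈ J, ∀ θ, Γ t θ ∈ U) {t : ℝ} (ht : t ∈ J) (θ : ℝ) :
    _root_.timeDeriv J (fun t θ => _root_.wirtinger φ (Γ t θ)) t θ * _root_.angleDeriv Γ t θ -
      _root_.angleDeriv (fun t θ => _root_.wirtinger φ (Γ t θ)) t θ * _root_.timeDeriv J Γ t θ =
    I / 2 * ((laplacian φ (Γ t θ) *
      (starRingEnd ℂ (_root_.timeDeriv J Γ t θ) * _root_.angleDeriv Γ t θ).im : ℝ) : ℂ) := by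
  have hd := hasFDerivAt_wirtinger hU hφ (hm t ht θ)
  have h1 : _root_.timeDeriv J (fun t θ => _root_.wirtinger φ (Γ t θ)) t θ =
      fderiv ℝ (_root_.wirtinger φ) (Γ t θ) (_root_.timeDeriv J Γ t θ) :=
    timeDeriv_eq_of_hasDerivWithinAt hJ hJ' ht
      (HasFDerivAt.comp_hasDerivWithinAt (f := fun τ => Γ τ θ) t hd
        (hΓ.hasDerivWithinAt_time ht θ))
  have h2 : _root_.angleDeriv (fun t θ => _root_.wirtinger φ (Γ t θ)) t θ =
      fderiv ℝ (_root_.wirtinger φ) (Γ t θ) (_root_.angleDeriv Γ t θ) :=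
    (hd.comp_hasDerivAt θ (hΓ.hasDerivAt_angle ht θ)).deriv
  rw [h1, h2]
  exact fderiv_wirtinger_antisymm hU hφ (hm t ht θ) _ _

end Wirtinger

/-- A Hele-Shaw flow with permeability `1 / Δφ`, together with a positively oriented
parametrization `Γ` of the moving boundary. -/
structure IsOrientedFlow (U : Set ℂ) (φ : ℂ → ℝ) (J : Set ℝ) (Ω : ℝ → Set ℂ)
    (Γ : ℝ → ℝ → ℂ) : Prop where
  isOpen : IsOpen U
  smooth : ContDiffOn ℝ ∞ φ U
  ordConnected : J.OrdConnected
  nontrivial : J.Nontrivial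
  increasing : IsIncreasingFamily J Ω
  family : IsSmoothJordanFamily J Ω Γ
  mem : ∀ t ∈ J, ∀ θ, Γ t θ ∈ U
  flux : ∀ t ∈ J, ∃ δ p, HasPressureFlux (Ω t) (Γ t) δ p (flowFlux J φ Γ t)

/-- The moment function `∫ w dz / (z - ζ)` over the moving boundary, where `w = ∂φ/∂z`. -/
def momentFun (φ : ℂ → ℝ) (γ : ℝ → ℂ) : ℂ → ℂ :=
  cauchyInt γ (fun θ => wirtinger φ (γ θ) * deriv γ θ)

namespace IsOrientedFlow

variable {U : Set ℂ} {φ : ℂ → ℝ} {J : Set ℝ} {Ω : ℝ → Set ℂ} {Γ : ℝ → ℝ → ℂ}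

theorem smoothOnStrip (h : IsOrientedFlow U φ J Ω Γ) : SmoothOnStrip J Γ := h.family.smooth

theorem curve (h : IsOrientedFlow U φ J Ω Γ) {t : ℝ} (ht : t ∈ J) : IsSimpleClosedCurve (Γ t) :=
  (h.family.jordan t ht).isSimpleClosedCurve

theorem subset (h : IsOrientedFlow U φ J Ω Γ) {t t' : ℝ} (ht : t ∈ J) (ht' : t' ∈ J)
    (htt' : t ≤ t') : Ω t ⊆ Ω t' := by
  rcases htt'.eq_or_lt with rfl | h1
  · exact subset_rfl
  · exact (h.increasing t ht t' ht' h1).subset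

theorem density_flowFlux (h : IsOrientedFlow U φ J Ω Γ) {t : ℝ} (ht : t ∈ J) (θ : ℝ) :
    HasPressureFlux.density (Γ t) (flowFlux J φ Γ t) θ = laplacian φ (Γ t θ) *
      (starRingEnd ℂ (timeDeriv J Γ t θ) * angleDeriv Γ t θ).im := by
  have h1 := (h.curve ht).regular θ
  have h2 : (‖deriv (Γ t) θ‖ : ℂ) ≠ 0 := by simpa using h1
  have h3 : inner ℝ (timeDeriv J Γ t θ) (rightNormal (Γ t) θ) * ‖deriv (Γ t) θ‖ =
      (starRingEnd ℂ (timeDeriv J Γ t θ) * angleDeriv Γ t θ).im := by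
    rw [Complex.inner, ← re_mul_ofReal, rightNormal, angleDeriv]
    have e : -I * (deriv (Γ t) θ / ‖deriv (Γ t) θ‖) * starRingEnd ℂ (timeDeriv J Γ t θ) *
        (‖deriv (Γ t) θ‖ : ℂ) = -I * (starRingEnd ℂ (timeDeriv J Γ t θ) * deriv (Γ t) θ) := by
      field_simp
    rw [e]
    simp
  rw [HasPressureFlux.density, flowFlux, mul_assoc, h3]

/-- Outside the domain, the moment function moves as for a source at the origin. -/
theorem integral_rate_eq (h : IsOrientedFlow U φ J Ω Γ) {t : ℝ} (ht : t ∈ J) {z : ℂ}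
    (hz : z ∉ closure (Ω t)) :
    ∫ θ in (0 : ℝ)..(2 * π),
      ((timeDeriv J (fun t θ => wirtinger φ (Γ t θ)) t θ * angleDeriv Γ t θ +
        wirtinger φ (Γ t θ) * angleDeriv (timeDeriv J Γ) t θ) / (Γ t θ - z) -
        wirtinger φ (Γ t θ) * angleDeriv Γ t θ * timeDeriv J Γ t θ / (Γ t θ - z) ^ 2) =
      -I / (2 * z) := by
  have hj := h.family.jordan t ht
  have hzr : z ∉ range (Γ t) := fun ⟨θ, hθ⟩ => hz (hθ ▸ hj.mem_closure θ)
  have hne := IsSimpleClosedCurve.sub_ne_zero_of_notMem hzr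
  have hs := h.smoothOnStrip
  have hst := hs.timeDeriv h.ordConnected h.nontrivial
  have hw := hs.wirtinger h.isOpen h.smooth h.mem
  obtain ⟨δ, p, hP⟩ := h.flux t ht
  -- the total derivative which integrates to zero over the period
  have hV : ∀ θ, HasDerivAt (fun θ => wirtinger φ (Γ t θ) * timeDeriv J Γ t θ / (Γ t θ - z))
      ((angleDeriv (fun t θ => wirtinger φ (Γ t θ)) t θ * timeDeriv J Γ t θ +
        wirtinger φ (Γ t θ) * angleDeriv (timeDeriv J Γ) t θ) / (Γ t θ - z) -
        wirtinger φ (Γ t θ) * angleDeriv Γ t θ * timeDeriv J Γ t θ / (Γ t θ - z) ^ 2) θ := by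
    intro θ
    refine (((hw.hasDerivAt_angle ht θ).mul (hst.hasDerivAt_angle ht θ)).div
      ((hs.hasDerivAt_angle ht θ).sub_const z) (hne θ)).congr_deriv ?_
    have := hne θ
    simp only [Pi.mul_apply]
    field_simp
  have c1 := (hs.contDiff ht).continuous
  have c2 := (hst.contDiff ht).continuous
  have c3 := (hw.contDiff ht).continuous
  have c4 : Continuous (angleDeriv (fun t θ => wirtinger φ (Γ t θ)) t) :=
    ((hw.angleDeriv h.ordConnected h.nontrivial).contDiff ht).continuous
  have c5 : Continuous (angleDeriv Γ t) :=
    ((hs.angleDeriv h.ordConnected h.nontrivial).contDiff ht).continuous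
  have c6 : Continuous (angleDeriv (timeDeriv J Γ) t) :=
    ((hst.angleDeriv h.ordConnected h.nontrivial).contDiff ht).continuous
  have cV : Continuous fun θ =>
      ((angleDeriv (fun t θ => wirtinger φ (Γ t θ)) t θ * timeDeriv J Γ t θ +
        wirtinger φ (Γ t θ) * angleDeriv (timeDeriv J Γ) t θ) / (Γ t θ - z) -
        wirtinger φ (Γ t θ) * angleDeriv Γ t θ * timeDeriv J Γ t θ / (Γ t θ - z) ^ 2) := by
    refine ((((c4.mul c2).add (c3.mul c6)).div (c1.sub continuous_const) hne).sub
      (((c3.mul c5).mul c2).div ((c1.sub continuous_const).pow 2) fun θ => pow_ne_zero 2 (hne θ)))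
  have hI := integral_eq_sub_of_hasDerivAt (a := 0) (b := 2 * π)
    (fun θ _ => hV θ) (cV.intervalIntegrable _ _)
  have hp1 := h.family.smoothPeriodic.at_two_pi ht
  have hp2 := (h.family.smoothPeriodic.timeDeriv h.ordConnected h.nontrivial).at_two_pi ht
  rw [hp1, hp2, sub_self] at hI
  have hD : Continuous fun θ => I / 2 *
      ((HasPressureFlux.density (Γ t) (flowFlux J φ Γ t) θ : ℂ) / (Γ t θ - z)) :=
    continuous_const.mul ((continuous_ofReal.comp hP.continuous_density).div
      (c1.sub continuous_const) hne)
  have hsum : (-I / (2 * z) : ℂ) = ∫ θ in (0 : ℝ)..(2 * π), (I / 2 *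
      ((HasPressureFlux.density (Γ t) (flowFlux J φ Γ t) θ : ℂ) / (Γ t θ - z)) +
      ((angleDeriv (fun t θ => wirtinger φ (Γ t θ)) t θ * timeDeriv J Γ t θ +
        wirtinger φ (Γ t θ) * angleDeriv (timeDeriv J Γ) t θ) / (Γ t θ - z) -
        wirtinger φ (Γ t θ) * angleDeriv Γ t θ * timeDeriv J Γ t θ / (Γ t θ - z) ^ 2)) := by
    rw [integral_add (hD.intervalIntegrable _ _) (cV.intervalIntegrable _ _), hI,
      integral_const_mul]
    have := hP.cauchyInt_density hz
    rw [cauchyInt] at this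
    rw [this, add_zero]
    have hz0 : z ≠ 0 := fun h0 => hz (h0 ▸ subset_closure hP.zero_mem)
    field_simp
  rw [hsum]
  refine integral_congr fun θ _ => ?_
  have e := hs.wirtinger_antisymm h.isOpen h.smooth h.ordConnected h.nontrivial h.mem ht θ
  rw [← h.density_flowFlux ht θ] at e
  have e' : timeDeriv J (fun t θ => wirtinger φ (Γ t θ)) t θ * angleDeriv Γ t θ =
    I / 2 * (HasPressureFlux.density (Γ t) (flowFlux J φ Γ t) θ : ℂ) +
    angleDeriv (fun t θ => wirtinger φ (Γ t θ)) t θ * timeDeriv J Γ t θ := by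
      linear_combination e
  simp only [e']
  ring

theorem momentFun_sub (h : IsOrientedFlow U φ J Ω Γ) {t t' : ℝ} (ht : t ∈ J) (ht' : t' ∈ J)
    (htt' : t ≤ t') {z : ℂ} (hz : z ∉ closure (Ω t')) :
    momentFun φ (Γ t') z = momentFun φ (Γ t) z - I * (t' - t) / (2 * z) := by
  have hK : Icc t t' ⊆ J := h.ordConnected.out ht ht'
  have hzτ : ∀ τ ∈ Icc t t', z ∉ closure (Ω τ) := fun τ hτ h' =>
    hz (closure_mono (h.subset (hK hτ) ht' hτ.2) h')
  have hne : ∀ τ ∈ Icc t t', ∀ θ, Γ τ θ - z ≠ 0 := fun τ hτ =>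
    IsSimpleClosedCurve.sub_ne_zero_of_notMem fun ⟨θ, hθ⟩ =>
      hzτ τ hτ (hθ ▸ (h.family.jordan τ (hK hτ)).mem_closure θ)
  have hs := h.smoothOnStrip
  have hst := hs.timeDeriv h.ordConnected h.nontrivial
  have hsa := hs.angleDeriv h.ordConnected h.nontrivial
  have hw := hs.wirtinger h.isOpen h.smooth h.mem
  have hd : ∀ τ ∈ Icc t t', HasDerivWithinAt (fun τ => momentFun φ (Γ τ) z)
      (-I / (2 * z)) (Icc t t') τ := by
    intro τ hτ
    rw [← h.integral_rate_eq (hK hτ) (hzτ τ hτ)]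
    refine hasDerivWithinAt_intervalIntegral ordConnected_Icc
      (u := fun t θ => wirtinger φ (Γ t θ) * deriv (Γ t) θ / (Γ t θ - z))
      (ut := fun t θ => (timeDeriv J (fun t θ => wirtinger φ (Γ t θ)) t θ * angleDeriv Γ t θ +
        wirtinger φ (Γ t θ) * angleDeriv (timeDeriv J Γ) t θ) / (Γ t θ - z) -
        wirtinger φ (Γ t θ) * angleDeriv Γ t θ * timeDeriv J Γ t θ / (Γ t θ - z) ^ 2)
      (fun τ hτ => ?_) (fun τ hτ θ _ => ?_) ?_ hτ
    · have c1 := (hs.contDiff (hK hτ)).continuous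
      have c3 := (hw.contDiff (hK hτ)).continuous
      have c5 : Continuous (deriv (Γ τ)) := (hsa.contDiff (hK hτ)).continuous
      exact ((c3.mul c5).div (c1.sub continuous_const) (hne τ hτ)).continuousOn
    · have d1 := (hs.hasDerivWithinAt_time (hK hτ) θ).mono hK
      have d2 := (hw.hasDerivWithinAt_time (hK hτ) θ).mono hK
      have d3 := (hsa.hasDerivWithinAt_time (hK hτ) θ).mono hK
      rw [hs.timeDeriv_angleDeriv h.ordConnected h.nontrivial (hK hτ)] at d3
      have d4 := (d2.mul d3).div (d1.sub_const z) (hne τ hτ θ)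
      refine d4.congr_deriv ?_
      have := hne τ hτ θ
      simp only [Pi.mul_apply]
      field_simp
    · have hm : Icc t t' ×ˢ uIcc 0 (2 * π) ⊆ J ×ˢ (univ : Set ℝ) :=
        prod_mono hK (subset_univ _)
      have c1 := hs.continuousOn.mono hm
      have c2 := hst.continuousOn.mono hm
      have c3 := hw.continuousOn.mono hm
      have c4 := (hw.timeDeriv h.ordConnected h.nontrivial).continuousOn.mono hm
      have c5 := hsa.continuousOn.mono hm
      have c6 := (hst.angleDeriv h.ordConnected h.nontrivial).continuousOn.mono hm
      have c7 := c1.sub (continuousOn_const (c := z))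
      exact (((c4.mul c5).add (c3.mul c6)).div c7 fun q hq => hne _ hq.1 _).sub
        (((c3.mul c5).mul c2).div (c7.pow 2) fun q hq => pow_ne_zero 2 (hne _ hq.1 _))
  have hd' : ∀ τ ∈ Icc t t', HasDerivWithinAt
      (fun τ => momentFun φ (Γ τ) z - (τ : ℂ) * (-I / (2 * z))) 0 (Icc t t') τ := fun τ hτ => by
    have h1 : HasDerivWithinAt (fun τ : ℝ => (τ : ℂ) * (-I / (2 * z))) (1 * (-I / (2 * z)))
        (Icc t t') τ :=
      ((hasDerivAt_id τ).ofReal_comp.mul_const _).hasDerivWithinAt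
    exact ((hd τ hτ).sub h1).congr_deriv (by ring)
  have hc := constant_of_has_deriv_right_zero (fun τ hτ => (hd' τ hτ).continuousWithinAt)
    (fun τ hτ => (hd' τ (Ico_subset_Icc_self hτ)).mono_of_mem_nhdsWithin
      (Icc_mem_nhdsGE_of_mem hτ)) t' ⟨htt', le_rfl⟩
  linear_combination hc

end IsOrientedFlow

/-! ### Circle integrals in the angular variable -/

namespace AngleChange

variable {J : Set ℝ} {α β : ℝ → ℝ → ℝ}

theorem continuous (h : AngleChange J α β) {t : ℝ} (ht : t ∈ J) : Continuous (α t) :=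
  continuous_iff_continuousAt.2 fun θ => (h.deriv t ht θ).continuousAt

theorem exists_exp_eq (h : AngleChange J α β) {t : ℝ} (ht : t ∈ J) {ζ : ℂ}
    (hζ : ζ ∈ sphere (0 : ℂ) 1) : ∃ θ, cexp (α t θ * I) = ζ := by
  have h1 := toIcoMod_mem_Ico Real.two_pi_pos (α t 0) (arg ζ)
  set y := toIcoMod Real.two_pi_pos (α t 0) (arg ζ) with hy
  have h2 := h.add_period t ht 0
  rw [zero_add] at h2
  rw [← h2] at h1
  obtain ⟨θ, -, hθ⟩ := intermediate_value_Icc Real.two_pi_pos.le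
    (h.continuous ht).continuousOn (Ico_subset_Icc_self h1)
  refine ⟨θ, ?_⟩
  have h3 : y + toIcoDiv Real.two_pi_pos (α t 0) (arg ζ) • (2 * π) = arg ζ :=
    toIcoMod_add_toIcoDiv_zsmul _ _ _
  have h4 : cexp (arg ζ * I) = ζ := by
    have := norm_mul_exp_arg_mul_I ζ
    rwa [mem_sphere_zero_iff_norm.1 hζ, ofReal_one, one_mul] at this
  rw [hθ, ← h4, exp_eq_exp_iff_exists_int]
  refine ⟨-toIcoDiv Real.two_pi_pos (α t 0) (arg ζ), ?_⟩
  have h5 : (arg ζ : ℂ) = y + toIcoDiv Real.two_pi_pos (α t 0) (arg ζ) * (2 * π) := by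
    conv_lhs => rw [← h3]
    push_cast [zsmul_eq_mul]
    ring
  rw [h5]
  push_cast
  ring

theorem integral_of_diffContOnCl (h : AngleChange J α β) (hJ : J.OrdConnected)
    (hJ' : J.Nontrivial) {t : ℝ} (ht : t ∈ J) {f : ℂ → ℂ}
    (hf : DiffContOnCl ℂ f (ball 0 1)) :
    ∫ θ in (0 : ℝ)..(2 * π), (β t θ : ℂ) * f (cexp (α t θ * I)) =
      2 * π * f 0 := by
  have hper : Periodic (fun φ : ℝ => f (cexp (φ * I))) (2 * π) := by
    intro φ
    have e1 : cexp (((φ + 2 * π : ℝ) : ℂ) * I) = cexp (φ * I) := by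
      rw [exp_eq_exp_iff_exists_int]; exact ⟨1, by push_cast; ring⟩
    simp only [e1]
  have hcont : Continuous fun φ : ℝ => f (cexp (φ * I)) := by
    have h1 : ContinuousOn f (closedBall 0 1) := by
      have := hf.continuousOn
      rwa [closure_ball _ one_ne_zero] at this
    exact h1.comp_continuous (by fun_prop) (fun φ => by
      rw [mem_closedBall_zero_iff, norm_exp_ofReal_mul_I])
  have hβc : Continuous (β t) := ((h.smoothPeriodic hJ hJ').smooth.contDiff ht).continuous
  have h1 := integral_deriv_smul_comp (a := 0) (b := 2 * π)
    (fun θ _ => h.deriv t ht θ) hβc.continuousOn hcont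
  have e := h.add_period t ht 0
  rw [zero_add] at e
  rw [e, hper.intervalIntegral_add_eq (α t 0) 0, zero_add] at h1
  simp only [comp_apply, real_smul] at h1
  rw [h1]
  have h2 := hf.circleIntegral_sub_inv_smul (w := 0) (mem_ball_self one_pos)
  rw [circleIntegral] at h2
  simp only [deriv_circleMap, circleMap, zero_add, ofReal_one, one_mul, sub_zero,
    smul_eq_mul] at h2
  have h3 : ∫ φ in (0 : ℝ)..(2 * π), I * f (cexp (φ * I)) = 2 * π * I * f 0 := by
    rw [← h2]
    refine integral_congr fun φ _ => ?_
    have e4 := exp_ne_zero (φ * I)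
    field_simp
  rw [integral_const_mul] at h3
  refine mul_left_cancel₀ I_ne_zero ?_
  rw [h3]; ring

end AngleChange

/-! ### Conformal maps from the disc -/

/-- `a` is a conformal map from the unit disc onto `Ω` with `a 0 = 0`, injective and continuous up
to the boundary, and `G` is its inverse. -/
structure IsDiscMap (Ω : Set ℂ) (a G : ℂ → ℂ) : Prop where
  differentiableOn : DifferentiableOn ℂ a (ball 0 1)
  continuousOn : ContinuousOn a (closedBall 0 1)
  map_zero : a 0 = 0
  bijOn : BijOn a (ball 0 1) Ω
  injOn : InjOn a (closedBall 0 1)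
  inverse : DifferentiableOn ℂ G Ω
  left_inv : ∀ ζ ∈ ball (0 : ℂ) 1, G (a ζ) = ζ
  deriv_ne_zero : ∀ ζ ∈ ball (0 : ℂ) 1, deriv a ζ ≠ 0

namespace IsDiscMap

variable {Ω : Set ℂ} {a b G : ℂ → ℂ}

theorem congr (h : IsDiscMap Ω a G) (hab : EqOn b a (closedBall 0 1)) :
    IsDiscMap Ω b G := by
  have hab' := hab.mono (ball_subset_closedBall)
  refine ⟨h.differentiableOn.congr hab', h.continuousOn.congr hab, ?_, h.bijOn.congr hab'.symm,
    h.injOn.congr hab.symm, h.inverse, fun ζ hζ => ?_, fun ζ hζ => ?_⟩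
  · rw [hab (by simp), h.map_zero]
  · rw [hab' hζ, h.left_inv ζ hζ]
  · rw [(hab'.eventuallyEq_of_mem (isOpen_ball.mem_nhds hζ)).deriv_eq]
    exact h.deriv_ne_zero ζ hζ

theorem eq_zero_iff (h : IsDiscMap Ω a G) {ζ : ℂ} (hζ : ζ ∈ closedBall (0 : ℂ) 1) :
    a ζ = 0 ↔ ζ = 0 :=
  ⟨fun h' => h.injOn hζ (by simp) (h'.trans h.map_zero.symm), fun h' => h' ▸ h.map_zero⟩

theorem mem_closure (h : IsDiscMap Ω a G) {ζ : ℂ} (hζ : ζ ∈ closedBall (0 : ℂ) 1) :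
    a ζ ∈ closure Ω := by
  have h1 := h.continuousOn
  rw [← closure_ball (0 : ℂ) one_ne_zero] at h1 hζ
  have h2 := h1.image_closure (mem_image_of_mem a hζ)
  rwa [h.bijOn.image_eq] at h2

theorem hasDerivAt_zero (h : IsDiscMap Ω a G) : HasDerivAt a (deriv a 0) 0 :=
  (h.differentiableOn.differentiableAt (isOpen_ball.mem_nhds (by simp))).hasDerivAt

theorem tendsto_div (h : IsDiscMap Ω a G) :
    Tendsto (fun ζ => ζ / a ζ) (𝓝[≠] 0) (𝓝 (deriv a 0)⁻¹) := by
  have h1 := (hasDerivAt_iff_tendsto_slope.1 h.hasDerivAt_zero).inv₀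
    (h.deriv_ne_zero 0 (by simp))
  refine h1.congr fun ζ => ?_
  rw [slope_def_field, h.map_zero, sub_zero, sub_zero, inv_div]

theorem tendsto_punctured (h : IsDiscMap Ω a G) : Tendsto a (𝓝[≠] 0) (𝓝[≠] 0) := by
  refine tendsto_nhdsWithin_iff.2 ⟨?_, ?_⟩
  · have := h.hasDerivAt_zero.continuousAt.tendsto
    rw [h.map_zero] at this
    exact this.mono_left nhdsWithin_le_nhds
  · filter_upwards [self_mem_nhdsWithin, nhdsWithin_le_nhds (closedBall_mem_nhds (0 : ℂ)
      one_pos)] with ζ hζ hζ' h0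
    exact hζ ((h.eq_zero_iff hζ').1 h0)

/-- Removal of a singularity at the origin. -/
theorem _root_.diffContOnCl_ball_of_continuousAt {f : ℂ → ℂ} (h0 : ContinuousAt f 0)
    (hd : ∀ ζ ∈ ball (0 : ℂ) 1, ζ ≠ 0 → DifferentiableAt ℂ f ζ)
    (hc : ∀ ζ ∈ closedBall (0 : ℂ) 1, ζ ≠ 0 → ContinuousWithinAt f (closedBall 0 1) ζ) :
    DiffContOnCl ℂ f (ball 0 1) := by
  refine ⟨(differentiableOn_compl_singleton_and_continuousAt_iff (isOpen_ball.mem_nhds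
    (by simp))).1 ⟨fun ξ hξ => (hd ξ hξ.1 hξ.2).differentiableWithinAt, h0⟩, ?_⟩
  rw [closure_ball _ one_ne_zero]
  intro ζ hζ
  by_cases hζ0 : ζ = 0
  · rw [hζ0]; exact h0.continuousWithinAt
  · exact hc ζ hζ hζ0

/-- The Schwarz function in the disc coordinate, made regular by the factor `ζ`. -/
def schwarzLift (a S : ℂ → ℂ) (r ζ : ℂ) : ℂ := if ζ = 0 then r / deriv a 0 else ζ * S (a ζ)

theorem diffContOnCl_schwarzLift (h : IsDiscMap Ω a G) (hΩ : IsOpen Ω) {φ : ℂ → ℝ} {S : ℂ → ℂ} {r : ℂ}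
    (hS : IsSchwarzFunction Ω φ S r) :
    DiffContOnCl ℂ (schwarzLift a S r) (ball 0 1) := by
  have h0 : ContinuousAt (schwarzLift a S r) 0 := by
    rw [continuousAt_iff_punctured_nhds]
    have h1 := h.tendsto_div.mul (hS.residue.comp h.tendsto_punctured)
    have e : (deriv a 0)⁻¹ * r = schwarzLift a S r 0 := by rw [schwarzLift, if_pos rfl]; ring
    rw [e] at h1
    refine h1.congr' ?_
    filter_upwards [self_mem_nhdsWithin, h.tendsto_punctured self_mem_nhdsWithin] with ζ hζ hζ'
    have hζ'' : a ζ ≠ 0 := hζ'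
    have hζ0 : ζ ≠ 0 := hζ
    rw [schwarzLift, if_neg hζ0, comp_apply]
    field_simp
  have hd : ∀ ζ ∈ ball (0 : ℂ) 1, ζ ≠ 0 → DifferentiableAt ℂ (schwarzLift a S r) ζ := by
    intro ζ hζ hζ0
    have h1 : a ζ ≠ 0 := fun h' => hζ0 ((h.eq_zero_iff (ball_subset_closedBall hζ)).1 h')
    have h2 : DifferentiableAt ℂ S (a ζ) := hS.holomorphic.differentiableAt
      ((hΩ.sdiff isClosed_singleton).mem_nhds ⟨h.bijOn.mapsTo hζ, h1⟩)
    have h3 := h.differentiableOn.differentiableAt (isOpen_ball.mem_nhds hζ)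
    refine (differentiableAt_id.mul (h2.comp ζ h3)).congr_of_eventuallyEq ?_
    filter_upwards [isOpen_ne.mem_nhds hζ0] with ξ hξ
    rw [schwarzLift, if_neg hξ]; rfl
  refine diffContOnCl_ball_of_continuousAt h0 hd fun ζ hζ hζ0 => ?_
  have h1 : a ζ ≠ 0 := fun h' => hζ0 ((h.eq_zero_iff hζ).1 h')
  have hev : ∀ᶠ ξ in 𝓝[closedBall 0 1] ζ, ξ ≠ 0 :=
    nhdsWithin_le_nhds (isOpen_ne.mem_nhds hζ0)
  have h2 : Tendsto a (𝓝[closedBall 0 1] ζ) (𝓝[closure Ω \ {0}] (a ζ)) :=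
    tendsto_nhdsWithin_iff.2 ⟨h.continuousOn ζ hζ, by
      filter_upwards [hev, self_mem_nhdsWithin] with ξ hξ hξ'
      exact ⟨h.mem_closure hξ', fun h' => hξ ((h.eq_zero_iff hξ').1 h')⟩⟩
  have h3 : Tendsto (fun ξ => ξ * S (a ξ)) (𝓝[closedBall 0 1] ζ) (𝓝 (ζ * S (a ζ))) :=
    (tendsto_id.mono_left nhdsWithin_le_nhds).mul
      ((hS.continuousOn _ ⟨h.mem_closure hζ, h1⟩).tendsto.comp h2)
  have e : schwarzLift a S r ζ = ζ * S (a ζ) := by rw [schwarzLift, if_neg hζ0]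
  rw [ContinuousWithinAt, e]
  refine h3.congr' ?_
  filter_upwards [hev] with ξ hξ
  rw [schwarzLift, if_neg hξ]

end IsDiscMap

/-! ### The conformal maps of a Hele-Shaw flow -/

/-- The boundary value of the angular variable of the conformal map at time `t`. -/
def flowAngle (J : Set ℝ) (φ : ℂ → ℝ) (Γ : ℝ → ℝ → ℂ) (t θ : ℝ) : ℝ :=
  HasPressureFlux.fluxAngle (Γ t) (flowFlux J φ Γ t) θ

/-- The derivative of `flowAngle`. -/
def flowDensity (J : Set ℝ) (φ : ℂ → ℝ) (Γ : ℝ → ℝ → ℂ) (t θ : ℝ) : ℝ :=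
  2 * π * HasPressureFlux.density (Γ t) (flowFlux J φ Γ t) θ

namespace IsOrientedFlow

variable {U : Set ℂ} {φ : ℂ → ℝ} {J : Set ℝ} {Ω : ℝ → Set ℂ} {Γ : ℝ → ℝ → ℂ}

theorem smooth_density (h : IsOrientedFlow U φ J Ω Γ) :
    SmoothOnStrip J (flowDensity J φ Γ) := by
  have hs := h.smoothOnStrip
  have h1 : SmoothOnStrip J (fun t θ => laplacian φ (Γ t θ)) :=
    hs.comp (contDiffOn_laplacian h.isOpen h.smooth) h.mem
  have h2 : SmoothOnStrip J (fun t θ => starRingEnd ℂ (timeDeriv J Γ t θ)) :=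
    conjCLE.contDiff.comp_contDiffOn (hs.timeDeriv h.ordConnected h.nontrivial)
  have h3 : SmoothOnStrip J (fun t θ =>
      (starRingEnd ℂ (timeDeriv J Γ t θ) * angleDeriv Γ t θ).im) :=
    imCLM.contDiff.comp_contDiffOn
      (ContDiffOn.mul h2 (hs.angleDeriv h.ordConnected h.nontrivial))
  have h4 : SmoothOnStrip J (fun t θ => 2 * π * (laplacian φ (Γ t θ) *
      (starRingEnd ℂ (timeDeriv J Γ t θ) * angleDeriv Γ t θ).im)) :=
    ContDiffOn.mul contDiffOn_const (ContDiffOn.mul h1 h3)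
  refine h4.congr fun t ht θ => ?_
  rw [flowDensity, h.density_flowFlux ht]

theorem angleChange (h : IsOrientedFlow U φ J Ω Γ) :
    AngleChange J (flowAngle J φ Γ) (flowDensity J φ Γ) := by
  refine ⟨?_, fun t ht θ => ?_, fun t ht θ => ?_, fun t ht θ => ?_⟩
  · refine (h.smooth_density.angle_integral h.ordConnected h.nontrivial).congr fun t ht θ => ?_
    simp only [flowAngle, flowDensity, HasPressureFlux.fluxAngle]
    rw [integral_const_mul]
  · obtain ⟨δ, p, hP⟩ := h.flux t ht
    exact hP.hasDerivAt_fluxAngle θ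
  · obtain ⟨δ, p, hP⟩ := h.flux t ht
    exact mul_pos Real.two_pi_pos (hP.density_pos θ)
  · obtain ⟨δ, p, hP⟩ := h.flux t ht
    exact hP.fluxAngle_add_period θ

end IsOrientedFlow

/-- The conformal map onto the domain at time `t`, as the power series whose coefficients are the
Fourier coefficients of the boundary values. -/
def flowMap (J : Set ℝ) (φ : ℂ → ℝ) (Γ : ℝ → ℝ → ℂ) (t : ℝ) : ℂ → ℂ :=
  powerSum fun n => modeCoeff (flowAngle J φ Γ) (flowDensity J φ Γ) Γ n t

/-- The derivative of `flowMap`. -/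
def flowMapDeriv (J : Set ℝ) (φ : ℂ → ℝ) (Γ : ℝ → ℝ → ℂ) (t : ℝ) : ℂ → ℂ :=
  powerSum (derivCoeff fun n => modeCoeff (flowAngle J φ Γ) (flowDensity J φ Γ) Γ n t)

namespace IsOrientedFlow

variable {U : Set ℂ} {φ : ℂ → ℝ} {J : Set ℝ} {Ω : ℝ → Set ℂ} {Γ : ℝ → ℝ → ℂ}

theorem rapidFamily (h : IsOrientedFlow U φ J Ω Γ) {v : ℝ → ℝ → ℂ} (hv : SmoothPeriodic J v) :
    RapidFamily J (fun j n t => modeCoeff (flowAngle J φ Γ) (flowDensity J φ Γ)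
      ((AngleChange.timeOp J (flowAngle J φ Γ) (flowDensity J φ Γ))^[j] v) n t) :=
  h.angleChange.rapidFamily h.ordConnected h.nontrivial hv

theorem exists_isDiscMap (h : IsOrientedFlow U φ J Ω Γ) {t : ℝ} (ht : t ∈ J) :
    ∃ G, IsDiscMap (Ω t) (flowMap J φ Γ t) G ∧
      ∀ θ, flowMap J φ Γ t (cexp (flowAngle J φ Γ t θ * I)) = Γ t θ := by
  obtain ⟨δ, p, hP⟩ := h.flux t ht
  obtain ⟨a, G, h1, h2, h3, h4, h5, h6, h7, h8, h9⟩ := hP.exists_riemannMap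
  have hcl : closure (ball (0 : ℂ) 1) = closedBall 0 1 :=
    closure_ball _ one_ne_zero
  have hab : EqOn (flowMap J φ Γ t) a (closedBall 0 1) := fun ζ hζ =>
    h.angleChange.powerSum_modeCoeff h.ordConnected h.nontrivial h.family.smoothPeriodic ht
      ⟨h1, by rwa [hcl]⟩ h4 hζ
  refine ⟨G, IsDiscMap.congr ⟨h1, h2, h5, h6, h7, h3, h8, h9⟩ hab, fun θ => ?_⟩
  rw [hab (by rw [mem_closedBall_zero_iff, norm_exp_ofReal_mul_I])]
  exact h4 θ

theorem hasDerivWithinAt_flowMap (h : IsOrientedFlow U φ J Ω Γ) {t : ℝ} (ht : t ∈ J) {ζ : ℂ}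
    (hζ : ζ ∈ closedBall (0 : ℂ) 1) :
    HasDerivWithinAt (flowMap J φ Γ t) (flowMapDeriv J φ Γ t ζ) (closedBall 0 1) ζ :=
  (h.rapidFamily h.family.smoothPeriodic).hasDerivWithinAt_space 0 ht hζ

theorem diffContOnCl_flowMapDeriv (h : IsOrientedFlow U φ J Ω Γ) {t : ℝ} (ht : t ∈ J) :
    DiffContOnCl ℂ (flowMapDeriv J φ Γ t) (ball 0 1) := by
  have h1 : ∀ ζ ∈ closedBall (0 : ℂ) 1, HasDerivWithinAt (flowMapDeriv J φ Γ t) _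
      (closedBall 0 1) ζ := fun ζ hζ =>
    (h.rapidFamily h.family.smoothPeriodic).space.hasDerivWithinAt_space 0 ht hζ
  refine ⟨fun ζ hζ => ?_, ?_⟩
  · exact ((h1 ζ (ball_subset_closedBall hζ)).mono
      ball_subset_closedBall).differentiableWithinAt
  · rw [closure_ball _ one_ne_zero]
    exact fun ζ hζ => (h1 ζ hζ).continuousWithinAt

theorem deriv_flowMap (h : IsOrientedFlow U φ J Ω Γ) {t : ℝ} (ht : t ∈ J) {ζ : ℂ}
    (hζ : ζ ∈ ball (0 : ℂ) 1) :
    deriv (flowMap J φ Γ t) ζ = flowMapDeriv J φ Γ t ζ :=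
  ((h.hasDerivWithinAt_flowMap ht (ball_subset_closedBall hζ)).hasDerivAt
    (mem_of_superset (isOpen_ball.mem_nhds hζ) ball_subset_closedBall)).deriv

theorem angleDeriv_eq (h : IsOrientedFlow U φ J Ω Γ) {t : ℝ} (ht : t ∈ J) (θ : ℝ) :
    deriv (Γ t) θ = flowDensity J φ Γ t θ * (I * cexp (flowAngle J φ Γ t θ * I) *
      flowMapDeriv J φ Γ t (cexp (flowAngle J φ Γ t θ * I))) := by
  obtain ⟨G, -, hG⟩ := h.exists_isDiscMap ht
  have hmem : ∀ θ, cexp (flowAngle J φ Γ t θ * I) ∈ closedBall (0 : ℂ) 1 := fun θ => by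
    rw [mem_closedBall_zero_iff, norm_exp_ofReal_mul_I]
  have h1 : HasDerivAt (fun θ => cexp (flowAngle J φ Γ t θ * I))
      (cexp (flowAngle J φ Γ t θ * I) * (flowDensity J φ Γ t θ * I)) θ :=
    ((h.angleChange.deriv t ht θ).ofReal_comp.mul_const I).cexp
  have h2 := HasDerivWithinAt.scomp_hasDerivAt (h := fun θ => cexp (flowAngle J φ Γ t θ * I)) θ
    (h.hasDerivWithinAt_flowMap ht (hmem θ)) h1 hmem
  have h3 : (flowMap J φ Γ t ∘ fun θ => cexp (flowAngle J φ Γ t θ * I)) = Γ t := funext hG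
  rw [h3] at h2
  rw [h2.deriv, smul_eq_mul]
  ring

/-- If there is a Schwarz function at the time `t`, then the moment function is explicit outside
the domain. -/
theorem momentFun_of_isSchwarzFunction (h : IsOrientedFlow U φ J Ω Γ) {t : ℝ} (ht : t ∈ J)
    {S : ℂ → ℂ} {r : ℂ} (hS : IsSchwarzFunction (Ω t) φ S r) {z : ℂ} (hz : z ∉ closure (Ω t)) :
    momentFun φ (Γ t) z = -(2 * π * I * r) / z := by
  obtain ⟨G, hd, hG⟩ := h.exists_isDiscMap ht
  set a := flowMap J φ Γ t with ha
  have hcl : closure (ball (0 : ℂ) 1) = closedBall 0 1 :=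
    closure_ball _ one_ne_zero
  have hz0 : z ≠ 0 := fun h0 => hz (by
    rw [h0, ← hd.map_zero]; exact hd.mem_closure (by simp))
  have hne : ∀ ζ ∈ closedBall (0 : ℂ) 1, a ζ - z ≠ 0 := fun ζ hζ h' =>
    hz (sub_eq_zero.1 h' ▸ hd.mem_closure hζ)
  have hden : DiffContOnCl ℂ (fun ζ => (a ζ - z)⁻¹) (ball 0 1) :=
    DiffContOnCl.inv (f := fun ζ => a ζ - z)
      ⟨hd.differentiableOn.sub_const z, by rw [hcl]; exact hd.continuousOn.sub continuousOn_const⟩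
      (by rw [hcl]; exact hne)
  have hf := ((hd.diffContOnCl_schwarzLift (h.family.jordan t ht).isOpen hS).smul (h.diffContOnCl_flowMapDeriv ht)).smul hden
  have hI := h.angleChange.integral_of_diffContOnCl h.ordConnected h.nontrivial ht hf
  have h0 : IsDiscMap.schwarzLift a S r 0 * flowMapDeriv J φ Γ t 0 = r := by
    rw [IsDiscMap.schwarzLift, if_pos rfl, ← h.deriv_flowMap ht (by simp), ← ha]
    exact div_mul_cancel₀ _ (hd.deriv_ne_zero 0 (by simp))
  have h1 : momentFun φ (Γ t) z = I * (2 * π * (r * (0 - z)⁻¹)) := by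
    have e : (IsDiscMap.schwarzLift a S r 0 • flowMapDeriv J φ Γ t 0) • (a 0 - z)⁻¹ =
        r * (0 - z)⁻¹ := by
      simp only [smul_eq_mul, h0, hd.map_zero]
    rw [← e, ← hI, ← integral_const_mul, momentFun, cauchyInt]
    refine integral_congr fun θ _ => ?_
    have hfr : Γ t θ ∈ frontier (Ω t) := by
      rw [(h.family.jordan t ht).frontier_eq]; exact mem_range_self θ
    simp only [smul_eq_mul, h.angleDeriv_eq ht θ, IsDiscMap.schwarzLift,
      if_neg (exp_ne_zero _), hG, hS.boundary _ hfr]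
    ring
  rw [h1]
  field_simp
  ring

/-- The moment function outside the domain at every time of the flow. -/
theorem momentFun_eq (h : IsOrientedFlow U φ J Ω Γ) {t₀ : ℝ} (ht₀ : t₀ ∈ J)
    {S : ℂ → ℂ} {r : ℂ} (hS : IsSchwarzFunction (Ω t₀) φ S r) {t : ℝ} (ht : t ∈ J) {z : ℂ}
    (hz : z ∉ closure (Ω t)) : momentFun φ (Γ t) z =
      -(2 * π * I * (r + (((t - t₀) / (4 * π) : ℝ) : ℂ))) / z := by
  have hπ : (π : ℂ) ≠ 0 := by exact_mod_cast Real.pi_ne_zero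
  have hzero : ∀ t ∈ J, ∀ z ∉ closure (Ω t), z ≠ 0 := by
    rintro t ht z hz rfl
    obtain ⟨δ, p, hP⟩ := h.flux t ht
    exact hz (subset_closure hP.zero_mem)
  rcases le_total t₀ t with h1 | h1
  · have hz' : z ∉ closure (Ω t₀) := fun h' => hz (closure_mono (h.subset ht₀ ht h1) h')
    have hz0 := hzero t ht z hz
    rw [h.momentFun_sub ht₀ ht h1 hz, h.momentFun_of_isSchwarzFunction ht₀ hS hz']
    push_cast
    field_simp
    ring
  · -- the formula holds outside the larger domain, hence everywhere outside by continuation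
    obtain ⟨δ, p, hP⟩ := h.flux t ht
    have hopen : IsOpen (closure (Ω t))ᶜ := isClosed_closure.isOpen_compl
    have hsub : (closure (Ω t))ᶜ ⊆ (range (Γ t))ᶜ := by
      rintro w hw ⟨θ, rfl⟩
      exact hw ((h.family.jordan t ht).mem_closure θ)
    have hc : Continuous fun θ => wirtinger φ (Γ t θ) * deriv (Γ t) θ :=
      ((h.smoothOnStrip.wirtinger h.isOpen h.smooth h.mem).contDiff ht).continuous.mul
        (h.curve ht).continuous_deriv
    have a1 : AnalyticOnNhd ℂ (momentFun φ (Γ t)) (closure (Ω t))ᶜ :=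
      (((h.curve ht).differentiableOn_cauchyInt hc).mono hsub).analyticOnNhd hopen
    have a2 : AnalyticOnNhd ℂ (fun z : ℂ =>
        -(2 * π * I * (r + (((t - t₀) / (4 * π) : ℝ) : ℂ))) / z) (closure (Ω t))ᶜ :=
      DifferentiableOn.analyticOnNhd (fun w hw =>
        ((differentiableAt_const _).div differentiableAt_id
          (hzero t ht w hw)).differentiableWithinAt) hopen
    obtain ⟨z₁, hz₁⟩ : ∃ z₁, z₁ ∉ closure (Ω t₀) := by
      by_contra hcon
      push Not at hcon
      exact (NormedSpace.unbounded_univ ℂ ℂ) ((h.family.jordan t₀ ht₀).bounded.closure.subset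
        fun x _ => hcon x)
    refine a1.eqOn_of_preconnected_of_eventuallyEq a2 (hP.collar.isPreconnected_compl_closure
      hP.jordan) (z₀ := z₁) (fun h' => hz₁ (closure_mono (h.subset ht ht₀ h1) h')) ?_ hz
    filter_upwards [isClosed_closure.isOpen_compl.mem_nhds hz₁] with w hw
    have hw0 := hzero t₀ ht₀ w hw
    have e := h.momentFun_sub ht ht₀ h1 hw
    rw [h.momentFun_of_isSchwarzFunction ht₀ hS hw] at e
    have e' : momentFun φ (Γ t) w = -(2 * π * I * r) / w + I * (t₀ - t) / (2 * w) := by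
      rw [e]; ring
    rw [e']
    push_cast
    field_simp
    ring

/-- The Schwarz function at the time `t`. -/
def schwarz (φ : ℂ → ℝ) (γ : ℝ → ℂ) (Ω : Set ℂ) (r z : ℂ) : ℂ :=
  open Classical in
  if z ∈ Ω then momentFun φ γ z / (2 * π * I) + r / z else wirtinger φ z

theorem isSchwarzFunction (h : IsOrientedFlow U φ J Ω Γ) {t : ℝ} (ht : t ∈ J) {r : ℂ}
    (hr : r ≠ 0) (hM : ∀ z ∉ closure (Ω t), momentFun φ (Γ t) z = -(2 * π * I * r) / z) :
    IsSchwarzFunction (Ω t) φ (schwarz φ (Γ t) (Ω t) r) r := by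
  have hπ : (π : ℂ) ≠ 0 := by exact_mod_cast Real.pi_ne_zero
  obtain ⟨δ, p, hP⟩ := h.flux t ht
  have hj := h.family.jordan t ht
  have hw := h.smoothOnStrip.wirtinger h.isOpen h.smooth h.mem
  have hc : Continuous fun θ => wirtinger φ (Γ t θ) * deriv (Γ t) θ :=
    (hw.contDiff ht).continuous.mul (h.curve ht).continuous_deriv
  have hcp : Periodic (fun θ => wirtinger φ (Γ t θ) * deriv (Γ t) θ) (2 * π) :=
    fun θ => by simp only [hj.periodic θ, (h.curve ht).deriv_periodic θ]
  have hsub : Ω t ⊆ (range (Γ t))ᶜ := by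
    rintro w hw ⟨θ, rfl⟩
    exact hj.notMem θ hw
  have hMd : ∀ z ∈ Ω t, DifferentiableAt ℂ (momentFun φ (Γ t)) z := fun z hz =>
    ((h.curve ht).hasDerivAt_cauchyInt hc (hsub hz)).differentiableAt
  have hev : ∀ z ∈ Ω t, schwarz φ (Γ t) (Ω t) r =ᶠ[𝓝 z]
      fun z => momentFun φ (Γ t) z / (2 * π * I) + r / z := fun z hz => by
    filter_upwards [hj.isOpen.mem_nhds hz] with w hw
    rw [schwarz, if_pos hw]
  have hd : ∀ z ∈ Ω t \ {0}, DifferentiableAt ℂ (schwarz φ (Γ t) (Ω t) r) z := fun z hz =>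
    (((hMd z hz.1).div_const _).add ((differentiableAt_const r).div differentiableAt_id
      hz.2)).congr_of_eventuallyEq (hev z hz.1)
  have hbd : ∀ θ, schwarz φ (Γ t) (Ω t) r (Γ t θ) = wirtinger φ (Γ t θ) := fun θ => by
    rw [schwarz, if_neg (hj.notMem θ)]
  refine ⟨fun z hz => (hd z hz).differentiableWithinAt, hr, ?_, ?_, fun z hz => ?_⟩
  · have h1 : Tendsto (fun z => z * (momentFun φ (Γ t) z / (2 * π * I)) + r) (𝓝[≠] 0)
        (𝓝 (0 * (momentFun φ (Γ t) 0 / (2 * π * I)) + r)) :=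
      ((tendsto_id.mul (((hMd 0 hP.zero_mem).continuousAt.tendsto).div_const _)).add_const
        r).mono_left nhdsWithin_le_nhds
    rw [zero_mul, zero_add] at h1
    refine h1.congr' ?_
    filter_upwards [self_mem_nhdsWithin, nhdsWithin_le_nhds (hev 0 hP.zero_mem)] with z hz hz'
    have hz0 : z ≠ 0 := hz
    rw [hz']
    field_simp
  · rintro z ⟨hz, hz0⟩
    rw [hj.closure_eq] at hz
    rcases hz with hz | ⟨θ, rfl⟩
    · exact (hd z ⟨hz, hz0⟩).continuousAt.continuousWithinAt
    · refine ContinuousWithinAt.mono (t := Ω t ∪ range (Γ t)) ?_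
        (by rw [hj.closure_eq]; exact sdiff_subset)
      rw [continuousWithinAt_union]
      constructor
      · -- the jump formula for the Cauchy type integral
        have hlim : Tendsto (fun z => momentFun φ (Γ t) z / (2 * π * I) + r / z)
            (𝓝[Ω t] (Γ t θ)) (𝓝 (wirtinger φ (Γ t θ))) := by
          refine Tendsto.mono_left ?_ (hP.collar.nhdsWithin_le_map hj θ)
          rw [tendsto_map'_iff]
          have h1 := (h.curve ht).tendsto_cauchyInt_jump hc hcp θ
          have hp1 : Tendsto (fun q : ℝ × ℝ => (q.1 : ℂ)) (𝓝[>] 0 ×ˢ 𝓝 θ) (𝓝 ((0 : ℝ) : ℂ)) :=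
            (continuous_ofReal.tendsto 0).comp (tendsto_fst.mono_right nhdsWithin_le_nhds)
          have hp2 : Tendsto (fun q : ℝ × ℝ => Γ t q.2) (𝓝[>] 0 ×ˢ 𝓝 θ) (𝓝 (Γ t θ)) :=
            ((h.curve ht).continuous.tendsto θ).comp tendsto_snd
          have hp3 : Tendsto (fun q : ℝ × ℝ => rightNormal (Γ t) q.2) (𝓝[>] 0 ×ˢ 𝓝 θ)
              (𝓝 (rightNormal (Γ t) θ)) :=
            ((h.curve ht).continuous_rightNormal.tendsto θ).comp tendsto_snd
          have hin := hp2.sub (hp1.mul hp3)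
          have hout := hp2.add (hp1.mul hp3)
          simp only [ofReal_zero, zero_mul, sub_zero, add_zero] at hin hout
          have hne := hP.ne_zero θ
          have h2 := ((h1.div_const (2 * π * I)).sub
            ((tendsto_const_nhds (x := r)).div hout hne)).add
            ((tendsto_const_nhds (x := r)).div hin hne)
          have e : 2 * π * I * (wirtinger φ (Γ t θ) * deriv (Γ t) θ) / deriv (Γ t) θ /
              (2 * π * I) - r / Γ t θ + r / Γ t θ = wirtinger φ (Γ t θ) := by
            have := (h.curve ht).regular θ
            field_simp
            ring
          rw [e] at h2
          refine h2.congr' ?_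
          have hs : ∀ᶠ q : ℝ × ℝ in 𝓝[>] 0 ×ˢ 𝓝 θ, q.1 ∈ Ioc 0 δ :=
            tendsto_fst.eventually (Ioc_mem_nhdsGT hP.collar.pos)
          filter_upwards [hs] with q hq
          have e2 := hM _ (hP.collar.outside q.2 q.1 hq)
          have e3 : Γ t q.2 + q.1 * rightNormal (Γ t) q.2 ≠ 0 := fun h0 =>
            hP.collar.outside q.2 q.1 hq (h0 ▸ subset_closure hP.zero_mem)
          rw [momentFun] at e2
          rw [e2, comp_apply, momentFun, Pi.div_apply, Pi.div_apply]
          field_simp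
          ring
        rw [ContinuousWithinAt, hbd]
        refine hlim.congr' ?_
        filter_upwards [self_mem_nhdsWithin] with w hw
        rw [schwarz, if_pos hw]
      · refine (((contDiffOn_wirtinger h.isOpen h.smooth).continuousOn.continuousAt
          (h.isOpen.mem_nhds (h.mem t ht θ))).continuousWithinAt (s := range (Γ t))).congr ?_
          (hbd θ)
        rintro _ ⟨θ', rfl⟩
        exact hbd θ'
  · rw [hj.frontier_eq] at hz
    obtain ⟨θ, rfl⟩ := hz
    exact hbd θ

/-- A Hele-Shaw flow whose domains have Schwarz functions lifts to a family of holomorphic discs. -/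
theorem exists_discFamily (h : IsOrientedFlow U φ J Ω Γ) {r : ℝ → ℂ}
    (hr : ∀ t ∈ J, r t ≠ 0)
    (hM : ∀ t ∈ J, ∀ z ∉ closure (Ω t), momentFun φ (Γ t) z = -(2 * π * I * r t) / z) :
    ∃ F : ℝ → ℂ → ℂ × OnePoint ℂ, IsSmoothDiscFamily U φ J F ∧
      ∀ t ∈ J, discShadow (F t) = Ω t := by
  have hac := h.angleChange
  set v : ℝ → ℝ → ℂ := fun t θ => cexp (flowAngle J φ Γ t θ * I) * wirtinger φ (Γ t θ) with hv
  have hexp : SmoothPeriodic J (fun t θ => cexp (flowAngle J φ Γ t θ * I)) := by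
    refine ⟨contDiff_exp.comp_contDiffOn
      (ContDiffOn.mul (ofRealCLM.contDiff.comp_contDiffOn hac.smooth) contDiffOn_const),
      fun t ht θ => ?_⟩
    simp only [hac.add_period t ht θ]
    rw [exp_eq_exp_iff_exists_int]; exact ⟨1, by push_cast; ring⟩
  have hvs : SmoothPeriodic J v := hexp.mul
    (h.family.smoothPeriodic.comp (contDiffOn_wirtinger h.isOpen h.smooth) h.mem)
  set B : ℝ → ℂ → ℂ := fun t => powerSum fun n =>
    modeCoeff (flowAngle J φ Γ) (flowDensity J φ Γ) v n t with hB
  have hRA := h.rapidFamily h.family.smoothPeriodic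
  have hRB := h.rapidFamily hvs
  have hA1 : ContDiffOn ℝ ∞ (fun q : ℝ × ℂ => flowMap J φ Γ q.1 q.2)
    (J ×ˢ closedBall 0 1) := hRA.contDiffOn h.ordConnected
  have hB1 : ContDiffOn ℝ ∞ (fun q : ℝ × ℂ => B q.1 q.2)
    (J ×ˢ closedBall 0 1) := hRB.contDiffOn h.ordConnected
  have hslice : ∀ t ∈ J, ∀ f : ℝ → ℂ → ℂ, ContDiffOn ℝ ∞ (fun q : ℝ × ℂ => f q.1 q.2)
      (J ×ˢ closedBall 0 1) → ContDiffOn ℝ ∞ (f t) (closedBall 0 1) :=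
    fun t ht f hf => ContDiffOn.comp (f := fun ζ : ℂ => (t, ζ)) hf (by fun_prop)
      (fun ζ hζ => ⟨ht, hζ⟩)
  -- `B t` is the Schwarz function in the disc coordinate, times `ζ`
  have hBS : ∀ t ∈ J, ∀ ζ ∈ closedBall (0 : ℂ) 1, B t ζ = IsDiscMap.schwarzLift
      (flowMap J φ Γ t) (schwarz φ (Γ t) (Ω t) (r t)) (r t) ζ := by
    intro t ht ζ hζ
    obtain ⟨G, hd, hG⟩ := h.exists_isDiscMap ht
    have hS := h.isSchwarzFunction ht (hr t ht) (hM t ht)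
    refine hac.powerSum_modeCoeff h.ordConnected h.nontrivial hvs ht
      (hd.diffContOnCl_schwarzLift (h.family.jordan t ht).isOpen hS) (fun θ => ?_) hζ
    rw [IsDiscMap.schwarzLift, if_neg (exp_ne_zero _), hG, hS.boundary _ (by
      rw [(h.family.jordan t ht).frontier_eq]; exact mem_range_self θ)]
  have hB0 : ∀ t ∈ J, B t 0 ≠ 0 := by
    intro t ht
    obtain ⟨G, hd, hG⟩ := h.exists_isDiscMap ht
    rw [hBS t ht 0 (by simp), IsDiscMap.schwarzLift, if_pos rfl]
    exact div_ne_zero (hr t ht) (hd.deriv_ne_zero 0 (by simp))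
  refine ⟨fun t => quotDisc (flowMap J φ Γ t) (B t), ⟨hA1,
    sphereSmoothOn_sphereQuot hB1 contDiffOn_snd fun q hq => ?_, fun t ht => ?_⟩, fun t ht => ?_⟩
  · by_cases h0 : q.2 = 0
    · exact Or.inl (by rw [h0]; exact hB0 _ hq.1)
    · exact Or.inr h0
  · obtain ⟨G, hd, hG⟩ := h.exists_isDiscMap ht
    have hS := h.isSchwarzFunction ht (hr t ht) (hM t ht)
    refine isAdmissibleDisc_quotDisc (G := G) (hslice t ht _ hA1) (hslice t ht _ hB1)
      hd.differentiableOn ?_ hd.injOn hd.map_zero (hB0 t ht) (fun ζ hζ => ?_) (fun ζ hζ => ?_)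
      (by rw [hd.bijOn.image_eq]; exact hd.inverse) hd.left_inv
    · exact (hd.diffContOnCl_schwarzLift (h.family.jordan t ht).isOpen hS).differentiableOn.congr fun ζ hζ =>
        hBS t ht ζ (ball_subset_closedBall hζ)
    · refine ⟨_, ?_, h.hasDerivWithinAt_flowMap ht hζ⟩
      rw [mem_closedBall_zero_iff] at hζ
      rcases hζ.lt_or_eq with h1 | h1
      · have h2 : ζ ∈ ball (0 : ℂ) 1 := mem_ball_zero_iff.2 h1
        rw [← h.deriv_flowMap ht h2]
        exact hd.deriv_ne_zero ζ h2
      · obtain ⟨θ, rfl⟩ := hac.exists_exp_eq ht (mem_sphere_zero_iff_norm.2 h1)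
        intro h0
        have h2 := h.angleDeriv_eq ht θ
        rw [h0, mul_zero, mul_zero] at h2
        exact (h.curve ht).regular θ h2
    · obtain ⟨θ, rfl⟩ := hac.exists_exp_eq ht hζ
      rw [hG, hBS t ht _ (sphere_subset_closedBall hζ), IsDiscMap.schwarzLift,
        if_neg (exp_ne_zero _), hG, hS.boundary _ (by
        rw [(h.family.jordan t ht).frontier_eq]; exact mem_range_self θ),
        mul_div_cancel_left₀ _ (exp_ne_zero _)]
      exact ⟨h.mem t ht θ, rfl⟩
  · obtain ⟨G, hd, hG⟩ := h.exists_isDiscMap ht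
    rw [discShadow_quotDisc, hd.bijOn.image_eq]

end IsOrientedFlow

/-- By the law of motion of the moments, a Schwarz function at one time gives Schwarz functions, and
hence holomorphic discs, at all times. -/
theorem IsHeleShawFlow.exists_discFamily {U : Set ℂ} (hU : IsOpen U) {φ : ℂ → ℝ}
    (hφ : ContDiffOn ℝ ∞ φ U) (hsub : ∀ z ∈ U, 0 < laplacian φ z) {J : Set ℝ}
    (hJ : J.OrdConnected) (hJ' : J.Nontrivial) {Ω : ℝ → Set ℂ}
    (hflow : IsHeleShawFlow (fun z => 1 / laplacian φ z) J Ω)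
    (hΩU : ∀ t ∈ J, frontier (Ω t) ⊆ U) {t₀ : ℝ} (ht₀ : t₀ ∈ J) {S : ℂ → ℂ} {r : ℂ}
    (hS : IsSchwarzFunction (Ω t₀) φ S r)
    (hr : ∀ t ∈ J, r + (((t - t₀) / (4 * π) : ℝ) : ℂ) ≠ 0) :
    ∃ F : ℝ → ℂ → ℂ × OnePoint ℂ, IsSmoothDiscFamily U φ J F ∧
      ∀ t ∈ J, discShadow (F t) = Ω t := by
  obtain ⟨Γ, hΓ, hflux⟩ := hflow.exists_positive_param hU hφ hsub hJ hJ' hΩU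
  have h : IsOrientedFlow U φ J Ω Γ := ⟨hU, hφ, hJ, hJ', hflow.1, hΓ, fun t ht θ =>
    hΩU t ht (by rw [(hΓ.jordan t ht).frontier_eq]; exact mem_range_self θ), hflux⟩
  exact h.exists_discFamily hr fun t ht z hz => h.momentFun_eq ht₀ hS ht hz

/-! ### Holomorphic extensions of smooth families of boundary values -/

theorem norm_exp_angle (θ : ℝ) : cexp (θ * I) ∈ closedBall (0 : ℂ) 1 := by
  rw [mem_closedBall_zero_iff, norm_exp_ofReal_mul_I]

theorem exp_angle_mem_sphere (θ : ℝ) : cexp (θ * I) ∈ sphere (0 : ℂ) 1 := by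
  rw [mem_sphere_zero_iff_norm, norm_exp_ofReal_mul_I]

theorem exp_angle_periodic : Periodic (fun θ : ℝ => cexp (θ * I)) (2 * π) := by
  intro θ
  simp only
  rw [exp_eq_exp_iff_exists_int]; exact ⟨1, by push_cast; ring⟩

theorem angleChange_id (J : Set ℝ) : AngleChange J (fun _ θ => θ) (fun _ _ => 1) :=
  ⟨contDiffOn_snd, fun _ _ θ => hasDerivAt_id θ, fun _ _ _ => one_pos, fun _ _ _ => rfl⟩

theorem exists_exp_angle_eq {ζ : ℂ} (hζ : ζ ∈ sphere (0 : ℂ) 1) :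
    ∃ θ : ℝ, cexp (θ * I) = ζ :=
  (angleChange_id univ).exists_exp_eq (mem_univ 0) hζ

theorem univ_nontrivial_real : (univ : Set ℝ).Nontrivial := nontrivial_univ

theorem DiffContOnCl.integral_circle {f : ℂ → ℂ} (hf : DiffContOnCl ℂ f (ball 0 1)) :
    ∫ θ in (0 : ℝ)..(2 * π), f (cexp (θ * I)) = 2 * π * f 0 := by
  have := (angleChange_id univ).integral_of_diffContOnCl ordConnected_univ univ_nontrivial_real
    (mem_univ 0) hf
  simpa using this

theorem DiffContOnCl.continuousOn_closedBall {f : ℂ → ℂ}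
    (hf : DiffContOnCl ℂ f (ball 0 1)) : ContinuousOn f (closedBall 0 1) := by
  have := hf.continuousOn
  rwa [closure_ball _ one_ne_zero] at this

theorem diffContOnCl_ball_of {f : ℂ → ℂ} (hf : DifferentiableOn ℂ f (ball 0 1))
    (hc : ContinuousOn f (closedBall 0 1)) : DiffContOnCl ℂ f (ball 0 1) :=
  ⟨hf, by rwa [closure_ball _ one_ne_zero]⟩

theorem DiffContOnCl.dslope_ball {f : ℂ → ℂ} (hf : DiffContOnCl ℂ f (ball 0 1)) {z : ℂ}
    (hz : z ∈ ball (0 : ℂ) 1) : DiffContOnCl ℂ (dslope f z) (ball 0 1) := by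
  have hn := isOpen_ball.mem_nhds hz
  refine diffContOnCl_ball_of ((Complex.differentiableOn_dslope hn).2 hf.differentiableOn) ?_
  exact (continuousOn_dslope (mem_of_superset hn ball_subset_closedBall)).2
    ⟨hf.continuousOn_closedBall, hf.differentiableOn.differentiableAt hn⟩

/-- A function holomorphic on the disc and real on the circle is constant on the circle. -/
theorem DiffContOnCl.eq_of_real_on_circle {f : ℂ → ℂ} (hf : DiffContOnCl ℂ f (ball 0 1))
    {k : ℝ → ℝ} (hk : ∀ θ : ℝ, f (cexp (θ * I)) = k θ) (θ : ℝ) : f 0 = k θ := by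
  have hπ : (π : ℂ) ≠ 0 := by exact_mod_cast Real.pi_ne_zero
  have hkc : Continuous k := by
    have h1 : Continuous fun θ : ℝ => (f (cexp (θ * I))).re :=
      continuous_re.comp (hf.continuousOn_closedBall.comp_continuous (by fun_prop) norm_exp_angle)
    simpa only [hk, ofReal_re] using h1
  -- the mean value is real
  obtain ⟨m, hm⟩ : ∃ m : ℝ, f 0 = m := by
    refine ⟨(∫ θ in (0 : ℝ)..(2 * π), k θ) / (2 * π), ?_⟩
    have h1 := hf.integral_circle
    simp only [hk] at h1
    rw [integral_ofReal] at h1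
    push_cast
    rw [h1]
    field_simp
  -- the square of `f - f 0` is nonnegative on the circle and has mean zero
  have h2 : DiffContOnCl ℂ (fun ζ => (f ζ - m) * (f ζ - m)) (ball 0 1) :=
    DiffContOnCl.smul (f := fun ζ => f ζ - m) (c := fun ζ => f ζ - m)
      (hf.sub_const _) (hf.sub_const _)
  have h3 := h2.integral_circle
  simp only [hk, hm, sub_self, mul_zero] at h3
  have h4 : ∫ θ in (0 : ℝ)..(2 * π), (k θ - m) ^ 2 = 0 := by
    have : ((∫ θ in (0 : ℝ)..(2 * π), (k θ - m) ^ 2 : ℝ) : ℂ) = 0 := by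
      rw [← h3, ← integral_ofReal]
      refine integral_congr fun θ _ => ?_
      push_cast; ring
    exact_mod_cast this
  have hcont : Continuous fun θ => (k θ - m) ^ 2 := (hkc.sub continuous_const).pow 2
  have hper : Periodic k (2 * π) := fun θ => by
    have h5 := hk (θ + 2 * π)
    have h6 := exp_angle_periodic θ
    simp only at h6
    rw [h6, hk θ] at h5
    exact_mod_cast h5.symm
  have h7 : ∀ θ ∈ Icc 0 (2 * π), k θ = m := by
    intro θ hθ
    by_contra hne
    have h8 : 0 < ∫ θ in (0 : ℝ)..(2 * π), (k θ - m) ^ 2 :=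
      intervalIntegral.integral_pos Real.two_pi_pos hcont.continuousOn
        (fun x _ => sq_nonneg _) ⟨θ, hθ, by
          have : k θ - m ≠ 0 := sub_ne_zero.2 hne
          positivity⟩
    exact h8.ne' h4
  obtain ⟨y, hy, hky⟩ := hper.exists_mem_Ico₀ Real.two_pi_pos θ
  rw [hm, hky, h7 y (Ico_subset_Icc_self hy)]

theorem powerSum_zero (c : ℕ → ℂ) : powerSum c 0 = c 0 := by
  rw [powerSum, tsum_eq_single 0 fun n hn => by simp [hn]]
  simp

section Extension

variable {J : Set ℝ} {u : ℝ → ℝ → ℂ} {A : ℝ → ℂ → ℂ}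

/-- The Fourier coefficients of nonnegative index of `u t`. -/
def fourierMode (u : ℝ → ℝ → ℂ) (n : ℕ) (t : ℝ) : ℂ :=
  modeCoeff (fun _ θ => θ) (fun _ _ => 1) u n t

theorem timeOp_id (hJ : J.OrdConnected) (hJ' : J.Nontrivial) {t : ℝ} (ht : t ∈ J) (θ : ℝ) :
    AngleChange.timeOp J (fun _ θ => θ) (fun _ _ => 1) u t θ = timeDeriv J u t θ := by
  have : timeDeriv J (fun _ θ => θ) t θ = (0 : ℝ) :=
    timeDeriv_eq_of_hasDerivWithinAt hJ hJ' ht (hasDerivWithinAt_const _ _ _)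
  simp [AngleChange.timeOp, this]

theorem fourierMode_congr {v : ℝ → ℝ → ℂ} {t : ℝ} (h : ∀ θ, u t θ = v t θ) (n : ℕ) :
    fourierMode u n t = fourierMode v n t := by
  simp only [fourierMode, modeCoeff, h]

theorem SmoothPeriodic.rapidFamily_id (hu : SmoothPeriodic J u) (hJ : J.OrdConnected)
    (hJ' : J.Nontrivial) : ∃ C : ℕ → ℕ → ℝ → ℂ, RapidFamily J C ∧ (C 0 = fourierMode u) ∧
      ∀ n, ∀ t ∈ J, C 1 n t = fourierMode (_root_.timeDeriv J u) n t :=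
  ⟨_, (angleChange_id J).rapidFamily hJ hJ' hu, rfl, fun _ _ ht =>
    fourierMode_congr (fun θ => timeOp_id hJ hJ' ht θ) _⟩

theorem SmoothPeriodic.powerSum_fourierMode (hu : SmoothPeriodic J u) (hJ : J.OrdConnected)
    (hJ' : J.Nontrivial) {t : ℝ} (ht : t ∈ J) {f : ℂ → ℂ}
    (hf : DiffContOnCl ℂ f (ball 0 1)) (hfu : ∀ θ : ℝ, f (cexp (θ * I)) = u t θ)
    {ζ : ℂ} (hζ : ζ ∈ closedBall (0 : ℂ) 1) :
    powerSum (fun n => fourierMode u n t) ζ = f ζ :=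
  (angleChange_id J).powerSum_modeCoeff hJ hJ' hu ht hf hfu hζ

theorem RapidFamily.diffContOnCl {C : ℕ → ℕ → ℝ → ℂ} (hC : RapidFamily J C) (j : ℕ) {t : ℝ}
    (ht : t ∈ J) : DiffContOnCl ℂ (powerSum fun n => C j n t) (ball 0 1) :=
  diffContOnCl_ball_of (fun _ hζ => ((hC.hasDerivWithinAt_space j ht
      (ball_subset_closedBall hζ)).mono ball_subset_closedBall).differentiableWithinAt)
    fun _ hζ => (hC.hasDerivWithinAt_space j ht hζ).continuousWithinAt

/-- A holomorphic function with smooth boundary values has a complex derivative up to the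
boundary. -/
theorem SmoothPeriodic.exists_deriv_extension (hu : SmoothPeriodic J u) (hJ : J.OrdConnected)
    (hJ' : J.Nontrivial) {t : ℝ} (ht : t ∈ J) {f : ℂ → ℂ}
    (hf : DiffContOnCl ℂ f (ball 0 1)) (hfu : ∀ θ : ℝ, f (cexp (θ * I)) = u t θ) :
    ∃ D, DiffContOnCl ℂ D (ball 0 1) ∧
      (∀ ζ ∈ closedBall (0 : ℂ) 1, HasDerivWithinAt f (D ζ) (closedBall 0 1) ζ) ∧
      (∀ ζ ∈ ball (0 : ℂ) 1, HasDerivAt f (D ζ) ζ) ∧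
      (∀ θ : ℝ, _root_.angleDeriv u t θ = I * cexp (θ * I) * D (cexp (θ * I))) ∧
      D 0 = fourierMode u 1 t := by
  obtain ⟨C, hC, hC0, -⟩ := hu.rapidFamily_id hJ hJ'
  have heq : EqOn f (powerSum fun n => C 0 n t) (closedBall 0 1) := fun ζ hζ => by
    rw [hC0]; exact (hu.powerSum_fourierMode hJ hJ' ht hf hfu hζ).symm
  have hd : ∀ ζ ∈ closedBall (0 : ℂ) 1, HasDerivWithinAt f
      (powerSum (derivCoeff fun n => C 0 n t) ζ) (closedBall 0 1) ζ := fun ζ hζ =>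
    (hC.hasDerivWithinAt_space 0 ht hζ).congr heq (heq hζ)
  refine ⟨_, hC.space.diffContOnCl 0 ht, hd, fun ζ hζ => ?_, fun θ => ?_, ?_⟩
  · exact (hd ζ (ball_subset_closedBall hζ)).hasDerivAt
      (mem_of_superset (isOpen_ball.mem_nhds hζ) ball_subset_closedBall)
  · have h1 : HasDerivAt (fun θ : ℝ => cexp (θ * I)) (cexp (θ * I) * (1 * I)) θ :=
      ((hasDerivAt_id θ).ofReal_comp.mul_const I).cexp
    have h2 := HasDerivWithinAt.scomp_hasDerivAt (h := fun θ : ℝ => cexp (θ * I)) θ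
      (hd _ (norm_exp_angle θ)) h1 norm_exp_angle
    have h3 : (f ∘ fun θ : ℝ => cexp (θ * I)) = u t := funext hfu
    rw [h3] at h2
    rw [_root_.angleDeriv, h2.deriv, smul_eq_mul]
    ring
  · show powerSum (derivCoeff fun n => C 0 n t) 0 = _
    rw [powerSum_zero, derivCoeff, hC0]
    simp

/-- The time derivative of a family of holomorphic functions with smooth boundary values. -/
theorem SmoothPeriodic.exists_time_extension (hu : SmoothPeriodic J u) (hJ : J.OrdConnected)
    (hJ' : J.Nontrivial) (hA : ∀ t ∈ J, DiffContOnCl ℂ (A t) (ball 0 1))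
    (hAu : ∀ t ∈ J, ∀ θ : ℝ, A t (cexp (θ * I)) = u t θ) {t : ℝ} (ht : t ∈ J) :
    ∃ D, DiffContOnCl ℂ D (ball 0 1) ∧
      (∀ θ : ℝ, D (cexp (θ * I)) = _root_.timeDeriv J u t θ) ∧
      (∀ ζ ∈ closedBall (0 : ℂ) 1, HasDerivWithinAt (fun τ => A τ ζ) (D ζ) J t) := by
  obtain ⟨C, hC, hC0, hC1⟩ := hu.rapidFamily_id hJ hJ'
  have hd : ∀ ζ ∈ closedBall (0 : ℂ) 1, HasDerivWithinAt (fun τ => A τ ζ)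
      (powerSum (fun n => C 1 n t) ζ) J t := fun ζ hζ => by
    have heq : ∀ τ ∈ J, A τ ζ = powerSum (fun n => C 0 n τ) ζ := fun τ hτ => by
      rw [hC0]; exact (hu.powerSum_fourierMode hJ hJ' hτ (hA τ hτ) (hAu τ hτ) hζ).symm
    exact (hC.hasDerivWithinAt_time hJ 0 ht hζ).congr heq (heq t ht)
  refine ⟨_, hC.diffContOnCl 1 ht, fun θ => ?_, hd⟩
  refine (timeDeriv_eq_of_hasDerivWithinAt hJ hJ' ht ?_).symm
  exact (hd _ (norm_exp_angle θ)).congr (fun τ hτ => (hAu τ hτ θ).symm) (hAu t ht θ).symm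

theorem SmoothPeriodic.hasDerivWithinAt_fourierMode (hu : SmoothPeriodic J u)
    (hJ : J.OrdConnected) (hJ' : J.Nontrivial) (n : ℕ) {t : ℝ} (ht : t ∈ J) :
    HasDerivWithinAt (fourierMode u n) (fourierMode (_root_.timeDeriv J u) n t) J t := by
  obtain ⟨C, hC, hC0, hC1⟩ := hu.rapidFamily_id hJ hJ'
  have := hC.deriv 0 n t ht
  rw [hC0] at this
  rw [← hC1 n t ht]
  exact this

end Extension

/-! ### Fourier modes and the projection to nonnegative frequencies -/

section Modes

variable {J : Set ℝ} {u v : ℝ → ℝ → ℂ}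

theorem fourierMode_eq (u : ℝ → ℝ → ℂ) (n : ℕ) (t : ℝ) : fourierMode u n t =
    (1 / (2 * π)) * ∫ θ in (0 : ℝ)..(2 * π), u t θ * cexp (-(n * θ) * I) := by
  simp only [fourierMode, modeCoeff, ofReal_one, mul_one]

theorem SmoothPeriodic.smooth_mul_exp (hu : SmoothPeriodic J u) (n : ℕ) :
    SmoothOnStrip J (fun t θ => u t θ * cexp (-(n * θ) * I)) :=
  (hu.mul ((angleChange_id J).smoothPeriodic_exp n)).smooth

theorem SmoothPeriodic.contDiffOn_fourierMode (hu : SmoothPeriodic J u) (hJ : J.OrdConnected)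
    (hJ' : J.Nontrivial) (n : ℕ) : ContDiffOn ℝ ∞ (fourierMode u n) J := by
  have h := (hu.smooth_mul_exp n).contDiffOn_integral hJ hJ' (2 * π)
  exact (contDiffOn_const.mul h).congr fun t _ => fourierMode_eq u n t

theorem SmoothPeriodic.conj (hu : SmoothPeriodic J u) :
    SmoothPeriodic J (fun t θ => starRingEnd ℂ (u t θ)) :=
  ⟨conjCLE.contDiff.comp_contDiffOn hu.smooth, fun t ht θ => by
    simp only [hu.periodic t ht θ]⟩

theorem SmoothPeriodic.fourierMode_add (hu : SmoothPeriodic J u) (hv : SmoothPeriodic J v)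
    {t : ℝ} (ht : t ∈ J) (n : ℕ) :
    fourierMode (fun t θ => u t θ + v t θ) n t = fourierMode u n t + fourierMode v n t := by
  rw [fourierMode_eq, fourierMode_eq, fourierMode_eq, ← mul_add,
    ← integral_add
      (((hu.smooth_mul_exp n).contDiff ht).continuous.intervalIntegrable _ _)
      (((hv.smooth_mul_exp n).contDiff ht).continuous.intervalIntegrable _ _)]
  simp only [add_mul]

theorem fourierMode_const_mul {c : ℂ} {t : ℝ} (h : ∀ θ, u t θ = c * v t θ) (n : ℕ) :
    fourierMode u n t = c * fourierMode v n t := by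
  rw [fourierMode_eq, fourierMode_eq, mul_left_comm, ← integral_const_mul c]
  simp only [h, mul_assoc]

/-- The projection of `u t` to the nonnegative Fourier modes. -/
def szego (u : ℝ → ℝ → ℂ) (t θ : ℝ) : ℂ := powerSum (fun n => fourierMode u n t) (cexp (θ * I))

theorem szego_const_mul {c : ℂ} {t : ℝ} (h : ∀ θ, u t θ = c * v t θ) (θ : ℝ) :
    szego u t θ = c * szego v t θ := by
  simp only [szego, powerSum, fourierMode_const_mul h, mul_assoc, tsum_mul_left]

theorem SmoothPeriodic.summable_szego (hu : SmoothPeriodic J u) (hJ : J.OrdConnected)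
    (hJ' : J.Nontrivial) {t : ℝ} (ht : t ∈ J) (θ : ℝ) :
    Summable fun n => fourierMode u n t * cexp (θ * I) ^ n := by
  obtain ⟨C, hC, hC0, -⟩ := hu.rapidFamily_id hJ hJ'
  have := hC.summable 0 ht (norm_exp_angle θ)
  rwa [hC0] at this

theorem SmoothPeriodic.szego_add (hu : SmoothPeriodic J u) (hv : SmoothPeriodic J v)
    (hJ : J.OrdConnected) (hJ' : J.Nontrivial) {t : ℝ} (ht : t ∈ J) (θ : ℝ) :
    szego (fun t θ => u t θ + v t θ) t θ = szego u t θ + szego v t θ := by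
  rw [szego, szego, szego, powerSum, powerSum, powerSum,
    ← (hu.summable_szego hJ hJ' ht θ).tsum_add (hv.summable_szego hJ hJ' ht θ)]
  simp only [hu.fourierMode_add hv ht, add_mul]

theorem SmoothPeriodic.szego (hu : SmoothPeriodic J u) (hJ : J.OrdConnected)
    (hJ' : J.Nontrivial) : SmoothPeriodic J (szego u) := by
  obtain ⟨C, hC, hC0, -⟩ := hu.rapidFamily_id hJ hJ'
  refine ⟨?_, fun t ht θ => ?_⟩
  · have h1 := hC.contDiffOn hJ
    rw [hC0] at h1
    refine ContDiffOn.comp (f := fun q : ℝ × ℝ => (q.1, cexp (q.2 * I))) h1 ?_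
      (fun q hq => ⟨hq.1, norm_exp_angle _⟩)
    exact contDiffOn_fst.prodMk (contDiff_exp.comp_contDiffOn
      ((ofRealCLM.contDiff.comp_contDiffOn contDiffOn_snd).mul contDiffOn_const))
  · have := exp_angle_periodic θ
    simp only at this
    rw [_root_.szego, _root_.szego, this]

theorem SmoothPeriodic.timeDeriv_szego (hu : SmoothPeriodic J u) (hJ : J.OrdConnected)
    (hJ' : J.Nontrivial) {t : ℝ} (ht : t ∈ J) (θ : ℝ) :
    _root_.timeDeriv J (_root_.szego u) t θ = _root_.szego (_root_.timeDeriv J u) t θ := by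
  obtain ⟨C, hC, hC0, hC1⟩ := hu.rapidFamily_id hJ hJ'
  refine timeDeriv_eq_of_hasDerivWithinAt hJ hJ' ht ?_
  have := hC.hasDerivWithinAt_time hJ 0 ht (norm_exp_angle θ)
  rw [hC0] at this
  refine this.congr_deriv ?_
  simp only [_root_.szego, zero_add, hC1 _ t ht]

theorem conj_intervalIntegral (f : ℝ → ℂ) (a b : ℝ) :
    starRingEnd ℂ (∫ θ in a..b, f θ) = ∫ θ in a..b, starRingEnd ℂ (f θ) := by
  rw [intervalIntegral, intervalIntegral, map_sub, integral_conj, integral_conj]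

/-- The negative modes of the boundary values of a holomorphic function vanish. -/
theorem fourierMode_conj_of_diffContOnCl {f : ℂ → ℂ} (hf : DiffContOnCl ℂ f (ball 0 1)) {t : ℝ}
    (hfu : ∀ θ : ℝ, f (cexp (θ * I)) = u t θ) (n : ℕ) :
    fourierMode (fun t θ => starRingEnd ℂ (u t θ)) n t =
      if n = 0 then starRingEnd ℂ (f 0) else 0 := by
  have hπ : (π : ℂ) ≠ 0 := by exact_mod_cast Real.pi_ne_zero
  have h1 : DiffContOnCl ℂ (fun ζ => ζ ^ n * f ζ) (ball 0 1) :=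
    DiffContOnCl.smul (c := fun ζ : ℂ => ζ ^ n) (differentiable_id.pow n).diffContOnCl hf
  have h2 := congrArg (starRingEnd ℂ) h1.integral_circle
  rw [conj_intervalIntegral] at h2
  rw [fourierMode_eq]
  have h3 : ∫ θ in (0 : ℝ)..(2 * π), starRingEnd ℂ (u t θ) * cexp (-(n * θ) * I) =
      starRingEnd ℂ (2 * π * ((0 : ℂ) ^ n * f 0)) := by
    rw [← h2]
    refine integral_congr fun θ _ => ?_
    simp only [map_mul, map_pow, hfu, ← Complex.exp_conj, conj_I, conj_ofReal]
    rw [← exp_nat_mul]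
    rw [mul_comm]
    congr 2
    ring
  rw [h3]
  split_ifs with hn
  · subst hn
    simp only [pow_zero, one_mul, map_mul, conj_ofReal, map_ofNat]
    field_simp
  · rw [zero_pow hn]; simp

end Modes

/-! ### Normalized families of holomorphic discs -/

/-- A family of holomorphic discs in normal form: `A t` maps the disc conformally onto `Ω t`, with
`A t 0 = 0` and positive derivative there, and `B t ζ / ζ` is the second component of the disc, so
that its boundary value is `∂φ/∂z`. The boundary values `u` of `A` are smooth. -/
structure IsNormalizedFamily (U : Set ℂ) (φ : ℂ → ℝ) (J : Set ℝ) (Ω : ℝ → Set ℂ)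
    (u : ℝ → ℝ → ℂ) (A B : ℝ → ℂ → ℂ) : Prop where
  isOpen : IsOpen U
  smooth : ContDiffOn ℝ ∞ φ U
  subharmonic : ∀ z ∈ U, 0 < laplacian φ z
  ordConnected : J.OrdConnected
  nontrivial : J.Nontrivial
  boundary_smooth : SmoothPeriodic J u
  mem : ∀ t ∈ J, ∀ θ, u t θ ∈ U
  regular : ∀ t ∈ J, ∀ θ, angleDeriv u t θ ≠ 0
  map : ∀ t ∈ J, DiffContOnCl ℂ (A t) (ball 0 1)
  boundary : ∀ t ∈ J, ∀ θ : ℝ, A t (cexp (θ * I)) = u t θ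
  map_zero : ∀ t ∈ J, A t 0 = 0
  injOn : ∀ t ∈ J, InjOn (A t) (closedBall 0 1)
  image : ∀ t ∈ J, A t '' ball 0 1 = Ω t
  isOpen_domain : ∀ t ∈ J, IsOpen (Ω t)
  deriv_ne_zero : ∀ t ∈ J, ∀ ζ ∈ ball (0 : ℂ) 1, deriv (A t) ζ ≠ 0
  deriv_pos : ∀ t ∈ J, ∃ c : ℝ, 0 < c ∧ deriv (A t) 0 = c
  increasing : IsIncreasingFamily J Ω
  lift : ∀ t ∈ J, DiffContOnCl ℂ (B t) (ball 0 1)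
  lift_boundary : ∀ t ∈ J, ∀ θ : ℝ, B t (cexp (θ * I)) = cexp (θ * I) * wirtinger φ (u t θ)

/-- The boundary values of `B`. -/
def liftBoundary (φ : ℂ → ℝ) (u : ℝ → ℝ → ℂ) (t θ : ℝ) : ℂ :=
  cexp (θ * I) * wirtinger φ (u t θ)

/-- The new time: `4π` times the residue of the Schwarz function. -/
def newTime (φ : ℂ → ℝ) (u : ℝ → ℝ → ℂ) (t : ℝ) : ℝ :=
  4 * π * (fourierMode u 1 t * fourierMode (liftBoundary φ u) 0 t).re

/-- The rate of change of the new time. -/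
def newRate (J : Set ℝ) (φ : ℂ → ℝ) (u : ℝ → ℝ → ℂ) (t : ℝ) : ℝ :=
  4 * π * (fourierMode (timeDeriv J u) 1 t * fourierMode (liftBoundary φ u) 0 t +
    fourierMode u 1 t * fourierMode (timeDeriv J (liftBoundary φ u)) 0 t).re

/-- The density `1 / (2π Δφ |u_θ|²)`. -/
def speedDensity (φ : ℂ → ℝ) (u : ℝ → ℝ → ℂ) (t θ : ℝ) : ℝ :=
  (2 * π * laplacian φ (u t θ) * normSq (angleDeriv u t θ))⁻¹

/-- The boundary value of the holomorphic function with real part `speedDensity` that is real at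
the origin. -/
def speedKernel (φ : ℂ → ℝ) (u : ℝ → ℝ → ℂ) (t θ : ℝ) : ℂ :=
  2 * szego (fun t θ => (speedDensity φ u t θ : ℂ)) t θ -
    fourierMode (fun t θ => (speedDensity φ u t θ : ℂ)) 0 t

namespace IsNormalizedFamily

variable {U : Set ℂ} {φ : ℂ → ℝ} {J : Set ℝ} {Ω : ℝ → Set ℂ} {u : ℝ → ℝ → ℂ} {A B : ℝ → ℂ → ℂ}

theorem smooth_exp (J : Set ℝ) : SmoothPeriodic J (fun _ θ => cexp (θ * I)) :=
  ⟨contDiff_exp.comp_contDiffOn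
    ((ofRealCLM.contDiff.comp_contDiffOn contDiffOn_snd).mul contDiffOn_const),
    fun _ _ => exp_angle_periodic⟩

theorem smooth_wirtinger (h : IsNormalizedFamily U φ J Ω u A B) :
    SmoothPeriodic J (fun t θ => wirtinger φ (u t θ)) :=
  h.boundary_smooth.comp (contDiffOn_wirtinger h.isOpen h.smooth) h.mem

theorem smooth_liftBoundary (h : IsNormalizedFamily U φ J Ω u A B) :
    SmoothPeriodic J (liftBoundary φ u) :=
  (smooth_exp J).mul h.smooth_wirtinger

theorem contDiffOn_speed (h : IsNormalizedFamily U φ J Ω u A B) :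
    ContDiffOn ℝ ∞ (fun p : ℂ × ℂ =>
      (2 * π * laplacian φ p.1 * normSq p.2)⁻¹) (U ×ˢ {0}ᶜ) := by
  have h1 : ContDiffOn ℝ ∞ (fun p : ℂ × ℂ => laplacian φ p.1) (U ×ˢ {0}ᶜ) :=
    (contDiffOn_laplacian h.isOpen h.smooth).comp contDiffOn_fst fun p hp => hp.1
  have h3 : ContDiff ℝ ∞ (fun p : ℂ × ℂ => normSq p.2) := by
    have h4 : ContDiff ℝ ∞ (fun p : ℂ × ℂ => ‖p.2‖ ^ 2) := contDiff_snd.norm_sq ℝ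
    simpa only [normSq_eq_norm_sq] using h4
  refine ContDiffOn.inv ((contDiffOn_const.mul h1).mul h3.contDiffOn) fun p hp => ?_
  have e1 := h.subharmonic _ hp.1
  have e2 := normSq_pos.2 hp.2
  have := Real.pi_pos
  positivity

theorem smooth_speedDensity (h : IsNormalizedFamily U φ J Ω u A B) :
    SmoothPeriodic J (speedDensity φ u) :=
  (h.boundary_smooth.prodMk (h.boundary_smooth.angleDeriv h.ordConnected h.nontrivial)).comp
    h.contDiffOn_speed fun t ht θ => ⟨h.mem t ht θ, h.regular t ht θ⟩

theorem contDiffOn_newTime (h : IsNormalizedFamily U φ J Ω u A B) :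
    ContDiffOn ℝ ∞ (newTime φ u) J :=
  contDiffOn_const.mul (reCLM.contDiff.comp_contDiffOn
    ((h.boundary_smooth.contDiffOn_fourierMode h.ordConnected h.nontrivial 1).mul
      (h.smooth_liftBoundary.contDiffOn_fourierMode h.ordConnected h.nontrivial 0)))

theorem hasDerivWithinAt_newTime (h : IsNormalizedFamily U φ J Ω u A B) {t : ℝ} (ht : t ∈ J) :
    HasDerivWithinAt (newTime φ u) (newRate J φ u t) J t := by
  have h1 := (h.boundary_smooth.hasDerivWithinAt_fourierMode h.ordConnected h.nontrivial 1 ht).mul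
    (h.smooth_liftBoundary.hasDerivWithinAt_fourierMode h.ordConnected h.nontrivial 0 ht)
  have h2 := (reCLM.hasFDerivAt.comp_hasDerivWithinAt t h1).const_mul (4 * π)
  exact h2

/-- The speed of the new time is the product of `2πΔφ` and the rate at which area is swept out, at
each boundary point. -/
theorem newRate_eq (h : IsNormalizedFamily U φ J Ω u A B) {t : ℝ} (ht : t ∈ J) (θ : ℝ) :
    newRate J φ u t = 2 * π * laplacian φ (u t θ) *
      (starRingEnd ℂ (timeDeriv J u t θ) * angleDeriv u t θ).im := by
  have hs := h.boundary_smooth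
  have hv := h.smooth_liftBoundary
  obtain ⟨D, hD, -, hDd, hDb, hD0⟩ := hs.exists_deriv_extension h.ordConnected h.nontrivial ht
    (h.map t ht) (h.boundary t ht)
  obtain ⟨E, hE, -, -, hEb, -⟩ := hv.exists_deriv_extension h.ordConnected h.nontrivial ht
    (h.lift t ht) (h.lift_boundary t ht)
  obtain ⟨A', hA', hA'b, hA'd⟩ := hs.exists_time_extension h.ordConnected h.nontrivial
    h.map h.boundary ht
  obtain ⟨B', hB', hB'b, hB'd⟩ := hv.exists_time_extension h.ordConnected h.nontrivial
    h.lift h.lift_boundary ht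
  have hst := hs.timeDeriv h.ordConnected h.nontrivial
  have hvt := hv.timeDeriv h.ordConnected h.nontrivial
  have m0 : (0 : ℂ) ∈ closedBall (0 : ℂ) 1 := by simp
  have hA'0 : A' 0 = 0 := by
    have h1 := (hA'd 0 m0).congr (f₁ := fun _ => (0 : ℂ)) (fun τ hτ => (h.map_zero τ hτ).symm)
      (h.map_zero t ht).symm
    exact (uniqueDiffOn_of_ordConnected h.ordConnected h.nontrivial t ht).eq_deriv _ h1
      (hasDerivWithinAt_const t J 0)
  have hB0 : B t 0 = fourierMode (liftBoundary φ u) 0 t := by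
    rw [← hv.powerSum_fourierMode h.ordConnected h.nontrivial ht (h.lift t ht)
      (h.lift_boundary t ht) m0, powerSum_zero]
  have hB'0 : B' 0 = fourierMode (timeDeriv J (liftBoundary φ u)) 0 t := by
    rw [← hvt.powerSum_fourierMode h.ordConnected h.nontrivial ht hB' hB'b m0, powerSum_zero]
  have hA'1 : deriv A' 0 = fourierMode (timeDeriv J u) 1 t := by
    obtain ⟨D', -, -, hD'd, -, hD'0⟩ := hst.exists_deriv_extension h.ordConnected h.nontrivial ht
      hA' hA'b
    rw [← hD'0, (hD'd 0 (by simp)).deriv]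
  have hdsl := hA'.dslope_ball (z := 0) (by simp)
  -- a holomorphic function that is real on the circle, hence constant; `D`, `E` are the complex
  -- derivatives and `A'`, `B'` the time derivatives of `A t`, `B t`
  have hK : DiffContOnCl ℂ (fun ζ => D ζ * B' ζ - E ζ * A' ζ + B t ζ * dslope A' 0 ζ)
      (ball 0 1) :=
    DiffContOnCl.add (DiffContOnCl.sub (DiffContOnCl.smul hD hB') (DiffContOnCl.smul hE hA'))
      (DiffContOnCl.smul (h.lift t ht) hdsl)
  have hKb : ∀ θ : ℝ, D (cexp (θ * I)) * B' (cexp (θ * I)) - E (cexp (θ * I)) * A' (cexp (θ * I)) +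
      B t (cexp (θ * I)) * dslope A' 0 (cexp (θ * I)) =
      ((laplacian φ (u t θ) *
        (starRingEnd ℂ (timeDeriv J u t θ) * angleDeriv u t θ).im / 2 : ℝ) : ℂ) := by
    intro θ
    have hζ := exp_ne_zero (θ * I)
    have e1 : D (cexp (θ * I)) = -I * angleDeriv u t θ / cexp (θ * I) := by
      rw [hDb θ]
      field_simp
      linear_combination D (cexp (θ * I)) * I_sq
    have hw := h.smooth_wirtinger.smooth
    have e2 : timeDeriv J (liftBoundary φ u) t θ =
        cexp (θ * I) * timeDeriv J (fun t θ => wirtinger φ (u t θ)) t θ :=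
      timeDeriv_eq_of_hasDerivWithinAt h.ordConnected h.nontrivial ht
        ((hw.hasDerivWithinAt_time ht θ).const_mul _)
    have e3 : angleDeriv (liftBoundary φ u) t θ = I * cexp (θ * I) * wirtinger φ (u t θ) +
        cexp (θ * I) * angleDeriv (fun t θ => wirtinger φ (u t θ)) t θ := by
      have h1 : HasDerivAt (fun θ : ℝ => cexp (θ * I)) (cexp (θ * I) * (1 * I)) θ :=
        ((hasDerivAt_id θ).ofReal_comp.mul_const I).cexp
      have h2 := h1.mul (hw.hasDerivAt_angle ht θ)
      have h3 : HasDerivAt (liftBoundary φ u t) _ θ := h2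
      rw [angleDeriv, h3.deriv]
      ring
    have e4 : E (cexp (θ * I)) = wirtinger φ (u t θ) -
        I * angleDeriv (fun t θ => wirtinger φ (u t θ)) t θ := by
      have h1 := hEb θ
      rw [e3] at h1
      have h2 : cexp (θ * I) * (I * E (cexp (θ * I))) = cexp (θ * I) * (I * wirtinger φ (u t θ) +
        angleDeriv (fun t θ => wirtinger φ (u t θ)) t θ) := by linear_combination -h1
      have h3 := mul_left_cancel₀ hζ h2
      linear_combination (-I) * h3 + (E (cexp (θ * I)) - wirtinger φ (u t θ)) * I_sq
    have e5 : dslope A' 0 (cexp (θ * I)) = timeDeriv J u t θ / cexp (θ * I) := by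
      rw [dslope_of_ne _ hζ, slope_def_field, hA'0, hA'b, sub_zero, sub_zero]
    have e6 := hs.smooth.wirtinger_antisymm h.isOpen h.smooth h.ordConnected h.nontrivial h.mem ht θ
    rw [e1, hB'b, e2, e4, hA'b, h.lift_boundary t ht θ, e5]
    generalize (starRingEnd ℂ (timeDeriv J u t θ) * angleDeriv u t θ).im = X at e6 ⊢
    push_cast at e6 ⊢
    field_simp
    linear_combination (-2 * I) * e6 - (laplacian φ (u t θ) * X : ℂ) * I_sq
  have hfin := hK.eq_of_real_on_circle hKb θ
  rw [hA'0, hB'0, hB0, dslope_same, hA'1, hD0, mul_zero, sub_zero] at hfin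
  have hre := congrArg Complex.re hfin
  rw [ofReal_re] at hre
  rw [newRate, add_comm (fourierMode (timeDeriv J u) 1 t * _),
    mul_comm (fourierMode (timeDeriv J u) 1 t), hre]
  ring

theorem speedDensity_pos (h : IsNormalizedFamily U φ J Ω u A B) {t : ℝ} (ht : t ∈ J) (θ : ℝ) :
    0 < speedDensity φ u t θ :=
  inv_pos.2 (mul_pos (mul_pos Real.two_pi_pos (h.subharmonic _ (h.mem t ht θ)))
    (normSq_pos.2 (h.regular t ht θ)))

theorem exists_mean_speedDensity (h : IsNormalizedFamily U φ J Ω u A B) {t : ℝ} (ht : t ∈ J) :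
    ∃ k : ℝ, 0 < k ∧ fourierMode (fun t θ => (speedDensity φ u t θ : ℂ)) 0 t = k := by
  refine ⟨1 / (2 * π) * ∫ θ in (0 : ℝ)..(2 * π), speedDensity φ u t θ, ?_, ?_⟩
  · have h1 := (h.smooth_speedDensity.smooth.contDiff ht).continuous
    have h2 : 0 < ∫ θ in (0 : ℝ)..(2 * π), speedDensity φ u t θ :=
      intervalIntegral.intervalIntegral_pos_of_pos (h1.intervalIntegrable _ _)
        (h.speedDensity_pos ht) Real.two_pi_pos
    have := Real.pi_pos
    positivity
  · rw [fourierMode_eq]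
    push_cast
    rw [← integral_ofReal]
    simp

theorem fourierMode_one_eq (h : IsNormalizedFamily U φ J Ω u A B) {t : ℝ} (ht : t ∈ J) :
    fourierMode u 1 t = deriv (A t) 0 := by
  obtain ⟨D, -, -, hDd, -, hD0⟩ := h.boundary_smooth.exists_deriv_extension h.ordConnected
    h.nontrivial ht (h.map t ht) (h.boundary t ht)
  rw [← hD0, (hDd 0 (by simp)).deriv]

theorem two_re_eq (h : IsNormalizedFamily U φ J Ω u A B) {t : ℝ} (ht : t ∈ J) (θ : ℝ) :
    I * timeDeriv J u t θ * (angleDeriv u t θ)⁻¹ +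
      starRingEnd ℂ (I * timeDeriv J u t θ * (angleDeriv u t θ)⁻¹) =
      ((2 * newRate J φ u t : ℝ) : ℂ) * (speedDensity φ u t θ : ℂ) := by
  have h1 := h.regular t ht θ
  have h2 := (h.subharmonic _ (h.mem t ht θ)).ne'
  have h3 := (normSq_pos.2 h1).ne'
  have hπ := Real.pi_ne_zero
  rw [Complex.add_conj, ← ofReal_mul]
  congr 1
  rw [h.newRate_eq ht θ, speedDensity]
  have e : (I * timeDeriv J u t θ * (angleDeriv u t θ)⁻¹).re =
      (starRingEnd ℂ (timeDeriv J u t θ) * angleDeriv u t θ).im /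
        normSq (angleDeriv u t θ) := by
    rw [Complex.inv_def, ← mul_assoc, re_mul_ofReal, div_eq_mul_inv]
    congr 1
    simp
    ring
  rw [e]
  field_simp

/-- The motion of the boundary in terms of the rate of the new time. -/
theorem timeDeriv_eq (h : IsNormalizedFamily U φ J Ω u A B) {t : ℝ} (ht : t ∈ J) :
    (fourierMode (timeDeriv J u) 1 t = newRate J φ u t *
      fourierMode (fun t θ => (speedDensity φ u t θ : ℂ)) 0 t * fourierMode u 1 t) ∧
    ∀ θ, timeDeriv J u t θ =
      newRate J φ u t * (-I * speedKernel φ u t θ * angleDeriv u t θ) := by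
  have hs := h.boundary_smooth
  obtain ⟨D, hD, -, hDd, hDb, hD0⟩ := hs.exists_deriv_extension h.ordConnected h.nontrivial ht
    (h.map t ht) (h.boundary t ht)
  obtain ⟨A', hA', hA'b, hA'd⟩ := hs.exists_time_extension h.ordConnected h.nontrivial
    h.map h.boundary ht
  have hst := hs.timeDeriv h.ordConnected h.nontrivial
  have hsa := hs.angleDeriv h.ordConnected h.nontrivial
  have m0 : (0 : ℂ) ∈ closedBall (0 : ℂ) 1 := by simp
  have hud := uniqueDiffOn_of_ordConnected h.ordConnected h.nontrivial t ht
  have hA'0 : A' 0 = 0 := by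
    have h1 := (hA'd 0 m0).congr (f₁ := fun _ => (0 : ℂ)) (fun τ hτ => (h.map_zero τ hτ).symm)
      (h.map_zero t ht).symm
    exact hud.eq_deriv _ h1 (hasDerivWithinAt_const t J 0)
  have hA'1 : deriv A' 0 = fourierMode (timeDeriv J u) 1 t := by
    obtain ⟨D', -, -, hD'd, -, hD'0⟩ := hst.exists_deriv_extension h.ordConnected h.nontrivial ht
      hA' hA'b
    rw [← hD'0, (hD'd 0 (by simp)).deriv]
  have hDne : ∀ ζ ∈ closure (ball (0 : ℂ) 1), D ζ ≠ 0 := by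
    rw [closure_ball _ one_ne_zero]
    intro ζ hζ
    rw [mem_closedBall_zero_iff] at hζ
    rcases hζ.lt_or_eq with h1 | h1
    · have h2 : ζ ∈ ball (0 : ℂ) 1 := mem_ball_zero_iff.2 h1
      rw [← (hDd ζ h2).deriv]
      exact h.deriv_ne_zero t ht ζ h2
    · obtain ⟨θ, rfl⟩ := exists_exp_angle_eq (mem_sphere_zero_iff_norm.2 h1)
      intro h0
      have := hDb θ
      rw [h0, mul_zero] at this
      exact h.regular t ht θ this
  -- `m = A' / (ζ D)` is holomorphic, and `newRate_eq` gives its real part on the circle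
  have hm : DiffContOnCl ℂ (fun ζ => dslope A' 0 ζ * (D ζ)⁻¹) (ball 0 1) :=
    DiffContOnCl.smul (hA'.dslope_ball (by simp)) (DiffContOnCl.inv hD hDne)
  -- the boundary values of `m`
  set mb : ℝ → ℝ → ℂ := fun t θ => I * timeDeriv J u t θ * (angleDeriv u t θ)⁻¹ with hmb
  have hmbs : SmoothPeriodic J mb := (hst.const_mul I).mul
    (hsa.comp (O := {0}ᶜ) (g := fun z : ℂ => z⁻¹) (contDiffOn_id.inv fun z hz => hz) h.regular)
  have hmv : ∀ θ : ℝ, dslope A' 0 (cexp (θ * I)) * (D (cexp (θ * I)))⁻¹ = mb t θ := by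
    intro θ
    have hζ := exp_ne_zero (θ * I)
    have hd : D (cexp (θ * I)) ≠ 0 := hDne _ (by
      rw [closure_ball _ one_ne_zero]; exact norm_exp_angle θ)
    simp only [hmb]
    rw [dslope_of_ne _ hζ, slope_def_field, hA'0, hA'b, sub_zero, sub_zero, hDb]
    field_simp
  -- `m` is real at the origin
  have hm0 : dslope A' 0 0 * (D 0)⁻¹ = fourierMode (timeDeriv J u) 1 t / fourierMode u 1 t := by
    rw [dslope_same, hA'1, hD0, div_eq_mul_inv]
  have hm0r : starRingEnd ℂ (dslope A' 0 0 * (D 0)⁻¹) = dslope A' 0 0 * (D 0)⁻¹ := by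
    have h1 : ∀ τ ∈ J, (fourierMode u 1 τ).im = 0 := fun τ hτ => by
      obtain ⟨c, -, hc⟩ := h.deriv_pos τ hτ
      rw [h.fourierMode_one_eq hτ, hc, ofReal_im]
    have h2 : HasDerivWithinAt (fun τ => (fourierMode u 1 τ).im)
        (fourierMode (timeDeriv J u) 1 t).im J t :=
      imCLM.hasFDerivAt.comp_hasDerivWithinAt t
        (hs.hasDerivWithinAt_fourierMode h.ordConnected h.nontrivial 1 ht)
    have h3 : (fourierMode (timeDeriv J u) 1 t).im = 0 := by
      have h4 := h2.congr (f₁ := fun _ => (0 : ℝ)) (fun τ hτ => (h1 τ hτ).symm) (h1 t ht).symm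
      exact hud.eq_deriv _ h4 (hasDerivWithinAt_const t J 0)
    rw [hm0, map_div₀, Complex.conj_eq_iff_im.2 h3, Complex.conj_eq_iff_im.2 (h1 t ht)]
  set ψ : ℝ → ℝ → ℂ := fun t θ => (speedDensity φ u t θ : ℂ) with hψ
  have hconj := fourierMode_conj_of_diffContOnCl hm hmv
  have hsum : ∀ θ, mb t θ + starRingEnd ℂ (mb t θ) = ((2 * newRate J φ u t : ℝ) : ℂ) * ψ t θ :=
    fun θ => h.two_re_eq ht θ
  have hmode0 : fourierMode mb 0 t = dslope A' 0 0 * (D 0)⁻¹ := by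
    rw [← powerSum_zero (fun n => fourierMode mb n t)]
    exact hmbs.powerSum_fourierMode h.ordConnected h.nontrivial ht hm hmv m0
  have hz : dslope A' 0 0 * (D 0)⁻¹ = newRate J φ u t * fourierMode ψ 0 t := by
    have h1 := fourierMode_const_mul (u := fun t θ => mb t θ + starRingEnd ℂ (mb t θ)) hsum 0
    rw [hmbs.fourierMode_add hmbs.conj ht, hmode0, hconj, if_pos rfl, hm0r] at h1
    push_cast at h1
    linear_combination h1 / 2
  refine ⟨?_, fun θ => ?_⟩
  · rw [hm0, div_eq_iff] at hz
    · exact hz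
    · rw [h.fourierMode_one_eq ht]
      exact h.deriv_ne_zero t ht 0 (by simp)
  · -- the projection recovers `m` from its real part
    have h1 := szego_const_mul (u := fun t θ => mb t θ + starRingEnd ℂ (mb t θ)) hsum θ
    have h2 : szego mb t θ = mb t θ := by
      rw [szego, hmbs.powerSum_fourierMode h.ordConnected h.nontrivial ht hm hmv
        (norm_exp_angle θ), hmv]
    have h3 : szego (fun t θ => starRingEnd ℂ (mb t θ)) t θ =
        newRate J φ u t * fourierMode ψ 0 t := by
      rw [szego, powerSum, tsum_eq_single 0 fun n hn => by rw [hconj, if_neg hn, zero_mul],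
        hconj, if_pos rfl, hm0r, hz, pow_zero, mul_one]
    rw [hmbs.szego_add hmbs.conj h.ordConnected h.nontrivial ht, h2, h3] at h1
    push_cast at h1
    have hreg := h.regular t ht θ
    have h4 : timeDeriv J u t θ = -I * mb t θ * angleDeriv u t θ := by
      simp only [hmb]
      field_simp
      linear_combination (timeDeriv J u t θ) * I_sq
    rw [h4, speedKernel]
    linear_combination (-I * angleDeriv u t θ) * h1

end IsNormalizedFamily

/-! ### Smoothness with respect to the new time -/

/-- `u` belongs to `TimeClass J ρ k` if its first `k` derivatives with respect to a time variable
with `ds = ρ dt` exist as smooth functions of the old time. -/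
def TimeClass (J : Set ℝ) (ρ : ℝ → ℝ) {E : Type*} [NormedAddCommGroup E] [NormedSpace ℝ E] :
    ℕ → (ℝ → ℝ → E) → Prop
  | 0, u => SmoothPeriodic J u
  | k + 1, u => SmoothPeriodic J u ∧ ∃ v, TimeClass J ρ k v ∧
      ∀ t ∈ J, ∀ θ, timeDeriv J u t θ = ρ t • v t θ

namespace TimeClass

variable {J : Set ℝ} {ρ : ℝ → ℝ}

theorem smoothPeriodic {E : Type*} [NormedAddCommGroup E] [NormedSpace ℝ E] {k : ℕ}
    {u : ℝ → ℝ → E} (h : TimeClass J ρ k u) : SmoothPeriodic J u := by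
  cases k with
  | zero => exact h
  | succ k => exact h.1

theorem of_succ {E : Type*} [NormedAddCommGroup E] [NormedSpace ℝ E] {k : ℕ} :
    ∀ {u : ℝ → ℝ → E}, TimeClass J ρ (k + 1) u → TimeClass J ρ k u := by
  induction k with
  | zero => intro u h; exact h.1
  | succ k ih =>
    rintro u ⟨h1, v, hv, h2⟩
    exact ⟨h1, v, ih hv, h2⟩

theorem angleDeriv {E : Type*} [NormedAddCommGroup E] [NormedSpace ℝ E] (hJ : J.OrdConnected)
    (hJ' : J.Nontrivial) {k : ℕ} :
    ∀ {u : ℝ → ℝ → E}, TimeClass J ρ k u → TimeClass J ρ k (angleDeriv u) := by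
  induction k with
  | zero => intro u h; exact SmoothPeriodic.angleDeriv h hJ hJ'
  | succ k ih =>
    rintro u ⟨h1, v, hv, h2⟩
    refine ⟨h1.angleDeriv hJ hJ', _, ih hv, fun t ht θ => ?_⟩
    rw [h1.smooth.timeDeriv_angleDeriv hJ hJ' ht]
    have e : timeDeriv J u t = fun θ => ρ t • v t θ := funext (h2 t ht)
    rw [_root_.angleDeriv, e]
    exact ((hv.smoothPeriodic.smooth.hasDerivAt_angle ht θ).const_smul (ρ t)).deriv

theorem prodMk {E F : Type} [NormedAddCommGroup E] [NormedSpace ℝ E] [NormedAddCommGroup F]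
    [NormedSpace ℝ F] (hJ : J.OrdConnected) (hJ' : J.Nontrivial) {k : ℕ} :
    ∀ {u : ℝ → ℝ → E} {w : ℝ → ℝ → F}, TimeClass J ρ k u → TimeClass J ρ k w →
      TimeClass J ρ k (fun t θ => (u t θ, w t θ)) := by
  induction k with
  | zero => intro u w hu hw; exact SmoothPeriodic.prodMk hu hw
  | succ k ih =>
    rintro u w ⟨h1, v, hv, h2⟩ ⟨h1', v', hv', h2'⟩
    refine ⟨h1.prodMk h1', _, ih hv hv', fun t ht θ => ?_⟩
    have h3 : HasDerivWithinAt (fun τ => (u τ θ, w τ θ))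
        (timeDeriv J u t θ, timeDeriv J w t θ) J t :=
      (h1.smooth.hasDerivWithinAt_time ht θ).prodMk (h1'.smooth.hasDerivWithinAt_time ht θ)
    have h4 : timeDeriv J (fun t θ => (u t θ, w t θ)) t θ = _ :=
      timeDeriv_eq_of_hasDerivWithinAt hJ hJ' ht h3
    rw [h4, h2 t ht, h2' t ht]
    rfl

theorem comp (hJ : J.OrdConnected) (hJ' : J.Nontrivial) {k : ℕ} :
    ∀ {E F : Type} [NormedAddCommGroup E] [NormedSpace ℝ E] [NormedAddCommGroup F]
      [NormedSpace ℝ F] {u : ℝ → ℝ → E} {O : Set E} {g : E → F}, IsOpen O → ContDiffOn ℝ ∞ g O →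
      (∀ t ∈ J, ∀ θ, u t θ ∈ O) → TimeClass J ρ k u → TimeClass J ρ k (fun t θ => g (u t θ)) := by
  induction k with
  | zero => intro E F _ _ _ _ u O g hO hg hm hu; exact SmoothPeriodic.comp hu hg hm
  | succ k ih =>
    intro E F _ _ _ _ u O g hO hg hm hu
    have hu0 := of_succ hu
    obtain ⟨h1, v, hv, h2⟩ := hu
    have hg' : ContDiffOn ℝ ∞ (fun p : E × E => fderiv ℝ g p.1 p.2) (O ×ˢ univ) :=
      (((hg.fderiv_of_isOpen hO (m := ∞) (by simp)).comp contDiffOn_fst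
        fun p hp => hp.1).clm_apply contDiffOn_snd)
    refine ⟨h1.comp hg hm, _, ih (hO.prod isOpen_univ) hg'
      (fun t ht θ => ⟨hm t ht θ, mem_univ _⟩) (prodMk hJ hJ' hu0 hv), fun t ht θ => ?_⟩
    have hd : HasFDerivAt g (fderiv ℝ g (u t θ)) (u t θ) :=
      ((hg.contDiffAt (hO.mem_nhds (hm t ht θ))).differentiableAt (by simp)).hasFDerivAt
    have h3 : HasDerivWithinAt (fun τ => g (u τ θ)) _ J t :=
      HasFDerivAt.comp_hasDerivWithinAt (f := fun τ => u τ θ) t hd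
        (h1.smooth.hasDerivWithinAt_time ht θ)
    rw [timeDeriv_eq_of_hasDerivWithinAt hJ hJ' ht h3, h2 t ht, map_smul]

theorem mul (hJ : J.OrdConnected) (hJ' : J.Nontrivial) {k : ℕ} {u w : ℝ → ℝ → ℂ}
    (hu : TimeClass J ρ k u) (hw : TimeClass J ρ k w) :
    TimeClass J ρ k (fun t θ => u t θ * w t θ) :=
  comp (g := fun p : ℂ × ℂ => p.1 * p.2) hJ hJ' isOpen_univ
    (contDiff_fst.mul contDiff_snd).contDiffOn (fun _ _ _ => mem_univ _) (prodMk hJ hJ' hu hw)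

theorem sub (hJ : J.OrdConnected) (hJ' : J.Nontrivial) {k : ℕ} {u w : ℝ → ℝ → ℂ}
    (hu : TimeClass J ρ k u) (hw : TimeClass J ρ k w) :
    TimeClass J ρ k (fun t θ => u t θ - w t θ) :=
  comp (g := fun p : ℂ × ℂ => p.1 - p.2) hJ hJ' isOpen_univ
    (contDiff_fst.sub contDiff_snd).contDiffOn (fun _ _ _ => mem_univ _) (prodMk hJ hJ' hu hw)

theorem const_mul (hJ : J.OrdConnected) (hJ' : J.Nontrivial) {k : ℕ} {u : ℝ → ℝ → ℂ}
    (hu : TimeClass J ρ k u) (c : ℂ) : TimeClass J ρ k (fun t θ => c * u t θ) :=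
  comp (g := fun z : ℂ => c * z) hJ hJ' isOpen_univ
    (contDiff_const.mul contDiff_id).contDiffOn (fun _ _ _ => mem_univ _) hu

theorem szego (hJ : J.OrdConnected) (hJ' : J.Nontrivial) {k : ℕ} :
    ∀ {u : ℝ → ℝ → ℂ}, TimeClass J ρ k u → TimeClass J ρ k (szego u) := by
  induction k with
  | zero => intro u h; exact SmoothPeriodic.szego h hJ hJ'
  | succ k ih =>
    rintro u ⟨h1, v, hv, h2⟩
    refine ⟨h1.szego hJ hJ', _, ih hv, fun t ht θ => ?_⟩
    rw [h1.timeDeriv_szego hJ hJ' ht, real_smul]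
    exact szego_const_mul (fun θ => by rw [h2 t ht, real_smul]) θ

theorem fourierMode (hJ : J.OrdConnected) (hJ' : J.Nontrivial) {k : ℕ} (n : ℕ) :
    ∀ {u : ℝ → ℝ → ℂ}, TimeClass J ρ k u →
      TimeClass J ρ k (fun t _ => fourierMode u n t) := by
  have hs : ∀ {u : ℝ → ℝ → ℂ}, SmoothPeriodic J u →
      SmoothPeriodic J (fun t _ => _root_.fourierMode u n t) := fun hu =>
    ⟨(hu.contDiffOn_fourierMode hJ hJ' n).comp contDiffOn_fst fun q hq => hq.1,
      fun _ _ _ => rfl⟩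
  induction k with
  | zero => intro u h; exact hs h
  | succ k ih =>
    rintro u ⟨h1, v, hv, h2⟩
    refine ⟨hs h1, _, ih hv, fun t ht θ => ?_⟩
    rw [timeDeriv_eq_of_hasDerivWithinAt hJ hJ' ht (h1.hasDerivWithinAt_fourierMode hJ hJ' n ht),
      real_smul]
    exact fourierMode_const_mul (fun θ => by rw [h2 t ht, real_smul]) n

end TimeClass

/-- A change of time whose derivative `ρ` is nonnegative (zeros are allowed), with inverse `T`. -/
structure IsTimeChange (J : Set ℝ) (s ρ T : ℝ → ℝ) : Prop where
  deriv : ∀ t ∈ J, HasDerivWithinAt s (ρ t) J t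
  nonneg : ∀ t ∈ J, 0 ≤ ρ t
  strictMono : StrictMonoOn s J
  left_inv : ∀ t ∈ J, T (s t) = t

namespace IsTimeChange

variable {J : Set ℝ} {s ρ T : ℝ → ℝ} {E : Type*} [NormedAddCommGroup E] [NormedSpace ℝ E]

theorem mapsTo (h : IsTimeChange J s ρ T) : MapsTo T (s '' J) J := by
  rintro _ ⟨t, ht, rfl⟩
  rwa [h.left_inv t ht]

theorem continuousOn (h : IsTimeChange J s ρ T) : ContinuousOn s J := fun t ht =>
  (h.deriv t ht).continuousWithinAt

theorem ordConnected (h : IsTimeChange J s ρ T) (hJ : J.OrdConnected) : (s '' J).OrdConnected :=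
  (hJ.isPreconnected.image s h.continuousOn).ordConnected

theorem nontrivial (h : IsTimeChange J s ρ T) (hJ' : J.Nontrivial) : (s '' J).Nontrivial :=
  hJ'.image_of_injOn h.strictMono.injOn

theorem continuousOn_inverse (h : IsTimeChange J s ρ T) (hJ : J.OrdConnected) :
    ContinuousOn T (s '' J) := by
  have := h.ordConnected hJ
  rw [continuousOn_iff_continuous_domRestrict]
  have e : (s '' J).domRestrict T = fun x => ((h.strictMono.orderIso s J).symm x : ℝ) := by
    funext x
    obtain ⟨y, rfl⟩ := (h.strictMono.orderIso s J).surjective x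
    rw [OrderIso.symm_apply_apply, domRestrict_apply]
    exact h.left_inv y y.2
  rw [e]
  exact continuous_subtype_val.comp (h.strictMono.orderIso s J).symm.continuous

theorem norm_sub_le (h : IsTimeChange J s ρ T) (hJ : J.OrdConnected) {f v : ℝ → E}
    (hf : ∀ t ∈ J, HasDerivWithinAt f (ρ t • v t) J t) {v₀ : E} {ε t₁ t₂ : ℝ} (h₁ : t₁ ∈ J)
    (h₂ : t₂ ∈ J) (h12 : t₁ ≤ t₂) (hv : ∀ t ∈ Icc t₁ t₂, ‖v t - v₀‖ ≤ ε) :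
    ‖f t₂ - f t₁ - (s t₂ - s t₁) • v₀‖ ≤ ε * (s t₂ - s t₁) := by
  have hK : Icc t₁ t₂ ⊆ J := hJ.out h₁ h₂
  have d1 : ∀ t ∈ Icc t₁ t₂, HasDerivWithinAt (fun t => f t - f t₁ - (s t - s t₁) • v₀)
      (ρ t • (v t - v₀)) (Icc t₁ t₂) t := fun t ht => by
    refine ((((hf t (hK ht)).mono hK).sub_const _).sub
      ((((h.deriv t (hK ht)).mono hK).sub_const (s t₁)).smul_const v₀)).congr_deriv ?_
    rw [smul_sub]
  have d2 : ∀ t ∈ Icc t₁ t₂, HasDerivWithinAt (fun t => ε * (s t - s t₁))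
      (ε * ρ t) (Icc t₁ t₂) t := fun t ht =>
    ((((h.deriv t (hK ht)).mono hK).sub_const (s t₁)).const_mul ε)
  refine image_norm_le_of_norm_deriv_right_le_deriv_boundary'
    (f := fun t => f t - f t₁ - (s t - s t₁) • v₀) (B := fun t => ε * (s t - s t₁))
    (fun t ht => (d1 t ht).continuousWithinAt)
    (fun t ht => (d1 t (Ico_subset_Icc_self ht)).mono_of_mem_nhdsWithin (Icc_mem_nhdsGE_of_mem ht))
    (by simp) (fun t ht => (d2 t ht).continuousWithinAt)
    (fun t ht => (d2 t (Ico_subset_Icc_self ht)).mono_of_mem_nhdsWithin (Icc_mem_nhdsGE_of_mem ht))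
    (fun t ht => ?_) ⟨h12, le_rfl⟩
  have ht' := Ico_subset_Icc_self ht
  rw [norm_smul, Real.norm_of_nonneg (h.nonneg t (hK ht')), mul_comm]
  exact mul_le_mul_of_nonneg_right (hv t ht') (h.nonneg t (hK ht'))

/-- The chain rule for the inverse of a change of time, valid also where `ρ` vanishes. -/
theorem hasDerivWithinAt_comp (h : IsTimeChange J s ρ T) (hJ : J.OrdConnected) {f v : ℝ → E}
    (hf : ∀ t ∈ J, HasDerivWithinAt f (ρ t • v t) J t) (hv : ContinuousOn v J) {σ : ℝ}
    (hσ : σ ∈ s '' J) : HasDerivWithinAt (fun σ => f (T σ)) (v (T σ)) (s '' J) σ := by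
  rw [hasDerivWithinAt_iff_isLittleO, Asymptotics.isLittleO_iff]
  intro ε hε
  obtain ⟨t, ht, rfl⟩ := hσ
  rw [h.left_inv t ht]
  obtain ⟨δ, hδ, hvδ⟩ := Metric.continuousWithinAt_iff.1 (hv t ht) ε hε
  have hT := h.continuousOn_inverse hJ (s t) (mem_image_of_mem s ht)
  have hT' : ∀ᶠ σ in 𝓝[s '' J] (s t), T σ ∈ ball t δ := by
    have := hT.tendsto
    rw [h.left_inv t ht] at this
    exact this.eventually (ball_mem_nhds t hδ)
  filter_upwards [hT', self_mem_nhdsWithin] with σ hσ hσJ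
  obtain ⟨τ, hτ, rfl⟩ := hσJ
  rw [h.left_inv τ hτ] at hσ ⊢
  have hb : ∀ x ∈ J, x ∈ ball t δ → ‖v x - v t‖ ≤ ε := fun x hx hxb => by
    rw [← dist_eq_norm]; exact (hvδ hx hxb).le
  have hball : ∀ x ∈ uIcc t τ, x ∈ ball t δ := fun x hx => by
    rw [mem_ball, Real.dist_eq] at hσ ⊢
    exact (abs_sub_left_of_mem_uIcc hx).trans_lt hσ
  rcases le_total t τ with h1 | h1
  · have h2 := h.norm_sub_le hJ hf ht hτ h1 fun x hx => hb x (hJ.out ht hτ hx)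
      (hball x (by rwa [uIcc_of_le h1]))
    rwa [Real.norm_of_nonneg (sub_nonneg.2 ((h.strictMono.monotoneOn) ht hτ h1))]
  · have h2 := h.norm_sub_le hJ hf hτ ht h1 fun x hx => hb x (hJ.out hτ ht hx)
      (hball x (by rwa [uIcc_of_ge h1]))
    have h3 := (h.strictMono.monotoneOn) hτ ht h1
    rw [Real.norm_of_nonpos (sub_nonpos.2 h3), ← norm_neg]
    rw [← neg_sub (s τ)] at h2
    refine le_trans (le_of_eq ?_) h2
    congr 1
    rw [neg_smul]
    abel

/-- Functions that have derivatives of all orders in the new time are smooth functions of it. -/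
theorem contDiffOn (h : IsTimeChange J s ρ T) (hJ : J.OrdConnected) (hJ' : J.Nontrivial)
    {u : ℝ → ℝ → E} (hu : ∀ k, TimeClass J ρ k u) :
    SmoothOnStrip (s '' J) (fun σ θ => u (T σ) θ) := by
  refine contDiffOn_infty.2 fun k => contDiffOn_of_graded_family (J := s '' J) (A := univ)
    (fun k w => ∃ v : ℝ → ℝ → E, TimeClass J ρ k v ∧ w = fun q : ℝ × ℝ => v (T q.1) q.2)
    ?_ ?_ k _ ⟨u, hu k, rfl⟩
  · rintro _ ⟨v, hv, rfl⟩
    exact hv.smoothPeriodic.smooth.continuousOn.comp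
      (f := fun q : ℝ × ℝ => (T q.1, q.2))
      (((h.continuousOn_inverse hJ).comp continuousOn_fst fun q hq => hq.1).prodMk
        continuousOn_snd) fun q hq => ⟨h.mapsTo hq.1, mem_univ _⟩
  · rintro k _ ⟨v, hv, rfl⟩
    have hva := hv.of_succ.angleDeriv hJ hJ'
    obtain ⟨h1, w, hw, h2⟩ := hv
    refine ⟨fun q => w (T q.1) q.2, fun q => angleDeriv v (T q.1) q.2, ⟨w, hw, rfl⟩,
      ⟨_, hva, rfl⟩, fun q hq => ?_⟩
    refine hasFDerivWithinAt_of_partials (𝕂 := ℝ) (v := fun q : ℝ × ℝ => v (T q.1) q.2)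
      (vx := fun q : ℝ × ℝ => angleDeriv v (T q.1) q.2) (vt := w (T q.1) q.2)
      convex_univ hq ?_ (fun p hp => ?_) ?_
    · refine h.hasDerivWithinAt_comp hJ (f := fun t => v t q.2) (v := fun t => w t q.2)
        (fun t ht => ?_) ?_ hq.1
      · rw [← h2 t ht]
        exact h1.smooth.hasDerivWithinAt_time ht q.2
      · exact hw.smoothPeriodic.smooth.continuousOn.comp (f := fun t : ℝ => (t, q.2))
          (by fun_prop) fun t ht => ⟨ht, mem_univ _⟩
    · exact (h1.smooth.hasDerivAt_angle (h.mapsTo hp.1) p.2).hasDerivWithinAt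
    · have := hva.smoothPeriodic.smooth.continuousOn.comp
        (f := fun q : ℝ × ℝ => (T q.1, q.2)) (s := (s '' J) ×ˢ univ)
        (((h.continuousOn_inverse hJ).comp continuousOn_fst fun q hq => hq.1).prodMk
        continuousOn_snd) fun q hq => ⟨h.mapsTo hq.1, mem_univ _⟩
      exact this q hq

end IsTimeChange

/-! ### The change of time -/

/-- The inverse of a conformal map that is regular up to the boundary. -/
theorem exists_inverse_of_injOn_closedBall {a D : ℂ → ℂ}
    (hinj : InjOn a (closedBall 0 1))
    (hD : ∀ ζ ∈ closedBall (0 : ℂ) 1, D ζ ≠ 0 ∧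
      HasDerivWithinAt a (D ζ) (closedBall 0 1) ζ) :
    ∃ G : ℂ → ℂ, ContinuousOn G (a '' closedBall 0 1) ∧
      (∀ ζ ∈ closedBall (0 : ℂ) 1, G (a ζ) = ζ) ∧
      ∀ ζ ∈ closedBall (0 : ℂ) 1,
        HasDerivWithinAt G (D ζ)⁻¹ (a '' closedBall 0 1) (a ζ) := by
  set K := closedBall (0 : ℂ) 1 with hK
  have ha : ContinuousOn a K := fun ζ hζ => (hD ζ hζ).2.continuousWithinAt
  have hG : ∀ ζ ∈ K, invFunOn a K (a ζ) = ζ := fun ζ hζ =>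
    hinj.leftInvOn_invFunOn hζ
  have hGc : ContinuousOn (invFunOn a K) (a '' K) := by
    rw [continuousOn_iff_isClosed]
    intro C hC
    refine ⟨a '' (K ∩ C), (((isCompact_closedBall 0 1).inter_right hC).image_of_continuousOn
      (ha.mono inter_subset_left)).isClosed, ?_⟩
    ext w
    constructor
    · rintro ⟨h1, ζ, hζ, rfl⟩
      rw [mem_preimage, hG ζ hζ] at h1
      exact ⟨⟨ζ, ⟨hζ, h1⟩, rfl⟩, ⟨ζ, hζ, rfl⟩⟩
    · rintro ⟨⟨ζ, ⟨hζ, h1⟩, rfl⟩, h2⟩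
      exact ⟨by rwa [mem_preimage, hG ζ hζ], h2⟩
  refine ⟨invFunOn a K, hGc, hG, fun ζ hζ => ?_⟩
  have h1 : Tendsto (invFunOn a K) (𝓝[a '' K] (a ζ))
      (𝓝[K] (invFunOn a K (a ζ))) :=
    tendsto_nhdsWithin_iff.2 ⟨hGc _ (mem_image_of_mem a hζ), by
      filter_upwards [self_mem_nhdsWithin] with w hw
      obtain ⟨ξ, hξ, rfl⟩ := hw
      rwa [hG ξ hξ]⟩
  have h2 : HasFDerivWithinAt a ((ContinuousLinearEquiv.unitsEquivAut ℂ
      (Units.mk0 (D ζ) (hD ζ hζ).1) : ℂ ≃L[ℂ] ℂ) : ℂ →L[ℂ] ℂ) K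
      (invFunOn a K (a ζ)) := by
    rw [hG ζ hζ]
    refine (hD ζ hζ).2.hasFDerivWithinAt.congr_fderiv ?_
    ext
    simp
  have h3 := HasFDerivWithinAt.of_local_left_inverse h1 h2 (mem_image_of_mem a hζ) (by
    filter_upwards [self_mem_nhdsWithin] with w hw
    obtain ⟨ξ, hξ, rfl⟩ := hw
    rw [hG ξ hξ])
  refine h3.hasDerivWithinAt.congr_deriv ?_
  simp [ContinuousLinearEquiv.unitsEquivAut]

namespace IsNormalizedFamily

variable {U : Set ℂ} {φ : ℂ → ℝ} {J : Set ℝ} {Ω : ℝ → Set ℂ} {u : ℝ → ℝ → ℂ} {A B : ℝ → ℂ → ℂ}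

theorem exists_deriv (h : IsNormalizedFamily U φ J Ω u A B) {t : ℝ} (ht : t ∈ J) :
    ∃ D : ℂ → ℂ, (∀ ζ ∈ closedBall (0 : ℂ) 1, D ζ ≠ 0 ∧
      HasDerivWithinAt (A t) (D ζ) (closedBall 0 1) ζ) ∧
      ∀ θ : ℝ, angleDeriv u t θ = I * cexp (θ * I) * D (cexp (θ * I)) := by
  obtain ⟨D, -, hDc, hDd, hDb, -⟩ := h.boundary_smooth.exists_deriv_extension h.ordConnected
    h.nontrivial ht (h.map t ht) (h.boundary t ht)
  refine ⟨D, fun ζ hζ => ⟨?_, hDc ζ hζ⟩, hDb⟩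
  rw [mem_closedBall_zero_iff] at hζ
  rcases hζ.lt_or_eq with h1 | h1
  · have h2 : ζ ∈ ball (0 : ℂ) 1 := mem_ball_zero_iff.2 h1
    rw [← (hDd ζ h2).deriv]
    exact h.deriv_ne_zero t ht ζ h2
  · obtain ⟨θ, rfl⟩ := exists_exp_angle_eq (mem_sphere_zero_iff_norm.2 h1)
    intro h0
    have := hDb θ
    rw [h0, mul_zero] at this
    exact h.regular t ht θ this

theorem exists_inverse (h : IsNormalizedFamily U φ J Ω u A B) {t : ℝ} (ht : t ∈ J) :
    ∃ D G : ℂ → ℂ, (∀ ζ ∈ closedBall (0 : ℂ) 1, D ζ ≠ 0 ∧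
      HasDerivWithinAt (A t) (D ζ) (closedBall 0 1) ζ) ∧
      (∀ θ : ℝ, angleDeriv u t θ = I * cexp (θ * I) * D (cexp (θ * I))) ∧
      ContinuousOn G (A t '' closedBall 0 1) ∧
      (∀ ζ ∈ closedBall (0 : ℂ) 1, G (A t ζ) = ζ) ∧
      (∀ ζ ∈ closedBall (0 : ℂ) 1,
        HasDerivWithinAt G (D ζ)⁻¹ (A t '' closedBall 0 1) (A t ζ)) ∧
      DifferentiableOn ℂ G (Ω t) := by
  obtain ⟨D, hD, hDb⟩ := h.exists_deriv ht
  obtain ⟨G, hGc, hG, hGd⟩ := exists_inverse_of_injOn_closedBall (h.injOn t ht) hD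
  refine ⟨D, G, hD, hDb, hGc, hG, hGd, ?_⟩
  have hsub : Ω t ⊆ A t '' closedBall 0 1 := by
    rw [← h.image t ht]; exact image_mono ball_subset_closedBall
  intro w hw
  obtain ⟨ζ, hζ, rfl⟩ := hsub hw
  exact ((hGd ζ hζ).mono hsub).differentiableWithinAt

/-- By the Schwarz lemma, the conformal radius increases. -/
theorem monotoneOn_conformalRadius (h : IsNormalizedFamily U φ J Ω u A B) :
    MonotoneOn (fun t => (fourierMode u 1 t).re) J := by
  intro t ht t' ht' htt'
  rcases htt'.eq_or_lt with rfl | hlt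
  · exact le_rfl
  have hsub := (h.increasing t ht t' ht' hlt).subset
  obtain ⟨D, G, -, -, -, hG, -, hGd⟩ := h.exists_inverse ht'
  have hpre : ∀ ζ ∈ ball (0 : ℂ) 1, ∃ ξ ∈ ball (0 : ℂ) 1, A t' ξ = A t ζ :=
    fun ζ hζ => by
      have h1 : A t ζ ∈ Ω t' := hsub (by rw [← h.image t ht]; exact mem_image_of_mem _ hζ)
      rwa [← h.image t' ht'] at h1
  have hgd : DifferentiableOn ℂ (fun ζ => G (A t ζ)) (ball 0 1) :=
    hGd.comp (h.map t ht).differentiableOn fun ζ hζ => hsub (by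
      rw [← h.image t ht]; exact mem_image_of_mem _ hζ)
  have hg0 : G (A t 0) = 0 := by
    have := hG 0 (by simp)
    rw [h.map_zero t' ht'] at this
    rw [h.map_zero t ht, this]
  have hmaps : MapsTo (fun ζ => G (A t ζ)) (ball 0 1)
      (closedBall (G (A t 0)) 1) := fun ζ hζ => by
    obtain ⟨ξ, hξ, hξζ⟩ := hpre ζ hζ
    simp only
    rw [hg0, ← hξζ, hG ξ (ball_subset_closedBall hξ)]
    exact ball_subset_closedBall hξ
  have hle := Complex.norm_deriv_le_one_of_mapsTo_ball hgd hmaps one_pos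
  have m0 : (0 : ℂ) ∈ ball (0 : ℂ) 1 := by simp
  have hn := isOpen_ball.mem_nhds m0
  have h1 := (hgd.differentiableAt hn).hasDerivAt
  have h2 : HasDerivAt (A t') (deriv (A t') 0) (G (A t 0)) := by
    rw [hg0]; exact ((h.map t' ht').differentiableOn.differentiableAt hn).hasDerivAt
  have h3 : HasDerivAt (fun ζ => A t' (G (A t ζ)))
      (deriv (A t') 0 * deriv (fun ζ => G (A t ζ)) 0) 0 := HasDerivAt.comp (0 : ℂ) h2 h1
  have h4 : deriv (A t) 0 = deriv (A t') 0 * deriv (fun ζ => G (A t ζ)) 0 := by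
    rw [← h3.deriv]
    refine EventuallyEq.deriv_eq ?_
    filter_upwards [hn] with ζ hζ
    obtain ⟨ξ, hξ, hξζ⟩ := hpre ζ hζ
    rw [← hξζ, hG ξ (ball_subset_closedBall hξ)]
  obtain ⟨c, hc, hct⟩ := h.deriv_pos t ht
  obtain ⟨c', hc', hct'⟩ := h.deriv_pos t' ht'
  simp only [h.fourierMode_one_eq ht, h.fourierMode_one_eq ht']
  have h5 := congrArg norm h4
  rw [hct, hct', norm_mul, norm_real, norm_real, Real.norm_of_nonneg hc.le,
    Real.norm_of_nonneg hc'.le] at h5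
  rw [hct, hct', ofReal_re, ofReal_re, h5]
  exact mul_le_of_le_one_right hc'.le hle

theorem newRate_nonneg (h : IsNormalizedFamily U φ J Ω u A B) {t : ℝ} (ht : t ∈ J) :
    0 ≤ newRate J φ u t := by
  have h1 : HasDerivWithinAt (fun τ => (fourierMode u 1 τ).re)
      (fourierMode (timeDeriv J u) 1 t).re J t :=
    reCLM.hasFDerivAt.comp_hasDerivWithinAt t
      (h.boundary_smooth.hasDerivWithinAt_fourierMode h.ordConnected h.nontrivial 1 ht)
  have h2 : 0 ≤ (fourierMode (timeDeriv J u) 1 t).re := by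
    rw [← h1.derivWithin (uniqueDiffOn_of_ordConnected h.ordConnected h.nontrivial t ht)]
    exact h.monotoneOn_conformalRadius.derivWithin_nonneg
  obtain ⟨k, hk, hkt⟩ := h.exists_mean_speedDensity ht
  obtain ⟨c, hc, hct⟩ := h.deriv_pos t ht
  rw [(h.timeDeriv_eq ht).1, hkt, h.fourierMode_one_eq ht, hct, ← ofReal_mul, ← ofReal_mul,
    ofReal_re] at h2
  exact nonneg_of_mul_nonneg_left (nonneg_of_mul_nonneg_left h2 hc) hk

theorem exists_newRate_ne_zero (h : IsNormalizedFamily U φ J Ω u A B) {t t' : ℝ} (ht : t ∈ J) (ht' : t' ∈ J)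
    (htt' : t < t') : ∃ τ ∈ Icc t t', newRate J φ u τ ≠ 0 := by
  by_contra hcon
  push Not at hcon
  have hK : Icc t t' ⊆ J := h.ordConnected.out ht ht'
  -- otherwise the boundary does not move
  have hconst : ∀ θ, u t' θ = u t θ := fun θ => by
    have hd : ∀ τ ∈ Icc t t', HasDerivWithinAt (fun τ => u τ θ) 0 (Icc t t') τ := fun τ hτ => by
      have := (h.boundary_smooth.smooth.hasDerivWithinAt_time (hK hτ) θ).mono hK
      rwa [(h.timeDeriv_eq (hK hτ)).2 θ, hcon τ hτ, ofReal_zero, zero_mul] at this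
    exact constant_of_has_deriv_right_zero (fun τ hτ => (hd τ hτ).continuousWithinAt)
      (fun τ hτ => (hd τ (Ico_subset_Icc_self hτ)).mono_of_mem_nhdsWithin
        (Icc_mem_nhdsGE_of_mem hτ)) t' ⟨htt'.le, le_rfl⟩
  have hA : EqOn (A t') (A t) (ball 0 1) := fun ζ hζ => by
    have hζ' := ball_subset_closedBall hζ
    rw [← h.boundary_smooth.powerSum_fourierMode h.ordConnected h.nontrivial ht' (h.map t' ht')
      (h.boundary t' ht') hζ', ← h.boundary_smooth.powerSum_fourierMode h.ordConnected h.nontrivial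
      ht (h.map t ht) (h.boundary t ht) hζ']
    congr 1
    funext n
    rw [fourierMode_eq, fourierMode_eq]
    simp only [hconst]
  have h1 := h.increasing t ht t' ht' htt'
  rw [← h.image t ht, ← h.image t' ht', hA.image_eq] at h1
  exact (ssubset_irrefl _) h1

theorem isTimeChange (h : IsNormalizedFamily U φ J Ω u A B) :
    IsTimeChange J (newTime φ u) (newRate J φ u) (invFunOn (newTime φ u) J) := by
  have hd := fun t (ht : t ∈ J) => h.hasDerivWithinAt_newTime ht
  have hmono : MonotoneOn (newTime φ u) J := by
    have hi : ∀ t ∈ interior J, HasDerivAt (newTime φ u) (newRate J φ u t) t := fun t ht =>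
      (hd t (interior_subset ht)).hasDerivAt (mem_interior_iff_mem_nhds.1 ht)
    refine monotoneOn_of_deriv_nonneg h.ordConnected.convex
      (fun t ht => (hd t ht).continuousWithinAt)
      (fun t ht => (hi t ht).differentiableAt.differentiableWithinAt) fun t ht => ?_
    rw [(hi t ht).deriv]
    exact h.newRate_nonneg (interior_subset ht)
  have hstrict : StrictMonoOn (newTime φ u) J := by
    intro t ht t' ht' htt'
    refine (hmono ht ht' htt'.le).lt_of_ne fun heq => ?_
    have hK : Icc t t' ⊆ J := h.ordConnected.out ht ht'
    obtain ⟨τ, hτ, hne⟩ := h.exists_newRate_ne_zero ht ht' htt'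
    have hc : ∀ x ∈ Icc t t', newTime φ u x = newTime φ u t := fun x hx =>
      le_antisymm ((hmono (hK hx) ht' hx.2).trans_eq heq.symm) (hmono ht (hK hx) hx.1)
    have h1 := ((hd τ (hK hτ)).mono hK).congr (f₁ := fun _ => newTime φ u t)
      (fun x hx => (hc x hx).symm) (hc τ hτ).symm
    exact hne ((uniqueDiffOn_Icc htt' τ hτ).eq_deriv _ h1 (hasDerivWithinAt_const _ _ _))
  exact ⟨hd, fun t ht => h.newRate_nonneg ht, hstrict, fun t ht =>
    hstrict.injOn.leftInvOn_invFunOn ht⟩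

theorem mem_closure_newRate_ne_zero (h : IsNormalizedFamily U φ J Ω u A B) {t : ℝ} (ht : t ∈ J) :
    t ∈ closure {τ | τ ∈ J ∧ newRate J φ u τ ≠ 0} := by
  have h1 : interior J ⊆ closure {τ | τ ∈ J ∧ newRate J φ u τ ≠ 0} := by
    intro x hx
    rw [Metric.mem_closure_iff]
    intro ε hε
    obtain ⟨δ, hδ, hδJ⟩ := Metric.mem_nhds_iff.1 (mem_interior_iff_mem_nhds.1 hx)
    set η := min δ ε / 2 with hη
    have hmin : 0 < min δ ε := lt_min hδ hε
    have hη0 : 0 < η := by positivity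
    have hηδ : η < δ := by have := min_le_left δ ε; linarith
    have hηε : η < ε := by have := min_le_right δ ε; linarith
    obtain ⟨τ, hτ, hne⟩ := h.exists_newRate_ne_zero (t := x) (t' := x + η) (interior_subset hx)
      (hδJ (by rw [mem_ball, Real.dist_eq, add_sub_cancel_left, abs_of_pos hη0]; exact hηδ))
      (by linarith)
    have h2 : |τ - x| ≤ η := by rw [abs_le]; constructor <;> linarith [hτ.1, hτ.2]
    refine ⟨τ, ⟨hδJ ?_, hne⟩, ?_⟩
    · rw [mem_ball, Real.dist_eq]; exact h2.trans_lt hηδ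
    · rw [dist_comm, Real.dist_eq]; exact h2.trans_lt hηε
  exact closure_minimal h1 isClosed_closure
    (subset_closure_interior_of_ordConnected h.ordConnected h.nontrivial ht)

theorem smooth_ofReal_speedDensity (h : IsNormalizedFamily U φ J Ω u A B) :
    SmoothPeriodic J (fun t θ => (speedDensity φ u t θ : ℂ)) := h.smooth_speedDensity.ofReal

theorem continuousOn_speedKernel (h : IsNormalizedFamily U φ J Ω u A B) (θ : ℝ) :
    ContinuousOn (fun t => speedKernel φ u t θ) J := by
  have h0 := h.smooth_ofReal_speedDensity
  have h1 := h0.szego h.ordConnected h.nontrivial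
  have h2 := (h0.contDiffOn_fourierMode h.ordConnected h.nontrivial 0).continuousOn
  unfold speedKernel
  generalize (fun t θ => (speedDensity φ u t θ : ℂ)) = ψ at h1 h2 ⊢
  have h3 : ContinuousOn (fun t => szego ψ t θ) J :=
    h1.smooth.continuousOn.comp (f := fun t : ℝ => (t, θ)) (by fun_prop) fun t ht => ⟨ht, mem_univ _⟩
  exact (continuousOn_const.mul h3).sub h2

/-- The kernel has the prescribed real part. This follows from the equation of motion where the
rate does not vanish, and in general by continuity. -/
theorem speedKernel_re (h : IsNormalizedFamily U φ J Ω u A B) {t : ℝ} (ht : t ∈ J) (θ : ℝ) :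
    (speedKernel φ u t θ).re = speedDensity φ u t θ := by
  set S := {τ | τ ∈ J ∧ newRate J φ u τ ≠ 0} with hS
  have hSJ : S ⊆ J := fun τ hτ => hτ.1
  have h1 : EqOn (fun τ => (speedKernel φ u τ θ).re) (fun τ => speedDensity φ u τ θ) S := by
    rintro τ ⟨hτ, hne⟩
    have e := h.newRate_eq hτ θ
    have hreg := (normSq_pos.2 (h.regular τ hτ θ)).ne'
    have hsub := (h.subharmonic _ (h.mem τ hτ θ)).ne'
    have hπ := Real.pi_ne_zero
    rw [(h.timeDeriv_eq hτ).2 θ] at e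
    have e2 : (starRingEnd ℂ (newRate J φ u τ * (-I * speedKernel φ u τ θ * angleDeriv u τ θ)) *
        angleDeriv u τ θ).im = newRate J φ u τ * ((speedKernel φ u τ θ).re *
          normSq (angleDeriv u τ θ)) := by
      simp only [map_mul, map_neg, conj_I, conj_ofReal]
      have : (newRate J φ u τ : ℂ) * (- -I * starRingEnd ℂ (speedKernel φ u τ θ) *
          starRingEnd ℂ (angleDeriv u τ θ)) * angleDeriv u τ θ =
          ((newRate J φ u τ * normSq (angleDeriv u τ θ) : ℝ) : ℂ) *
          (I * starRingEnd ℂ (speedKernel φ u τ θ)) := by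
        push_cast
        rw [normSq_eq_conj_mul_self]
        ring
      rw [this, Complex.im_ofReal_mul]
      simp
      ring
    rw [e2] at e
    simp only [speedDensity]
    field_simp
    have e3 : newRate J φ u τ * 1 = newRate J φ u τ * ((speedKernel φ u τ θ).re * (2 * π *
      laplacian φ (u τ θ) * normSq (angleDeriv u τ θ))) := by
        linear_combination e
    have e4 := mul_left_cancel₀ hne e3
    linear_combination -e4
  have hc1 : ContinuousOn (fun τ => (speedKernel φ u τ θ).re) J :=
    continuous_re.comp_continuousOn (h.continuousOn_speedKernel θ)
  have hc2 : ContinuousOn (fun τ => speedDensity φ u τ θ) J :=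
    h.smooth_speedDensity.smooth.continuousOn.comp (f := fun t : ℝ => (t, θ)) (by fun_prop)
      fun t ht => ⟨ht, mem_univ _⟩
  exact h1.of_subset_closure hc1 hc2 hSJ (fun τ hτ => h.mem_closure_newRate_ne_zero hτ) ht

/-- The boundary values have derivatives of all orders in the new time. -/
theorem timeClass (h : IsNormalizedFamily U φ J Ω u A B) (k : ℕ) :
    TimeClass J (newRate J φ u) k u ∧
      TimeClass J (newRate J φ u) k (fun t θ => -I * speedKernel φ u t θ * angleDeriv u t θ) := by
  have hJ := h.ordConnected
  have hJ' := h.nontrivial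
  have hstep : ∀ k, TimeClass J (newRate J φ u) k u →
      TimeClass J (newRate J φ u) k (fun t θ => -I * speedKernel φ u t θ * angleDeriv u t θ) := by
    intro k hk
    have h1 := hk.angleDeriv hJ hJ'
    have hp := TimeClass.prodMk hJ hJ' hk h1
    have hg : ContDiffOn ℝ ∞ (fun p : ℂ × ℂ =>
        (((2 * π * laplacian φ p.1 * normSq p.2)⁻¹ : ℝ) : ℂ))
        (U ×ˢ {0}ᶜ) := ofRealCLM.contDiff.comp_contDiffOn h.contDiffOn_speed
    have hm : ∀ t ∈ J, ∀ θ, (u t θ, angleDeriv u t θ) ∈ U ×ˢ ({0}ᶜ : Set ℂ) :=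
      fun t ht θ => ⟨h.mem t ht θ, h.regular t ht θ⟩
    have h2 := TimeClass.comp hJ hJ' (h.isOpen.prod isOpen_compl_singleton) hg hm hp
    have h3 : TimeClass J (newRate J φ u) k (speedKernel φ u) := by
      change TimeClass J (newRate J φ u) k (fun t θ => (speedDensity φ u t θ : ℂ)) at h2
      unfold speedKernel
      generalize (fun t θ => (speedDensity φ u t θ : ℂ)) = ψ at h2 ⊢
      exact TimeClass.sub hJ hJ' (TimeClass.const_mul hJ hJ' (h2.szego hJ hJ') 2)
        (h2.fourierMode hJ hJ' 0)
    exact TimeClass.mul hJ hJ' (TimeClass.const_mul hJ hJ' h3 (-I)) h1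
  have hu : ∀ k, TimeClass J (newRate J φ u) k u := by
    intro k
    induction k with
    | zero => exact h.boundary_smooth
    | succ k ih =>
      refine ⟨h.boundary_smooth, _, hstep k ih, fun t ht θ => ?_⟩
      rw [(h.timeDeriv_eq ht).2 θ, real_smul]
  exact ⟨hu k, hstep k (hu k)⟩

end IsNormalizedFamily

/-! ### The Hele-Shaw flow of a normalized family -/

namespace IsNormalizedFamily

variable {U : Set ℂ} {φ : ℂ → ℝ} {J : Set ℝ} {Ω : ℝ → Set ℂ} {u : ℝ → ℝ → ℂ} {A B : ℝ → ℂ → ℂ}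

theorem closure_eq (h : IsNormalizedFamily U φ J Ω u A B) {t : ℝ} (ht : t ∈ J) :
    closure (Ω t) = A t '' closedBall 0 1 := by
  rw [← h.image t ht, closure_image_ball (h.map t ht).continuousOn_closedBall]

theorem isJordanParam (h : IsNormalizedFamily U φ J Ω u A B) {t : ℝ} (ht : t ∈ J) :
    IsJordanParam (Ω t) (u t) := by
  have hs := fun θ => sphere_subset_closedBall (exp_angle_mem_sphere θ)
  refine ⟨h.boundary_smooth.smooth.contDiff ht, h.boundary_smooth.periodic t ht,
    fun a ha b hb hab => ?_, h.regular t ht, h.isOpen_domain t ht, ?_, ?_, ?_⟩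
  · rw [← h.boundary t ht, ← h.boundary t ht] at hab
    have h1 := h.injOn t ht (hs a) (hs b) hab
    obtain ⟨n, hn⟩ := exp_eq_exp_iff_exists_int.1 h1
    have h2 : a = b + n * (2 * π) := by
      have : (a : ℂ) * I = ((b + n * (2 * π) : ℝ) : ℂ) * I := by rw [hn]; push_cast; ring
      exact_mod_cast mul_right_cancel₀ I_ne_zero this
    exact eq_of_eq_add_int_mul ha hb h2
  · rw [← h.image t ht]
    exact (isConnected_ball one_pos).image _ (h.map t ht).differentiableOn.continuousOn
  · refine Bornology.IsBounded.subset ?_ subset_closure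
    rw [h.closure_eq ht]
    exact ((isCompact_closedBall 0 1).image_of_continuousOn
      (h.map t ht).continuousOn_closedBall).isBounded
  · rw [(h.isOpen_domain t ht).frontier_eq, h.closure_eq ht, ← h.image t ht]
    ext z
    constructor
    · rintro ⟨⟨ζ, hζ, rfl⟩, hz⟩
      obtain ⟨θ, rfl⟩ := exists_exp_angle_eq (ζ := ζ) <| mem_sphere_zero_iff_norm.2 <|
        (mem_closedBall_zero_iff.1 hζ).eq_of_not_lt
          fun h1 => hz (mem_image_of_mem _ (mem_ball_zero_iff.2 h1))
      exact ⟨θ, (h.boundary t ht θ).symm⟩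
    · rintro ⟨θ, rfl⟩
      rw [← h.boundary t ht]
      refine ⟨mem_image_of_mem _ (hs θ), ?_⟩
      rintro ⟨ξ, hξ, he⟩
      have h1 := h.injOn t ht (ball_subset_closedBall hξ) (hs θ) he
      rw [h1, mem_ball_zero_iff, mem_sphere_zero_iff_norm.1 (exp_angle_mem_sphere θ)] at hξ
      exact lt_irrefl _ hξ

theorem rightNormal_eq {D : ℂ} {γ : ℝ → ℂ} {θ : ℝ} (hD : deriv γ θ = I * cexp (θ * I) * D) :
    rightNormal γ θ = cexp (θ * I) * D / ‖D‖ ∧ ‖deriv γ θ‖ = ‖D‖ := by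
  have h1 : ‖deriv γ θ‖ = ‖D‖ := by
    rw [hD, norm_mul, norm_mul, norm_I, norm_exp_ofReal_mul_I, one_mul, one_mul]
  refine ⟨?_, h1⟩
  rw [rightNormal, h1, hD]
  linear_combination (-(cexp (θ * I) * D / ‖D‖)) * I_sq

theorem exists_isLeftCollar (h : IsNormalizedFamily U φ J Ω u A B) {t : ℝ} (ht : t ∈ J) :
    ∃ δ, IsLeftCollar (Ω t) (u t) δ := by
  have hj := h.isJordanParam ht
  have h0 := hj.isSimpleClosedCurve
  obtain ⟨δ, hδ, hb⟩ := h0.exists_normal_bound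
  have hout : ∀ θ, ∀ s ∈ Ioc 0 δ, u t θ + s * rightNormal (u t) θ ∉ closure (Ω t) := by
    rcases hj.collar_subset_or hb (ε := 1) (by simp) with H | H
    swap
    · intro θ s hs; simpa using H θ s hs
    -- otherwise the inverse map would leave the disc along the normal at `u t 0`
    exfalso
    obtain ⟨D, G, hD, hDb, -, hG, hGd, -⟩ := h.exists_inverse ht
    obtain ⟨hn, -⟩ := rightNormal_eq (hDb 0)
    have hs0 := sphere_subset_closedBall (exp_angle_mem_sphere 0)
    obtain ⟨hD0, -⟩ := hD _ hs0
    have hd := hGd _ hs0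
    have hu0 := h.boundary t ht 0
    set ζ := cexp ((0 : ℝ) * I) with hζ
    have hζ1 : ‖ζ‖ = 1 := norm_exp_ofReal_mul_I 0
    have hG0 := hG ζ hs0
    rw [hu0] at hd hG0
    have hin : ∀ s ∈ Icc 0 δ, u t 0 + s * rightNormal (u t) 0 ∈ A t '' closedBall 0 1 := by
      intro s hs
      rw [← h.closure_eq ht]
      rcases hs.1.eq_or_lt with rfl | h1
      · simpa using hj.mem_closure 0
      · exact subset_closure (by simpa using H 0 s ⟨h1, hs.2⟩)
    have hl : HasDerivWithinAt (fun s : ℝ => u t 0 + s * rightNormal (u t) 0)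
        (1 * rightNormal (u t) 0) (Icc 0 δ) 0 :=
      (((ofRealCLM.hasDerivAt (x := 0)).mul_const _).const_add _).hasDerivWithinAt
    have e0 : u t 0 + ((0 : ℝ) : ℂ) * rightNormal (u t) 0 = u t 0 := by simp
    have h1 : HasDerivWithinAt (fun s : ℝ => G (u t 0 + s * rightNormal (u t) 0))
        ((1 * rightNormal (u t) 0) • (D ζ)⁻¹) (Icc 0 δ) 0 :=
      HasDerivWithinAt.scomp (h := fun s : ℝ => u t 0 + s * rightNormal (u t) 0) 0
        (by rw [e0]; exact hd) hl hin
    have h2 := h1.norm_sq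
    rw [e0, hG0] at h2
    have h3 : ∀ s ∈ Icc 0 δ, ‖G (u t 0 + s * rightNormal (u t) 0)‖ ^ 2 ≤ 1 := fun s hs => by
      obtain ⟨ξ, hξ, he⟩ := hin s hs
      rw [← he, hG ξ hξ]
      exact pow_le_one₀ (norm_nonneg _) (mem_closedBall_zero_iff.1 hξ)
    have h4 : IsMaxOn (fun s : ℝ => ‖G (u t 0 + s * rightNormal (u t) 0)‖ ^ 2) (Icc 0 δ) 0 :=
      fun s hs => by
        change _ ≤ ‖G (u t 0 + ((0 : ℝ) : ℂ) * rightNormal (u t) 0)‖ ^ 2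
        rw [e0, hG0, hζ1, one_pow]
        exact h3 s hs
    have h5 := (h4.localize).hasFDerivWithinAt_nonpos h2.hasFDerivWithinAt
      (y := δ) (mem_posTangentConeAt_of_segment_subset (by
        rw [zero_add, segment_eq_Icc hδ.le]))
    have h6 : inner ℝ ζ ((1 * rightNormal (u t) 0) • (D ζ)⁻¹) = ‖D ζ‖⁻¹ := by
      have hDn : (‖D ζ‖ : ℂ) ≠ 0 := by exact_mod_cast norm_ne_zero_iff.2 hD0
      have : (1 * rightNormal (u t) 0) • (D ζ)⁻¹ * starRingEnd ℂ ζ = ((‖D ζ‖⁻¹ : ℝ) : ℂ) := by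
        have e1 : ζ * starRingEnd ℂ ζ = 1 := by
          rw [mul_conj, normSq_eq_norm_sq, hζ1]; simp
        rw [hn, smul_eq_mul]
        push_cast
        field_simp
        linear_combination e1
      rw [Complex.inner, this, ofReal_re]
    have h7 : 0 < δ * (2 * inner ℝ ζ ((1 * rightNormal (u t) 0) • (D ζ)⁻¹)) := by
      have := norm_pos_iff.2 hD0
      rw [h6]; positivity
    rw [ContinuousLinearMap.toSpanSingleton_apply] at h5
    exact absurd h7 (not_lt.2 h5)
  refine hj.exists_isLeftCollar (θ := 0) ?_ ?_
  · refine Eventually.frequently ?_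
    rcases hj.collar_subset_or hb (ε := -1) (by simp) with H | H
    · filter_upwards [Ioc_mem_nhdsGT hδ] with s hs
      simpa [sub_eq_add_neg] using H 0 s hs
    -- otherwise no point of the domain would be close to the curve
    obtain ⟨z, hz, hzd⟩ := Metric.mem_closure_iff.1 (hj.mem_closure 0) δ hδ
    obtain ⟨θ, s, hs, hmin⟩ := h0.exists_nearest z
    have hs1 : |s| < δ := by
      refine (hmin 0).trans_lt ?_
      rwa [← dist_eq_norm, dist_comm]
    rcases lt_trichotomy s 0 with h1 | h1 | h1
    · rw [abs_of_neg h1] at hs1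
      refine absurd (subset_closure hz) ?_
      have := H θ (-s) ⟨by linarith, hs1.le⟩
      rw [hs]
      simpa using this
    · rw [h1] at hs
      exact absurd hz (by rw [hs]; simpa using hj.notMem θ)
    · rw [abs_of_pos h1] at hs1
      exact absurd (subset_closure hz) (by rw [hs]; exact hout θ s ⟨h1, hs1.le⟩)
  · exact Eventually.frequently <| by
      filter_upwards [Ioc_mem_nhdsGT hδ] with s hs using hout 0 s hs

/-- The pressure is `-(1 / 2π) log |G|`, where `G` is the conformal map onto the disc. -/
theorem exists_pressure (h : IsNormalizedFamily U φ J Ω u A B) {t : ℝ} (ht : t ∈ J) :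
    ∃ p : ℂ → ℝ, IsPressure (Ω t) p ∧ ∀ θ, HasGradientWithinAt p
      (-((2 * π * ‖angleDeriv u t θ‖)⁻¹ • rightNormal (u t) θ)) (closure (Ω t)) (u t θ) := by
  have hπ := Real.pi_pos
  obtain ⟨D, G, hD, hDb, hGc, hG, hGd, hGo⟩ := h.exists_inverse ht
  have hcl := h.closure_eq ht
  have m0 : (0 : ℂ) ∈ ball (0 : ℂ) 1 := by simp
  have h0 : (0 : ℂ) ∈ Ω t := by
    rw [← h.image t ht]; exact ⟨0, m0, h.map_zero t ht⟩
  have hG0 : G 0 = 0 := by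
    have := hG 0 (ball_subset_closedBall m0)
    rwa [h.map_zero t ht] at this
  have hne : ∀ z ∈ closure (Ω t), z ≠ 0 → G z ≠ 0 := by
    rw [hcl]
    rintro _ ⟨ζ, hζ, rfl⟩ hz hGz
    rw [hG ζ hζ] at hGz
    exact hz (by rw [hGz, h.map_zero t ht])
  have hfr : ∀ z ∈ frontier (Ω t), ‖G z‖ = 1 := by
    rw [(h.isJordanParam ht).frontier_eq]
    rintro _ ⟨θ, rfl⟩
    rw [← h.boundary t ht, hG _ (norm_exp_angle θ), norm_exp_ofReal_mul_I]
  refine ⟨fun z => -(4 * π)⁻¹ * Real.log (‖G z‖ ^ 2), ⟨?_, fun z hz => ?_,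
    fun z => -(2 * π)⁻¹ * Real.log ‖dslope G 0 z‖, fun z hz => ?_, fun z hz => ?_⟩,
    fun θ => ?_⟩
  · refine continuousOn_const.mul (ContinuousOn.log (((hGc.mono ?_).norm).pow 2) fun z hz => ?_)
    · rw [← hcl]; exact sdiff_subset
    · exact pow_ne_zero 2 (norm_ne_zero_iff.2 (hne z hz.1 hz.2))
  · simp [hfr z hz]
  · have hn := (h.isOpen_domain t ht).mem_nhds hz
    have h1 : AnalyticAt ℂ (dslope G 0) z := DifferentiableOn.analyticAt
      ((differentiableOn_dslope ((h.isOpen_domain t ht).mem_nhds h0)).2 hGo) hn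
    refine (h1.harmonicAt_log_norm ?_).const_smul
    by_cases hz0 : z = 0
    · subst hz0
      have h2 := hGd 0 (ball_subset_closedBall m0)
      rw [h.map_zero t ht, ← hcl] at h2
      rw [dslope_same, (h2.hasDerivAt (mem_of_superset hn subset_closure)).deriv]
      exact inv_ne_zero (hD 0 (ball_subset_closedBall m0)).1
    · rw [dslope_of_ne _ hz0, slope_def_field, hG0, sub_zero, sub_zero]
      exact div_ne_zero (hne z (subset_closure hz) hz0) hz0
  · have hz0 : z ≠ 0 := hz.2
    have hGz := hne z (subset_closure hz.1) hz0
    simp only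
    rw [dslope_of_ne _ hz0, slope_def_field, hG0, sub_zero, sub_zero, norm_div,
      Real.log_div (norm_ne_zero_iff.2 hGz) (norm_ne_zero_iff.2 hz0), Real.log_pow]
    push_cast
    field_simp
    ring
  · have hm := norm_exp_angle θ
    obtain ⟨hn, hnn⟩ := rightNormal_eq (hDb θ)
    have h1 := (hGd _ hm).hasFDerivWithinAt.restrictScalars ℝ
    rw [← hcl, h.boundary t ht] at h1
    have hGu : G (u t θ) = cexp (θ * I) := by rw [← h.boundary t ht, hG _ hm]
    have h2 := (h1.norm_sq.log (by rw [hGu, norm_exp_ofReal_mul_I]; simp)).const_mul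
      (-(4 * π)⁻¹)
    refine h2.congr_fderiv ?_
    refine ContinuousLinearMap.ext fun v => ?_
    have hD0 := (hD _ hm).1
    have hDn : (‖D (cexp (θ * I))‖ : ℂ) ≠ 0 := by exact_mod_cast norm_ne_zero_iff.2 hD0
    have e1 : v * starRingEnd ℂ (cexp (θ * I) * D (cexp (θ * I)) / ‖D (cexp (θ * I))‖) =
        ((‖D (cexp (θ * I))‖ : ℝ) : ℂ) *
          (v * (D (cexp (θ * I)))⁻¹ * starRingEnd ℂ (cexp (θ * I))) := by
      have := mul_conj (D (cexp (θ * I)))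
      rw [normSq_eq_norm_sq] at this
      push_cast at this
      simp only [map_mul, map_div₀, conj_ofReal]
      field_simp
      linear_combination v * this
    have e2 : inner ℝ (rightNormal (u t) θ) v = ‖D (cexp (θ * I))‖ *
        inner ℝ (cexp (θ * I)) (v * (D (cexp (θ * I)))⁻¹) := by
      rw [Complex.inner, Complex.inner, hn, e1, re_ofReal_mul]
    rw [InnerProductSpace.toDual_apply_apply, inner_neg_left, real_inner_smul_left, e2]
    have hnn' : ‖angleDeriv u t θ‖ = _ := hnn
    rw [hnn', hGu, norm_exp_ofReal_mul_I]
    have := norm_ne_zero_iff.2 hD0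
    simp
    field_simp
    ring

/-- In the new time, the domains of a normalized family solve the Hele-Shaw flow. -/
theorem isHeleShawFlow (h : IsNormalizedFamily U φ J Ω u A B) :
    IsHeleShawFlow (fun z => 1 / laplacian φ z) (newTime φ u '' J)
      (fun σ => Ω (invFunOn (newTime φ u) J σ)) := by
  have hc := h.isTimeChange
  have hJ := h.ordConnected
  have hJ' := h.nontrivial
  set T := invFunOn (newTime φ u) J with hT
  refine ⟨?_, fun σ hσ => ?_, fun σ θ => u (T σ) θ,
    ⟨hc.contDiffOn hJ hJ' fun k => (h.timeClass k).1, fun σ hσ => h.isJordanParam (hc.mapsTo hσ)⟩,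
    fun σ hσ => ?_⟩
  · rintro _ ⟨t, ht, rfl⟩ _ ⟨t', ht', rfl⟩ hlt
    simp only [hc.left_inv t ht, hc.left_inv t' ht']
    exact h.increasing t ht t' ht' ((hc.strictMono.lt_iff_lt ht ht').1 hlt)
  · have ht := hc.mapsTo hσ
    simp only
    rw [← h.image _ ht]
    exact ⟨0, by simp, h.map_zero _ ht⟩
  · have ht := hc.mapsTo hσ
    have hj := h.isJordanParam ht
    have h0 := hj.isSimpleClosedCurve
    obtain ⟨p, hp, hpg⟩ := h.exists_pressure ht
    obtain ⟨δ, hδ⟩ := h.exists_isLeftCollar ht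
    refine ⟨p, hp, fun θ => ⟨rightNormal (u (T σ)) θ, _,
      ⟨h0.norm_rightNormal θ, IsSimpleClosedCurve.inner_rightNormal_deriv θ, ?_⟩, hpg θ, ?_⟩⟩
    · filter_upwards [Ioc_mem_nhdsGT hδ.pos] with s hs
      exact ⟨hδ.inside θ s hs, hδ.outside θ s hs⟩
    · have h1 : HasDerivWithinAt (fun τ => u (T τ) θ)
          (-I * speedKernel φ u (T σ) θ * angleDeriv u (T σ) θ) (newTime φ u '' J) σ := by
        refine hc.hasDerivWithinAt_comp hJ (f := fun t => u t θ)
          (v := fun t => -I * speedKernel φ u t θ * angleDeriv u t θ) (fun t ht' => ?_) ?_ hσ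
        · rw [real_smul, ← (h.timeDeriv_eq ht').2 θ]
          exact h.boundary_smooth.smooth.hasDerivWithinAt_time ht' θ
        · exact (h.timeClass 0).2.smoothPeriodic.smooth.continuousOn.comp
            (f := fun t : ℝ => (t, θ)) (by fun_prop) fun t ht => ⟨ht, mem_univ _⟩
      rw [h1.derivWithin (uniqueDiffOn_of_ordConnected (hc.ordConnected hJ)
        (hc.nontrivial hJ') σ hσ), smul_neg, neg_neg, smul_smul]
      congr 1
      have hreg : ‖angleDeriv u (T σ) θ‖ ≠ 0 := norm_ne_zero_iff.2 (h.regular _ ht θ)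
      have hk := h.speedKernel_re ht θ
      rw [speedDensity, normSq_eq_norm_sq] at hk
      have e : -I * speedKernel φ u (T σ) θ * angleDeriv u (T σ) θ *
          starRingEnd ℂ (rightNormal (u (T σ)) θ) =
          ((‖angleDeriv u (T σ) θ‖ : ℝ) : ℂ) * speedKernel φ u (T σ) θ := by
        have e1 : rightNormal (u (T σ)) θ = -I * (angleDeriv u (T σ) θ / ‖angleDeriv u (T σ) θ‖) :=
          rfl
        have e2 := mul_conj (angleDeriv u (T σ) θ)
        rw [normSq_eq_norm_sq] at e2
        push_cast at e2
        have hreg' : (‖angleDeriv u (T σ) θ‖ : ℂ) ≠ 0 := by exact_mod_cast hreg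
        rw [e1]
        simp only [map_mul, map_neg, conj_I, map_div₀, conj_ofReal]
        field_simp
        linear_combination (-I ^ 2 * speedKernel φ u (T σ) θ) * e2 -
          (speedKernel φ u (T σ) θ * ‖angleDeriv u (T σ) θ‖ ^ 2) * I_sq
      have hL := (h.subharmonic _ (h.mem _ ht θ)).ne'
      have hπ := Real.pi_ne_zero
      rw [real_inner_comm, Complex.inner, e, re_ofReal_mul, hk]
      field_simp

end IsNormalizedFamily

/-! ### Automorphisms of the disc -/

/-- The automorphism `ζ ↦ (l ζ + z) / (1 + conj z l ζ)` of the disc, where `‖z‖ < 1`, `‖l‖ = 1`. -/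
def discAut (z l ζ : ℂ) : ℂ := (l * ζ + z) / (1 + starRingEnd ℂ z * l * ζ)

section DiscAut

variable {z l ζ : ℂ}

theorem discAut_zero (z l : ℂ) : discAut z l 0 = z := by simp [discAut]

theorem discAut_den_ne_zero (hz : ‖z‖ < 1) (hl : ‖l‖ = 1) (hζ : ζ ∈ closedBall (0 : ℂ) 1) :
    1 + starRingEnd ℂ z * l * ζ ≠ 0 := by
  intro h0
  have h1 : ‖starRingEnd ℂ z * l * ζ‖ < 1 := by
    rw [norm_mul, norm_mul, RCLike.norm_conj, hl, mul_one]
    exact (mul_le_of_le_one_right (norm_nonneg z) (mem_closedBall_zero_iff.1 hζ)).trans_lt hz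
  rw [← neg_eq_of_add_eq_zero_right h0, norm_neg, norm_one] at h1
  exact lt_irrefl _ h1

theorem conj_mul_self_of_norm_eq_one (hl : ‖l‖ = 1) : starRingEnd ℂ l * l = 1 := by
  rw [← normSq_eq_conj_mul_self, normSq_eq_norm_sq, hl]; simp

theorem one_sub_normSq_discAut (hz : ‖z‖ < 1) (hl : ‖l‖ = 1)
    (hζ : ζ ∈ closedBall (0 : ℂ) 1) :
    1 - ‖discAut z l ζ‖ ^ 2 =
      (1 - ‖z‖ ^ 2) * (1 - ‖ζ‖ ^ 2) / ‖1 + starRingEnd ℂ z * l * ζ‖ ^ 2 := by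
  have h0 := discAut_den_ne_zero hz hl hζ
  have h1 := norm_ne_zero_iff.2 h0
  rw [discAut, norm_div, div_pow, eq_div_iff (pow_ne_zero 2 h1), sub_mul,
    div_mul_cancel₀ _ (pow_ne_zero 2 h1), one_mul]
  have h2 := conj_mul_self_of_norm_eq_one hl
  simp only [← normSq_eq_norm_sq]
  apply Complex.ofReal_injective
  push_cast
  simp only [normSq_eq_conj_mul_self, map_add, map_mul, map_one, conj_conj]
  linear_combination (-ζ * starRingEnd ℂ ζ + z * starRingEnd ℂ z * ζ * starRingEnd ℂ ζ) * h2

theorem discAut_mem_ball (hz : ‖z‖ < 1) (hl : ‖l‖ = 1) (hζ : ζ ∈ ball (0 : ℂ) 1) :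
    discAut z l ζ ∈ ball (0 : ℂ) 1 := by
  have hm := ball_subset_closedBall hζ
  have h1 := one_sub_normSq_discAut hz hl hm
  rw [mem_ball_zero_iff] at hζ ⊢
  have h2 : 0 < 1 - ‖z‖ ^ 2 := by nlinarith [norm_nonneg z]
  have h3 : 0 < 1 - ‖ζ‖ ^ 2 := by nlinarith [norm_nonneg ζ]
  have h4 := norm_pos_iff.2 (discAut_den_ne_zero hz hl hm)
  have h5 : 0 < 1 - ‖discAut z l ζ‖ ^ 2 := by rw [h1]; positivity
  nlinarith [norm_nonneg (discAut z l ζ)]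

theorem discAut_mem_sphere (hz : ‖z‖ < 1) (hl : ‖l‖ = 1) (hζ : ζ ∈ sphere (0 : ℂ) 1) :
    discAut z l ζ ∈ sphere (0 : ℂ) 1 := by
  have h1 := one_sub_normSq_discAut hz hl (sphere_subset_closedBall hζ)
  rw [mem_sphere_zero_iff_norm] at hζ ⊢
  rw [hζ, one_pow, sub_self, mul_zero, zero_div, sub_eq_zero] at h1
  exact (pow_eq_one_iff_of_nonneg (norm_nonneg _) two_ne_zero).1 h1.symm

theorem discAut_mem_closedBall (hz : ‖z‖ < 1) (hl : ‖l‖ = 1)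
    (hζ : ζ ∈ closedBall (0 : ℂ) 1) : discAut z l ζ ∈ closedBall (0 : ℂ) 1 := by
  rw [← ball_union_sphere] at hζ ⊢
  exact hζ.imp (discAut_mem_ball hz hl) (discAut_mem_sphere hz hl)

theorem discAut_discAut (hz : ‖z‖ < 1) (hl : ‖l‖ = 1) (hζ : ζ ∈ closedBall (0 : ℂ) 1) :
    discAut (-starRingEnd ℂ l * z) (starRingEnd ℂ l) (discAut z l ζ) = ζ := by
  have h0 := discAut_den_ne_zero hz hl hζ
  have h2 := conj_mul_self_of_norm_eq_one hl
  have hz' : ‖-starRingEnd ℂ l * z‖ < 1 := by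
    rw [norm_mul, norm_neg, RCLike.norm_conj, hl, one_mul]; exact hz
  have h3 := discAut_den_ne_zero hz' (by rwa [RCLike.norm_conj])
    (discAut_mem_closedBall hz hl hζ)
  have h4 : discAut z l ζ * (1 + starRingEnd ℂ z * l * ζ) = l * ζ + z := div_mul_cancel₀ _ h0
  rw [discAut, div_eq_iff h3]
  simp only [map_mul, map_neg, conj_conj]
  refine mul_right_cancel₀ h0 ?_
  linear_combination (starRingEnd ℂ l + ζ * l * starRingEnd ℂ z * starRingEnd ℂ l) * h4 +
    (ζ + starRingEnd ℂ z * l * ζ ^ 2) * h2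

theorem injOn_discAut (hz : ‖z‖ < 1) (hl : ‖l‖ = 1) :
    InjOn (discAut z l) (closedBall 0 1) := fun ζ hζ ξ hξ h => by
  rw [← discAut_discAut hz hl hζ, h, discAut_discAut hz hl hξ]

theorem image_discAut (hz : ‖z‖ < 1) (hl : ‖l‖ = 1) :
    discAut z l '' ball 0 1 = ball 0 1 := by
  refine Subset.antisymm (image_subset_iff.2 fun ζ => discAut_mem_ball hz hl) fun w hw => ?_
  have h2 := conj_mul_self_of_norm_eq_one hl
  have hz' : ‖-starRingEnd ℂ l * z‖ < 1 := by
    rw [norm_mul, norm_neg, RCLike.norm_conj, hl, one_mul]; exact hz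
  have hl' : ‖starRingEnd ℂ l‖ = 1 := by rwa [RCLike.norm_conj]
  refine ⟨_, discAut_mem_ball hz' hl' hw, ?_⟩
  have h3 := discAut_discAut hz' hl' (ball_subset_closedBall hw)
  rwa [conj_conj, show -l * (-starRingEnd ℂ l * z) = z by linear_combination z * h2] at h3

theorem hasDerivAt_discAut (hz : ‖z‖ < 1) (hl : ‖l‖ = 1) (hζ : ζ ∈ closedBall (0 : ℂ) 1) :
    HasDerivAt (discAut z l)
      (l * ((1 - ‖z‖ ^ 2 : ℝ) : ℂ) / (1 + starRingEnd ℂ z * l * ζ) ^ 2) ζ := by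
  have h0 := discAut_den_ne_zero hz hl hζ
  refine ((((hasDerivAt_id ζ).const_mul l).add_const z).div
    (((hasDerivAt_id ζ).const_mul (starRingEnd ℂ z * l)).const_add 1) h0).congr_deriv ?_
  rw [← normSq_eq_norm_sq]
  push_cast
  rw [normSq_eq_conj_mul_self]
  simp only [id]
  congr 1
  ring

theorem deriv_discAut_ne_zero (hz : ‖z‖ < 1) (hl : ‖l‖ = 1)
    (hζ : ζ ∈ closedBall (0 : ℂ) 1) :
    l * ((1 - ‖z‖ ^ 2 : ℝ) : ℂ) / (1 + starRingEnd ℂ z * l * ζ) ^ 2 ≠ 0 := by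
  refine div_ne_zero (mul_ne_zero ?_ ?_) (pow_ne_zero 2 (discAut_den_ne_zero hz hl hζ))
  · rintro rfl; simp at hl
  · exact_mod_cast (show (0 : ℝ) < 1 - ‖z‖ ^ 2 by nlinarith [norm_nonneg z]).ne'

end DiscAut

/-! ### Admissible discs -/

/-- The derivative of a smooth function that is holomorphic inside the disc is complex linear also
at the boundary. -/
theorem exists_hasDerivWithinAt_closedBall {g : ℂ → ℂ} {ζ : ℂ}
    (hζ : ζ ∈ closedBall (0 : ℂ) 1)
    (hg : ContDiffWithinAt ℝ ∞ g (closedBall 0 1) ζ)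
    (hd : ∀ᶠ ξ in 𝓝[ball 0 1] ζ, DifferentiableAt ℂ g ξ) :
    ∃ d, HasDerivWithinAt g d (closedBall 0 1) ζ := by
  set L := fderivWithin ℝ g (closedBall 0 1) ζ with hL
  have h1 : ContinuousWithinAt (fderivWithin ℝ g (closedBall 0 1)) (closedBall 0 1) ζ :=
    (hg.fderivWithin_right uniqueDiffOn_closedBall (m := 0) (by simp) hζ).continuousWithinAt
  have hne : (𝓝[ball (0 : ℂ) 1] ζ).NeBot := by
    rw [← mem_closure_iff_nhdsWithin_neBot, closure_ball _ one_ne_zero]; exact hζ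
  have h2 := h1.mono ball_subset_closedBall
  have h3 : L I = I * L 1 := by
    have a1 := (ContinuousLinearMap.apply ℝ ℂ I).continuous.continuousAt.comp_continuousWithinAt h2
    have a2 := (ContinuousLinearMap.apply ℝ ℂ (1 : ℂ)).continuous.continuousAt.comp_continuousWithinAt h2
    refine tendsto_nhds_unique_of_eventuallyEq a1.tendsto (a2.tendsto.const_mul I) ?_
    filter_upwards [hd, self_mem_nhdsWithin] with ξ hξ hξb
    have e : fderivWithin ℝ g (closedBall 0 1) ξ = (fderiv ℂ g ξ).restrictScalars ℝ := by
      rw [fderivWithin_of_mem_nhds (mem_of_superset (isOpen_ball.mem_nhds hξb)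
        ball_subset_closedBall)]
      exact (hξ.hasFDerivAt.restrictScalars ℝ).fderiv
    simp only [comp_apply, ContinuousLinearMap.apply_apply, e,
      ContinuousLinearMap.coe_restrictScalars']
    rw [← smul_eq_mul, ← map_smul, smul_eq_mul, mul_one]
  refine ⟨L 1, ?_⟩
  have h4 := (hg.differentiableWithinAt (by simp)).hasFDerivWithinAt
  rw [← hL] at h4
  rw [hasDerivWithinAt_iff_isLittleO]
  rw [hasFDerivWithinAt_iff_isLittleO] at h4
  refine h4.congr_left fun w => ?_
  congr 1
  have e : ∀ v : ℂ, L v = v * L 1 := fun v => by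
    conv_lhs => rw [← re_add_im v, map_add, ← mul_one (v.re : ℂ), ← real_smul, ← real_smul,
      map_smul, map_smul, h3]
    conv_rhs => rw [← re_add_im v]
    rw [real_smul, real_smul]
    ring
  rw [e, smul_eq_mul]

theorem sphereChartInfty_eq_inv (w : OnePoint ℂ) : sphereChartInfty w = (sphereChartZero w)⁻¹ := by
  cases w
  · simp [sphereChartZero, sphereChartInfty]
  · rfl

/-- The residue theorem for `g / a`, where `a` has just one zero in the closed disc, a simple
one. -/
theorem integral_div_of_simple_zero {a g : ℂ → ℂ} (ha : DiffContOnCl ℂ a (ball 0 1))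
    (hg : DiffContOnCl ℂ g (ball 0 1)) {z : ℂ} (hz : z ∈ ball (0 : ℂ) 1)
    (haz : a z = 0) (hz' : ∀ ζ ∈ closedBall (0 : ℂ) 1, a ζ = 0 → ζ = z)
    (hd : deriv a z ≠ 0) :
    ∫ θ in (0 : ℝ)..(2 * π), cexp (θ * I) * g (cexp (θ * I)) / a (cexp (θ * I)) =
      2 * π * g z / deriv a z := by
  have hne : ∀ ζ ∈ closure (ball (0 : ℂ) 1), dslope a z ζ ≠ 0 := fun ζ hζ => by
    rw [closure_ball _ one_ne_zero] at hζ
    by_cases h : ζ = z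
    · rwa [h, dslope_same]
    · rw [dslope_of_ne _ h, slope_def_field, haz, sub_zero]
      exact div_ne_zero (fun h' => h (hz' ζ hζ h')) (sub_ne_zero.2 h)
  have hk : DiffContOnCl ℂ (fun ζ => g ζ • (dslope a z ζ)⁻¹) (ball 0 1) :=
    hg.smul ((ha.dslope_ball hz).inv hne)
  have h1 := hk.circleIntegral_sub_inv_smul hz
  rw [dslope_same, circleIntegral] at h1
  have h2 : ∀ θ : ℝ, deriv (circleMap 0 1) θ • ((circleMap 0 1 θ - z)⁻¹ •
      g (circleMap 0 1 θ) • (dslope a z (circleMap 0 1 θ))⁻¹) =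
      I * (cexp (θ * I) * g (cexp (θ * I)) / a (cexp (θ * I))) := fun θ => by
    have e : circleMap 0 1 θ = cexp (θ * I) := by simp [circleMap]
    have hs := exp_angle_mem_sphere θ
    have hθ : cexp (θ * I) ≠ z := fun h' => by
      rw [h'] at hs
      exact (mem_ball.1 hz).ne (mem_sphere.1 hs)
    have ha0 : a (cexp (θ * I)) ≠ 0 := fun h' =>
      hθ (hz' _ (sphere_subset_closedBall hs) h')
    have hs0 := sub_ne_zero.2 hθ
    rw [deriv_circleMap, e, dslope_of_ne _ hθ, slope_def_field, haz]
    simp only [smul_eq_mul, sub_zero]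
    field_simp
  simp only [h2, integral_const_mul] at h1
  refine mul_left_cancel₀ I_ne_zero (h1.trans ?_)
  simp only [smul_eq_mul]
  ring

namespace IsAdmissibleDisc

variable {U : Set ℂ} {φ : ℂ → ℝ} {f : ℂ → ℂ × OnePoint ℂ}

theorem continuousOn (hf : IsAdmissibleDisc U φ f) : ContinuousOn f (closedBall 0 1) :=
  hf.disc.smooth_fst.continuousOn.prodMk hf.disc.smooth_snd.1

theorem diffContOnCl_fst (hf : IsAdmissibleDisc U φ f) :
    DiffContOnCl ℂ (fun ζ => (f ζ).1) (ball 0 1) :=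
  diffContOnCl_ball_of hf.disc.holomorphic_fst hf.disc.smooth_fst.continuousOn

theorem boundary_eq (hf : IsAdmissibleDisc U φ f) {ζ : ℂ} (hζ : ζ ∈ sphere (0 : ℂ) 1) :
    (f ζ).1 ∈ U ∧ (f ζ).2 = (wirtinger φ (f ζ).1 : OnePoint ℂ) := by
  obtain ⟨z, hz, he⟩ := hf.boundary (mem_image_of_mem f hζ)
  rw [he]
  exact ⟨hz, rfl⟩

theorem exists_pole (hf : IsAdmissibleDisc U φ f) :
    ∃ z ∈ ball (0 : ℂ) 1, f z = ((0 : ℂ), OnePoint.infty) ∧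
      ∀ ζ ∈ closedBall (0 : ℂ) 1, (f ζ).1 = 0 ∨ (f ζ).2 = OnePoint.infty → ζ = z := by
  have h1 : closure (discImage f) = f '' closedBall 0 1 :=
    closure_image_ball hf.continuousOn
  have h3 := hf.meets_fibre
  have h4 := hf.meets_infty
  rw [h1] at h3 h4
  obtain ⟨z, hz, hfz⟩ := (h3.symm.subset rfl).1
  have hzb : z ∈ ball (0 : ℂ) 1 := by
    rw [← ball_union_sphere] at hz
    refine hz.resolve_right fun hs => ?_
    have := (hf.boundary_eq hs).2
    rw [hfz] at this
    exact OnePoint.infty_ne_coe _ this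
  refine ⟨z, hzb, hfz, fun ζ hζ h => hf.disc.injective hζ (ball_subset_closedBall hzb) ?_⟩
  rw [hfz]
  rcases h with h | h
  · exact h3.subset ⟨mem_image_of_mem f hζ, h⟩
  · exact h4.subset ⟨mem_image_of_mem f hζ, h⟩

theorem injOn_fst (hf : IsAdmissibleDisc U φ f) (ho : IsOpen (discShadow f)) :
    InjOn (fun ζ => (f ζ).1) (closedBall 0 1) := by
  obtain ⟨g, hg, hgf⟩ := hf.isom
  -- a boundary point cannot have the same projection as an interior point
  have key : ∀ ζ ∈ sphere (0 : ℂ) 1, ∀ ξ ∈ ball (0 : ℂ) 1, (f ζ).1 ≠ (f ξ).1 := by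
    intro ζ hζ ξ hξ he
    have hmem : (f ξ).1 ∈ discShadow f := ⟨_, mem_image_of_mem f hξ, rfl⟩
    have hgc : ContinuousAt g (f ζ).1 := by
      rw [he]; exact (hg.differentiableAt (ho.mem_nhds hmem)).continuousAt
    have hζK := sphere_subset_closedBall hζ
    have h1 := (hf.disc.smooth_fst.continuousOn ζ hζK).mono ball_subset_closedBall
    have hne : (𝓝[ball (0 : ℂ) 1] ζ).NeBot := by
      rw [← mem_closure_iff_nhdsWithin_neBot, closure_ball _ one_ne_zero]; exact hζK
    have h2 : Tendsto (fun y => g (f y).1) (𝓝[ball 0 1] ζ) (𝓝 (g (f ζ).1)) :=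
      hgc.tendsto.comp h1
    have h3 := tendsto_nhds_unique_of_eventuallyEq h2 (tendsto_id.mono_left nhdsWithin_le_nhds)
      (by filter_upwards [self_mem_nhdsWithin] with y hy using hgf y hy)
    rw [he, hgf ξ hξ] at h3
    rw [h3] at hξ
    exact (mem_ball.1 hξ).ne (mem_sphere.1 hζ)
  intro ζ hζ ξ hξ he
  have he' : (f ζ).1 = (f ξ).1 := he
  rw [← ball_union_sphere] at hζ hξ
  rcases hζ with hζ | hζ <;> rcases hξ with hξ | hξ
  · rw [← hgf ζ hζ, he', hgf ξ hξ]
  · exact absurd he'.symm (key ξ hξ ζ hζ)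
  · exact absurd he' (key ζ hζ ξ hξ)
  · refine hf.disc.injective (sphere_subset_closedBall hζ)
      (sphere_subset_closedBall hξ) (Prod.ext he' ?_)
    rw [(hf.boundary_eq hζ).2, (hf.boundary_eq hξ).2, he']

theorem deriv_fst_ne_zero (hf : IsAdmissibleDisc U φ f) (ho : IsOpen (discShadow f)) {ζ : ℂ}
    (hζ : ζ ∈ ball (0 : ℂ) 1) : deriv (fun ζ => (f ζ).1) ζ ≠ 0 := by
  obtain ⟨g, hg, hgf⟩ := hf.isom
  have hmem : (f ζ).1 ∈ discShadow f := ⟨_, mem_image_of_mem f hζ, rfl⟩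
  have hn := isOpen_ball.mem_nhds hζ
  have h1 := (hf.disc.holomorphic_fst.differentiableAt hn).hasDerivAt
  have h2 := (hg.differentiableAt (ho.mem_nhds hmem)).hasDerivAt
  have h3 : HasDerivAt (fun y => g (f y).1) _ ζ := HasDerivAt.comp ζ h2 h1
  have h4 : HasDerivAt (fun y => g (f y).1) 1 ζ := (hasDerivAt_id ζ).congr_of_eventuallyEq (by
    filter_upwards [hn] with y hy using hgf y hy)
  intro h0
  rw [h0, mul_zero] at h3
  exact zero_ne_one (h3.unique h4)

/-- The second component is determined by the first along the boundary, so that the first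
component is itself an immersion there. -/
theorem exists_hasDerivWithinAt_fst (hf : IsAdmissibleDisc U φ f) (hU : IsOpen U)
    (hφ : ContDiffOn ℝ ∞ φ U) {ζ : ℂ} (hζ : ζ ∈ sphere (0 : ℂ) 1) :
    ∃ d, d ≠ 0 ∧ HasDerivWithinAt (fun y => (f y).1) d (closedBall 0 1) ζ := by
  have hK := sphere_subset_closedBall hζ
  obtain ⟨hmem, heq⟩ := hf.boundary_eq hζ
  have hfin : (f ζ).2 ≠ OnePoint.infty := by rw [heq]; exact OnePoint.coe_ne_infty _
  obtain ⟨d, hd⟩ := exists_hasDerivWithinAt_closedBall hK (hf.disc.smooth_fst ζ hK) (by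
    filter_upwards [self_mem_nhdsWithin] with ξ hξ
    exact hf.disc.holomorphic_fst.differentiableAt (isOpen_ball.mem_nhds hξ))
  obtain ⟨e, he⟩ := exists_hasDerivWithinAt_closedBall hK ((hf.disc.smooth_snd.2 ζ hK).1 hfin) (by
    have h1 := (hf.disc.smooth_snd.1 ζ hK).mono ball_subset_closedBall
    filter_upwards [self_mem_nhdsWithin, h1.tendsto.eventually (isOpen_compl_singleton.mem_nhds hfin)]
      with ξ hξ hξ'
    exact (hf.disc.holomorphic_snd.2 ξ hξ).1 hξ')
  refine ⟨d, fun hd0 => ?_, hd⟩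
  subst hd0
  obtain ⟨θ, rfl⟩ := exists_exp_angle_eq hζ
  have hc : HasDerivWithinAt (fun θ : ℝ => cexp (θ * I)) (cexp (θ * I) * (1 * I)) univ θ :=
    ((ofRealCLM.hasDerivAt (x := θ)).mul_const I).cexp.hasDerivWithinAt
  have hm : MapsTo (fun θ : ℝ => cexp (θ * I)) univ (closedBall 0 1) :=
    fun θ _ => norm_exp_angle θ
  have h1 := (HasDerivWithinAt.scomp (h := fun θ : ℝ => cexp (θ * I)) θ hd hc hm).hasDerivAt
    univ_mem
  have h2 := (HasDerivWithinAt.scomp (h := fun θ : ℝ => cexp (θ * I)) θ he hc hm).hasDerivAt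
    univ_mem
  have h3 : HasDerivAt (fun θ : ℝ => wirtinger φ (f (cexp (θ * I))).1) _ θ :=
    HasFDerivAt.comp_hasDerivAt (f := fun θ : ℝ => (f (cexp (θ * I))).1) θ
      (hasFDerivAt_wirtinger hU hφ hmem) h1
  have h4 : (fun θ : ℝ => wirtinger φ (f (cexp (θ * I))).1) =
      (fun y => sphereChartZero (f y).2) ∘ fun θ : ℝ => cexp (θ * I) := by
    funext θ
    rw [comp_apply, (hf.boundary_eq (exp_angle_mem_sphere θ)).2]
    rfl
  rw [h4, smul_zero, map_zero] at h3
  have h5 := h3.unique h2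
  have he0 : e = 0 := by
    rcases smul_eq_zero.1 h5.symm with h6 | h6
    · simp [I_ne_zero] at h6
    · exact h6
  subst he0
  have hu : UniqueDiffWithinAt ℝ (closedBall (0 : ℂ) 1) (cexp (θ * I)) :=
    uniqueDiffOn_closedBall _ hK
  have h6 : ∀ g : ℂ → ℂ, HasDerivWithinAt g 0 (closedBall 0 1) (cexp (θ * I)) →
      fderivWithin ℝ g (closedBall 0 1) (cexp (θ * I)) = 0 := fun g hg => by
    rw [(hg.hasFDerivWithinAt.restrictScalars ℝ).fderivWithin hu]
    ext
    simp
  rcases hf.disc.immersion _ hK with h7 | ⟨-, h7⟩ | ⟨h8, h7⟩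
  · exact h7 (h6 _ hd)
  · exact h7 (h6 _ he)
  · refine h7 (h6 _ ?_)
    simp only [sphereChartInfty_eq_inv]
    have h9 : sphereChartZero (f (cexp (θ * I))).2 ≠ 0 := by
      rw [heq] at h8 ⊢
      exact fun h' => h8 (congrArg _ h')
    have := he.fun_inv h9
    simpa using this

variable {z l : ℂ}

/-- `ζ` times the second component of the disc, in the coordinate given by `discAut z l`. The pole
at `0` is thus removed. -/
def pullbackLift (f : ℂ → ℂ × OnePoint ℂ) (z l : ℂ) (ζ : ℂ) : ℂ :=
  (dslope (fun ξ => sphereChartInfty (f (discAut z l ξ)).2) 0 ζ)⁻¹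

theorem pullbackLift_eq (hfz : (f z).2 = OnePoint.infty) {ζ : ℂ} (hζ : ζ ≠ 0) :
    pullbackLift f z l ζ = ζ * sphereChartZero (f (discAut z l ζ)).2 := by
  rw [pullbackLift, dslope_of_ne _ hζ, slope_def_field, discAut_zero, hfz,
    sphereChartInfty_infty, sub_zero, sub_zero, sphereChartInfty_eq_inv, inv_div, div_inv_eq_mul]

theorem diffContOnCl_pullbackLift (hf : IsAdmissibleDisc U φ f) (hz : ‖z‖ < 1) (hl : ‖l‖ = 1)
    (hfz : (f z).2 = OnePoint.infty)
    (hz' : ∀ ζ ∈ closedBall (0 : ℂ) 1, (f ζ).2 = OnePoint.infty → ζ = z) :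
    DiffContOnCl ℂ (pullbackLift f z l) (ball 0 1) := by
  have m0 : (0 : ℂ) ∈ ball (0 : ℂ) 1 := by simp
  have hne : ∀ ζ ∈ closedBall (0 : ℂ) 1, ζ ≠ 0 → (f (discAut z l ζ)).2 ≠ OnePoint.infty :=
    fun ζ hζ hζ0 h => hζ0 <| injOn_discAut hz hl hζ (ball_subset_closedBall m0) <| by
      rw [discAut_zero]; exact hz' _ (discAut_mem_closedBall hz hl hζ) h
  have h0 : ContinuousAt (pullbackLift f z l) 0 := by
    have hzb : z ∈ ball (0 : ℂ) 1 := mem_ball_zero_iff.2 hz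
    have ht := hf.transversal z hzb hfz
    have h1 := (differentiableAt_of_deriv_ne_zero ht).hasDerivAt
    have h2 := hasDerivAt_discAut hz hl (ball_subset_closedBall m0)
    rw [← discAut_zero z l] at h1
    have h3 : HasDerivAt (fun ξ => sphereChartInfty (f (discAut z l ξ)).2) _ 0 :=
      HasDerivAt.comp (0 : ℂ) h1 h2
    refine (continuousAt_dslope_same.2 h3.differentiableAt).inv₀ ?_
    rw [dslope_same, h3.deriv, discAut_zero]
    exact mul_ne_zero ht (deriv_discAut_ne_zero hz hl (ball_subset_closedBall m0))
  have hd : ∀ ζ ∈ ball (0 : ℂ) 1, ζ ≠ 0 → DifferentiableAt ℂ (pullbackLift f z l) ζ := by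
    intro ζ hζ hζ0
    have hm := ball_subset_closedBall hζ
    have h1 := (hf.disc.holomorphic_snd.2 _ (discAut_mem_ball hz hl hζ)).1 (hne ζ hm hζ0)
    refine (differentiableAt_id.mul (h1.comp ζ
      (hasDerivAt_discAut hz hl hm).differentiableAt)).congr_of_eventuallyEq ?_
    filter_upwards [isOpen_ne.mem_nhds hζ0] with ξ hξ using pullbackLift_eq hfz hξ
  refine diffContOnCl_ball_of_continuousAt h0 hd fun ζ hζ hζ0 => ?_
  have hm := discAut_mem_closedBall hz hl hζ
  have h1 := ((hf.disc.smooth_snd.2 _ hm).1 (hne ζ hζ hζ0)).continuousWithinAt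
  have h2 : ContinuousWithinAt (fun ξ => ξ * sphereChartZero (f (discAut z l ξ)).2)
      (closedBall 0 1) ζ := continuousWithinAt_id.mul
    (ContinuousWithinAt.comp (f := discAut z l) h1
      (hasDerivAt_discAut hz hl hζ).continuousAt.continuousWithinAt
      fun ξ => discAut_mem_closedBall hz hl)
  refine h2.congr_of_eventuallyEq ?_ (pullbackLift_eq hfz hζ0)
  filter_upwards [nhdsWithin_le_nhds (isOpen_ne.mem_nhds hζ0)] with ξ hξ
    using pullbackLift_eq hfz hξ

end IsAdmissibleDisc

/-! ### Normalization of a family of discs -/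

/-- For `k = 0, 1`, these are `2π / f'(z)` and `2π z / f'(z)`, where `f` is the first component of
`F t` and `z` is its zero. -/
def zeroMoment (F : ℝ → ℂ → ℂ × OnePoint ℂ) (k : ℕ) (t : ℝ) : ℂ :=
  ∫ θ in (0 : ℝ)..(2 * π), cexp (θ * I) * cexp (θ * I) ^ k / (F t (cexp (θ * I))).1

theorem ContDiffOn.complex_div {E : Type*} [NormedAddCommGroup E] [NormedSpace ℝ E] {f g : E → ℂ}
    {s : Set E} (hf : ContDiffOn ℝ ∞ f s) (hg : ContDiffOn ℝ ∞ g s) (h0 : ∀ x ∈ s, g x ≠ 0) :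
    ContDiffOn ℝ ∞ (fun x => f x / g x) s := by
  simp only [div_eq_mul_inv]
  exact hf.mul (hg.inv h0)

namespace IsSmoothDiscFamily

variable {U : Set ℂ} {φ : ℂ → ℝ} {J : Set ℝ} {F : ℝ → ℂ → ℂ × OnePoint ℂ}

theorem contDiffOn_zeroMoment (hF : IsSmoothDiscFamily U φ J F) (hJ : J.OrdConnected)
    (hJ' : J.Nontrivial) (k : ℕ) : ContDiffOn ℝ ∞ (zeroMoment F k) J := by
  refine SmoothOnStrip.contDiffOn_integral (u := fun t θ =>
    cexp (θ * I) * cexp (θ * I) ^ k / (F t (cexp (θ * I))).1) ?_ hJ hJ' (2 * π)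
  have he : ContDiffOn ℝ ∞ (fun q : ℝ × ℝ => cexp (q.2 * I)) (J ×ˢ univ) :=
    (IsNormalizedFamily.smooth_exp J).smooth
  refine (he.mul (he.pow k)).complex_div (hF.smooth_fst.comp (f := fun q : ℝ × ℝ => (q.1, cexp (q.2 * I)))
    (contDiffOn_fst.prodMk he) fun q hq => ⟨hq.1, norm_exp_angle _⟩) fun q hq h0 => ?_
  obtain ⟨z, hz, -, hz'⟩ := (hF.admissible q.1 hq.1).exists_pole
  have hs := exp_angle_mem_sphere q.2
  rw [hz' _ (sphere_subset_closedBall hs) (Or.inl h0)] at hs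
  exact (mem_ball.1 hz).ne (mem_sphere.1 hs)

/-- The zero `z` of the first component `f` and `l = |f'(z)| / f'(z)`, in terms of moments. -/
theorem exists_zero (hF : IsSmoothDiscFamily U φ J F) {t : ℝ} (ht : t ∈ J)
    (ho : IsOpen (discShadow (F t))) :
    zeroMoment F 0 t ≠ 0 ∧ ‖zeroMoment F 1 t / zeroMoment F 0 t‖ < 1 ∧
      ‖zeroMoment F 0 t / ‖zeroMoment F 0 t‖‖ = 1 ∧
      F t (zeroMoment F 1 t / zeroMoment F 0 t) = ((0 : ℂ), OnePoint.infty) ∧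
      (∀ ζ ∈ closedBall (0 : ℂ) 1, (F t ζ).2 = OnePoint.infty →
        ζ = zeroMoment F 1 t / zeroMoment F 0 t) ∧
      deriv (fun ζ => (F t ζ).1) (zeroMoment F 1 t / zeroMoment F 0 t) *
        zeroMoment F 0 t = 2 * π := by
  have hf := hF.admissible t ht
  obtain ⟨z, hz, hfz, hz'⟩ := hf.exists_pole
  have hd := hf.deriv_fst_ne_zero ho hz
  have hπ : (π : ℂ) ≠ 0 := by exact_mod_cast Real.pi_ne_zero
  have h : ∀ k, zeroMoment F k t = 2 * π * z ^ k / deriv (fun ζ => (F t ζ).1) z := fun k =>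
    integral_div_of_simple_zero (g := fun ζ => ζ ^ k) hf.diffContOnCl_fst
      (differentiable_id.pow k).diffContOnCl hz (by rw [hfz])
      (fun ζ hζ h0 => hz' ζ hζ (Or.inl h0)) hd
  have h0 := h 0
  rw [pow_zero, mul_one] at h0
  have hne : zeroMoment F 0 t ≠ 0 := by
    rw [h0]; exact div_ne_zero (mul_ne_zero two_ne_zero hπ) hd
  have e : zeroMoment F 1 t / zeroMoment F 0 t = z := by rw [h, h0]; field_simp
  rw [e]
  refine ⟨hne, mem_ball_zero_iff.1 hz, ?_, hfz, fun ζ hζ h1 => hz' ζ hζ (Or.inr h1), ?_⟩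
  · rw [norm_div, norm_real, norm_norm, div_self (norm_ne_zero_iff.2 hne)]
  · rw [h0]; field_simp

/-- After a change of parametrization by automorphisms of the disc, a family of discs is in normal
form. -/
theorem exists_isNormalizedFamily (hF : IsSmoothDiscFamily U φ J F) (hU : IsOpen U)
    (hφ : ContDiffOn ℝ ∞ φ U) (hsub : ∀ z ∈ U, 0 < laplacian φ z)
    (hJ : J.OrdConnected) (hJ' : J.Nontrivial) (ho : ∀ t ∈ J, IsOpen (discShadow (F t)))
    (hinc : IsIncreasingFamily J fun t => discShadow (F t)) :
    ∃ u A B, IsNormalizedFamily U φ J (fun t => discShadow (F t)) u A B := by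
  set z : ℝ → ℂ := fun t => zeroMoment F 1 t / zeroMoment F 0 t with hz
  set l : ℝ → ℂ := fun t => zeroMoment F 0 t / ‖zeroMoment F 0 t‖ with hl
  have hn := fun t (ht : t ∈ J) => (hF.exists_zero ht (ho t ht)).1
  have hz1 : ∀ t ∈ J, ‖z t‖ < 1 := fun t ht => (hF.exists_zero ht (ho t ht)).2.1
  have hl1 : ∀ t ∈ J, ‖l t‖ = 1 := fun t ht => (hF.exists_zero ht (ho t ht)).2.2.1
  have hFz : ∀ t ∈ J, F t (z t) = ((0 : ℂ), OnePoint.infty) :=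
    fun t ht => (hF.exists_zero ht (ho t ht)).2.2.2.1
  have hz' := fun t (ht : t ∈ J) => (hF.exists_zero ht (ho t ht)).2.2.2.2.1
  have hN := hF.contDiffOn_zeroMoment hJ hJ'
  have hzs : ContDiffOn ℝ ∞ z J := (hN 1).complex_div (hN 0) hn
  have hls : ContDiffOn ℝ ∞ l J := (hN 0).complex_div
    (ofRealCLM.contDiff.comp_contDiffOn ((hN 0).norm ℝ hn))
    fun t ht => by simpa using hn t ht
  have hK : ∀ θ : ℝ, cexp (θ * I) ∈ closedBall (0 : ℂ) 1 := norm_exp_angle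
  have hder : ∀ t ∈ J, ∀ ζ ∈ ball (0 : ℂ) 1,
      HasDerivAt (fun ζ => (F t (discAut (z t) (l t) ζ)).1)
        (deriv (fun ζ => (F t ζ).1) (discAut (z t) (l t) ζ) * (l t * ((1 - ‖z t‖ ^ 2 : ℝ) : ℂ) /
          (1 + starRingEnd ℂ (z t) * l t * ζ) ^ 2)) ζ := fun t ht ζ hζ =>
    HasDerivAt.comp (h₂ := fun ζ => (F t ζ).1) ζ
      ((hF.admissible t ht).disc.holomorphic_fst.differentiableAt
        (isOpen_ball.mem_nhds (discAut_mem_ball (hz1 t ht) (hl1 t ht) hζ))).hasDerivAt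
      (hasDerivAt_discAut (hz1 t ht) (hl1 t ht) (ball_subset_closedBall hζ))
  have hus : SmoothPeriodic J
      (fun t θ => (F t (discAut (z t) (l t) (cexp (θ * I)))).1) := by
    have he : ContDiffOn ℝ ∞ (fun q : ℝ × ℝ => cexp (q.2 * I)) (J ×ˢ univ) :=
      (IsNormalizedFamily.smooth_exp J).smooth
    have hz2 : ContDiffOn ℝ ∞ (fun q : ℝ × ℝ => z q.1) (J ×ˢ univ) :=
      hzs.comp contDiffOn_fst fun q hq => hq.1
    have hl2 : ContDiffOn ℝ ∞ (fun q : ℝ × ℝ => l q.1) (J ×ˢ univ) :=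
      hls.comp contDiffOn_fst fun q hq => hq.1
    have hM : ContDiffOn ℝ ∞ (fun q : ℝ × ℝ => discAut (z q.1) (l q.1) (cexp (q.2 * I)))
        (J ×ˢ univ) :=
      ((hl2.mul he).add hz2).complex_div (contDiffOn_const.add
        (((conjCLE.contDiff.comp_contDiffOn hz2).mul hl2).mul he))
        fun q hq => discAut_den_ne_zero (hz1 _ hq.1) (hl1 _ hq.1) (hK q.2)
    refine ⟨hF.smooth_fst.comp (contDiffOn_fst.prodMk hM) fun q hq =>
      ⟨hq.1, discAut_mem_closedBall (hz1 _ hq.1) (hl1 _ hq.1) (hK q.2)⟩, fun t ht θ => ?_⟩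
    have := exp_angle_periodic θ
    simp only at this ⊢
    rw [this]
  refine ⟨_, fun t ζ => (F t (discAut (z t) (l t) ζ)).1,
    fun t => IsAdmissibleDisc.pullbackLift (F t) (z t) (l t), hU, hφ, hsub, hJ, hJ', hus,
    fun t ht θ => ?_, fun t ht θ => ?_, fun t ht => ?_, fun t ht θ => rfl, fun t ht => ?_,
    fun t ht => ?_, fun t ht => ?_, ho, fun t ht ζ hζ => ?_, fun t ht => ?_, hinc, fun t ht => ?_,
    fun t ht θ => ?_⟩
  all_goals
    have hf := hF.admissible t ht
    have hz1' := hz1 t ht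
    have hl1' := hl1 t ht
  · exact (hf.boundary_eq (discAut_mem_sphere hz1' hl1' (exp_angle_mem_sphere θ))).1
  · obtain ⟨d, hd0, hd⟩ := hf.exists_hasDerivWithinAt_fst hU hφ
      (discAut_mem_sphere hz1' hl1' (exp_angle_mem_sphere θ))
    have h1 : HasDerivAt (fun θ : ℝ => discAut (z t) (l t) (cexp (θ * I))) _ θ :=
      HasDerivAt.comp (h₂ := discAut (z t) (l t)) (h := fun θ : ℝ => cexp (θ * I)) θ
        (hasDerivAt_discAut hz1' hl1' (hK θ))
        ((ofRealCLM.hasDerivAt (x := θ)).mul_const I).cexp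
    have h2 := (HasDerivWithinAt.scomp (h := fun θ : ℝ => discAut (z t) (l t) (cexp (θ * I))) θ hd
      h1.hasDerivWithinAt fun θ _ => discAut_mem_closedBall hz1' hl1' (hK θ)).hasDerivAt univ_mem
    have h3 : angleDeriv (fun t θ => (F t (discAut (z t) (l t) (cexp (θ * I)))).1) t θ = _ :=
      h2.deriv
    rw [h3]
    refine smul_ne_zero (mul_ne_zero (deriv_discAut_ne_zero hz1' hl1' (hK θ)) ?_) hd0
    simp [I_ne_zero]
  · refine diffContOnCl_ball_of
      (fun ζ hζ => (hder t ht ζ hζ).differentiableAt.differentiableWithinAt) ?_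
    exact hf.disc.smooth_fst.continuousOn.comp (f := discAut (z t) (l t))
      (fun ζ hζ => (hasDerivAt_discAut hz1' hl1' hζ).continuousAt.continuousWithinAt)
      fun ζ => discAut_mem_closedBall hz1' hl1'
  · simp only [discAut_zero, hFz t ht]
  · exact (hf.injOn_fst (ho t ht)).comp (injOn_discAut hz1' hl1')
      fun ζ => discAut_mem_closedBall hz1' hl1'
  · conv_rhs => rw [discShadow, discImage, ← image_discAut hz1' hl1']
    rw [image_image, image_image]
  · rw [(hder t ht ζ hζ).deriv]
    exact mul_ne_zero (hf.deriv_fst_ne_zero (ho t ht) (discAut_mem_ball hz1' hl1' hζ))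
      (deriv_discAut_ne_zero hz1' hl1' (ball_subset_closedBall hζ))
  · have h1 := norm_pos_iff.2 (hn t ht)
    have h2 : (0 : ℝ) < 1 - ‖z t‖ ^ 2 := by nlinarith [norm_nonneg (z t)]
    have hπ := Real.pi_pos
    refine ⟨2 * π * (1 - ‖z t‖ ^ 2) / ‖zeroMoment F 0 t‖, by positivity, ?_⟩
    rw [(hder t ht 0 (by simp)).deriv, discAut_zero]
    have h3 := (hF.exists_zero ht (ho t ht)).2.2.2.2.2
    push_cast
    rw [← h3]
    simp only [hl, mul_zero, add_zero, one_pow, div_one]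
    ring
  · exact hf.diffContOnCl_pullbackLift hz1' hl1' (by rw [hFz t ht]) (hz' t ht)
  · rw [IsAdmissibleDisc.pullbackLift_eq (by rw [hFz t ht]) (exp_ne_zero _),
      (hf.boundary_eq (discAut_mem_sphere hz1' hl1' (exp_angle_mem_sphere θ))).2]
    rfl

end IsSmoothDiscFamily

end

theorem mainTheorem6 (U : Set ℂ) (hU : IsOpen U) (φ : ℂ → ℝ) (hφ : ContDiffOn ℝ ∞ φ U)
    (hsub : ∀ z ∈ U, 0 < Laplacian.laplacian φ z)
    (J : Set ℝ) (hJ : J.OrdConnected) (hJ' : J.Nontrivial) :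
    (∀ F : ℝ → ℂ → ℂ × OnePoint ℂ, IsSmoothDiscFamily U φ J F →
      (∀ t ∈ J, IsSmoothJordanDomain (discShadow (F t))) →
      IsIncreasingFamily J (fun t => discShadow (F t)) →
      ∃ s : ℝ → ℝ, ContDiffOn ℝ ∞ s J ∧ StrictMonoOn s J ∧
        ∃ Ω : ℝ → Set ℂ, (∀ t ∈ J, Ω (s t) = discShadow (F t)) ∧
          IsHeleShawFlow (fun z => 1 / Laplacian.laplacian φ z) (s '' J) Ω) ∧
    (∀ Ω : ℝ → Set ℂ, IsHeleShawFlow (fun z => 1 / Laplacian.laplacian φ z) J Ω →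
      (∀ t ∈ J, frontier (Ω t) ⊆ U) →
      ∀ t₀ ∈ J, ∀ (S : ℂ → ℂ) (r : ℂ), IsSchwarzFunction (Ω t₀) φ S r →
      (∀ t ∈ J, r + (((t - t₀) / (4 * Real.pi) : ℝ) : ℂ) ≠ 0) →
      ∃ F : ℝ → ℂ → ℂ × OnePoint ℂ, IsSmoothDiscFamily U φ J F ∧
        ∀ t ∈ J, discShadow (F t) = Ω t) := by
  refine ⟨fun F hF hdom hinc => ?_, fun Ω hflow hΩU t₀ ht₀ S r hS hr =>
    hflow.exists_discFamily hU hφ hsub hJ hJ' hΩU ht₀ hS hr⟩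
  obtain ⟨u, A, B, h⟩ := hF.exists_isNormalizedFamily hU hφ hsub hJ hJ'
    (fun t ht => (hdom t ht).choose_spec.isOpen) hinc
  refine ⟨newTime φ u, h.contDiffOn_newTime, h.isTimeChange.strictMono, _, fun t ht => ?_,
    h.isHeleShawFlow⟩
  simp only [h.isTimeChange.left_inv t ht]
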